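/- We work over $\mathbb C$. Let $0=[0:\cdots:0:1]\in\mathbb P^5$, let $P\subset\mathbb P^5\times\mathbb P^4$ be the closed subscheme $\{x_iy_j=x_jy_i:\ 0\le i,j\le 4\}$, with its projections $b:P\to\mathbb P^5$ and $\rho:P\to\mathbb P^4$. Then $b$ is the blow-up $P=\mathrm{Bl}_0\mathbb P^5$ of $\mathbb P^5$ in the point $0$; let $e=b^{-1}(0)\subset P$ be its exceptional divisor. The sections of the line bundle $b^*\mathcal O(3)(-2e)$ on $P$ are the cubic forms $F$ on $\mathbb P^5$ for which $b^*F$ vanishes to order at least $2$ along $e$ (these define the cubic fourfolds that are singular at $0$). For a pencil in $|\mathcal O(3)(-2e)|$, spanned by linearly independent sections $F_0,F_1$, the universal hypersurface $\mathcal H\subset P\times\mathbb P^1$ is the zero scheme of $t_0F_0+t_1F_1$, regarded as a section of $\mathcal O(3)(-2e)\boxtimes\mathcal O_{\mathbb P^1}(1)$, where $[t_0:t_1]$ are the coordinates of $\mathbb P^1$. Then for a generic pencil (that is, for all pairs $(F_0,F_1)$ in some non-empty Zariski open subset of the space of pairs of linearly independent sections) there are bihomogeneous forms $Q$ of bidegree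 $(2,1)$ and $C$ of bidegree $(3,1)$ on $\mathbb P^4\times\mathbb P^1$ such that the scheme-theoretic intersection $Y=\{Q=0\}\cap\{C=0\}\subset\mathbb P^4\times\mathbb P^1$ is a Calabi–Yau threefold (smooth and irreducible of dimension $3$, projective, with trivial canonical bundle and $H^1(Y,\mathcal O_Y)=0$) and such that the morphism $(\rho\times 1)|_{\mathcal H}:\mathcal H\to\mathbb P^4\times\mathbb P^1$ is the blow-up of $\mathbb P^4\times\mathbb P^1$ along $Y$. In particular $$\mathcal H\;\cong\;\mathrm{Bl}_Y(\mathbb P^4\times\mathbb P^1).$$ -/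

import Mathlib

open CategoryTheory CategoryTheory.Limits AlgebraicGeometry TopologicalSpace

noncomputable section

namespace CubicPencil

/-! ### Schemes over `ℂ`, invertible ideals, blow-ups -/

/-- The base `Spec ℂ`. -/
abbrev SpecC : Scheme.{0} := Spec (CommRingCat.of ℂ)

/-- The restriction homomorphism `Γ(X, V) → Γ(X, U)` for `U ≤ V`. -/
def res {X : Scheme.{0}} {U V : X.Opens} (h : U ≤ V) : Γ(X, V) →+* Γ(X, U) :=
  (X.presheaf.map (homOfLE h).op).hom

lemma res_comp_res {X : Scheme.{0}} {U V W : X.Opens} (h : U ≤ V) (h' : V ≤ W) :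
    (res h).comp (res h') = res (h.trans h') := by
  unfold res
  rw [← CommRingCat.hom_comp, ← Functor.map_comp]
  rfl

/-- For a scheme `p : X ⟶ Spec ℂ`, the structure homomorphism `ℂ → Γ(X, U)`. -/
def constHom {X : Scheme.{0}} (p : X ⟶ SpecC) (U : X.Opens) : ℂ →+* Γ(X, U) :=
  (res le_top).comp (p.appTop.hom.comp (Scheme.ΓSpecIso (CommRingCat.of ℂ)).inv.hom)

lemma res_comp_constHom {X : Scheme.{0}} (p : X ⟶ SpecC) {U V : X.Opens} (h : U ≤ V) :
    (res h).comp (constHom p V) = constHom p U := by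
  unfold constHom
  rw [← RingHom.comp_assoc, res_comp_res]

/-- An ideal sheaf is invertible if locally it is generated by one non-zero-divisor
(equivalently, its closed subscheme is an effective Cartier divisor). -/
def IsInvertibleIdeal {X : Scheme.{0}} (I : X.IdealSheafData) : Prop :=
  ∀ x : X, ∃ U : X.affineOpens, x ∈ U.1 ∧
    ∃ f ∈ nonZeroDivisors Γ(X, U.1), I.ideal U = Ideal.span {f}

/-- `π : B ⟶ X` is the blow-up of `X` along the closed subscheme with ideal sheaf `I`:
it is the terminal object among the `X`-schemes on which the inverse image ideal sheaf of `I`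
is invertible. -/
structure IsBlowup {B X : Scheme.{0}} (π : B ⟶ X) (I : X.IdealSheafData) : Prop where
  isInvertibleIdeal : IsInvertibleIdeal (I.comap π)
  existsUnique_lift : ∀ (T : Scheme.{0}) (g : T ⟶ X), IsInvertibleIdeal (I.comap g) →
    ∃! h : T ⟶ B, h ≫ π = g

/-! ### Projective space and zero loci of homogeneous forms -/

/-- The standard grading of `ℂ[x₀, …, xₙ]`. -/
abbrev grading (n : ℕ) : ℕ → Submodule ℂ (MvPolynomial (Fin (n + 1)) ℂ) :=
  MvPolynomial.homogeneousSubmodule (Fin (n + 1)) ℂ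

instance gradedAlgebra_grading (n : ℕ) : GradedAlgebra (grading n) := MvPolynomial.gradedAlgebra

/-- Projective `n`-space over `ℂ`. -/
abbrev PSpace (n : ℕ) : Scheme.{0} := Proj (grading n)

/-- The structure morphism of projective space. -/
def PSpace.toBase (n : ℕ) : PSpace n ⟶ SpecC :=
  Proj.toSpecZero (grading n) ≫ Spec.map (CommRingCat.ofHom (algebraMap ℂ (grading n 0)))

/-- The standard chart `{xᵢ ≠ 0}`. -/
def chart (n : ℕ) (i : Fin (n + 1)) : (PSpace n).Opens :=
  Proj.basicOpen (grading n) (MvPolynomial.X i)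

/-- The function `xₖ / xᵢ` on the chart `{xᵢ ≠ 0}`. -/
def coordRatio (n : ℕ) (i k : Fin (n + 1)) : Γ(PSpace n, chart n i) :=
  (Proj.awayToSection (grading n) (MvPolynomial.X i)).hom
    (HomogeneousLocalization.Away.mk (grading n)
      (f := MvPolynomial.X i) (d := 1) (MvPolynomial.isHomogeneous_X ℂ i) 1
      (MvPolynomial.X k) (by simpa using MvPolynomial.isHomogeneous_X ℂ k))

/-- The ideal sheaf of functions that on each open set `V k` of the given family are multiples
of `s k`. It is used when the `V k` cover `X` and the `s k` are the local equations of a section of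
a line bundle, so that `s k` and `s l` differ by a unit on `V k ⊓ V l`; then it is the ideal sheaf
of the zero scheme of this section. -/
def localEquationsIdeal {X : Scheme.{0}} {κ : Type} (V : κ → X.Opens) (s : ∀ k, Γ(X, V k)) :
    X.IdealSheafData :=
  .ofIdeals fun U ↦ ⨅ k, (Ideal.span {res (inf_le_right : U.1 ⊓ V k ≤ V k) (s k)}).comap
    (res (inf_le_left : U.1 ⊓ V k ≤ U.1))

/-- The ideal sheaf on `X` of the zero scheme of `f^* G`, where `f : X ⟶ ℙⁿ` and `G` is a
homogeneous form in the coordinates of `ℙⁿ`: on `{xᵢ ≠ 0}` the equation is `G(x₀/xᵢ, …, xₙ/xᵢ)`. -/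
def zeroIdeal {X : Scheme.{0}} {n : ℕ} (f : X ⟶ PSpace n)
    (G : MvPolynomial (Fin (n + 1)) ℂ) : X.IdealSheafData :=
  localEquationsIdeal (fun i : Fin (n + 1) ↦ f ⁻¹ᵁ chart n i) fun i ↦
    MvPolynomial.eval₂ (constHom (f ≫ PSpace.toBase n) _)
      (fun k ↦ (f.app (chart n i)).hom (coordRatio n i k)) G

/-- The ideal sheaf on `X` of the zero scheme of `(f, g)^* G`, where `f : X ⟶ ℙᵐ`, `g : X ⟶ ℙⁿ`
are morphisms over `ℂ` and `G` is a bihomogeneous form in the coordinates `x` of `ℙᵐ` and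
`y` of `ℙⁿ`: on `{xᵢ ≠ 0, yⱼ ≠ 0}` the equation is
`G(x₀/xᵢ, …, xₘ/xᵢ; y₀/yⱼ, …, yₙ/yⱼ)`. -/
def zeroIdeal₂ {X : Scheme.{0}} {m n : ℕ} (f : X ⟶ PSpace m) (g : X ⟶ PSpace n)
    (G : MvPolynomial (Fin (m + 1) ⊕ Fin (n + 1)) ℂ) : X.IdealSheafData :=
  localEquationsIdeal
    (fun ij : Fin (m + 1) × Fin (n + 1) ↦ f ⁻¹ᵁ chart m ij.1 ⊓ g ⁻¹ᵁ chart n ij.2) fun ij ↦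
    MvPolynomial.eval₂ (constHom (f ≫ PSpace.toBase m) _)
      (Sum.elim
        (fun k ↦ res inf_le_left ((f.app (chart m ij.1)).hom (coordRatio m ij.1 k)))
        (fun l ↦ res inf_le_right ((g.app (chart n ij.2)).hom (coordRatio n ij.2 l)))) G

/-- Bihomogeneous forms of bidegree `(a, b)`, that is, sections of `𝒪(a, b)` on `ℙᵐ × ℙⁿ`. -/
def IsBihomogeneous {m n : ℕ} (G : MvPolynomial (Fin (m + 1) ⊕ Fin (n + 1)) ℂ) (a b : ℕ) : Prop :=
  G.IsWeightedHomogeneous (Sum.elim (fun _ ↦ ((1, 0) : ℕ × ℕ)) (fun _ ↦ (0, 1))) (a, b)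

/-- `ℙᵐ × ℙⁿ` over `ℂ`. -/
abbrev PProd (m n : ℕ) : Scheme.{0} := pullback (PSpace.toBase m) (PSpace.toBase n)

/-- The structure morphism of `ℙᵐ × ℙⁿ`. -/
def PProd.toBase (m n : ℕ) : PProd m n ⟶ SpecC := pullback.fst _ _ ≫ PSpace.toBase m

/-! ### The blow-up `P` of `ℙ⁵` in a point, with its projection to `ℙ⁴`

The coordinates of `ℙ⁵` are `x₀, …, x₄, x₅`, the point is `0 = [0 : ⋯ : 0 : 1]`. -/

/-- The ideal sheaf of the point `0 = {x₀ = ⋯ = x₄ = 0} ∈ ℙ⁵`. -/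
def originIdeal : (PSpace 5).IdealSheafData :=
  ⨆ i : Fin 5, zeroIdeal (𝟙 (PSpace 5)) (MvPolynomial.X i.castSucc)

/-- The ideal sheaf of the closed subscheme `{xᵢ yⱼ = xⱼ yᵢ : 0 ≤ i, j ≤ 4}` of `ℙ⁵ × ℙ⁴`. -/
def incidenceIdeal : (PProd 5 4).IdealSheafData :=
  ⨆ ij : Fin 5 × Fin 5, zeroIdeal₂ (pullback.fst _ _) (pullback.snd _ _)
    (MvPolynomial.X (.inl ij.1.castSucc) * MvPolynomial.X (.inr ij.2) -
      MvPolynomial.X (.inl ij.2.castSucc) * MvPolynomial.X (.inr ij.1))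

/-- `P = Bl₀ ℙ⁵`, as the incidence variety of points of `ℙ⁵` and lines through `0`. -/
abbrev P : Scheme.{0} := incidenceIdeal.subscheme

/-- The blow-down map `P ⟶ ℙ⁵`. -/
def blowDown : P ⟶ PSpace 5 := incidenceIdeal.subschemeι ≫ pullback.fst _ _

/-- The projection `ρ : P ⟶ ℙ⁴` to the space of lines through `0`. -/
def rho : P ⟶ PSpace 4 := incidenceIdeal.subschemeι ≫ pullback.snd _ _

/-- The structure morphism of `P`. -/
def P.toBase : P ⟶ SpecC := blowDown ≫ PSpace.toBase 5

lemma rho_toBase : rho ≫ PSpace.toBase 4 = P.toBase := by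
  unfold rho P.toBase blowDown
  rw [Category.assoc, Category.assoc, pullback.condition]

/-- The ideal sheaf of the exceptional divisor `e ⊂ P`. -/
def excIdeal : P.IdealSheafData := originIdeal.comap blowDown

/-! ### Pencils in `|𝒪(3)(-2e)|` and the universal hypersurface -/

/-- Sections of `𝒪(3)(-2e)` on `P`: cubic forms on `ℙ⁵` whose pullback to `P` vanishes to
order at least two along `e`. -/
def IsSectionO3Minus2e (F : MvPolynomial (Fin 6) ℂ) : Prop :=
  F.IsHomogeneous 3 ∧ zeroIdeal blowDown F ≤ excIdeal ^ 2

/-- A pencil in `|𝒪(3)(-2e)|`, given by a basis of the two-dimensional space of sections. -/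
def IsPencil (F : Fin 2 → MvPolynomial (Fin 6) ℂ) : Prop :=
  LinearIndependent ℂ F ∧ ∀ k, IsSectionO3Minus2e (F k)

/-- The value of a polynomial `Δ` at the coefficients of the pair of forms `F`. -/
def evalCoeffs (Δ : MvPolynomial (Fin 2 × (Fin 6 →₀ ℕ)) ℂ)
    (F : Fin 2 → MvPolynomial (Fin 6) ℂ) : ℂ :=
  MvPolynomial.eval (fun km ↦ (F km.1).coeff km.2) Δ

/-- `p` holds for the generic pencil: it holds on a non-empty Zariski open subset of the space
of all pencils. -/
def ForGenericPencil (p : (Fin 2 → MvPolynomial (Fin 6) ℂ) → Prop) : Prop :=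
  ∃ Δ : MvPolynomial (Fin 2 × (Fin 6 →₀ ℕ)) ℂ,
    (∃ F, IsPencil F ∧ evalCoeffs Δ F ≠ 0) ∧
    ∀ F, IsPencil F → evalCoeffs Δ F ≠ 0 → p F

/-- `P × ℙ¹`. -/
abbrev PxP1 : Scheme.{0} := pullback P.toBase (PSpace.toBase 1)

/-- The form `t₀ F₀ + t₁ F₁` of bidegree `(3, 1)` on `ℙ⁵ × ℙ¹`. -/
def pencilForm (F : Fin 2 → MvPolynomial (Fin 6) ℂ) : MvPolynomial (Fin 6 ⊕ Fin 2) ℂ :=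
  ∑ k, MvPolynomial.X (.inr k) * MvPolynomial.rename Sum.inl (F k)

/-- The ideal sheaf of the universal hypersurface `ℋ ⊂ P × ℙ¹`, the zero scheme of
`t₀ F₀ + t₁ F₁` as a section of `𝒪(3)(-2e) ⊠ 𝒪(1)`. If `D` is the zero scheme
of the same expression as a section of `𝒪(3) ⊠ 𝒪(1)`, then `ℋ = D - 2 (e × ℙ¹)` as a divisor, that
is, the ideal of `ℋ` is the quotient of that of `D` by the square of that of `e × ℙ¹`. -/
def universalIdeal (F : Fin 2 → MvPolynomial (Fin 6) ℂ) : PxP1.IdealSheafData :=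
  sSup {J | J * (excIdeal.comap (pullback.fst P.toBase (PSpace.toBase 1))) ^ 2 ≤
    zeroIdeal₂ (pullback.fst P.toBase (PSpace.toBase 1) ≫ blowDown)
      (pullback.snd P.toBase (PSpace.toBase 1)) (pencilForm F)}

/-- The universal hypersurface `ℋ`. -/
abbrev universalHypersurface (F : Fin 2 → MvPolynomial (Fin 6) ℂ) : Scheme.{0} :=
  (universalIdeal F).subscheme

/-- `ρ × 1 : P × ℙ¹ ⟶ ℙ⁴ × ℙ¹`. -/
def rhoTimesId : PxP1 ⟶ PProd 4 1 :=
  pullback.lift (pullback.fst _ _ ≫ rho) (pullback.snd _ _)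
    (by rw [Category.assoc, rho_toBase, pullback.condition])

/-- The restriction of `ρ × 1` to `ℋ`. -/
def rhoRestrict (F : Fin 2 → MvPolynomial (Fin 6) ℂ) : universalHypersurface F ⟶ PProd 4 1 :=
  (universalIdeal F).subschemeι ≫ rhoTimesId

/-- The ideal sheaf of the intersection of the divisors `{Q = 0}` and `{C = 0}` in `ℙ⁴ × ℙ¹`. -/
def intersectionIdeal (Q C : MvPolynomial (Fin 5 ⊕ Fin 2) ℂ) : (PProd 4 1).IdealSheafData :=
  zeroIdeal₂ (pullback.fst _ _) (pullback.snd _ _) Q ⊔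
    zeroIdeal₂ (pullback.fst _ _) (pullback.snd _ _) C

/-! ### Calabi–Yau threefolds -/

section Forms

variable (R A B : Type) [CommRing R] [CommRing A] [CommRing B] [Algebra R A] [Algebra R B]
  [Algebra A B] [IsScalarTower R A B]

/-- Pullback of differential `n`-forms along `A → B`,
`da₁ ∧ ⋯ ∧ daₙ ↦ db₁ ∧ ⋯ ∧ dbₙ` with `bᵢ` the image of `aᵢ`. -/
def formMap (n : ℕ) :
    (⋀[A]^n (KaehlerDifferential R A)) →+ (⋀[B]^n (KaehlerDifferential R B)) :=
  letI : Module A (⋀[B]^n (KaehlerDifferential R B)) := Module.compHom _ (algebraMap A B)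
  let φ := KaehlerDifferential.map R R A B
  (exteriorPower.alternatingMapLinearEquiv (R := A) (n := n)
    ({ toFun := fun w ↦ exteriorPower.ιMulti B n fun i ↦ φ (w i)
       map_update_add' := fun w i x y ↦ by
        have h (z) : (fun j ↦ φ (Function.update w i z j)) =
            Function.update (fun j ↦ φ (w j)) i (φ z) := by
          funext j; by_cases hj : j = i
          · subst hj; simp
          · simp [hj]
        simp only [h, map_add, AlternatingMap.map_update_add]
       map_update_smul' := fun w i c x ↦ by
        have h (z) : (fun j ↦ φ (Function.update w i z j)) =
            Function.update (fun j ↦ φ (w j)) i (φ z) := by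
          funext j; by_cases hj : j = i
          · subst hj; simp
          · simp [hj]
        simp only [h, map_smul]
        rw [← algebraMap_smul B c (φ x), AlternatingMap.map_update_smul]
        rfl
       map_eq_zero_of_eq' := fun w i j hw hij ↦
        AlternatingMap.map_eq_zero_of_eq _ _ (by simp [hw]) hij } :
      (KaehlerDifferential R A) [⋀^Fin n]→ₗ[A] (⋀[B]^n (KaehlerDifferential R B)))).toAddMonoidHom

end Forms

variable {Y : Scheme.{0}} (p : Y ⟶ SpecC)

/-- The `ℂ`-algebra structure on `Γ(Y, U)`. -/
abbrev sectionsAlgebra (U : Y.Opens) : Algebra ℂ Γ(Y, U) := (constHom p U).toAlgebra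

/-- Algebraic differential `n`-forms on an (affine) open set `U`: the `n`-th exterior power over
`Γ(Y, U)` of the Kähler differentials of `Γ(Y, U)` over `ℂ`. -/
abbrev Forms (n : ℕ) (U : Y.Opens) : Type :=
  letI := sectionsAlgebra p U
  ⋀[Γ(Y, U)]^n (KaehlerDifferential ℂ Γ(Y, U))

/-- Restriction of forms to a smaller open set. -/
def Forms.restrict (n : ℕ) {U V : Y.Opens} (h : U ≤ V) (ω : Forms p n V) : Forms p n U :=
  letI := sectionsAlgebra p U
  letI := sectionsAlgebra p V
  letI : Algebra Γ(Y, V) Γ(Y, U) := (res h).toAlgebra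
  haveI : IsScalarTower ℂ Γ(Y, V) Γ(Y, U) :=
    IsScalarTower.of_algebraMap_eq' (res_comp_constHom p h).symm
  formMap ℂ Γ(Y, V) Γ(Y, U) n ω

/-- For `Y` smooth of dimension `n` over `ℂ`, the canonical bundle `⋀ⁿ Ω_Y` is trivial: it has a
nowhere vanishing global section, given by compatible generators over the affine open sets. -/
def HasTrivialCanonicalBundle (n : ℕ) : Prop :=
  ∃ ω : ∀ U : Y.affineOpens, Forms p n U.1,
    (∀ (U V : Y.affineOpens) (h : U.1 ≤ V.1), Forms.restrict p n h (ω V) = ω U) ∧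
    ∀ U : Y.affineOpens, Submodule.span Γ(Y, U.1) {ω U} = ⊤

/-- `H¹(Y, 𝒪_Y) = 0` for a separated scheme `Y`, by Čech cohomology: for some affine open cover,
every Čech 1-cocycle with values in `𝒪_Y` is a coboundary. -/
def HasVanishingH1 (Y : Scheme.{0}) : Prop :=
  ∃ (ι : Type) (U : ι → Y.Opens), (∀ i, IsAffineOpen (U i)) ∧ (⨆ i, U i = ⊤) ∧
    ∀ f : ∀ i j, Γ(Y, U i ⊓ U j),
      (∀ i j k,
        res (le_inf (inf_le_left.trans inf_le_left) (inf_le_left.trans inf_le_right) :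
          U i ⊓ U j ⊓ U k ≤ U i ⊓ U j) (f i j) +
        res (le_inf (inf_le_left.trans inf_le_right) inf_le_right :
          U i ⊓ U j ⊓ U k ≤ U j ⊓ U k) (f j k) =
        res (le_inf (inf_le_left.trans inf_le_left) inf_le_right :
          U i ⊓ U j ⊓ U k ≤ U i ⊓ U k) (f i k)) →
      ∃ g : ∀ i, Γ(Y, U i), ∀ i j,
        f i j = res inf_le_right (g j) - res inf_le_left (g i)

/-- A Calabi–Yau threefold over `ℂ`: proper, smooth of dimension three, irreducible, with trivial
canonical bundle and `H¹(𝒪) = 0`. (It is applied to closed subschemes of `ℙ⁴ × ℙ¹`, which are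
projective.) -/
structure IsCalabiYauThreefold : Prop where
  isProper : IsProper p
  smooth : SmoothOfRelativeDimension 3 p
  irreducible : IrreducibleSpace Y
  trivialCanonical : HasTrivialCanonicalBundle p 3
  vanishingH1 : HasVanishingH1 Y

end CubicPencil

end

noncomputable section

namespace CubicPencil

/-! ### Restriction and pullback of sections -/

section Sections

variable {X Y Z : Scheme.{0}}

/-! A cubic form that is singular at `0` has no monomial divisible by `x₅²`, so it is `x₅ q + c`
with forms `q`, `c` of degrees 2 and 3 in `x₀, …, x₄` (`IsSectionO3Minus2e.exists_eq_coneForm`). For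
a pencil of such forms put `Q = t₀ q₀ + t₁ q₁` and `C = t₀ c₀ + t₁ c₁`. Where `yⱼ = 1` on `P` one
has `xₐ = xⱼ yₐ`, and `xⱼ = 0` is the equation of `e`. Hence `x₅ Q + C` pulls back to `xⱼ² (x₅ Q(y,
t) + xⱼ C(y, t))`, and `ℋ` is the zero locus of `x₅ Q + xⱼ C` in the `ℙ¹`-bundle `P × ℙ¹ ⟶ ℙ⁴ × ℙ¹`
with fibre coordinates `[x₅ : xⱼ]` (`universalIdeal_eq`). If `Q`, `C` is a regular sequence, this is
the blow-up of `Y = {Q = C = 0}`: the ideal `(Q, C)` is generated by `Q` where `xⱼ ≠ 0` and by `C`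
where `x₅ ≠ 0`. The universal property is deduced from such charts in `BlowupCharts.isBlowup`, which
also shows that `P` is the blow-up of `ℙ⁵`.

The properties of `Y` all come from `IsSmoothPair`: some power of each `xⱼ tₗ` lies in the ideal
generated by `Q`, `C` and the minors of their Jacobian matrix. It gives smoothness by the Jacobian
criterion, and it excludes a common factor of `Q` and `C`, so that they form a regular sequence. The
canonical bundle is trivialized by the residue form `ω` of `IsVolume`; it is the same on all charts
because the bidegrees `(2, 1)` and `(3, 1)` add up to `(5, 2)`, the numbers of variables
(`rowsDet_change`).

Functions on intersections of charts of `Y` are Laurent polynomials of bidegree `0` modulo `(Q, C)`.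
The Čech complex of Laurent polynomials in the five variables `x` is exact in low degrees
(`cechD_homotopy`), and the Koszul relation of `Q` and `C` carries this over to `Y`
(`exists_cocycle`). What remains is the cohomology of `ℙ¹`. So `H¹(Y, 𝒪) = 0` and `H⁰(Y, 𝒪) = ℂ`;
thus `Y` is connected, and being smooth it is irreducible.

`IsSmoothPair` is an open condition, expressed by a determinant in the coefficients of the pencil
(`exists_discriminant`), so one example is enough. It is `Q = ∑ (t₀ - aᵢ t₁) xᵢ²`, `C = ∑ σᵢ (t₀ -
bᵢ t₁) xᵢ³`. At a singular point the equations can be solved for the `xᵢ`, and what is left, for `z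
= t₀ / t₁`, is a multiple zero of a partial sum of `∑ σᵢ⁻² (z - aᵢ)³ / (z - bᵢ)²`. Weights without
multiple zeros are chosen one at a time, each outside a finite set (`exists_isGoodWeight`). -/

@[simp] lemma res_res {U V W : X.Opens} (h : U ≤ V) (h' : V ≤ W) (a : Γ(X, W)) :
    res h (res h' a) = res (h.trans h') a :=
  congr($(res_comp_res h h') a)

@[simp] lemma res_self {U : X.Opens} (h : U ≤ U) (a : Γ(X, U)) : res h a = a := by
  simp [res]

lemma res_constHom (p : X ⟶ SpecC) {U V : X.Opens} (h : U ≤ V) (c : ℂ) :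
    res h (constHom p V c) = constHom p U c :=
  congr($(res_comp_constHom p h) c)

/-- Pullback of sections. -/
def pb (f : X ⟶ Y) {U : Y.Opens} {V : X.Opens} (e : V ≤ f ⁻¹ᵁ U) : Γ(Y, U) →+* Γ(X, V) :=
  (f.appLE U V e).hom

lemma pb_eq_res_app (f : X ⟶ Y) {U : Y.Opens} {V : X.Opens} (e : V ≤ f ⁻¹ᵁ U) (a : Γ(Y, U)) :
    pb f e a = res e ((f.app U).hom a) := rfl

@[simp] lemma res_pb (f : X ⟶ Y) {U : Y.Opens} {V W : X.Opens} (e : V ≤ f ⁻¹ᵁ U) (h : W ≤ V)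
    (a : Γ(Y, U)) : res h (pb f e a) = pb f (h.trans e) a :=
  congr(($(f.appLE_map e (homOfLE h).op)).hom a)

@[simp] lemma pb_res (f : X ⟶ Y) {U U' : Y.Opens} {V : X.Opens} (e : V ≤ f ⁻¹ᵁ U) (h : U ≤ U')
    (a : Γ(Y, U')) : pb f e (res h a) = pb f (e.trans (f.preimage_mono h)) a :=
  congr(($(f.map_appLE e (homOfLE h).op)).hom a)

@[simp] lemma pb_pb (f : X ⟶ Y) (g : Y ⟶ Z) {U : Z.Opens} {V : Y.Opens} {W : X.Opens}
    (e : V ≤ g ⁻¹ᵁ U) (e' : W ≤ f ⁻¹ᵁ V) (a : Γ(Z, U)) :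
    pb f e' (pb g e a) = pb (f ≫ g) (e'.trans (f.preimage_mono e)) a :=
  congr(($(f.appLE_comp_appLE g U V W e e')).hom a)

lemma pb_comp (f : X ⟶ Y) (g : Y ⟶ Z) {U : Z.Opens} {V : Y.Opens} {W : X.Opens}
    (e : V ≤ g ⁻¹ᵁ U) (e' : W ≤ f ⁻¹ᵁ V) :
    (pb f e').comp (pb g e) = pb (f ≫ g) (e'.trans (f.preimage_mono e)) :=
  RingHom.ext fun a ↦ pb_pb f g e e' a

lemma pb_congr {f g : X ⟶ Y} (h : f = g) {U : Y.Opens} {V : X.Opens} (e : V ≤ f ⁻¹ᵁ U)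
    (e' : V ≤ g ⁻¹ᵁ U) : pb f e = pb g e' := by
  subst h; rfl

lemma pb_id {U V : X.Opens} (e : V ≤ (𝟙 X : X ⟶ X) ⁻¹ᵁ U) : pb (𝟙 X) e = res e := by
  ext a
  exact (pb_eq_res_app (𝟙 X) e a).trans (by rw [Scheme.Hom.id_app]; rfl)

lemma pb_constHom (f : X ⟶ Y) (p : Y ⟶ SpecC) {U : Y.Opens} {V : X.Opens} (e : V ≤ f ⁻¹ᵁ U)
    (c : ℂ) : pb f e (constHom p U c) = constHom (f ≫ p) V c := by
  -- Constants are themselves pullbacks along the structure morphism, so functoriality of `pb`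
  -- applies.
  have h (X : Scheme.{0}) (q : X ⟶ SpecC) (W : X.Opens) (c : ℂ) : constHom q W c =
      pb q (U := ⊤) (V := W) le_top ((Scheme.ΓSpecIso (CommRingCat.of ℂ)).inv.hom c) := rfl
  rw [h, h]
  exact pb_pb f p _ e _

lemma basicOpen_pb (f : X ⟶ Y) {U : Y.Opens} {V : X.Opens} (e : V ≤ f ⁻¹ᵁ U) (a : Γ(Y, U)) :
    X.basicOpen (pb f e a) = V ⊓ f ⁻¹ᵁ Y.basicOpen a :=
  Scheme.basicOpen_appLE f V U e a

lemma basicOpen_res' {U V : X.Opens} (h : U ≤ V) (a : Γ(X, V)) :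
    X.basicOpen (res h a) = U ⊓ X.basicOpen a :=
  Scheme.basicOpen_res X a (homOfLE h).op

lemma bijective_pb_of_isOpenImmersion (f : X ⟶ Y) [IsOpenImmersion f] {U : Y.Opens}
    (hU : f.opensRange = U) (e : ⊤ ≤ f ⁻¹ᵁ U) : Function.Bijective (pb f e) := by
  subst hU
  have h1 : pb f e = (X.presheaf.map (homOfLE e).op).hom.comp (f.app f.opensRange).hom := rfl
  rw [h1, RingHom.coe_comp]
  have h2 : f ⁻¹ᵁ f.opensRange = ⊤ := f.preimage_opensRange
  have h3 : IsIso (homOfLE e) := ⟨homOfLE le_top, rfl, rfl⟩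
  have h4 : IsIso (f.app f.opensRange) := f.isIso_app _ le_rfl
  exact (ConcreteCategory.bijective_of_isIso (X.presheaf.map (homOfLE e).op)).comp
    (ConcreteCategory.bijective_of_isIso _)

end Sections

/-! ### Ideal sheaves -/

section IdealSheaf

variable {X Y : Scheme.{0}}

/-- The ideal of an ideal sheaf on an affine open set. -/
def idealOn (I : X.IdealSheafData) {U : X.Opens} (hU : IsAffineOpen U) : Ideal Γ(X, U) :=
  I.ideal ⟨U, hU⟩

lemma map_res_idealOn (I : X.IdealSheafData) {U V : X.Opens} (hU : IsAffineOpen U)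
    (hV : IsAffineOpen V) (h : U ≤ V) : (idealOn I hV).map (res h) = idealOn I hU :=
  I.map_ideal (U := ⟨U, hU⟩) (V := ⟨V, hV⟩) h

lemma idealOn_comap_top_of_isOpenImmersion (I : Y.IdealSheafData) (f : X ⟶ Y)
    [IsOpenImmersion f] (hX : IsAffineOpen (⊤ : X.Opens)) {U : Y.Opens} (hU' : IsAffineOpen U)
    (hU : f.opensRange = U) (e : ⊤ ≤ f ⁻¹ᵁ U) :
    idealOn (I.comap f) hX = (idealOn I hU').map (pb f e) := by
  have hle : f ''ᵁ ⊤ ≤ U := by rw [← hU]; exact (f.image_top_eq_opensRange).le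
  have h0 : idealOn (I.comap f) hX =
      (idealOn I (hX.image_of_isOpenImmersion f)).comap (f.appIso ⊤).inv.hom :=
    I.ideal_comap_of_isOpenImmersion f ⟨⊤, hX⟩
  have h1 : (idealOn I (hX.image_of_isOpenImmersion f)).comap (f.appIso ⊤).inv.hom =
      (idealOn I (hX.image_of_isOpenImmersion f)).map (f.appIso ⊤).hom.hom :=
    Ideal.comap_symm (f.appIso ⊤).commRingCatIsoToRingEquiv
  rw [h0, h1, ← map_res_idealOn I _ hU' hle, Ideal.map_map]
  congr 1
  ext a
  change ((f.appIso ⊤).hom.hom) (res hle a) = _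
  rw [Scheme.Hom.appIso_hom']
  exact pb_res f _ hle a

/-- On affine schemes ideal sheaves are ideals. The inverse image is left adjoint to the direct
image, and the latter is `Ideal.comap` on global sections; so the inverse image is the extension of
ideals, the left adjoint of `Ideal.comap`. -/
lemma idealOn_comap_top (I : Y.IdealSheafData) (f : X ⟶ Y)
    (hX : IsAffineOpen (⊤ : X.Opens)) (hY : IsAffineOpen (⊤ : Y.Opens)) (e : ⊤ ≤ f ⁻¹ᵁ ⊤) :
    idealOn (I.comap f) hX = (idealOn I hY).map (pb f e) := by
  have : IsAffine X := .of_isIso (h := hX) X.topIso.inv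
  have : IsAffine Y := .of_isIso (h := hY) Y.topIso.inv
  have key (K : X.IdealSheafData) : I.comap f ≤ K ↔
      (idealOn I hY).map (pb f e) ≤ idealOn K hX := by
    rw [← Scheme.IdealSheafData.le_map_iff_comap_le, Ideal.map_le_iff_le_comap]
    have : idealOn (K.map f) hY = (idealOn K hX).comap (pb f e) := by
      refine (Scheme.IdealSheafData.ideal_map K f ⟨⊤, hY⟩ hX).trans ?_
      change Ideal.comap _ (idealOn K hX) = _
      congr 1
      ext a
      exact ((pb_eq_res_app f e a).trans (res_self _ _)).symm
    rw [← this]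
    exact ⟨fun h ↦ h ⟨⊤, hY⟩, fun h ↦ Scheme.IdealSheafData.le_of_isAffine h⟩
  apply le_antisymm
  · set K := Scheme.IdealSheafData.equivOfIsAffine.symm ((idealOn I hY).map (pb f e)) with hK
    have hK' : idealOn K hX = (idealOn I hY).map (pb f e) := by
      change Scheme.IdealSheafData.equivOfIsAffine K = _
      rw [hK]
      exact Scheme.IdealSheafData.equivOfIsAffine.apply_symm_apply _
    exact ((key K).mpr hK'.ge ⟨⊤, hX⟩).trans hK'.le
  · exact (key _).mp le_rfl

/-- The inverse image ideal sheaf on an affine open set. -/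
theorem idealOn_comap (I : Y.IdealSheafData) (f : X ⟶ Y) {U : Y.Opens} {V : X.Opens}
    (hU : IsAffineOpen U) (hV : IsAffineOpen V) (e : V ≤ f ⁻¹ᵁ U) :
    idealOn (I.comap f) hV = (idealOn I hU).map (pb f e) := by
  have : IsAffine V.toScheme := hV
  have : IsAffine U.toScheme := hU
  have e1 : ⊤ ≤ V.ι ⁻¹ᵁ V := by simp
  have e2 : ⊤ ≤ U.ι ⁻¹ᵁ U := by simp
  have e3 : ⊤ ≤ (f.resLE U V e) ⁻¹ᵁ ⊤ := le_rfl
  -- The composite `V.ι ≫ f` factors as `f.resLE U V e ≫ U.ι`: an affine morphism problem between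
  -- two open immersions, for which the formula is already known.
  have h1 := idealOn_comap_top_of_isOpenImmersion (I.comap f) V.ι (isAffineOpen_top _) hV
    (by simp) e1
  have h2 := idealOn_comap_top_of_isOpenImmersion I U.ι (isAffineOpen_top _) hU (by simp) e2
  have h3 := idealOn_comap_top (I.comap U.ι) (f.resLE U V e) (isAffineOpen_top _)
    (isAffineOpen_top _) e3
  rw [h2, ← Scheme.IdealSheafData.comap_comp, Scheme.Hom.resLE_comp_ι,
    Scheme.IdealSheafData.comap_comp, h1, Ideal.map_map] at h3
  have hb := bijective_pb_of_isOpenImmersion V.ι (U := V) (by simp) e1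
  have h4 : (pb (f.resLE U V e) e3).comp (pb U.ι e2) = (pb V.ι e1).comp (pb f e) := by
    rw [pb_comp, pb_comp]
    exact pb_congr (f.resLE_comp_ι e) _ _
  rw [h4, ← Ideal.map_map] at h3
  have hinj (J : Ideal Γ(X, V)) : (J.map (pb V.ι e1)).comap (pb V.ι e1) = J :=
    Ideal.comap_map_of_bijective _ hb
  rw [← hinj (idealOn (I.comap f) hV), h3, hinj]

/-- The open set `W` is only required to be equal to a basic open set, because it usually arises as
an intersection. -/
lemma exists_res_eq_pow_mul {U W : X.Opens} (hU : IsCompact (U : Set X))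
    (hU' : IsQuasiSeparated (U : Set X)) (f : Γ(X, U)) (h : W ≤ U) (hW : W = X.basicOpen f)
    (c : Γ(X, W)) : ∃ (n : ℕ) (c' : Γ(X, U)), res h c' = res h f ^ n * c := by
  subst hW
  exact exists_eq_pow_mul_of_isCompact_of_isQuasiSeparated X U hU hU' f c

lemma exists_pow_mul_eq_zero {U W : X.Opens} (hU : IsCompact (U : Set X)) (f : Γ(X, U))
    (h : W ≤ U) (hW : W = X.basicOpen f) (c : Γ(X, U)) (hc : res h c = 0) :
    ∃ n : ℕ, f ^ n * c = 0 := by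
  subst hW
  exact exists_pow_mul_eq_zero_of_res_basicOpen_eq_zero_of_isCompact X hU c f hc

/-- The ideal of sections on `U` that are multiples of `s k` on each `V k`. -/
def multiplesIdeal {κ : Type} (V : κ → X.Opens) (s : ∀ k, Γ(X, V k)) (U : X.Opens) :
    Ideal Γ(X, U) :=
  ⨅ k, (Ideal.span {res (inf_le_right : U ⊓ V k ≤ V k) (s k)}).comap
    (res (inf_le_left : U ⊓ V k ≤ U))

lemma mem_multiplesIdeal {κ : Type} {V : κ → X.Opens} {s : ∀ k, Γ(X, V k)} {U : X.Opens}
    {a : Γ(X, U)} : a ∈ multiplesIdeal V s U ↔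
      ∀ k, res (inf_le_right : U ⊓ V k ≤ V k) (s k) ∣ res inf_le_left a := by
  simp only [multiplesIdeal, Ideal.mem_iInf, Ideal.mem_comap, Ideal.mem_span_singleton]

/-- This is the quasi-coherence of the ideal of multiples. If `s k` divides `b` on `D(f) ⊓ V k`, the
quotient has a power of `f` as denominator, since `U ⊓ V k` is quasi-compact; as there are finitely
many `k`, one power of `f` serves for all. -/
lemma map_multiplesIdeal_basicOpen {κ : Type} [Finite κ] [QuasiSeparatedSpace X]
    (V : κ → X.Opens) (s : ∀ k, Γ(X, V k)) (hV : ∀ k, IsCompact (V k : Set X)) {U : X.Opens}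
    (hU : IsAffineOpen U) (f : Γ(X, U)) :
    (multiplesIdeal V s U).map (res (X.basicOpen_le f)) = multiplesIdeal V s (X.basicOpen f) := by
  have hDU : X.basicOpen f ≤ U := X.basicOpen_le f
  have hinf (k) : X.basicOpen f ⊓ V k ≤ U ⊓ V k := inf_le_inf_right _ hDU
  apply le_antisymm
  · rw [Ideal.map_le_iff_le_comap]
    intro a ha
    rw [Ideal.mem_comap, mem_multiplesIdeal]
    intro k
    simpa using map_dvd (res (hinf k)) (mem_multiplesIdeal.mp ha k)
  · intro b hb
    rw [mem_multiplesIdeal] at hb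
    choose c hc using hb
    obtain ⟨n, a, ha⟩ := exists_res_eq_pow_mul hU.isCompact hU.isQuasiSeparated f hDU rfl b
    have hcomp (k) : IsCompact ((U ⊓ V k : X.Opens) : Set X) :=
      QuasiSeparatedSpace.inter_isCompact _ _ U.2 hU.isCompact (V k).2 (hV k)
    have hqs (k) : IsQuasiSeparated ((U ⊓ V k : X.Opens) : Set X) :=
      hU.isQuasiSeparated.of_subset Set.inter_subset_left
    have hW (k) : X.basicOpen f ⊓ V k = X.basicOpen (res (inf_le_left : U ⊓ V k ≤ U) f) := by
      rw [basicOpen_res']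
      apply le_antisymm
      · exact le_inf (hinf k) inf_le_left
      · exact le_inf inf_le_right (inf_le_left.trans inf_le_right)
    -- The exponent `m` clears the denominator of the quotient `c k`, and `l` kills the error, which
    -- is zero only after restriction to `D(f)`.
    have step (k) : ∃ N : ℕ, ∃ d, d * res inf_le_right (s k) =
        res (inf_le_left : U ⊓ V k ≤ U) (f ^ N * a) := by
      obtain ⟨m, c', hc'⟩ := exists_res_eq_pow_mul (hcomp k) (hqs k) _ (hinf k) (hW k) (c k)
      obtain ⟨l, hl⟩ := exists_pow_mul_eq_zero (hcomp k) _ (hinf k) (hW k)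
        (res inf_le_left (f ^ m * a) -
          res inf_le_left f ^ n * (c' * res inf_le_right (s k))) (by
          have h1 := congr(res (inf_le_left : X.basicOpen f ⊓ V k ≤ X.basicOpen f) $ha)
          have h2 := hc k
          simp only [map_sub, map_mul, map_pow, res_res] at h1 h2 hc' ⊢
          rw [hc', h1, h2]; ring)
      refine ⟨l + m, res inf_le_left f ^ l * (res inf_le_left f ^ n * c'), ?_⟩
      rw [mul_sub, sub_eq_zero] at hl
      simp only [map_mul, map_pow] at hl ⊢
      rw [pow_add]
      linear_combination -hl
    choose N d hd using step
    cases nonempty_fintype κ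
    have hle (k) : N k ≤ ∑ k, N k :=
      Finset.single_le_sum (fun _ _ ↦ Nat.zero_le _) (Finset.mem_univ k)
    have hmem : f ^ (∑ k, N k) * a ∈ multiplesIdeal V s U := by
      rw [mem_multiplesIdeal]
      intro k
      refine ⟨res inf_le_left f ^ (∑ k, N k - N k) * d k, ?_⟩
      rw [mul_left_comm, mul_comm (res _ (s k)), hd k, ← map_pow, ← map_mul, ← mul_assoc,
        ← pow_add, Nat.sub_add_cancel (hle k)]
    have hu : IsUnit (res hDU f) := RingedSpace.isUnit_res_basicOpen _ f
    have h3 := Ideal.mem_map_of_mem (res hDU) hmem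
    rw [map_mul, map_pow, ha, ← mul_assoc, ← pow_add] at h3
    exact (Ideal.unit_mul_mem_iff_mem _ (hu.pow _)).mp h3

variable {κ : Type} [Finite κ] [QuasiSeparatedSpace X] (V : κ → X.Opens) (s : ∀ k, Γ(X, V k))

/-- `Scheme.IdealSheafData.ofIdeals` does not shrink a family of ideals that is compatible with
localization, and `map_multiplesIdeal_basicOpen` says that this one is. -/
theorem idealOn_localEquationsIdeal (hV : ∀ k, IsCompact (V k : Set X)) {U : X.Opens}
    (hU : IsAffineOpen U) :
    idealOn (localEquationsIdeal V s) hU = multiplesIdeal V s U := by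
  let I : X.IdealSheafData :=
    { ideal := fun U ↦ multiplesIdeal V s U.1
      map_ideal_basicOpen := fun U f ↦ map_multiplesIdeal_basicOpen V s hV U.2 f }
  have : localEquationsIdeal V s = I := Scheme.IdealSheafData.ofIdeals_ideal I
  rw [this]
  rfl

/-- On an affine open set inside `V k`, the ideal sheaf with compatible local equations `s` is
generated by `s k`. -/
theorem idealOn_localEquationsIdeal_of_le (hV : ∀ k, IsCompact (V k : Set X)) {U : X.Opens}
    (hU' : IsAffineOpen U) (k : κ) (hU : U ≤ V k)
    (h : ∀ l, res (inf_le_right : V k ⊓ V l ≤ V l) (s l) ∣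
      res (inf_le_left : V k ⊓ V l ≤ V k) (s k)) :
    idealOn (localEquationsIdeal V s) hU' = Ideal.span {res hU (s k)} := by
  rw [idealOn_localEquationsIdeal V s hV]
  apply le_antisymm
  · intro a ha
    rw [mem_multiplesIdeal] at ha
    rw [Ideal.mem_span_singleton]
    simpa using map_dvd (res (le_inf le_rfl hU : U ≤ U ⊓ V k)) (ha k)
  · rw [Ideal.span_singleton_le_iff_mem, mem_multiplesIdeal]
    intro l
    simpa using map_dvd (res (inf_le_inf_right _ hU : U ⊓ V l ≤ V k ⊓ V l)) (h l)

end IdealSheaf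

/-! ### Polynomial presentations of rings of sections -/

section Presentation

variable {X Y : Scheme.{0}}

/-- Evaluation of polynomials at a tuple of sections. -/
def evalAt (p : X ⟶ SpecC) {U : X.Opens} {σ : Type} (z : σ → Γ(X, U)) :
    MvPolynomial σ ℂ →+* Γ(X, U) :=
  MvPolynomial.eval₂Hom (constHom p U) z

@[simp] lemma evalAt_X (p : X ⟶ SpecC) {U : X.Opens} {σ : Type} (z : σ → Γ(X, U)) (k : σ) :
    evalAt p z (MvPolynomial.X k) = z k := by simp [evalAt]

@[simp] lemma evalAt_C (p : X ⟶ SpecC) {U : X.Opens} {σ : Type} (z : σ → Γ(X, U)) (c : ℂ) :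
    evalAt p z (MvPolynomial.C c) = constHom p U c := by simp [evalAt]

lemma pb_evalAt (f : X ⟶ Y) (p : Y ⟶ SpecC) {U : Y.Opens} {V : X.Opens} (e : V ≤ f ⁻¹ᵁ U)
    {σ : Type} (z : σ → Γ(Y, U)) (G : MvPolynomial σ ℂ) :
    pb f e (evalAt p z G) = evalAt (f ≫ p) (fun k ↦ pb f e (z k)) G := by
  have : (pb f e).comp (evalAt p z) = evalAt (f ≫ p) (fun k ↦ pb f e (z k)) :=
    MvPolynomial.ringHom_ext (fun c ↦ by simp [pb_constHom]) (fun k ↦ by simp)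
  exact congr($this G)

lemma res_evalAt (p : X ⟶ SpecC) {U V : X.Opens} (h : U ≤ V)
    {σ : Type} (z : σ → Γ(X, V)) (G : MvPolynomial σ ℂ) :
    res h (evalAt p z G) = evalAt p (fun k ↦ res h (z k)) G := by
  have : (res h).comp (evalAt p z) = evalAt p (fun k ↦ res h (z k)) :=
    MvPolynomial.ringHom_ext (fun c ↦ by simp [res_constHom]) (fun k ↦ by simp)
  exact congr($this G)

/-- The sections `z` generate `Γ(X, U)` over `ℂ`, with ideal of relations `J`. -/
structure Presents (p : X ⟶ SpecC) (U : X.Opens) {σ : Type} (z : σ → Γ(X, U))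
    (J : Ideal (MvPolynomial σ ℂ)) : Prop where
  surjective : Function.Surjective (evalAt p z)
  ker_eq : RingHom.ker (evalAt p z) = J

/-- Relations on the coordinates of a subscheme. -/
lemma Presents.subscheme {p : X ⟶ SpecC} {U : X.Opens} {σ : Type} {z : σ → Γ(X, U)}
    {J : Ideal (MvPolynomial σ ℂ)} (h : Presents p U z J) (hU : IsAffineOpen U)
    (I : X.IdealSheafData) :
    Presents (I.subschemeι ≫ p) (I.subschemeι ⁻¹ᵁ U) (fun k ↦ pb I.subschemeι le_rfl (z k))
      ((idealOn I hU).comap (evalAt p z)) := by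
  have hpb : evalAt (I.subschemeι ≫ p) (fun k ↦ pb I.subschemeι (V := I.subschemeι ⁻¹ᵁ U)
      le_rfl (z k)) = (pb I.subschemeι le_rfl).comp (evalAt p z) :=
    RingHom.ext fun G ↦ (pb_evalAt _ _ _ _ G).symm
  have hpb' : pb I.subschemeι (U := U) (V := I.subschemeι ⁻¹ᵁ U) le_rfl =
    (I.subschemeι.app U).hom := RingHom.ext fun a ↦ (pb_eq_res_app _ _ a).trans (res_self _ _)
  constructor
  · rw [hpb, RingHom.coe_comp]
    refine Function.Surjective.comp ?_ h.surjective
    rw [hpb']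
    exact I.subschemeι_app_surjective ⟨U, hU⟩
  · rw [hpb, ← RingHom.comap_ker, hpb']
    exact congrArg _ (I.ker_subschemeι_app ⟨U, hU⟩)

lemma Presents.comap_map {p : X ⟶ SpecC} {U : X.Opens} {σ : Type} {z : σ → Γ(X, U)}
    {J : Ideal (MvPolynomial σ ℂ)} (h : Presents p U z J) (K : Ideal (MvPolynomial σ ℂ)) :
    (K.map (evalAt p z)).comap (evalAt p z) = K ⊔ J := by
  rw [Ideal.comap_map_of_surjective' _ h.surjective, h.ker_eq]

/-- Ring homomorphisms out of a ring of sections with a presentation. -/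
lemma Presents.exists_lift {p : X ⟶ SpecC} {U : X.Opens} {σ : Type} {z : σ → Γ(X, U)}
    {J : Ideal (MvPolynomial σ ℂ)} (h : Presents p U z J) {R : Type*} [CommRing R]
    (g : MvPolynomial σ ℂ →+* R) (hg : ∀ G ∈ J, g G = 0) :
    ∃ χ : Γ(X, U) →+* R, χ.comp (evalAt p z) = g := by
  refine ⟨RingHom.liftOfSurjective _ h.surjective ⟨g, ?_⟩, RingHom.liftOfSurjective_comp _ _ _⟩
  rw [h.ker_eq]
  exact hg

lemma Presents.hom_ext {p : X ⟶ SpecC} {U : X.Opens} {σ : Type} {z : σ → Γ(X, U)}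
    {J : Ideal (MvPolynomial σ ℂ)} (h : Presents p U z J) {R : Type*} [CommRing R]
    {χ χ' : Γ(X, U) →+* R} (hc : ∀ c, χ (constHom p U c) = χ' (constHom p U c))
    (hz : ∀ k, χ (z k) = χ' (z k)) : χ = χ' := by
  have : χ.comp (evalAt p z) = χ'.comp (evalAt p z) :=
    MvPolynomial.ringHom_ext (fun c ↦ by simp [hc]) (fun k ↦ by simp [hz])
  exact (RingHom.cancel_right h.surjective).mp this

lemma Presents.of_bijective {p : X ⟶ SpecC} {U : X.Opens} {σ : Type} {z : σ → Γ(X, U)}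
    {J : Ideal (MvPolynomial σ ℂ)}
    (hJ : ∀ G ∈ J, evalAt p z G = 0) (χ : Γ(X, U) →+* MvPolynomial σ ℂ ⧸ J)
    (hχ : ∀ G, χ (evalAt p z G) = Ideal.Quotient.mk J G)
    (hs : Function.Surjective (evalAt p z)) : Presents p U z J := by
  refine ⟨hs, le_antisymm (fun G hG ↦ ?_) fun G hG ↦ hJ G hG⟩
  rw [← Ideal.Quotient.eq_zero_iff_mem, ← hχ, RingHom.mem_ker.mp hG, map_zero]

section Product

variable {p : X ⟶ SpecC} {q : Y ⟶ SpecC} {U : X.Opens} {V : Y.Opens}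

/-- The open subset `U × V` of `X × Y`. -/
abbrev prodOpen (p : X ⟶ SpecC) (q : Y ⟶ SpecC) (U : X.Opens) (V : Y.Opens) :
    (pullback p q).Opens :=
  pullback.fst p q ⁻¹ᵁ U ⊓ pullback.snd p q ⁻¹ᵁ V

lemma isAffineOpen_prodOpen (hU : IsAffineOpen U) (hV : IsAffineOpen V) :
    IsAffineOpen (prodOpen p q U V) := by
  have : IsAffine U.toScheme := hU
  have : IsAffine V.toScheme := hV
  have : IsAffine (⊤ : SpecC.Opens).toScheme := isAffineOpen_top _
  exact IsAffine.of_isPullback (Scheme.Hom.isPullback_resLE (IsPullback.of_hasPullback p q)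
    (US := ⊤) (UT := V) (UX := U) le_top le_top rfl)

/-- The open set is the fibre product of the affine schemes `U` and `V`, so its ring of functions is
a tensor product over `ℂ`. -/
lemma isPushout_prodOpen (hU : IsAffineOpen U) (hV : IsAffineOpen V) :
    IsPushout (p.appLE ⊤ U le_top) (q.appLE ⊤ V le_top)
      ((pullback.fst p q).appLE U (prodOpen p q U V) inf_le_left)
      ((pullback.snd p q).appLE V (prodOpen p q U V) inf_le_right) := by
  have : IsAffine U.toScheme := hU
  have : IsAffine V.toScheme := hV
  have : IsAffine (⊤ : SpecC.Opens).toScheme := isAffineOpen_top _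
  have h := isPushout_appTop_of_isPullback
    (Scheme.Hom.isPullback_resLE (IsPullback.of_hasPullback p q)
      (US := ⊤) (UT := V) (UX := U) le_top le_top (UY := prodOpen p q U V) rfl)
  refine IsPushout.of_iso h (Scheme.Opens.topIso _) U.topIso V.topIso (Scheme.Opens.topIso _)
    ?_ ?_ ?_ ?_ <;>
  · exact (Iso.eq_comp_inv _).mp
      ((Scheme.Hom.resLE_app_top ..).trans (Category.assoc _ _ _).symm)

lemma exists_lift_prodOpen (hU : IsAffineOpen U) (hV : IsAffineOpen V) {R : Type} [CommRing R]
    (φ : Γ(X, U) →+* R) (ψ : Γ(Y, V) →+* R)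
    (h : ∀ c, φ (constHom p U c) = ψ (constHom q V c)) :
    ∃ χ : Γ(pullback p q, prodOpen p q U V) →+* R,
      χ.comp (pb (pullback.fst p q) inf_le_left) = φ ∧
      χ.comp (pb (pullback.snd p q) inf_le_right) = ψ := by
  have hP := isPushout_prodOpen (p := p) (q := q) hU hV
  have hw : p.appLE ⊤ U le_top ≫ CommRingCat.ofHom φ =
      q.appLE ⊤ V le_top ≫ CommRingCat.ofHom ψ := by
    ext a
    obtain ⟨c, rfl⟩ := (ConcreteCategory.bijective_of_isIso
      (Scheme.ΓSpecIso (CommRingCat.of ℂ)).inv).2 a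
    exact h c
  refine ⟨(hP.desc _ _ hw).hom, ?_, ?_⟩
  · exact congr(($(hP.inl_desc _ _ hw)).hom)
  · exact congr(($(hP.inr_desc _ _ hw)).hom)

lemma hom_ext_prodOpen (hU : IsAffineOpen U) (hV : IsAffineOpen V) {R : Type} [CommRing R]
    {χ χ' : Γ(pullback p q, prodOpen p q U V) →+* R}
    (h1 : χ.comp (pb (pullback.fst p q) inf_le_left) =
      χ'.comp (pb (pullback.fst p q) inf_le_left))
    (h2 : χ.comp (pb (pullback.snd p q) inf_le_right) =
      χ'.comp (pb (pullback.snd p q) inf_le_right)) : χ = χ' := by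
  have hP := isPushout_prodOpen (p := p) (q := q) hU hV
  have : CommRingCat.ofHom χ = CommRingCat.ofHom χ' :=
    hP.hom_ext (CommRingCat.hom_ext h1) (CommRingCat.hom_ext h2)
  exact congr(($this).hom)

/-- Relations on the coordinates of a product. -/
lemma Presents.prod (hU : IsAffineOpen U) (hV : IsAffineOpen V) {σ τ : Type}
    {z : σ → Γ(X, U)} {w : τ → Γ(Y, V)} {J : Ideal (MvPolynomial σ ℂ)}
    {K : Ideal (MvPolynomial τ ℂ)} (h : Presents p U z J) (h' : Presents q V w K) :
    Presents (pullback.fst p q ≫ p) (prodOpen p q U V)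
      (Sum.elim (fun k ↦ pb (pullback.fst p q) inf_le_left (z k))
        (fun l ↦ pb (pullback.snd p q) inf_le_right (w l)))
      (J.map (MvPolynomial.rename Sum.inl).toRingHom ⊔
        K.map (MvPolynomial.rename Sum.inr).toRingHom) := by
  set ev := evalAt (pullback.fst p q ≫ p) (U := prodOpen p q U V)
    (Sum.elim (fun k ↦ pb (pullback.fst p q) inf_le_left (z k))
        (fun l ↦ pb (pullback.snd p q) inf_le_right (w l))) with hev
  set L := J.map (MvPolynomial.rename (R := ℂ) (Sum.inl : σ → σ ⊕ τ)).toRingHom ⊔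
        K.map (MvPolynomial.rename (R := ℂ) (Sum.inr : τ → σ ⊕ τ)).toRingHom with hL
  have hevl : ev.comp (MvPolynomial.rename Sum.inl).toRingHom =
      (pb (pullback.fst p q) inf_le_left).comp (evalAt p z) :=
    MvPolynomial.ringHom_ext (fun c ↦ by simp [hev, pb_constHom]) (fun k ↦ by simp [hev])
  have hevr : ev.comp (MvPolynomial.rename Sum.inr).toRingHom =
      (pb (pullback.snd p q) inf_le_right).comp (evalAt q w) :=
    MvPolynomial.ringHom_ext (fun c ↦ by simp [hev, pb_constHom, pullback.condition])
      (fun k ↦ by simp [hev])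
  have hJ : ∀ G ∈ L, ev G = 0 := by
    change L ≤ RingHom.ker ev
    rw [hL, sup_le_iff, Ideal.map_le_iff_le_comap, Ideal.map_le_iff_le_comap, RingHom.comap_ker,
      RingHom.comap_ker, hevl, hevr]
    constructor
    · intro G hG
      rw [← h.ker_eq] at hG
      rw [RingHom.mem_ker, RingHom.comp_apply, RingHom.mem_ker.mp hG, map_zero]
    · intro G hG
      rw [← h'.ker_eq] at hG
      rw [RingHom.mem_ker, RingHom.comp_apply, RingHom.mem_ker.mp hG, map_zero]
  obtain ⟨φ, hφ⟩ := h.exists_lift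
    ((Ideal.Quotient.mk L).comp (MvPolynomial.rename Sum.inl).toRingHom) (fun G hG ↦
      Ideal.Quotient.eq_zero_iff_mem.mpr (Ideal.mem_sup_left (Ideal.mem_map_of_mem _ hG)))
  obtain ⟨ψ, hψ⟩ := h'.exists_lift
    ((Ideal.Quotient.mk L).comp (MvPolynomial.rename Sum.inr).toRingHom) (fun G hG ↦
      Ideal.Quotient.eq_zero_iff_mem.mpr (Ideal.mem_sup_right (Ideal.mem_map_of_mem _ hG)))
  obtain ⟨χ, hχ1, hχ2⟩ := exists_lift_prodOpen (p := p) (q := q) hU hV φ ψ (fun c ↦ by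
    have h1 := congr($hφ (MvPolynomial.C c))
    have h2 := congr($hψ (MvPolynomial.C c))
    simp at h1 h2
    rw [h1, h2])
  have hχ : χ.comp ev = Ideal.Quotient.mk L := by
    refine MvPolynomial.ringHom_ext (fun c ↦ ?_) ?_
    · have h1 := congr($hφ (MvPolynomial.C c))
      have h2 := congr($hχ1 (constHom p U c))
      simp [pb_constHom] at h1 h2
      simp [hev, h1, h2]
    · rintro (k | l)
      · have h1 := congr($hφ (MvPolynomial.X k))
        have h2 := congr($hχ1 (z k))
        simp at h1 h2
        simp [hev, h1, h2]
      · have h1 := congr($hψ (MvPolynomial.X l))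
        have h2 := congr($hχ2 (w l))
        simp at h1 h2
        simp [hev, h1, h2]
  refine Presents.of_bijective hJ χ (fun G ↦ congr($hχ G)) ?_
  -- This composition is the identity on the images of both factors, hence everywhere; therefore
  -- each section is the value of a polynomial.
  have hid : (Ideal.Quotient.lift L ev hJ).comp χ = RingHom.id _ := by
    apply hom_ext_prodOpen hU hV
    · rw [RingHom.comp_assoc, hχ1]
      apply (RingHom.cancel_right h.surjective).mp
      rw [RingHom.comp_assoc, hφ, ← RingHom.comp_assoc, Ideal.Quotient.lift_comp_mk, hevl]
      rfl
    · rw [RingHom.comp_assoc, hχ2]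
      apply (RingHom.cancel_right h'.surjective).mp
      rw [RingHom.comp_assoc, hψ, ← RingHom.comp_assoc, Ideal.Quotient.lift_comp_mk, hevr]
      rfl
  intro a
  obtain ⟨G, hG⟩ := Ideal.Quotient.mk_surjective (χ a)
  refine ⟨G, ?_⟩
  have := congr($hid a)
  rw [RingHom.comp_apply, ← hG] at this
  exact this

end Product

end Presentation

/-! ### Charts of projective space -/

lemma X_mem_grading (n : ℕ) (i : Fin (n + 1)) : MvPolynomial.X i ∈ grading n 1 :=
  MvPolynomial.isHomogeneous_X ℂ i

lemma PSpace.isAffineOpen_chart (n : ℕ) (i : Fin (n + 1)) : IsAffineOpen (chart n i) :=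
  Proj.isAffineOpen_basicOpen (grading n) (MvPolynomial.X i) (m := 1)
    (X_mem_grading n i) one_pos

/-- The comparison is made after the isomorphism of `Γ(X, U)` with the global functions on `U`,
where `constHom` can be read off from the morphism to `Spec ℂ`. -/
lemma constHom_eq_of_toSpecΓ {X : Scheme.{0}} {p : X ⟶ SpecC} {U : X.Opens}
    (ψ : CommRingCat.of ℂ ⟶ Γ(X, U)) (h : U.ι ≫ p = U.toSpecΓ ≫ Spec.map ψ) :
    constHom p U = ψ.hom := by
  have e : ⊤ ≤ U.ι ⁻¹ᵁ U := by simp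
  have hb := bijective_pb_of_isOpenImmersion U.ι (U := U) (by simp) e
  ext c
  apply hb.1
  rw [pb_constHom, h]
  have h1 : constHom (U.toSpecΓ ≫ Spec.map ψ) ⊤ c =
    (U.toSpecΓ ≫ Spec.map ψ).appTop.hom ((Scheme.ΓSpecIso (CommRingCat.of ℂ)).inv.hom c) :=
      res_self _ _
  rw [h1]
  have h2 : (Scheme.ΓSpecIso (CommRingCat.of ℂ)).inv ≫ (U.toSpecΓ ≫ Spec.map ψ).appTop =
      ψ ≫ U.topIso.inv := by
    rw [Scheme.Hom.comp_appTop, ← Scheme.ΓSpecIso_inv_naturality_assoc,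
      Scheme.Opens.toSpecΓ_appTop, Iso.inv_hom_id_assoc]
  refine congr(($h2).hom c).trans ?_
  have h3 : U.topIso.inv = U.ι.appLE U ⊤ e := by
    simp only [Scheme.Opens.topIso_inv, Scheme.Hom.appLE, Scheme.Opens.ι_app]
    exact (congrArg X.presheaf.map (Subsingleton.elim _ _)).trans (X.presheaf.map_comp _ _)
  exact congr(($h3).hom (ψ.hom c))

lemma PSpace.constHom_chart (n : ℕ) (i : Fin (n + 1)) : constHom (PSpace.toBase n) (chart n i) =
    (Proj.awayToSection (grading n) (MvPolynomial.X i)).hom.comp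
      ((HomogeneousLocalization.fromZeroRingHom (grading n) _).comp
        (algebraMap ℂ (grading n 0))) := by
  refine constHom_eq_of_toSpecΓ (CommRingCat.ofHom (algebraMap ℂ (grading n 0)) ≫
    CommRingCat.ofHom (HomogeneousLocalization.fromZeroRingHom (grading n) _) ≫
    Proj.awayToSection (grading n) (MvPolynomial.X i)) ?_
  have h := Proj.awayι_toSpecZero (grading n) (MvPolynomial.X i) (m := 1)
    (X_mem_grading n i) one_pos
  unfold Proj.awayι at h
  rw [Category.assoc, Iso.inv_comp_eq, Proj.basicOpenIsoSpec_hom] at h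
  rw [PSpace.toBase, Spec.map_comp, Spec.map_comp, ← Category.assoc, ← Category.assoc]
  congr 1

/-! ### Weighted homogeneous polynomials and scaling -/

/-- A character `u` of the monoid of weights covers at once the scaling of homogeneous forms, of
bihomogeneous forms, and of forms that are homogeneous in a subset of the variables. -/
lemma eval₂_smul_of_isWeightedHomogeneous {σ M R S : Type*} [AddCommMonoid M] [CommSemiring R]
    [CommSemiring S] {w : σ → M} {a : M} {G : MvPolynomial σ R}
    (hG : G.IsWeightedHomogeneous w a) (φ : R →+* S) (u : Multiplicative M →* S) (z : σ → S) :
    MvPolynomial.eval₂ φ (fun k ↦ u (.ofAdd (w k)) * z k) G =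
      u (.ofAdd a) * MvPolynomial.eval₂ φ z G := by
  rw [MvPolynomial.eval₂_eq, MvPolynomial.eval₂_eq, Finset.mul_sum]
  refine Finset.sum_congr rfl fun d hd ↦ ?_
  have h := hG (MvPolynomial.mem_support_iff.mp hd)
  simp only [mul_pow, Finset.prod_mul_distrib]
  have : u (.ofAdd a) = ∏ i ∈ d.support, u (.ofAdd (w i)) ^ d i := by
    rw [← h, Finsupp.weight_apply, Finsupp.sum, ofAdd_sum, map_prod]
    simp [ofAdd_nsmul]
  rw [this]; ring

/-- The character `n ↦ r ^ n` of `ℕ`. -/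
def powChar {S : Type*} [CommMonoid S] (r : S) : Multiplicative ℕ →* S := powersHom S r

lemma eval₂_smul_of_isHomogeneous {σ R S : Type*} [CommSemiring R]
    [CommSemiring S] {a : ℕ} {G : MvPolynomial σ R}
    (hG : G.IsHomogeneous a) (φ : R →+* S) (r : S) (z : σ → S) :
    MvPolynomial.eval₂ φ (fun k ↦ r * z k) G = r ^ a * MvPolynomial.eval₂ φ z G := by
  simpa [powChar] using eval₂_smul_of_isWeightedHomogeneous hG φ (powChar r) z

lemma eval₂_smul_of_isBihomogeneous {m n : ℕ} {S : Type*}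
    [CommSemiring S] {a b : ℕ} {G : MvPolynomial (Fin (m + 1) ⊕ Fin (n + 1)) ℂ}
    (hG : IsBihomogeneous G a b) (φ : ℂ →+* S) (r s : S) (x : Fin (m + 1) → S)
    (y : Fin (n + 1) → S) :
    MvPolynomial.eval₂ φ (Sum.elim (fun k ↦ r * x k) (fun k ↦ s * y k)) G =
      r ^ a * s ^ b * MvPolynomial.eval₂ φ (Sum.elim x y) G := by
  let u : Multiplicative (ℕ × ℕ) →* S :=
    { toFun := fun c ↦ r ^ (Multiplicative.toAdd c).1 * s ^ (Multiplicative.toAdd c).2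
      map_one' := by simp
      map_mul' := fun c d ↦ by simp only [toAdd_mul, Prod.fst_add, Prod.snd_add, pow_add]; ring }
  have h := eval₂_smul_of_isWeightedHomogeneous hG φ u (Sum.elim x y)
  have h2 : (fun k ↦ u (.ofAdd (Sum.elim (fun _ ↦ ((1, 0) : ℕ × ℕ)) (fun _ ↦ (0, 1)) k)) *
      Sum.elim x y k) = Sum.elim (fun k ↦ r * x k) (fun k ↦ s * y k) := by
    funext k; rcases k with k | k <;> simp [u]
  rw [h2] at h
  exact h

/-! ### Coordinates on the charts of projective space -/

namespace PSpace

variable (n : ℕ) (i j k : Fin (n + 1))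

/-- The fraction `xₖ / xᵢ`. -/
def ratio : HomogeneousLocalization.Away (grading n) (MvPolynomial.X i) :=
  HomogeneousLocalization.Away.mk (grading n)
      (f := MvPolynomial.X i) (d := 1) (X_mem_grading n i) 1
      (MvPolynomial.X k) (by simpa using MvPolynomial.isHomogeneous_X ℂ k)

/-- Homogeneous fractions as functions on a chart. -/
def toSection : HomogeneousLocalization.Away (grading n) (MvPolynomial.X i) →+*
    Γ(PSpace n, chart n i) :=
  (Proj.awayToSection (grading n) (MvPolynomial.X i)).hom

lemma coordRatio_eq : coordRatio n i k = toSection n i (ratio n i k) := rfl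

lemma constHom_chart' : constHom (PSpace.toBase n) (chart n i) =
    (toSection n i).comp
      ((HomogeneousLocalization.fromZeroRingHom (grading n) _).comp
        (algebraMap ℂ (grading n 0))) := constHom_chart n i

lemma bijective_toSection : Function.Bijective (toSection n i) := by
  have : IsIso (Proj.awayToSection (grading n) (MvPolynomial.X i)) :=
    (Proj.basicOpenIsoAway (grading n) (MvPolynomial.X i) (m := 1) (X_mem_grading n i)
      one_pos).isIso_hom
  exact ConcreteCategory.bijective_of_isIso (Proj.awayToSection (grading n) (MvPolynomial.X i))

/-- Evaluation at the fractions `xₖ / xᵢ`. -/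
def evalRatio : MvPolynomial (Fin (n + 1)) ℂ →+*
    HomogeneousLocalization.Away (grading n) (MvPolynomial.X i) :=
  MvPolynomial.eval₂Hom ((HomogeneousLocalization.fromZeroRingHom (grading n) _).comp
        (algebraMap ℂ (grading n 0))) (ratio n i)

lemma evalRatio_X : evalRatio n i (MvPolynomial.X k) = ratio n i k :=
  MvPolynomial.eval₂Hom_X' _ _ _

lemma evalRatio_C (c : ℂ) : evalRatio n i (MvPolynomial.C c) =
    HomogeneousLocalization.fromZeroRingHom (grading n) _ (algebraMap ℂ (grading n 0) c) :=
  MvPolynomial.eval₂Hom_C _ _ _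

lemma evalAt_coordRatio : evalAt (toBase n) (coordRatio n i) =
    (toSection n i).comp (evalRatio n i) := by
  refine MvPolynomial.ringHom_ext (fun c ↦ ?_) (fun k ↦ ?_)
  · rw [evalAt_C, constHom_chart', RingHom.comp_apply, RingHom.comp_apply, RingHom.comp_apply,
      evalRatio_C]
  · rw [evalAt_X, coordRatio_eq, RingHom.comp_apply, evalRatio_X]

/-- Homogeneous fractions as elements of the localization. -/
def toLoc : HomogeneousLocalization.Away (grading n) (MvPolynomial.X i) →+*
    Localization.Away (MvPolynomial.X (R := ℂ) i) := algebraMap _ _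

lemma injective_toLoc : Function.Injective (toLoc n i) :=
  HomogeneousLocalization.val_injective _

/-- The localization map of the homogeneous coordinate ring. -/
def locMap : MvPolynomial (Fin (n + 1)) ℂ →+* Localization.Away (MvPolynomial.X (R := ℂ) i) :=
  algebraMap _ _

lemma isUnit_locMap : IsUnit (locMap n i (MvPolynomial.X i)) :=
  IsLocalization.map_units (Localization.Away (MvPolynomial.X (R := ℂ) i))
    (⟨MvPolynomial.X i, Submonoid.mem_powers _⟩ : Submonoid.powers (MvPolynomial.X (R := ℂ) i))

lemma injective_locMap : Function.Injective (locMap n i) :=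
  IsLocalization.injective _ (powers_le_nonZeroDivisors_of_noZeroDivisors (MvPolynomial.X_ne_zero i))

lemma locMap_mul_toLoc_mk (d : ℕ) (G : MvPolynomial (Fin (n + 1)) ℂ)
    (hG : G ∈ grading n (d • 1)) :
    locMap n i (MvPolynomial.X i ^ d) *
      toLoc n i (HomogeneousLocalization.Away.mk (grading n) (X_mem_grading n i) d G hG) =
    locMap n i G := by
  have : toLoc n i (HomogeneousLocalization.Away.mk (grading n) (X_mem_grading n i) d G hG) =
      Localization.mk G (⟨MvPolynomial.X i ^ d, pow_mem (Submonoid.mem_powers _) d⟩ :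
        Submonoid.powers (MvPolynomial.X (R := ℂ) i)) := rfl
  rw [this, Localization.mk_eq_mk', mul_comm]
  exact IsLocalization.mk'_spec _ _ _

/-- Homogeneity in the form `xᵢᵈ G(x / xᵢ) = G(x)`. Since `xᵢ` is a unit of the localization, this
identifies evaluation at the ratios with division by `xᵢᵈ`. -/
lemma locMap_mul_toLoc_evalRatio {d : ℕ} {G : MvPolynomial (Fin (n + 1)) ℂ}
    (hG : G.IsHomogeneous d) :
    locMap n i (MvPolynomial.X i ^ d) * toLoc n i (evalRatio n i G) = locMap n i G := by
  set a := locMap n i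
  set b := toLoc n i
  have h1 : b.comp (evalRatio n i) = MvPolynomial.eval₂Hom (a.comp MvPolynomial.C)
      (fun k ↦ b (ratio n i k)) := by
    refine MvPolynomial.ringHom_ext (fun c ↦ ?_) (fun k ↦ ?_)
    · rw [RingHom.comp_apply, evalRatio_C, MvPolynomial.eval₂Hom_C]
      exact Localization.mk_one_eq_algebraMap _
    · rw [RingHom.comp_apply, evalRatio_X, MvPolynomial.eval₂Hom_X']
  have h2 := eval₂_smul_of_isHomogeneous hG (a.comp MvPolynomial.C) (a (MvPolynomial.X i))
    (fun k ↦ b (ratio n i k))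
  have h3 (k) : a (MvPolynomial.X i) * b (ratio n i k) = a (MvPolynomial.X k) := by
    have := locMap_mul_toLoc_mk n i 1 (MvPolynomial.X k)
      (by simpa using MvPolynomial.isHomogeneous_X ℂ k)
    rwa [pow_one] at this
  simp only [h3] at h2
  have h4 : MvPolynomial.eval₂ (a.comp MvPolynomial.C) (fun k ↦ a (MvPolynomial.X k)) G = a G := by
    have : MvPolynomial.eval₂Hom (a.comp MvPolynomial.C) (fun k ↦ a (MvPolynomial.X k)) = a :=
      MvPolynomial.ringHom_ext (fun c ↦ by simp) (fun k ↦ by simp)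
    exact congr($this G)
  have h5 : b (evalRatio n i G) = MvPolynomial.eval₂ (a.comp MvPolynomial.C)
      (fun k ↦ b (ratio n i k)) G := congr($h1 G)
  rw [h4, ← h5] at h2
  rw [h2, ← map_pow]

lemma surjective_evalRatio : Function.Surjective (evalRatio n i) := by
  intro y
  obtain ⟨d, G, hG, rfl⟩ := HomogeneousLocalization.Away.mk_surjective (grading n)
    (X_mem_grading n i) y
  refine ⟨G, ?_⟩
  have hG' : G.IsHomogeneous d := by simpa using hG
  apply injective_toLoc n i
  refine ((isUnit_locMap n i).pow d).mul_left_cancel ?_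
  rw [← map_pow, locMap_mul_toLoc_evalRatio n i hG', locMap_mul_toLoc_mk]

lemma evalRatio_X_self : evalRatio n i (MvPolynomial.X i) = 1 := by
  apply injective_toLoc n i
  refine (isUnit_locMap n i).mul_left_cancel ?_
  have := locMap_mul_toLoc_evalRatio n i (MvPolynomial.isHomogeneous_X ℂ i)
  rw [pow_one] at this
  rw [this, map_one, mul_one]

/-- Modulo `xᵢ - 1` every polynomial is congruent to a homogeneous one, by padding its components
with powers of `xᵢ`. A homogeneous polynomial in the kernel is zero. -/
lemma ker_evalRatio : RingHom.ker (evalRatio n i) = Ideal.span {MvPolynomial.X i - 1} := by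
  apply le_antisymm
  · intro G hG
    set N := G.totalDegree
    set G' := ∑ d ∈ Finset.range (N + 1), MvPolynomial.homogeneousComponent d G *
      MvPolynomial.X i ^ (N - d) with hG'
    have hmem : G - G' ∈ Ideal.span {MvPolynomial.X i - (1 : MvPolynomial (Fin (n + 1)) ℂ)} := by
      have : G - G' = ∑ d ∈ Finset.range (N + 1), (MvPolynomial.homogeneousComponent d G -
          MvPolynomial.homogeneousComponent d G * MvPolynomial.X i ^ (N - d)) := by
        rw [Finset.sum_sub_distrib, MvPolynomial.sum_homogeneousComponent G]
      rw [this]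
      refine Ideal.sum_mem _ fun d _ ↦ ?_
      rw [← mul_one_sub]
      refine Ideal.mul_mem_left _ _ ?_
      rw [← Ideal.neg_mem_iff, neg_sub, Ideal.mem_span_singleton]
      simpa using sub_dvd_pow_sub_pow (MvPolynomial.X i) (1 : MvPolynomial (Fin (n + 1)) ℂ) (N - d)
    have hle : Ideal.span {MvPolynomial.X i - (1 : MvPolynomial (Fin (n + 1)) ℂ)} ≤
        RingHom.ker (evalRatio n i) := by
      rw [Ideal.span_singleton_le_iff_mem, RingHom.mem_ker, map_sub, map_one, evalRatio_X_self, sub_self]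
    have h0 : evalRatio n i G' = 0 := by
      have := hle hmem
      rw [RingHom.mem_ker, map_sub, RingHom.mem_ker.mp hG, zero_sub, neg_eq_zero] at this
      exact this
    have hhom : G'.IsHomogeneous N := by
      refine MvPolynomial.IsHomogeneous.sum _ _ _ fun d hd ↦ ?_
      have := (MvPolynomial.homogeneousComponent_isHomogeneous d G).mul
        ((MvPolynomial.isHomogeneous_X_pow (R := ℂ) i (N - d)))
      rwa [Nat.add_sub_cancel' (Nat.lt_succ_iff.mp (Finset.mem_range.mp hd))] at this
    have h1 := locMap_mul_toLoc_evalRatio n i hhom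
    have hG0 : G' = 0 := by
      apply injective_locMap n i
      rw [← h1, h0, map_zero, mul_zero, map_zero]
    rwa [hG0, sub_zero] at hmem
  · rw [Ideal.span_singleton_le_iff_mem, RingHom.mem_ker, map_sub, map_one, evalRatio_X_self, sub_self]

theorem presents_chart : Presents (toBase n) (chart n i) (coordRatio n i)
    (Ideal.span {MvPolynomial.X i - 1}) := by
  have hb := bijective_toSection n i
  constructor
  · rw [evalAt_coordRatio]
    exact hb.2.comp (surjective_evalRatio n i)
  · rw [evalAt_coordRatio, ← ker_evalRatio]
    exact RingHom.ker_comp_of_injective _ hb.1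

lemma iSup_chart : ⨆ i, chart n i = ⊤ := by
  refine Proj.iSup_basicOpen_eq_top (grading n) _ ?_
  intro G hG
  have h0 : G.coeff 0 = 0 := by
    have h1 : GradedRing.proj (grading n) 0 G = 0 := hG
    have h2 : MvPolynomial.homogeneousComponent 0 G = 0 := by
      rw [← h1]
      exact (MvPolynomial.decomposition.decompose'_apply G 0).symm
    have h3 := congr(MvPolynomial.coeff 0 $h2)
    simpa [MvPolynomial.homogeneousComponent_zero] using h3
  have := MvPolynomial.mem_ideal_span_X_image (x := G) (s := Set.univ)
  rw [Set.image_univ] at this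
  rw [this]
  intro d hd
  by_contra! h
  have : d = 0 := by ext k; simpa using h k (Set.mem_univ k)
  subst this
  exact (MvPolynomial.mem_support_iff.mp hd) h0

end PSpace

namespace PSpace

variable (n : ℕ) (i j k : Fin (n + 1))

lemma coordRatio_self : coordRatio n i i = 1 := by
  rw [coordRatio_eq, ← evalRatio_X, evalRatio_X_self, map_one]

lemma res_toSection {x : MvPolynomial (Fin (n + 1)) ℂ}
    (hx : x = MvPolynomial.X i * MvPolynomial.X k)
    (h : Proj.basicOpen (grading n) x ≤ chart n i)
    (a : HomogeneousLocalization.Away (grading n) (MvPolynomial.X i)) :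
    res h (toSection n i a) = (Proj.awayToSection (grading n) x).hom
      (HomogeneousLocalization.awayMap (grading n) (X_mem_grading n k) hx a) :=
  (congr(($(Proj.awayMap_awayToSection (grading n) (X_mem_grading n k) hx)).hom a)).symm

lemma coordRatio_mul_coordRatio (l : Fin (n + 1)) {U : (PSpace n).Opens} (h : U ≤ chart n i)
    (h' : U ≤ chart n k) :
    res h (coordRatio n i k) * res h' (coordRatio n k l) = res h (coordRatio n i l) := by
  have hD : U ≤ Proj.basicOpen (grading n) (MvPolynomial.X i * MvPolynomial.X k) := by
    rw [Proj.basicOpen_mul]; exact le_inf h h'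
  have h1 : Proj.basicOpen (grading n) (MvPolynomial.X i * MvPolynomial.X k) ≤ chart n i :=
    Proj.basicOpen_mono _ _ _ ⟨_, rfl⟩
  have h2 : Proj.basicOpen (grading n) (MvPolynomial.X i * MvPolynomial.X k) ≤ chart n k :=
    Proj.basicOpen_mono _ _ _ ⟨_, mul_comm _ _⟩
  have key : res h1 (coordRatio n i k) * res h2 (coordRatio n k l) =
      res h1 (coordRatio n i l) := by
    rw [coordRatio_eq, coordRatio_eq, coordRatio_eq, res_toSection n i k rfl,
      res_toSection n k i (mul_comm _ _), res_toSection n i k rfl]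
    refine (map_mul _ _ _).symm.trans (congrArg _ ?_)
    unfold ratio
    rw [HomogeneousLocalization.awayMap_mk, HomogeneousLocalization.awayMap_mk,
      HomogeneousLocalization.awayMap_mk]
    apply HomogeneousLocalization.val_injective
    rw [HomogeneousLocalization.val_mul, HomogeneousLocalization.Away.val_mk,
      HomogeneousLocalization.Away.val_mk, HomogeneousLocalization.Away.val_mk,
      Localization.mk_mul, Localization.mk_eq_mk_iff, Localization.r_iff_exists]
    refine ⟨1, ?_⟩
    simp only [OneMemClass.coe_one, one_mul, pow_one, Submonoid.coe_mul]
    ring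
  simpa only [map_mul, res_res] using congr(res hD $key)

end PSpace

/-! ### Ratios of homogeneous coordinates as functions on a scheme over projective space. -/

section Coordinates

variable {X Y : Scheme.{0}} {n : ℕ}

/-- The function `xₖ / xᵢ` on an open set of `X` that is mapped to the chart `{xᵢ ≠ 0}`. -/
def crd (f : X ⟶ PSpace n) {U : X.Opens} {i : Fin (n + 1)} (h : U ≤ f ⁻¹ᵁ chart n i)
    (k : Fin (n + 1)) : Γ(X, U) := pb f h (coordRatio n i k)

variable (f : X ⟶ PSpace n) {U V : X.Opens} {i k : Fin (n + 1)}

@[simp] lemma crd_self (h : U ≤ f ⁻¹ᵁ chart n i) : crd f h i = 1 := by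
  rw [crd, PSpace.coordRatio_self, map_one]

@[simp] lemma res_crd (h : U ≤ f ⁻¹ᵁ chart n i) (h' : V ≤ U) (k : Fin (n + 1)) :
    res h' (crd f h k) = crd f (h'.trans h) k := res_pb _ _ _ _

@[simp] lemma pb_crd (g : Y ⟶ X) {W : Y.Opens} (h : U ≤ f ⁻¹ᵁ chart n i) (e : W ≤ g ⁻¹ᵁ U)
    (k : Fin (n + 1)) :
    pb g e (crd f h k) = crd (g ≫ f) (e.trans (g.preimage_mono h)) k := pb_pb _ _ _ _ _

lemma crd_congr {f g : X ⟶ PSpace n} (hfg : f = g) (h : U ≤ f ⁻¹ᵁ chart n i)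
    (h' : U ≤ g ⁻¹ᵁ chart n i) (k : Fin (n + 1)) : crd f h k = crd g h' k := by
  subst hfg; rfl

lemma crd_mul_crd (h : U ≤ f ⁻¹ᵁ chart n i) (h' : U ≤ f ⁻¹ᵁ chart n k) (l : Fin (n + 1)) :
    crd f h k * crd f h' l = crd f h l := by
  have e : U ≤ f ⁻¹ᵁ (chart n i ⊓ chart n k) := le_inf h h'
  have := congr(pb f e $(PSpace.coordRatio_mul_coordRatio n i k l inf_le_left inf_le_right))
  rwa [map_mul, pb_res, pb_res, pb_res] at this

lemma crd_mul_crd_self (h : U ≤ f ⁻¹ᵁ chart n i) (h' : U ≤ f ⁻¹ᵁ chart n k) :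
    crd f h k * crd f h' i = 1 := by
  rw [crd_mul_crd, crd_self]

lemma isUnit_crd (h : U ≤ f ⁻¹ᵁ chart n i) (h' : U ≤ f ⁻¹ᵁ chart n k) : IsUnit (crd f h k) :=
  IsUnit.of_mul_eq_one _ (crd_mul_crd_self f h h')

lemma PSpace.pb_awayι (n : ℕ) (i : Fin (n + 1))
    (e : ⊤ ≤ (Proj.awayι (grading n) (MvPolynomial.X i) (X_mem_grading n i) one_pos) ⁻¹ᵁ chart n i)
    (a : HomogeneousLocalization.Away (grading n) (MvPolynomial.X i)) :
    pb (Proj.awayι (grading n) (MvPolynomial.X i) (X_mem_grading n i) one_pos) e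
      (toSection n i a) = (Scheme.ΓSpecIso (CommRingCat.of
        (HomogeneousLocalization.Away (grading n) (MvPolynomial.X i)))).inv.hom a := by
  have e1 : ⊤ ≤ (chart n i).ι ⁻¹ᵁ chart n i := by simp
  set β := Proj.basicOpenIsoSpec (grading n) (MvPolynomial.X i) (X_mem_grading n i) one_pos
  have h1 : pb (chart n i).ι e1 (toSection n i a) = β.hom.appTop.hom ((Scheme.ΓSpecIso
      (CommRingCat.of
        (HomogeneousLocalization.Away (grading n) (MvPolynomial.X i)))).inv.hom a) := by
    have h3 : (chart n i).topIso.inv = (chart n i).ι.appLE (chart n i) ⊤ e1 := by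
      simp only [Scheme.Opens.topIso_inv, Scheme.Hom.appLE, Scheme.Opens.ι_app]
      exact (congrArg (PSpace n).presheaf.map (Subsingleton.elim _ _)).trans
        ((PSpace n).presheaf.map_comp _ _)
    have h4 : (Scheme.ΓSpecIso (CommRingCat.of
        (HomogeneousLocalization.Away (grading n) (MvPolynomial.X i)))).inv ≫ β.hom.appTop =
        Proj.awayToSection (grading n) (MvPolynomial.X i) ≫ (chart n i).topIso.inv := by
      exact (Iso.inv_comp_eq _).mpr
        (Proj.basicOpenToSpec_app_top (grading n) (MvPolynomial.X i))
    rw [h3] at h4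
    exact (congr(($h4).hom a)).symm
  have h2 : pb β.inv (U := ⊤) (V := ⊤) le_top (pb (chart n i).ι e1 (toSection n i a)) =
    pb (Proj.awayι (grading n) (MvPolynomial.X i) (X_mem_grading n i) one_pos) e
      (toSection n i a) := pb_pb _ _ _ _ _
  rw [← h2, h1]
  have h5 (b) : pb β.inv (U := ⊤) (V := ⊤) le_top (β.hom.appTop.hom b) = b := by
    have h6 : β.hom.appTop ≫ β.inv.appTop = 𝟙 _ := by
      rw [← Scheme.Hom.comp_appTop, β.inv_hom_id, Scheme.Hom.id_appTop]
    exact (res_self _ _).trans (congr(($h6).hom b))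
  exact h5 _

/-- On the overlap of the charts `xₖ / xᵢ` has the inverse `xᵢ / xₖ`. Conversely, in the affine
chart the nonvanishing locus of the ratio is by construction the preimage of `{xₖ ≠ 0}`. -/
lemma PSpace.basicOpen_coordRatio (n : ℕ) (i k : Fin (n + 1)) :
    (PSpace n).basicOpen (coordRatio n i k) = chart n i ⊓ chart n k := by
  set α := Proj.awayι (grading n) (MvPolynomial.X i) (X_mem_grading n i) one_pos with hα
  have hr : α.opensRange = chart n i := Proj.opensRange_awayι _ _ _ _
  have e : ⊤ ≤ α ⁻¹ᵁ chart n i := by rw [← hr]; simp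
  apply le_antisymm
  · refine le_inf (RingedSpace.basicOpen_le _ _) fun x hx ↦ ?_
    have hxi : x ∈ α.opensRange := by rw [hr]; exact RingedSpace.basicOpen_le _ _ hx
    obtain ⟨y, rfl⟩ := hxi
    have hy : y ∈ (Spec _).basicOpen (pb α e (coordRatio n i k)) := by
      rw [basicOpen_pb]; exact ⟨trivial, hx⟩
    rw [coordRatio_eq, pb_awayι, basicOpen_eq_of_affine] at hy
    have h2 : ratio n i k = HomogeneousLocalization.Away.isLocalizationElem
        (X_mem_grading n i) (X_mem_grading n k) := by
      apply HomogeneousLocalization.val_injective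
      rw [ratio, HomogeneousLocalization.Away.val_mk, HomogeneousLocalization.Away.val_mk]
      simp only [pow_one]
    rw [h2, ← Proj.awayι_preimage_basicOpen (grading n) (X_mem_grading n i) one_pos
      (X_mem_grading n k) one_pos] at hy
    exact hy
  · intro x hx
    have h1 := coordRatio_mul_coordRatio n i k i (U := chart n i ⊓ chart n k) inf_le_left
      inf_le_right
    rw [coordRatio_self, map_one] at h1
    have h2 : IsUnit (res (inf_le_left : chart n i ⊓ chart n k ≤ chart n i)
      (coordRatio n i k)) := IsUnit.of_mul_eq_one _ h1
    have h3 := Scheme.basicOpen_of_isUnit _ h2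
    have h4 := basicOpen_res' (inf_le_left : chart n i ⊓ chart n k ≤ chart n i)
      (coordRatio n i k)
    have h5 : x ∈ (PSpace n).basicOpen (res (inf_le_left : chart n i ⊓ chart n k ≤ chart n i)
      (coordRatio n i k)) := by rw [h3]; exact hx
    rw [h4] at h5
    exact h5.2

lemma basicOpen_crd (h : U ≤ f ⁻¹ᵁ chart n i) (k : Fin (n + 1)) :
    X.basicOpen (crd f h k) = U ⊓ f ⁻¹ᵁ chart n k := by
  rw [crd, basicOpen_pb, PSpace.basicOpen_coordRatio]
  exact le_antisymm (inf_le_inf_left _ (f.preimage_mono inf_le_right))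
    (le_inf inf_le_left (le_inf (inf_le_left.trans h) inf_le_right))

end Coordinates

/-! ### Zero loci of forms on charts -/

section ZeroIdeal

variable {X : Scheme.{0}} {m n : ℕ}

lemma PSpace.isCompact_chart_preimage (f : X ⟶ PSpace n) [QuasiCompact f] (i : Fin (n + 1)) :
    IsCompact ((f ⁻¹ᵁ chart n i : X.Opens) : Set X) :=
  f.isCompact_preimage (PSpace.isAffineOpen_chart n i).isCompact

lemma evalAt_smul_of_isHomogeneous {a : ℕ} {σ : Type} {G : MvPolynomial σ ℂ}
    (hG : G.IsHomogeneous a) (p : X ⟶ SpecC) {U : X.Opens} (r : Γ(X, U)) (z : σ → Γ(X, U)) :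
    evalAt p (fun k ↦ r * z k) G = r ^ a * evalAt p z G :=
  eval₂_smul_of_isHomogeneous hG (constHom p U) r z

lemma evalAt_smul_of_isBihomogeneous {a b : ℕ}
    {G : MvPolynomial (Fin (m + 1) ⊕ Fin (n + 1)) ℂ}
    (hG : IsBihomogeneous G a b) (p : X ⟶ SpecC) {U : X.Opens} (r s : Γ(X, U))
    (x : Fin (m + 1) → Γ(X, U)) (y : Fin (n + 1) → Γ(X, U)) :
    evalAt p (Sum.elim (fun k ↦ r * x k) (fun k ↦ s * y k)) G =
      r ^ a * s ^ b * evalAt p (Sum.elim x y) G :=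
  eval₂_smul_of_isBihomogeneous hG (constHom p U) r s x y

lemma zeroIdeal_eq (f : X ⟶ PSpace n) (G : MvPolynomial (Fin (n + 1)) ℂ) :
    zeroIdeal f G = localEquationsIdeal (fun i : Fin (n + 1) ↦ f ⁻¹ᵁ chart n i)
      fun i ↦ evalAt (f ≫ PSpace.toBase n) (crd f (i := i) le_rfl) G := by
  have this (i k) : (f.app (chart n i)).hom (coordRatio n i k) = crd f (i := i) le_rfl k :=
    (res_self le_rfl _).symm
  unfold zeroIdeal
  simp only [this]
  rfl

/-- The equation of a zero locus on a chart. -/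
theorem idealOn_zeroIdeal [QuasiSeparatedSpace X] (f : X ⟶ PSpace n) [QuasiCompact f] {a : ℕ}
    {G : MvPolynomial (Fin (n + 1)) ℂ} (hG : G.IsHomogeneous a) {U : X.Opens}
    (hU : IsAffineOpen U) {i : Fin (n + 1)} (h : U ≤ f ⁻¹ᵁ chart n i) :
    idealOn (zeroIdeal f G) hU =
      Ideal.span {evalAt (f ≫ PSpace.toBase n) (crd f h) G} := by
  rw [zeroIdeal_eq]
  refine (idealOn_localEquationsIdeal_of_le _ _ (PSpace.isCompact_chart_preimage f) hU i h
    fun l ↦ ?_).trans ?_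
  · simp only [res_evalAt, res_crd]
    -- The local equations of a form of degree `a` on the charts `i` and `l` differ by the factor
    -- `(xₗ / xᵢ)ᵃ`.
    refine ⟨crd f inf_le_left l ^ a, ?_⟩
    have := evalAt_smul_of_isHomogeneous hG (f ≫ PSpace.toBase n)
      (crd f (i := i) inf_le_left l) (crd f (i := l) inf_le_right)
    simp only [crd_mul_crd] at this
    rw [mul_comm]
    exact this
  · simp only [res_evalAt, res_crd]

lemma zeroIdeal₂_eq (f : X ⟶ PSpace m) (g : X ⟶ PSpace n)
    (G : MvPolynomial (Fin (m + 1) ⊕ Fin (n + 1)) ℂ) :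
    zeroIdeal₂ f g G = localEquationsIdeal
      (fun ij : Fin (m + 1) × Fin (n + 1) ↦ f ⁻¹ᵁ chart m ij.1 ⊓ g ⁻¹ᵁ chart n ij.2) fun ij ↦
        evalAt (f ≫ PSpace.toBase m)
          (Sum.elim (crd f (i := ij.1) inf_le_left) (crd g (i := ij.2) inf_le_right)) G := by
  have this (ij : Fin (m + 1) × Fin (n + 1)) (k) :
      res (inf_le_left : f ⁻¹ᵁ chart m ij.1 ⊓ g ⁻¹ᵁ chart n ij.2 ≤ f ⁻¹ᵁ chart m ij.1)
      ((f.app (chart m ij.1)).hom (coordRatio m ij.1 k)) = crd f (i := ij.1) inf_le_left k := rfl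
  have h' (ij : Fin (m + 1) × Fin (n + 1)) (k) :
      res (inf_le_right : f ⁻¹ᵁ chart m ij.1 ⊓ g ⁻¹ᵁ chart n ij.2 ≤ g ⁻¹ᵁ chart n ij.2)
      ((g.app (chart n ij.2)).hom (coordRatio n ij.2 k)) = crd g (i := ij.2) inf_le_right k := rfl
  unfold zeroIdeal₂
  simp only [this, h']
  rfl

/-- The equation of a zero locus of a bihomogeneous form on a chart. -/
theorem idealOn_zeroIdeal₂ [QuasiSeparatedSpace X] (f : X ⟶ PSpace m) (g : X ⟶ PSpace n)
    [QuasiCompact f] [QuasiCompact g] {a b : ℕ}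
    {G : MvPolynomial (Fin (m + 1) ⊕ Fin (n + 1)) ℂ} (hG : IsBihomogeneous G a b) {U : X.Opens}
    (hU : IsAffineOpen U) {i : Fin (m + 1)} {j : Fin (n + 1)} (h : U ≤ f ⁻¹ᵁ chart m i)
    (h' : U ≤ g ⁻¹ᵁ chart n j) :
    idealOn (zeroIdeal₂ f g G) hU =
      Ideal.span {evalAt (f ≫ PSpace.toBase m) (Sum.elim (crd f h) (crd g h')) G} := by
  have hres {V W : X.Opens} (e : V ≤ W) {i : Fin (m + 1)} {j : Fin (n + 1)}
      (h : W ≤ f ⁻¹ᵁ chart m i) (h' : W ≤ g ⁻¹ᵁ chart n j) :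
      (fun k ↦ res e (Sum.elim (crd f h) (crd g h') k)) =
      Sum.elim (crd f (e.trans h)) (crd g (e.trans h')) := by
    funext k; rcases k with k | k <;> simp
  rw [zeroIdeal₂_eq]
  have hc (ij : Fin (m + 1) × Fin (n + 1)) :
      IsCompact ((f ⁻¹ᵁ chart m ij.1 ⊓ g ⁻¹ᵁ chart n ij.2 : X.Opens) : Set X) :=
    QuasiSeparatedSpace.inter_isCompact _ _ (f ⁻¹ᵁ chart m ij.1).2
      (PSpace.isCompact_chart_preimage f ij.1) (g ⁻¹ᵁ chart n ij.2).2
        (PSpace.isCompact_chart_preimage g ij.2)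
  have hle : U ≤ f ⁻¹ᵁ chart m i ⊓ g ⁻¹ᵁ chart n j := le_inf h h'
  refine (idealOn_localEquationsIdeal_of_le
    (fun ij : Fin (m + 1) × Fin (n + 1) ↦ f ⁻¹ᵁ chart m ij.1 ⊓ g ⁻¹ᵁ chart n ij.2)
    (fun ij ↦ evalAt (f ≫ PSpace.toBase m)
          (Sum.elim (crd f (i := ij.1) inf_le_left) (crd g (i := ij.2) inf_le_right)) G)
    hc hU (i, j) hle fun l ↦ ?_).trans ?_
  · simp only [res_evalAt, hres]
    refine ⟨crd f (inf_le_left.trans inf_le_left) l.1 ^ a *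
      crd g (inf_le_left.trans inf_le_right) l.2 ^ b, ?_⟩
    have := evalAt_smul_of_isBihomogeneous hG (f ≫ PSpace.toBase m)
      (crd f (i := i) (inf_le_left.trans inf_le_left) l.1)
      (crd g (i := j) (inf_le_left.trans inf_le_right) l.2)
      (crd f (i := l.1) (inf_le_right.trans inf_le_left))
      (crd g (i := l.2) (inf_le_right.trans inf_le_right))
    simp only [crd_mul_crd] at this
    rw [mul_comm]
    exact this
  · simp only [res_evalAt, hres]

end ZeroIdeal

/-! ### Properness of projective space -/

instance finiteType_grading (n : ℕ) :
    Algebra.FiniteType (grading n 0) (MvPolynomial (Fin (n + 1)) ℂ) := by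
  have : IsScalarTower ℂ (grading n 0) (MvPolynomial (Fin (n + 1)) ℂ) :=
    ⟨fun a b c ↦ smul_mul_assoc a (b : MvPolynomial (Fin (n + 1)) ℂ) c⟩
  exact Algebra.FiniteType.of_restrictScalars_finiteType ℂ _ _

instance isProper_toBase (n : ℕ) : IsProper (PSpace.toBase n) := by
  -- `Proj` is proper over the spectrum of the degree `0` part of the graded ring, and that part
  -- consists of the constants.
  have hb : Function.Bijective (algebraMap ℂ (grading n 0)) := by
    constructor
    · intro a b hab
      exact MvPolynomial.C_injective (Fin (n + 1)) ℂ congr(($hab).1)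
    · rintro ⟨G, hG⟩
      refine ⟨G.coeff 0, Subtype.ext ?_⟩
      have h : G.IsHomogeneous 0 := hG
      exact (MvPolynomial.totalDegree_eq_zero_iff_eq_C.mp
        (Nat.le_zero.mp h.totalDegree_le)).symm
  have : IsIso (CommRingCat.ofHom (algebraMap ℂ (grading n 0))) := by
    rw [ConcreteCategory.isIso_iff_bijective]; exact hb
  unfold PSpace.toBase
  infer_instance

/-! ### Recognizing blow-ups on charts -/

section Blowup

variable {X Y T B : Scheme.{0}}

lemma res_mem_nonZeroDivisors {U V : X.Opens} (hU : IsAffineOpen U) {d : Γ(X, U)}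
    (hd : d ∈ nonZeroDivisors Γ(X, U)) (f : Γ(X, U)) (h : V ≤ U) (hV : V = X.basicOpen f) :
    res h d ∈ nonZeroDivisors Γ(X, V) := by
  rw [mem_nonZeroDivisors_iff_right]
  intro c hc
  obtain ⟨n, c', hc'⟩ := exists_res_eq_pow_mul hU.isCompact hU.isQuasiSeparated f h hV c
  have hu : IsUnit (res h f) := by
    subst hV
    exact RingedSpace.isUnit_res_basicOpen _ f
  obtain ⟨m, hm⟩ := exists_pow_mul_eq_zero hU.isCompact f h hV (c' * d) (by
    rw [map_mul, hc', mul_assoc, hc, mul_zero])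
  rw [← mul_assoc] at hm
  have h0 := (mem_nonZeroDivisors_iff_right.mp hd) _ hm
  have h1 := congr(res h $h0)
  rw [map_mul, map_pow, hc', map_zero, ← mul_assoc, ← pow_add] at h1
  exact ((hu.pow _).mul_right_eq_zero).mp h1

lemma exists_isAffineOpen_basicOpen {U : X.Opens} (hU : IsAffineOpen U) (V : X.Opens) {x : X}
    (hx : x ∈ U) (hxV : x ∈ V) : ∃ f : Γ(X, U), X.basicOpen f ≤ V ∧ x ∈ X.basicOpen f :=
  hU.exists_basicOpen_le (⟨x, hxV⟩ : V) hx

lemma idealOn_eq_span_of_le (J : X.IdealSheafData) {U V : X.Opens} (hU : IsAffineOpen U)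
    (hV : IsAffineOpen V) (h : V ≤ U) {s : Set Γ(X, U)} (hs : idealOn J hU = Ideal.span s) :
    idealOn J hV = Ideal.span (res h '' s) := by
  rw [← map_res_idealOn J hV hU h, hs, Ideal.map_span]

/-- An invertible ideal has regular generators on arbitrarily small affine open sets. -/
lemma IsInvertibleIdeal.exists_generator {J : X.IdealSheafData} (hJ : IsInvertibleIdeal J)
    {V : X.Opens} {x : X} (hx : x ∈ V) : ∃ (U : X.Opens) (hU : IsAffineOpen U)
      (d : Γ(X, U)), x ∈ U ∧ U ≤ V ∧ d ∈ nonZeroDivisors Γ(X, U) ∧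
        idealOn J hU = Ideal.span {d} := by
  obtain ⟨⟨U, hU⟩, hxU, d, hd, hI⟩ := hJ x
  obtain ⟨f, hf, hxf⟩ := exists_isAffineOpen_basicOpen hU V hxU hx
  refine ⟨X.basicOpen f, hU.basicOpen f, res (X.basicOpen_le f) d, hxf, hf,
    res_mem_nonZeroDivisors hU hd f _ rfl, ?_⟩
  rw [idealOn_eq_span_of_le J hU (hU.basicOpen f) (X.basicOpen_le f) hI, Set.image_singleton]

lemma bijective_pb_of_isOpenImmersion_of_le (f : X ⟶ Y) [IsOpenImmersion f] {U : Y.Opens}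
    {V : X.Opens} (hU : U ≤ f.opensRange) (e : V ≤ f ⁻¹ᵁ U) (hV : V = f ⁻¹ᵁ U) :
    Function.Bijective (pb f e) := by
  have h1 : pb f e = (res e).comp (f.app U).hom := rfl
  rw [h1, RingHom.coe_comp]
  subst hV
  have h2 : IsIso (f.app U) := f.isIso_app _ hU
  have h3 : res e = RingHom.id _ := RingHom.ext fun a ↦ res_self e a
  rw [h3]
  exact Function.bijective_id.comp (ConcreteCategory.bijective_of_isIso (f.app U))

lemma IsInvertibleIdeal.comap_of_isOpenImmersion {J : Y.IdealSheafData}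
    (hJ : IsInvertibleIdeal J) (f : X ⟶ Y) [IsOpenImmersion f] :
    IsInvertibleIdeal (J.comap f) := by
  intro x
  obtain ⟨U, hU, d, hxU, hUr, hd, hI⟩ := hJ.exists_generator (x := f x) (V := f.opensRange)
    ⟨x, rfl⟩
  have hV : IsAffineOpen (f ⁻¹ᵁ U) := hU.preimage_of_isOpenImmersion f hUr
  have hb := bijective_pb_of_isOpenImmersion_of_le f hUr (le_refl (f ⁻¹ᵁ U)) rfl
  refine ⟨⟨f ⁻¹ᵁ U, hV⟩, hxU, pb f le_rfl d, ?_, ?_⟩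
  · rw [mem_nonZeroDivisors_iff_right]
    intro c hc
    obtain ⟨c, rfl⟩ := hb.2 c
    rw [← map_mul, map_eq_zero_iff _ hb.1] at hc
    rw [(mem_nonZeroDivisors_iff_right.mp hd) _ hc, map_zero]
  · refine (idealOn_comap J f hU hV le_rfl).trans ?_
    rw [hI, Ideal.map_span, Set.image_singleton]

lemma exists_mem_basicOpen_of_sum_eq_one {U : X.Opens} {ι : Type*} (s : Finset ι)
    (e : ι → Γ(X, U)) (h : ∑ i ∈ s, e i = 1) {x : X} (hx : x ∈ U) :
    ∃ i ∈ s, x ∈ X.basicOpen (e i) := by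
  by_contra! hc
  have h1 : ∑ i ∈ s, X.presheaf.germ U x hx (e i) ∈
      IsLocalRing.maximalIdeal (X.presheaf.stalk x) := by
    refine Ideal.sum_mem _ fun i hi ↦ ?_
    rw [IsLocalRing.mem_maximalIdeal, mem_nonunits_iff, ← X.mem_basicOpen (e i) x hx]
    exact hc i hi
  rw [← map_sum, h, map_one] at h1
  exact (IsLocalRing.maximalIdeal.isMaximal _).ne_top ((Ideal.eq_top_iff_one _).mpr h1)

/-- Charts of a morphism `π`: over the affine open sets `U a` of `X`, where `I` is generated by the
`f a b`, there are affine open sets `W a b` with the properties of the chart of the blow-up on which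
`f a b` generates the inverse image of `I`. -/
structure BlowupCharts (π : B ⟶ X) (I : X.IdealSheafData) (α β : Type) [Finite β] where
  U : α → X.Opens
  hU : ∀ a, IsAffineOpen (U a)
  cov : ⨆ a, U a = ⊤
  f : ∀ a, β → Γ(X, U a)
  ideal_eq : ∀ a, idealOn I (hU a) = Ideal.span (Set.range (f a))
  W : α → β → B.Opens
  hW : ∀ a b, IsAffineOpen (W a b)
  hWU : ∀ a b, W a b ≤ π ⁻¹ᵁ U a
  covW : ∀ a, π ⁻¹ᵁ U a ≤ ⨆ b, W a b
  regular : ∀ a b, pb π (hWU a b) (f a b) ∈ nonZeroDivisors Γ(B, W a b)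
  -- The condition on `B.basicOpen c` controls where morphisms over `X` land: a point at which `f a
  -- b'` also generates the ideal must lie in `W a b'`.
  dvd : ∀ a b b', ∃ c : Γ(B, W a b),
    pb π (hWU a b) (f a b') = pb π (hWU a b) (f a b) * c ∧ B.basicOpen c ≤ W a b'
  exists_lift : ∀ a b (R : Type) [CommRing R] (ψ : Γ(X, U a) →+* R), ψ (f a b) ∈ nonZeroDivisors R →
    (∀ b', ψ (f a b) ∣ ψ (f a b')) → ∃ χ : Γ(B, W a b) →+* R, χ.comp (pb π (hWU a b)) = ψ
  hom_ext : ∀ a b (R : Type) [CommRing R] (χ χ' : Γ(B, W a b) →+* R),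
    χ.comp (pb π (hWU a b)) = χ'.comp (pb π (hWU a b)) →
    χ (pb π (hWU a b) (f a b)) ∈ nonZeroDivisors R → χ = χ'

namespace BlowupCharts

variable {π : B ⟶ X} {I : X.IdealSheafData} {α β : Type} [Finite β] (D : BlowupCharts π I α β)

lemma isInvertibleIdeal_comap (D : BlowupCharts π I α β) : IsInvertibleIdeal (I.comap π) := by
  intro x
  have hx : π x ∈ ⨆ a, D.U a := by rw [D.cov]; trivial
  obtain ⟨a, ha⟩ := Opens.mem_iSup.mp hx
  obtain ⟨b, hb⟩ := Opens.mem_iSup.mp (D.covW a (show x ∈ π ⁻¹ᵁ D.U a from ha))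
  refine ⟨⟨D.W a b, D.hW a b⟩, hb, _, D.regular a b, ?_⟩
  refine (idealOn_comap I π (D.hU a) (D.hW a b) (D.hWU a b)).trans ?_
  rw [D.ideal_eq, Ideal.map_span]
  apply le_antisymm
  · rw [Ideal.span_le]
    rintro _ ⟨_, ⟨b', rfl⟩, rfl⟩
    obtain ⟨c, hc, -⟩ := D.dvd a b b'
    exact Ideal.mem_span_singleton.mpr ⟨c, hc⟩
  · exact Ideal.span_mono (Set.singleton_subset_iff.mpr ⟨_, ⟨b, rfl⟩, rfl⟩)

/-- `f a b` generates the inverse image of `I` on the open set `T'`. -/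
structure IsGenerator (g : T ⟶ X) (T' : T.Opens) (a : α) (b : β) : Prop where
  isAffineOpen : IsAffineOpen T'
  le : T' ≤ g ⁻¹ᵁ D.U a
  regular : pb g le (D.f a b) ∈ nonZeroDivisors Γ(T, T')
  dvd : ∀ b', pb g le (D.f a b) ∣ pb g le (D.f a b')

/-- Near `t` the inverse image ideal is `(d)` with `d` regular. Writing `f b = d · e b` and `d = ∑ c
b · f b`, and cancelling `d`, gives `∑ c b · e b = 1`; so some `e b` is invertible at `t`, and there
`f b` generates. -/
lemma exists_isGenerator {g : T ⟶ X} (hg : IsInvertibleIdeal (I.comap g)) (t : T) :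
    ∃ (a : α) (b : β) (T' : T.Opens), t ∈ T' ∧ D.IsGenerator g T' a b := by
  have hx : g t ∈ ⨆ a, D.U a := by rw [D.cov]; trivial
  obtain ⟨a, ha⟩ := Opens.mem_iSup.mp hx
  obtain ⟨V, hV, d, htV, hVU, hd, hI⟩ := hg.exists_generator (x := t)
    (show t ∈ g ⁻¹ᵁ D.U a from ha)
  rw [idealOn_comap I g (D.hU a) hV hVU, D.ideal_eq, Ideal.map_span, ← Set.range_comp] at hI
  have h1 (b) : ∃ e, pb g hVU (D.f a b) = d * e := by
    have : pb g hVU (D.f a b) ∈ Ideal.span {d} := hI ▸ Ideal.subset_span ⟨b, rfl⟩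
    exact Ideal.mem_span_singleton.mp this
  choose e he using h1
  cases nonempty_fintype β
  have h2 : d ∈ Ideal.span (Set.range (pb g hVU ∘ D.f a)) := hI ▸ Ideal.mem_span_singleton_self d
  obtain ⟨c, hc⟩ := (Ideal.mem_span_range_iff_exists_fun).mp h2
  have h3 : ∑ b, c b * e b = 1 := by
    have h4 : (1 - ∑ b, c b * e b) * d = 0 := by
      rw [sub_mul, Finset.sum_mul, one_mul, sub_eq_zero]
      conv_lhs => rw [← hc]
      refine Finset.sum_congr rfl fun b _ ↦ ?_
      simp only [Function.comp_apply, he]; ring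
    exact (sub_eq_zero.mp ((mem_nonZeroDivisors_iff_right.mp hd) _ h4)).symm
  obtain ⟨b, -, hb⟩ := exists_mem_basicOpen_of_sum_eq_one _ _ h3 htV
  have hbe : t ∈ T.basicOpen (e b) := by
    rw [Scheme.basicOpen_mul] at hb; exact hb.2
  have hle := T.basicOpen_le (e b)
  have hu : IsUnit (res hle (e b)) := RingedSpace.isUnit_res_basicOpen _ (e b)
  have hr (b') : pb g (hle.trans hVU) (D.f a b') = res hle d * res hle (e b') := by
    rw [← map_mul, ← he, res_pb]
  refine ⟨a, b, T.basicOpen (e b), hbe, hV.basicOpen _, hle.trans hVU, ?_, fun b' ↦ ?_⟩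
  · rw [hr]
    exact mul_mem (res_mem_nonZeroDivisors hV hd _ _ rfl) hu.mem_nonZeroDivisors
  · rw [hr, hr, hu.mul_right_dvd]
    exact dvd_mul_right _ _

/-- The image of a point of `T'` lies in some chart `W a b'`, where `f b = f b' · c`. On `T'` also
`f b' = f b · u`. As `f b` is regular, `c` is invertible at the point, and the nonvanishing of `c`
places the image in `W a b`. -/
lemma le_preimage_of_isGenerator {g : T ⟶ X} {T' : T.Opens} {a : α} {b : β}
    (hT : D.IsGenerator g T' a b) {h : T ⟶ B} (hh : h ≫ π = g) : T' ≤ h ⁻¹ᵁ D.W a b := by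
  subst hh
  intro t ht
  have h1 : h t ∈ π ⁻¹ᵁ D.U a := hT.le ht
  obtain ⟨b', hb'⟩ := Opens.mem_iSup.mp (D.covW a h1)
  obtain ⟨c, hc, hcW⟩ := D.dvd a b' b
  obtain ⟨r, hr, htr⟩ := exists_isAffineOpen_basicOpen hT.isAffineOpen (h ⁻¹ᵁ D.W a b') ht hb'
  obtain ⟨u, hu⟩ := hT.dvd b'
  have hle := T.basicOpen_le r
  have h2 := congr(pb h hr $hc)
  have h3 := congr(res hle $hu)
  have h4 := res_mem_nonZeroDivisors hT.isAffineOpen hT.regular r hle rfl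
  rw [map_mul, pb_pb, pb_pb] at h2
  rw [map_mul, res_pb, res_pb] at h3
  rw [res_pb] at h4
  set x := pb (h ≫ π) (hle.trans hT.le) (D.f a b)
  have h5 : (1 - res hle u * pb h hr c) * x = 0 := by
    have h2' : x = pb (h ≫ π) (hle.trans hT.le) (D.f a b') * pb h hr c := h2
    rw [h3] at h2'
    linear_combination h2'
  have h6 : IsUnit (pb h hr c) := by
    have := sub_eq_zero.mp ((mem_nonZeroDivisors_iff_right.mp h4) _ h5)
    exact IsUnit.of_mul_eq_one _ ((mul_comm _ _).trans this.symm)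
  have h7 : t ∈ T.basicOpen (pb h hr c) := by
    rw [Scheme.basicOpen_of_isUnit _ h6]; exact htr
  rw [basicOpen_pb] at h7
  exact hcW h7.2

lemma lift_unique (D : BlowupCharts π I α β) {g : T ⟶ X} (hg : IsInvertibleIdeal (I.comap g)) {h h' : T ⟶ B}
    (hh : h ≫ π = g) (hh' : h' ≫ π = g) : h = h' := by
  refine Scheme.hom_ext_of_forall _ _ fun t ↦ ?_
  obtain ⟨a, b, T', ht, hT⟩ := D.exists_isGenerator hg t
  refine ⟨T', ht, ?_⟩
  have e := D.le_preimage_of_isGenerator hT hh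
  have e' := D.le_preimage_of_isGenerator hT hh'
  have key : pb h e = pb h' e' := by
    refine D.hom_ext a b _ _ _ ?_ ?_
    · rw [pb_comp, pb_comp]
      exact pb_congr (hh.trans hh'.symm) _ _
    · have : pb h e (pb π (D.hWU a b) (D.f a b)) = pb g hT.le (D.f a b) :=
        (pb_pb _ _ _ _ _).trans congr($(pb_congr hh _ _) _)
      rw [this]
      exact hT.regular
  have h1 := (D.hW a b).SpecMap_appLE_fromSpec h hT.isAffineOpen e
  have h2 := (D.hW a b).SpecMap_appLE_fromSpec h' hT.isAffineOpen e'
  have h3 : h.appLE _ _ e = h'.appLE _ _ e' := CommRingCat.hom_ext key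
  rw [h3, h2] at h1
  have h4 : T'.ι = hT.isAffineOpen.isoSpec.hom ≫ hT.isAffineOpen.fromSpec := by
    rw [IsAffineOpen.isoSpec_hom, IsAffineOpen.toSpecΓ_fromSpec]
  rw [h4, Category.assoc, Category.assoc, h1]

lemma exists_local_lift {g : T ⟶ X} {T' : T.Opens} {a : α} {b : β}
    (hT : D.IsGenerator g T' a b) : ∃ h : T'.toScheme ⟶ B, h ≫ π = T'.ι ≫ g := by
  obtain ⟨χ, hχ⟩ := D.exists_lift a b _ (pb g hT.le) hT.regular hT.dvd
  refine ⟨hT.isAffineOpen.isoSpec.hom ≫ Spec.map (CommRingCat.ofHom χ) ≫ (D.hW a b).fromSpec, ?_⟩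
  have h1 := (D.hU a).SpecMap_appLE_fromSpec π (D.hW a b) (D.hWU a b)
  have h2 := (D.hU a).SpecMap_appLE_fromSpec g hT.isAffineOpen hT.le
  have h3 : π.appLE _ _ (D.hWU a b) ≫ CommRingCat.ofHom χ = g.appLE _ _ hT.le :=
    CommRingCat.hom_ext hχ
  have h4 : T'.ι = hT.isAffineOpen.isoSpec.hom ≫ hT.isAffineOpen.fromSpec := by
    rw [IsAffineOpen.isoSpec_hom, IsAffineOpen.toSpecΓ_fromSpec]
  rw [h4, Category.assoc, Category.assoc, Category.assoc, ← h1, ← h2, ← h3, Spec.map_comp,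
    Category.assoc]

theorem isBlowup (D : BlowupCharts π I α β) : IsBlowup π I := by
  refine ⟨D.isInvertibleIdeal_comap, fun T g hg ↦ ?_⟩
  choose a b T' ht hT using fun t ↦ D.exists_isGenerator hg t
  choose l hl using fun t ↦ D.exists_local_lift (hT t)
  have hT' : IsOpenCover T' := by
    refine top_le_iff.mp fun t _ ↦ Opens.mem_iSup.mpr ⟨t, ht t⟩
  let 𝒰 := T.openCoverOfIsOpenCover T' hT'
  -- Local lifts agree on overlaps by `lift_unique`, which applies because invertibility of the
  -- ideal survives pullback along open immersions.
  have hcomp (s t : T) : pullback.fst (T' s).ι (T' t).ι ≫ l s =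
      pullback.snd (T' s).ι (T' t).ι ≫ l t := by
    have hJ : IsInvertibleIdeal (I.comap (pullback.fst (T' s).ι (T' t).ι ≫ (T' s).ι ≫ g)) := by
      rw [Scheme.IdealSheafData.comap_comp, Scheme.IdealSheafData.comap_comp]
      exact (hg.comap_of_isOpenImmersion _).comap_of_isOpenImmersion _
    refine D.lift_unique hJ ?_ ?_
    · rw [Category.assoc, hl]
    · rw [Category.assoc, hl, ← Category.assoc, ← pullback.condition, Category.assoc]
  let h : T ⟶ B := 𝒰.glueMorphisms l hcomp
  have hh (t : T) : (T' t).ι ≫ h = l t := 𝒰.ι_glueMorphisms l hcomp t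
  have hg' : h ≫ π = g := Scheme.hom_ext_of_forall _ _ fun t ↦ ⟨T' t, ht t, by
    rw [← Category.assoc, hh, hl]⟩
  exact ⟨h, hg', fun h' hh' ↦ D.lift_unique hg hh' hg'⟩

end BlowupCharts

end Blowup

/-! ### Presentations with explicit generators of the relations. -/

section PresentationLemmas

variable {X Y : Scheme.{0}}

lemma Presents.subscheme_span {p : X ⟶ SpecC} {U : X.Opens} {σ : Type} {z : σ → Γ(X, U)}
    {S R : Set (MvPolynomial σ ℂ)} (h : Presents p U z (Ideal.span S)) (hU : IsAffineOpen U)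
    (I : X.IdealSheafData) (hI : idealOn I hU = Ideal.span (evalAt p z '' R)) :
    Presents (I.subschemeι ≫ p) (I.subschemeι ⁻¹ᵁ U) (fun k ↦ pb I.subschemeι le_rfl (z k))
      (Ideal.span (R ∪ S)) := by
  have := h.subscheme hU I
  rwa [hI, ← Ideal.map_span, h.comap_map, ← Ideal.span_union] at this

lemma Presents.congr {p q : X ⟶ SpecC} {U : X.Opens} {σ : Type} {z w : σ → Γ(X, U)}
    {J K : Ideal (MvPolynomial σ ℂ)} (h : Presents p U z J) (hpq : p = q) (hzw : ∀ k, z k = w k)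
    (hJK : J = K) : Presents q U w K := by
  have : z = w := funext hzw
  subst hpq this hJK
  exact h

lemma Presents.evalAt_eq_zero {p : X ⟶ SpecC} {U : X.Opens} {σ : Type} {z : σ → Γ(X, U)}
    {J : Ideal (MvPolynomial σ ℂ)} (h : Presents p U z J) {G : MvPolynomial σ ℂ} (hG : G ∈ J) :
    evalAt p z G = 0 := by
  rw [← h.ker_eq] at hG; exact hG

lemma Presents.exists_lift_span {p : X ⟶ SpecC} {U : X.Opens} {σ : Type} {z : σ → Γ(X, U)}
    {S : Set (MvPolynomial σ ℂ)} (h : Presents p U z (Ideal.span S)) {R : Type*} [CommRing R]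
    (φ : ℂ →+* R) (r : σ → R) (hr : ∀ G ∈ S, MvPolynomial.eval₂ φ r G = 0) :
    ∃ χ : Γ(X, U) →+* R, (∀ c, χ (constHom p U c) = φ c) ∧ ∀ k, χ (z k) = r k := by
  obtain ⟨χ, hχ⟩ := h.exists_lift (MvPolynomial.eval₂Hom φ r) (fun G hG ↦ by
    have : Ideal.span S ≤ RingHom.ker (MvPolynomial.eval₂Hom φ r) := by
      rw [Ideal.span_le]; exact hr
    exact this hG)
  refine ⟨χ, fun c ↦ ?_, fun k ↦ ?_⟩
  · have := congr($hχ (MvPolynomial.C c)); simpa using this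
  · have := congr($hχ (MvPolynomial.X k)); simpa using this

lemma idealOn_iSup {ι : Type*} (I : ι → X.IdealSheafData) {U : X.Opens} (hU : IsAffineOpen U) :
    idealOn (⨆ i, I i) hU = ⨆ i, idealOn (I i) hU :=
  (congrFun Scheme.IdealSheafData.ideal_iSup ⟨U, hU⟩).trans (iSup_apply ..)

end PresentationLemmas

/-! ### Charts of products of projective spaces. -/

section ProductOfProjectiveSpaces

variable (m n : ℕ) (i : Fin (m + 1)) (j : Fin (n + 1))

/-- The chart `{xᵢ ≠ 0, yⱼ ≠ 0}` of `ℙᵐ × ℙⁿ`. -/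
abbrev PProd.chart : (PProd m n).Opens :=
  prodOpen (PSpace.toBase m) (PSpace.toBase n) (CubicPencil.chart m i) (CubicPencil.chart n j)

lemma PProd.isAffineOpen_chart : IsAffineOpen (PProd.chart m n i j) :=
  isAffineOpen_prodOpen (PSpace.isAffineOpen_chart m i) (PSpace.isAffineOpen_chart n j)

/-- The coordinates `(xₖ / xᵢ, yₗ / yⱼ)`. -/
abbrev crd₂ {X : Scheme.{0}} {m n : ℕ} (f : X ⟶ PSpace m) (g : X ⟶ PSpace n) {U : X.Opens}
    {i : Fin (m + 1)} {j : Fin (n + 1)} (h : U ≤ f ⁻¹ᵁ chart m i) (h' : U ≤ g ⁻¹ᵁ chart n j) :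
    Fin (m + 1) ⊕ Fin (n + 1) → Γ(X, U) :=
  Sum.elim (crd f h) (crd g h')

lemma PProd.presents : Presents (PProd.toBase m n) (PProd.chart m n i j)
    (crd₂ (pullback.fst (PSpace.toBase m) (PSpace.toBase n))
      (pullback.snd (PSpace.toBase m) (PSpace.toBase n)) inf_le_left inf_le_right)
    (Ideal.span {MvPolynomial.X (.inl i) - 1, MvPolynomial.X (.inr j) - 1}) := by
  refine (Presents.prod (PSpace.isAffineOpen_chart m i) (PSpace.isAffineOpen_chart n j)
    (PSpace.presents_chart m i) (PSpace.presents_chart n j)).congr rfl (fun k ↦ rfl) ?_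
  rw [Ideal.map_span, Ideal.map_span, Set.image_singleton, Set.image_singleton,
    ← Ideal.span_union]
  simp [Set.pair_comm]

lemma PProd.iSup_chart : ⨆ ij : Fin (m + 1) × Fin (n + 1), PProd.chart m n ij.1 ij.2 = ⊤ := by
  refine top_le_iff.mp fun x _ ↦ ?_
  obtain ⟨i, hi⟩ := Opens.mem_iSup.mp (show pullback.fst (PSpace.toBase m) (PSpace.toBase n) x ∈
    ⨆ i, CubicPencil.chart m i by rw [PSpace.iSup_chart]; trivial)
  obtain ⟨j, hj⟩ := Opens.mem_iSup.mp (show pullback.snd (PSpace.toBase m) (PSpace.toBase n) x ∈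
    ⨆ i, CubicPencil.chart n i by rw [PSpace.iSup_chart]; trivial)
  exact Opens.mem_iSup.mpr ⟨(i, j), hi, hj⟩

instance isProper_PProd : IsProper (PProd.toBase m n) := by
  unfold PProd.toBase; infer_instance

instance quasiSeparatedSpace_PProd : QuasiSeparatedSpace (PProd m n) :=
  quasiSeparatedSpace_of_quasiSeparated (PProd.toBase m n)

end ProductOfProjectiveSpaces

/-! ### The blow-up of `ℙ⁵` in a point -/

section BlowupPoint

/-- The equations `xₐ y_b = x_b yₐ`. -/
def incidenceEq (ab : Fin 5 × Fin 5) : MvPolynomial (Fin 6 ⊕ Fin 5) ℂ :=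
  MvPolynomial.X (.inl ab.1.castSucc) * MvPolynomial.X (.inr ab.2) -
      MvPolynomial.X (.inl ab.2.castSucc) * MvPolynomial.X (.inr ab.1)

lemma isBihomogeneous_incidenceEq (ab : Fin 5 × Fin 5) :
    IsBihomogeneous (m := 5) (n := 4) (incidenceEq ab) 1 1 := by
  refine Submodule.sub_mem (MvPolynomial.weightedHomogeneousSubmodule ℂ _ ((1, 1) : ℕ × ℕ))
    ?_ ?_ <;>
  exact (MvPolynomial.isWeightedHomogeneous_X ℂ _ _).mul
    (MvPolynomial.isWeightedHomogeneous_X ℂ _ _)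

/-- The chart `{x_k ≠ 0, y_j ≠ 0}` of `P`. -/
abbrev pChart (k : Fin 6) (j : Fin 5) : P.Opens :=
  blowDown ⁻¹ᵁ chart 5 k ⊓ rho ⁻¹ᵁ chart 4 j

lemma isAffineOpen_pChart (k : Fin 6) (j : Fin 5) : IsAffineOpen (pChart k j) :=
  (PProd.isAffineOpen_chart 5 4 k j).preimage incidenceIdeal.subschemeι

lemma idealOn_incidenceIdeal (k : Fin 6) (j : Fin 5) :
    idealOn incidenceIdeal (PProd.isAffineOpen_chart 5 4 k j) =
      Ideal.span (evalAt (PProd.toBase 5 4) (crd₂ (pullback.fst (PSpace.toBase 5) (PSpace.toBase 4))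
        (pullback.snd (PSpace.toBase 5) (PSpace.toBase 4)) inf_le_left inf_le_right) ''
          Set.range incidenceEq) := by
  rw [incidenceIdeal, idealOn_iSup, ← Set.range_comp, Ideal.span_range_eq_iSup]
  refine iSup_congr fun ab ↦ ?_
  exact idealOn_zeroIdeal₂ _ _ (isBihomogeneous_incidenceEq ab)
    (PProd.isAffineOpen_chart 5 4 k j) inf_le_left inf_le_right

lemma presents_pChart (k : Fin 6) (j : Fin 5) : Presents P.toBase (pChart k j)
    (crd₂ blowDown rho (U := pChart k j) inf_le_left inf_le_right)
    (Ideal.span (Set.range incidenceEq ∪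
      {MvPolynomial.X (.inl k) - 1, MvPolynomial.X (.inr j) - 1})) := by
  refine ((PProd.presents 5 4 k j).subscheme_span (PProd.isAffineOpen_chart 5 4 k j)
    incidenceIdeal (idealOn_incidenceIdeal k j)).congr rfl (fun l ↦ ?_) rfl
  rcases l with l | l
  · exact pb_crd _ _ _ _ _
  · exact pb_crd _ _ _ _ _

lemma incidence_crd_mul_crd {U : P.Opens} {k : Fin 6} {j : Fin 5} (h : U ≤ blowDown ⁻¹ᵁ chart 5 k)
    (h' : U ≤ rho ⁻¹ᵁ chart 4 j) (a b : Fin 5) :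
    crd blowDown h a.castSucc * crd rho h' b = crd blowDown h b.castSucc * crd rho h' a := by
  have h1 := (presents_pChart k j).evalAt_eq_zero (G := incidenceEq (a, b))
    (Ideal.subset_span (Or.inl ⟨_, rfl⟩))
  have h2 := congr(res (le_inf h h' : U ≤ pChart k j) $h1)
  simp only [incidenceEq, map_sub, map_mul, evalAt_X, Sum.elim_inl, Sum.elim_inr, res_crd,
    map_zero, sub_eq_zero] at h2
  exact h2

lemma incidence_crd_eq_mul {U : P.Opens} {k : Fin 6} {j : Fin 5} (h : U ≤ blowDown ⁻¹ᵁ chart 5 k)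
    (h' : U ≤ rho ⁻¹ᵁ chart 4 j) (a : Fin 5) :
    crd blowDown h a.castSucc = crd blowDown h j.castSucc * crd rho h' a := by
  have := incidence_crd_mul_crd h h' a j
  rwa [crd_self, mul_one] at this

/-- Away from the hyperplane at infinity of the point, that is for `k` the last index, the chart is
an affine space in which `xⱼ` is a coordinate. On the other charts `1 = xₐ / xₐ` is a multiple of
`xⱼ / xₐ`, which is therefore a unit. -/
lemma incidence_crd_mem_nonZeroDivisors (k : Fin 6) (j : Fin 5) :
    crd blowDown (U := pChart k j) (i := k) inf_le_left j.castSucc ∈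
      nonZeroDivisors Γ(P, pChart k j) := by
  obtain ⟨a, rfl⟩ | rfl := k.eq_castSucc_or_eq_last
  · have h1 := incidence_crd_eq_mul (U := pChart a.castSucc j) (k := a.castSucc) (j := j)
      inf_le_left inf_le_right a
    rw [crd_self] at h1
    exact (IsUnit.of_mul_eq_one _ h1.symm).mem_nonZeroDivisors
  · let A := MvPolynomial (Fin 5) ℂ
    -- Since `yⱼ` is normalized to `1`, the variable `X j` is not needed for it and stands for `xⱼ`.
    let y (b : Fin 5) : A := if b = j then 1 else MvPolynomial.X b
    let x : Fin 6 → A := Fin.lastCases 1 (fun b ↦ MvPolynomial.X j * y b)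
    have hx (b : Fin 5) : x b.castSucc = MvPolynomial.X j * y b := Fin.lastCases_castSucc ..
    have hx' : x (Fin.last 5) = 1 := Fin.lastCases_last ..
    obtain ⟨θ, hθc, hθ⟩ := (presents_pChart (Fin.last 5) j).exists_lift_span (R := A) MvPolynomial.C
      (Sum.elim x y) (by
        rintro G (⟨⟨b, c⟩, rfl⟩ | rfl | rfl)
        · simp only [incidenceEq, MvPolynomial.eval₂_sub, MvPolynomial.eval₂_mul,
            MvPolynomial.eval₂_X, Sum.elim_inl, Sum.elim_inr, hx]
          ring
        · simp only [MvPolynomial.eval₂_sub, MvPolynomial.eval₂_X, MvPolynomial.eval₂_one,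
            Sum.elim_inl, hx', sub_self]
        · simp [y])
    let z : Fin 5 → Γ(P, pChart (Fin.last 5) j) := fun b ↦
      if b = j then crd blowDown (U := pChart (Fin.last 5) j) (i := Fin.last 5) inf_le_left
        j.castSucc else crd rho (U := pChart (Fin.last 5) j) (i := j) inf_le_right b
    have hy (b) : evalAt P.toBase z (y b) =
        crd rho (U := pChart (Fin.last 5) j) (i := j) inf_le_right b := by
      by_cases hb : b = j
      · subst hb; simp only [y, if_true, map_one, crd_self]
      · simp only [y, hb, z, if_false, evalAt_X]
    have hid : (evalAt P.toBase z).comp θ = RingHom.id _ := by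
      refine (presents_pChart (Fin.last 5) j).hom_ext (fun c ↦ by
        rw [RingHom.comp_apply, hθc, evalAt_C]; rfl) ?_
      rintro (b | b)
      · rw [RingHom.comp_apply, hθ, Sum.elim_inl, RingHom.id_apply, crd₂, Sum.elim_inl]
        obtain ⟨b, rfl⟩ | rfl := b.eq_castSucc_or_eq_last
        · rw [hx, map_mul, hy, evalAt_X, incidence_crd_eq_mul (U := pChart (Fin.last 5) j) (j := j)
            inf_le_left inf_le_right b]
          simp [z]
        · rw [hx', map_one, crd_self]
      · rw [RingHom.comp_apply, hθ, Sum.elim_inr, hy, RingHom.id_apply, crd₂, Sum.elim_inr]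
    have hinj : Function.Injective θ := by
      intro a b hab
      have := congr(evalAt P.toBase z $hab)
      rwa [← RingHom.comp_apply, ← RingHom.comp_apply, hid] at this
    have h0 := hθ (.inl j.castSucc)
    simp only [Sum.elim_inl, hx, y, if_true, mul_one] at h0
    rw [mem_nonZeroDivisors_iff_right]
    intro c hc
    apply hinj
    have h1 := congr(θ $hc)
    rw [map_mul, h0, map_zero] at h1
    rw [map_zero]
    exact (mul_eq_zero.mp h1).resolve_right (MvPolynomial.X_ne_zero j)

lemma idealOn_originIdeal (k : Fin 6) : idealOn originIdeal (PSpace.isAffineOpen_chart 5 k) =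
    Ideal.span (Set.range fun j : Fin 5 ↦ coordRatio 5 k j.castSucc) := by
  rw [originIdeal, idealOn_iSup, Ideal.span_range_eq_iSup]
  refine iSup_congr fun j ↦ ?_
  have h : chart 5 k ≤ (𝟙 (PSpace 5)) ⁻¹ᵁ chart 5 k := le_rfl
  rw [idealOn_zeroIdeal (𝟙 _) (MvPolynomial.isHomogeneous_X ℂ _) (PSpace.isAffineOpen_chart 5 k) h,
    evalAt_X, crd, pb_id]
  exact congrArg (fun a ↦ Ideal.span {a}) (res_self _ _)

lemma iSup_rho_preimage : ⨆ j, rho ⁻¹ᵁ chart 4 j = ⊤ := by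
  refine top_le_iff.mp fun x _ ↦ ?_
  obtain ⟨j, hj⟩ := Opens.mem_iSup.mp (show rho x ∈ ⨆ i, chart 4 i by
    rw [PSpace.iSup_chart]; trivial)
  exact Opens.mem_iSup.mpr ⟨j, hj⟩

/-- The charts of the blow-up `P` of `ℙ⁵` in a point. -/
def blowDownCharts : BlowupCharts blowDown originIdeal (Fin 6) (Fin 5) where
  U := chart 5
  hU := PSpace.isAffineOpen_chart 5
  cov := PSpace.iSup_chart 5
  f k j := coordRatio 5 k j.castSucc
  ideal_eq := idealOn_originIdeal
  W := pChart
  hW := isAffineOpen_pChart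
  hWU k j := inf_le_left
  covW k x hx := by
    obtain ⟨j, hj⟩ := Opens.mem_iSup.mp (show x ∈ ⨆ j, rho ⁻¹ᵁ chart 4 j by
      rw [iSup_rho_preimage]; trivial)
    exact Opens.mem_iSup.mpr ⟨j, hx, hj⟩
  regular k j := incidence_crd_mem_nonZeroDivisors k j
  dvd k j b := by
    refine ⟨crd rho (U := pChart k j) (i := j) inf_le_right b, incidence_crd_eq_mul _ _ b, ?_⟩
    rw [basicOpen_crd]
    exact le_inf (inf_le_left.trans inf_le_left) inf_le_right
  exists_lift k j R _ ψ hψ hd := by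
    choose y hy using hd
    obtain ⟨χ, hc, hz⟩ := (presents_pChart k j).exists_lift_span
      (ψ.comp (constHom (PSpace.toBase 5) (chart 5 k)))
      (Sum.elim (fun l ↦ ψ (coordRatio 5 k l)) y) (by
        rintro G (⟨⟨b, c⟩, rfl⟩ | rfl | rfl)
        · simp only [incidenceEq, MvPolynomial.eval₂_sub, MvPolynomial.eval₂_mul,
            MvPolynomial.eval₂_X, Sum.elim_inl, Sum.elim_inr, hy b, hy c]
          ring
        · simp [PSpace.coordRatio_self]
        · have : (y j - 1) * ψ (coordRatio 5 k j.castSucc) = 0 := by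
            linear_combination -(hy j)
          simpa using (mem_nonZeroDivisors_iff_right.mp hψ) _ this)
    refine ⟨χ, (PSpace.presents_chart 5 k).hom_ext (fun c ↦ ?_) fun l ↦ ?_⟩
    · rw [RingHom.comp_apply, pb_constHom]
      exact hc c
    · exact hz (.inl l)
  hom_ext k j R _ χ χ' h hreg := by
    have hx (l) : χ (crd blowDown (U := pChart k j) (i := k) inf_le_left l) =
      χ' (crd blowDown (U := pChart k j) (i := k) inf_le_left l) := congr($h (coordRatio 5 k l))
    refine (presents_pChart k j).hom_ext (fun c ↦ ?_) ?_
    · have := congr($h (constHom (PSpace.toBase 5) (chart 5 k) c))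
      rw [RingHom.comp_apply, RingHom.comp_apply, pb_constHom] at this
      exact this
    · rintro (l | l)
      · exact hx l
      -- The coordinate `yₗ` is determined by `xₗ = xⱼ yₗ`, because the image of `xⱼ` is regular.
      · have h1 := incidence_crd_eq_mul (U := pChart k j) (k := k) (j := j) inf_le_left inf_le_right l
        have h2 := congr(χ $h1)
        have h3 := congr(χ' $h1)
        rw [map_mul] at h2 h3
        rw [← hx, ← hx, h2] at h3
        have : (χ (crd rho (U := pChart k j) (i := j) inf_le_right l) -
            χ' (crd rho (U := pChart k j) (i := j) inf_le_right l)) *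
          χ (crd blowDown (U := pChart k j) (i := k) inf_le_left j.castSucc) = 0 := by
          linear_combination h3
        exact sub_eq_zero.mp ((mem_nonZeroDivisors_iff_right.mp hreg) _ this)

theorem isBlowup_blowDown : IsBlowup blowDown originIdeal := blowDownCharts.isBlowup

end BlowupPoint

/-! ### Pencils of forms -/

section Forms

lemma isWeightedHomogeneous_rename {σ τ M R : Type*} [CommSemiring R] [AddCommMonoid M]
    {w : σ → M} {w' : τ → M} {f : σ → τ} (hw : ∀ k, w' (f k) = w k) {a : M}
    {G : MvPolynomial σ R} (hG : G.IsWeightedHomogeneous w a) :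
    (MvPolynomial.rename f G).IsWeightedHomogeneous w' a := by
  intro d hd
  obtain ⟨u, rfl, hu⟩ := MvPolynomial.coeff_rename_ne_zero _ _ _ hd
  rw [← hG hu, Finsupp.weight_apply, Finsupp.weight_apply,
    Finsupp.sum_mapDomain_index (by simp) (by simp [add_smul])]
  simp [hw]

/-- The form `t₀ q₀ + t₁ q₁`. -/
def pencilOf {n : ℕ} (q : Fin 2 → MvPolynomial (Fin n) ℂ) : MvPolynomial (Fin n ⊕ Fin 2) ℂ :=
  ∑ k, MvPolynomial.X (.inr k) * MvPolynomial.rename Sum.inl (q k)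

lemma isBihomogeneous_pencilOf {n d : ℕ} {q : Fin 2 → MvPolynomial (Fin (n + 1)) ℂ}
    (hq : ∀ k, (q k).IsHomogeneous d) :
    IsBihomogeneous (m := n) (n := 1) (pencilOf q) d 1 := by
  refine MvPolynomial.IsWeightedHomogeneous.sum Finset.univ _ _ fun k _ ↦ ?_
  have h1 : ((q k).IsWeightedHomogeneous (fun _ ↦ ((1, 0) : ℕ × ℕ)) (d, 0)) := by
    intro u hu
    have := hq k hu
    rw [Finsupp.weight_apply] at this ⊢
    ext
    · simpa [Finsupp.sum, Prod.fst_sum] using this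
    · simp [Finsupp.sum, Prod.snd_sum]
  have h2 := (MvPolynomial.isWeightedHomogeneous_X ℂ
    (Sum.elim (fun _ : Fin (n + 1) ↦ ((1, 0) : ℕ × ℕ)) (fun _ : Fin 2 ↦ (0, 1))) (.inr k)).mul
    (isWeightedHomogeneous_rename (f := Sum.inl) (w' := Sum.elim (fun _ : Fin (n + 1) ↦
      ((1, 0) : ℕ × ℕ)) (fun _ : Fin 2 ↦ (0, 1))) (fun _ ↦ rfl) h1)
  simpa [Prod.mk_add_mk] using h2

/-- The form `x₅ q + c`. -/
def coneForm (q c : MvPolynomial (Fin 5) ℂ) : MvPolynomial (Fin 6) ℂ :=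
  MvPolynomial.X (Fin.last 5) * MvPolynomial.rename Fin.castSucc q +
    MvPolynomial.rename Fin.castSucc c

lemma pencilForm_coneForm (q c : Fin 2 → MvPolynomial (Fin 5) ℂ) :
    pencilForm (fun k ↦ coneForm (q k) (c k)) =
      MvPolynomial.X (.inl (Fin.last 5)) *
        MvPolynomial.rename (Sum.map Fin.castSucc id) (pencilOf q) +
      MvPolynomial.rename (Sum.map Fin.castSucc id) (pencilOf c) := by
  have h : Sum.map (Fin.castSucc (n := 5)) (id : Fin 2 → Fin 2) ∘ Sum.inl =
    Sum.inl ∘ Fin.castSucc := rfl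
  simp only [pencilForm, coneForm, pencilOf, map_add, map_mul, map_sum, MvPolynomial.rename_X,
    MvPolynomial.rename_rename, mul_add, Finset.sum_add_distrib, Finset.mul_sum,
    h, Sum.map_inr, id]
  refine congrArg (· + _) (Finset.sum_congr rfl fun k _ ↦ mul_left_comm _ _ _)

lemma isHomogeneous_coneForm {q c : MvPolynomial (Fin 5) ℂ} (hq : q.IsHomogeneous 2)
    (hc : c.IsHomogeneous 3) : (coneForm q c).IsHomogeneous 3 := by
  refine MvPolynomial.IsHomogeneous.add ?_ hc.rename_isHomogeneous
  exact (MvPolynomial.isHomogeneous_X ℂ _).mul hq.rename_isHomogeneous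

lemma evalAt_rename {X : Scheme.{0}} (p : X ⟶ SpecC) {U : X.Opens} {σ τ : Type} (f : σ → τ)
    (z : τ → Γ(X, U)) (G : MvPolynomial σ ℂ) :
    evalAt p z (MvPolynomial.rename f G) = evalAt p (z ∘ f) G :=
  MvPolynomial.eval₂_rename _ _ _ _

end Forms

/-! ### Regular sequences and charts of blow-ups -/

section RegularSequence

variable {A : Type*} [CommRing A]

/-- `(a, b)` is a regular sequence in both orders, in the weak sense. -/
structure IsRegularPair (a b : A) : Prop where
  left : a ∈ nonZeroDivisors A
  right : b ∈ nonZeroDivisors A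
  left_dvd : ∀ c, a ∣ b * c → a ∣ c
  right_dvd : ∀ c, b ∣ a * c → b ∣ c

lemma IsRegularPair.symm {a b : A} (h : IsRegularPair a b) : IsRegularPair b a :=
  ⟨h.right, h.left, h.right_dvd, h.left_dvd⟩

open Polynomial in
/-- `a` is regular modulo `aX + b`. -/
lemma IsRegularPair.mk_C_mem_nonZeroDivisors {a b : A} (h : IsRegularPair a b) :
    Ideal.Quotient.mk (Ideal.span {C a * X + C b}) (C a) ∈ nonZeroDivisors
      (A[X] ⧸ Ideal.span {C a * X + C b}) := by
  rw [mem_nonZeroDivisors_iff_right]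
  intro c hc
  obtain ⟨c, rfl⟩ := Ideal.Quotient.mk_surjective c
  rw [← map_mul, Ideal.Quotient.eq_zero_iff_mem, Ideal.mem_span_singleton] at hc
  obtain ⟨d, hd⟩ := hc
  rw [Ideal.Quotient.eq_zero_iff_mem, Ideal.mem_span_singleton]
  -- If `a c = (a X + b) d`, then `a` divides `b d`, hence every coefficient of `d` by regularity,
  -- and `a` can be cancelled.
  have h1 : C a ∣ C b * d := ⟨c - X * d, by linear_combination -hd⟩
  have h2 : C a ∣ d := by
    rw [Polynomial.C_dvd_iff_dvd_coeff] at h1 ⊢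
    intro n
    have := h1 n
    rw [Polynomial.coeff_C_mul] at this
    exact h.left_dvd _ this
  obtain ⟨e, rfl⟩ := h2
  refine ⟨e, ?_⟩
  have h3 : C a ∈ nonZeroDivisors A[X] := by
    rw [mem_nonZeroDivisors_iff_right]
    intro g hg
    ext n
    have := congr(Polynomial.coeff $hg n)
    rw [Polynomial.coeff_mul_C, Polynomial.coeff_zero] at this
    simpa using (mem_nonZeroDivisors_iff_right.mp h.left) _ this
  have h4 : (c - (C a * X + C b) * e) * C a = 0 := by linear_combination hd
  exact sub_eq_zero.mp ((mem_nonZeroDivisors_iff_right.mp h3) _ h4)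

lemma mem_nonZeroDivisors_of_injective {B : Type*} [CommRing B] (f : A →+* B)
    (hf : Function.Injective f) {a : A} (ha : f a ∈ nonZeroDivisors B) :
    a ∈ nonZeroDivisors A := by
  rw [mem_nonZeroDivisors_iff_right] at ha ⊢
  intro c hc
  apply hf
  rw [map_zero]
  exact ha _ (by rw [← map_mul, hc, map_zero])

end RegularSequence

/-! ### Charts of `P × ℙ¹` -/

section PxP1

/-- The projection `P × ℙ¹ ⟶ ℙ⁵`. -/
abbrev toP5 : PxP1 ⟶ PSpace 5 := pullback.fst P.toBase (PSpace.toBase 1) ≫ blowDown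

/-- The projection `P × ℙ¹ ⟶ ℙ⁴`. -/
abbrev toP4 : PxP1 ⟶ PSpace 4 := pullback.fst P.toBase (PSpace.toBase 1) ≫ rho

/-- The projection `P × ℙ¹ ⟶ ℙ¹`. -/
abbrev toP1 : PxP1 ⟶ PSpace 1 := pullback.snd P.toBase (PSpace.toBase 1)

/-- The structure morphism of `P × ℙ¹`. -/
abbrev PxP1.toBase : PxP1 ⟶ SpecC := pullback.fst P.toBase (PSpace.toBase 1) ≫ P.toBase

lemma toP5_toBase : toP5 ≫ PSpace.toBase 5 = PxP1.toBase := Category.assoc _ _ _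

lemma toP4_toBase : toP4 ≫ PSpace.toBase 4 = PxP1.toBase := by
  rw [toP4, Category.assoc, rho_toBase]

lemma rhoTimesId_fst : rhoTimesId ≫ pullback.fst _ _ = toP4 := pullback.lift_fst _ _ _

lemma rhoTimesId_snd : rhoTimesId ≫ pullback.snd _ _ = toP1 := pullback.lift_snd _ _ _

lemma rhoTimesId_toBase : rhoTimesId ≫ PProd.toBase 4 1 = PxP1.toBase := by
  rw [PProd.toBase, ← Category.assoc, rhoTimesId_fst, toP4_toBase]

/-- The chart `{x_k ≠ 0, y_j ≠ 0, t_l ≠ 0}` of `P × ℙ¹`. -/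
abbrev xChart (k : Fin 6) (j : Fin 5) (l : Fin 2) : PxP1.Opens :=
  prodOpen P.toBase (PSpace.toBase 1) (pChart k j) (chart 1 l)

variable {U : PxP1.Opens} {k : Fin 6} {j : Fin 5} {l : Fin 2}

lemma xChart_le_toP5 : xChart k j l ≤ toP5 ⁻¹ᵁ chart 5 k := fun _ hx ↦ hx.1.1
lemma xChart_le_toP4 : xChart k j l ≤ toP4 ⁻¹ᵁ chart 4 j := fun _ hx ↦ hx.1.2
lemma xChart_le_toP1 : xChart k j l ≤ toP1 ⁻¹ᵁ chart 1 l := fun _ hx ↦ hx.2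

lemma isAffineOpen_xChart : IsAffineOpen (xChart k j l) :=
  isAffineOpen_prodOpen (isAffineOpen_pChart k j) (PSpace.isAffineOpen_chart 1 l)

/-- The coordinates on `P × ℙ¹`. -/
abbrev crd₃ (h5 : U ≤ toP5 ⁻¹ᵁ chart 5 k) (h4 : U ≤ toP4 ⁻¹ᵁ chart 4 j)
    (h1 : U ≤ toP1 ⁻¹ᵁ chart 1 l) : (Fin 6 ⊕ Fin 5) ⊕ Fin 2 → Γ(PxP1, U) :=
  Sum.elim (crd₂ toP5 toP4 h5 h4) (crd toP1 h1)

/-- The relations between the coordinates on `P × ℙ¹`. -/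
def xRelations (k : Fin 6) (j : Fin 5) (l : Fin 2) :
    Set (MvPolynomial ((Fin 6 ⊕ Fin 5) ⊕ Fin 2) ℂ) :=
  MvPolynomial.rename Sum.inl '' (Set.range incidenceEq ∪
      {MvPolynomial.X (.inl k) - 1, MvPolynomial.X (.inr j) - 1}) ∪ {MvPolynomial.X (.inr l) - 1}

lemma presents_xChart : Presents PxP1.toBase (xChart k j l)
    (crd₃ xChart_le_toP5 xChart_le_toP4 xChart_le_toP1) (Ideal.span (xRelations k j l)) := by
  refine (Presents.prod (isAffineOpen_pChart k j) (PSpace.isAffineOpen_chart 1 l)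
    (presents_pChart k j) (PSpace.presents_chart 1 l)).congr rfl (fun a ↦ ?_) ?_
  · rcases a with (a | a) | a
    · exact pb_crd _ _ _ _ _
    · exact pb_crd _ _ _ _ _
    · rfl
  · rw [Ideal.map_span, Ideal.map_span, Set.image_singleton, ← Ideal.span_union, xRelations]
    simp

lemma eval₂_xRelations {R : Type*} [CommRing R] (φ : ℂ →+* R) (x : Fin 6 → R) (y : Fin 5 → R)
    (t : Fin 2 → R) (hx : ∀ a : Fin 5, x a.castSucc = x j.castSucc * y a) (hk : x k = 1)
    (hj : y j = 1) (hl : t l = 1) :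
    ∀ G ∈ xRelations k j l, MvPolynomial.eval₂ φ (Sum.elim (Sum.elim x y) t) G = 0 := by
  rintro _ (⟨G, (⟨⟨b, c⟩, rfl⟩ | rfl | rfl), rfl⟩ | rfl)
  · rw [MvPolynomial.eval₂_rename]
    simp only [incidenceEq, MvPolynomial.eval₂_sub, MvPolynomial.eval₂_mul,
            MvPolynomial.eval₂_X, Sum.elim_inl, Sum.elim_inr, hx b, hx c, Function.comp_apply]
    ring
  · simp [hk]
  · simp [hj]
  · simp [hl]

lemma crd_toP5_eq_mul (h5 : U ≤ toP5 ⁻¹ᵁ chart 5 k) (h4 : U ≤ toP4 ⁻¹ᵁ chart 4 j) (a : Fin 5) :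
    crd toP5 h5 a.castSucc = crd toP5 h5 j.castSucc * crd toP4 h4 a := by
  have h1 := incidence_crd_eq_mul (U := pChart k j) (k := k) (j := j) inf_le_left inf_le_right a
  have e : U ≤ pullback.fst P.toBase (PSpace.toBase 1) ⁻¹ᵁ pChart k j := le_inf h5 h4
  have := congr(pb (pullback.fst P.toBase (PSpace.toBase 1)) e $h1)
  rwa [map_mul, pb_crd, pb_crd, pb_crd] at this

lemma pb_rhoTimesId_crd_fst {V : (PProd 4 1).Opens}
    (h : V ≤ pullback.fst (PSpace.toBase 4) (PSpace.toBase 1) ⁻¹ᵁ chart 4 j)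
    (e : U ≤ rhoTimesId ⁻¹ᵁ V) (h4 : U ≤ toP4 ⁻¹ᵁ chart 4 j) (a : Fin 5) :
    pb rhoTimesId e (crd (pullback.fst (PSpace.toBase 4) (PSpace.toBase 1)) h a) =
      crd toP4 h4 a :=
  (pb_crd _ _ _ _ _).trans (crd_congr rhoTimesId_fst _ _ _)

lemma pb_rhoTimesId_crd_snd {V : (PProd 4 1).Opens}
    (h : V ≤ pullback.snd (PSpace.toBase 4) (PSpace.toBase 1) ⁻¹ᵁ chart 1 l)
    (e : U ≤ rhoTimesId ⁻¹ᵁ V) (h1 : U ≤ toP1 ⁻¹ᵁ chart 1 l) (a : Fin 2) :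
    pb rhoTimesId e (crd (pullback.snd (PSpace.toBase 4) (PSpace.toBase 1)) h a) =
      crd toP1 h1 a :=
  (pb_crd _ _ _ _ _).trans (crd_congr rhoTimesId_snd _ _ _)

lemma le_rhoTimesId (h4 : U ≤ toP4 ⁻¹ᵁ chart 4 j) (h1 : U ≤ toP1 ⁻¹ᵁ chart 1 l) :
    U ≤ rhoTimesId ⁻¹ᵁ PProd.chart 4 1 j l := by
  have e1 : (rhoTimesId ≫ pullback.fst (PSpace.toBase 4) (PSpace.toBase 1)) ⁻¹ᵁ chart 4 j =
      toP4 ⁻¹ᵁ chart 4 j := by rw [rhoTimesId_fst]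
  have e2 : (rhoTimesId ≫ pullback.snd (PSpace.toBase 4) (PSpace.toBase 1)) ⁻¹ᵁ chart 1 l =
      toP1 ⁻¹ᵁ chart 1 l := by rw [rhoTimesId_snd]
  exact fun x hx ↦ ⟨e1.ge (h4 hx), e2.ge (h1 hx)⟩

/-- The coordinates `(yₐ / yⱼ, t_b / t_l)` on the charts of `ℙ⁴ × ℙ¹`. -/
abbrev crdZ (j : Fin 5) (l : Fin 2) : Fin 5 ⊕ Fin 2 → Γ(PProd 4 1, PProd.chart 4 1 j l) :=
  crd₂ (pullback.fst (PSpace.toBase 4) (PSpace.toBase 1))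
    (pullback.snd (PSpace.toBase 4) (PSpace.toBase 1)) inf_le_left inf_le_right

lemma pb_rhoTimesId_crdZ (h4 : U ≤ toP4 ⁻¹ᵁ chart 4 j) (h1 : U ≤ toP1 ⁻¹ᵁ chart 1 l)
    (a : Fin 5 ⊕ Fin 2) :
    pb rhoTimesId (le_rhoTimesId h4 h1) (crdZ j l a) = crd₂ toP4 toP1 h4 h1 a := by
  rcases a with a | a
  · exact pb_rhoTimesId_crd_fst _ _ _ _
  · exact pb_rhoTimesId_crd_snd _ _ _ _

/-- Values of the coordinates `x`. -/
def coneCoord {R : Type*} [CommRing R] (v s : R) (y : Fin 5 → R) : Fin 6 → R :=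
  Fin.lastCases v fun a ↦ s * y a

@[simp] lemma coneCoord_last {R : Type*} [CommRing R] (v s : R) (y : Fin 5 → R) :
    coneCoord v s y (Fin.last 5) = v := Fin.lastCases_last ..

@[simp] lemma coneCoord_castSucc {R : Type*} [CommRing R] (v s : R) (y : Fin 5 → R) (a : Fin 5) :
    coneCoord v s y a.castSucc = s * y a := Fin.lastCases_castSucc ..

lemma eval₂_xRelations_coneCoord {R : Type*} [CommRing R] (φ : ℂ →+* R) (v s : R) (y : Fin 5 → R)
    (t : Fin 2 → R) (hk : coneCoord v s y k = 1) (hj : y j = 1) (hl : t l = 1) :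
    ∀ G ∈ xRelations k j l,
      MvPolynomial.eval₂ φ (Sum.elim (Sum.elim (coneCoord v s y) y) t) G = 0 :=
  eval₂_xRelations φ _ y t (fun a ↦ by simp [hj]) hk hj hl

-- For `k` the last index, the functions on the chart embed in the polynomial ring over the
-- functions on a chart of `ℙ⁴ × ℙ¹`, with `xⱼ / x₅` as variable. On the other charts `xⱼ / xₖ` is a
-- unit.
open Polynomial in
lemma crd_toP5_mem_nonZeroDivisors : crd toP5 (xChart_le_toP5 (k := k) (j := j) (l := l))
    j.castSucc ∈ nonZeroDivisors Γ(PxP1, xChart k j l) := by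
  obtain ⟨a, rfl⟩ | rfl := k.eq_castSucc_or_eq_last
  · have h1 := crd_toP5_eq_mul (xChart_le_toP5 (k := a.castSucc) (j := j) (l := l))
      xChart_le_toP4 a
    rw [crd_self] at h1
    exact (IsUnit.of_mul_eq_one _ h1.symm).mem_nonZeroDivisors
  · let A := Γ(PProd 4 1, PProd.chart 4 1 j l)
    obtain ⟨θ, hθc, hθ⟩ := (presents_xChart (k := Fin.last 5) (j := j) (l := l)).exists_lift_span
      (R := A[X]) (C.comp (constHom (PProd.toBase 4 1) (PProd.chart 4 1 j l)))
      (Sum.elim (Sum.elim (coneCoord 1 X fun a ↦ C (crdZ j l (.inl a)))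
        fun a ↦ C (crdZ j l (.inl a))) fun a ↦ C (crdZ j l (.inr a)))
      (eval₂_xRelations_coneCoord _ _ _ _ _ (coneCoord_last _ _ _) (by simp) (by simp))
    let η : A[X] →+* Γ(PxP1, xChart (Fin.last 5) j l) := Polynomial.eval₂RingHom
      (pb rhoTimesId (le_rhoTimesId xChart_le_toP4 xChart_le_toP1))
      (crd toP5 xChart_le_toP5 j.castSucc)
    have hηC (a) : η (C a) = pb rhoTimesId (le_rhoTimesId xChart_le_toP4 xChart_le_toP1) a :=
      Polynomial.eval₂_C _ _
    have hηX : η X = crd toP5 xChart_le_toP5 j.castSucc := Polynomial.eval₂_X _ _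
    have hid : η.comp θ = RingHom.id _ := by
      refine presents_xChart.hom_ext (fun c ↦ ?_) ?_
      · rw [RingHom.comp_apply, hθc, RingHom.comp_apply, hηC, pb_constHom, rhoTimesId_toBase]
        rfl
      · rintro ((a | a) | a)
        · rw [RingHom.comp_apply, hθ, RingHom.id_apply]
          simp only [Sum.elim_inl]
          obtain ⟨a, rfl⟩ | rfl := a.eq_castSucc_or_eq_last
          · rw [coneCoord_castSucc, map_mul, hηC, hηX, crd_toP5_eq_mul _ xChart_le_toP4 a]
            exact congrArg _ (pb_rhoTimesId_crdZ xChart_le_toP4 xChart_le_toP1 (.inl a))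
          · rw [coneCoord_last, map_one, crd_self]
        · rw [RingHom.comp_apply, hθ]
          exact (hηC _).trans (pb_rhoTimesId_crdZ xChart_le_toP4 xChart_le_toP1 (.inl a))
        · rw [RingHom.comp_apply, hθ]
          exact (hηC _).trans (pb_rhoTimesId_crdZ xChart_le_toP4 xChart_le_toP1 (.inr a))
    have hinj : Function.Injective θ := by
      intro a b hab
      have := congr(η $hab)
      rwa [← RingHom.comp_apply, ← RingHom.comp_apply, hid] at this
    refine mem_nonZeroDivisors_of_injective θ hinj ?_
    have h0 : θ (crd toP5 xChart_le_toP5 j.castSucc) = X := by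
      refine (hθ (.inl (.inl j.castSucc))).trans ?_
      simp
    rw [h0]
    exact Polynomial.monic_X.mem_nonZeroDivisors

end PxP1

/-! ### The universal hypersurface -/

section Hypersurface

variable {U : PxP1.Opens} {k k' : Fin 6} {j j' : Fin 5} {l l' : Fin 2}
  (Q C : MvPolynomial (Fin 5 ⊕ Fin 2) ℂ)

/-- The local equation `x₅ Q(y, t) + xⱼ C(y, t)` of the universal hypersurface. -/
def hyperEq (j : Fin 5) : MvPolynomial ((Fin 6 ⊕ Fin 5) ⊕ Fin 2) ℂ :=
  MvPolynomial.X (.inl (.inl (Fin.last 5))) * MvPolynomial.rename (Sum.map Sum.inr id) Q +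
    MvPolynomial.X (.inl (.inl j.castSucc)) * MvPolynomial.rename (Sum.map Sum.inr id) C

/-- The function `x₅ Q(y, t) + xⱼ C(y, t)`. -/
def hyperSec (h5 : U ≤ toP5 ⁻¹ᵁ chart 5 k) (h4 : U ≤ toP4 ⁻¹ᵁ chart 4 j)
    (h1 : U ≤ toP1 ⁻¹ᵁ chart 1 l) : Γ(PxP1, U) :=
  crd toP5 h5 (Fin.last 5) * evalAt PxP1.toBase (crd₂ toP4 toP1 h4 h1) Q +
    crd toP5 h5 j.castSucc * evalAt PxP1.toBase (crd₂ toP4 toP1 h4 h1) C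

lemma evalAt_hyperEq (h5 : U ≤ toP5 ⁻¹ᵁ chart 5 k) (h4 : U ≤ toP4 ⁻¹ᵁ chart 4 j)
    (h1 : U ≤ toP1 ⁻¹ᵁ chart 1 l) :
    evalAt PxP1.toBase (crd₃ h5 h4 h1) (hyperEq Q C j) = hyperSec Q C h5 h4 h1 := by
  have h : crd₃ h5 h4 h1 ∘ Sum.map Sum.inr id = crd₂ toP4 toP1 h4 h1 := by
    funext a; rcases a with a | a <;> rfl
  rw [hyperEq, map_add, map_mul, map_mul, evalAt_X, evalAt_X, evalAt_rename, evalAt_rename, h]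
  rfl

lemma res_crd₂ {X : Scheme.{0}} {m n : ℕ} (f : X ⟶ PSpace m) (g : X ⟶ PSpace n) {U V : X.Opens}
    {i : Fin (m + 1)} {j : Fin (n + 1)} (h : U ≤ f ⁻¹ᵁ chart m i) (h' : U ≤ g ⁻¹ᵁ chart n j)
    (e : V ≤ U) (a) : res e (crd₂ f g h h' a) = crd₂ f g (e.trans h) (e.trans h') a := by
  rcases a with a | a <;> exact res_crd _ _ _ _

lemma res_evalAt_crd₂ {X : Scheme.{0}} {m n : ℕ} (p : X ⟶ SpecC) (f : X ⟶ PSpace m)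
    (g : X ⟶ PSpace n) {U V : X.Opens}
    {i : Fin (m + 1)} {j : Fin (n + 1)} (h : U ≤ f ⁻¹ᵁ chart m i) (h' : U ≤ g ⁻¹ᵁ chart n j)
    (e : V ≤ U) (G) : res e (evalAt p (crd₂ f g h h') G) =
      evalAt p (crd₂ f g (e.trans h) (e.trans h')) G := by
  rw [res_evalAt]
  exact congrArg (fun z ↦ evalAt p z G) (funext fun a ↦ res_crd₂ f g h h' e a)

/-- Change of charts for the value of a bihomogeneous form. -/
lemma evalAt_crd₂_eq {X : Scheme.{0}} {m n : ℕ} (p : X ⟶ SpecC) (f : X ⟶ PSpace m)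
    (g : X ⟶ PSpace n) {U : X.Opens} {i i' : Fin (m + 1)} {j j' : Fin (n + 1)} {a b : ℕ}
    {G : MvPolynomial (Fin (m + 1) ⊕ Fin (n + 1)) ℂ} (hG : IsBihomogeneous G a b)
    (h : U ≤ f ⁻¹ᵁ chart m i) (h' : U ≤ g ⁻¹ᵁ chart n j) (e : U ≤ f ⁻¹ᵁ chart m i')
    (e' : U ≤ g ⁻¹ᵁ chart n j') :
    evalAt p (crd₂ f g h h') G =
      crd f h i' ^ a * crd g h' j' ^ b * evalAt p (crd₂ f g e e') G := by
  rw [← evalAt_smul_of_isBihomogeneous hG]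
  simp only [crd_mul_crd]

lemma res_hyperSec {V : PxP1.Opens} (h5 : U ≤ toP5 ⁻¹ᵁ chart 5 k) (h4 : U ≤ toP4 ⁻¹ᵁ chart 4 j)
    (h1 : U ≤ toP1 ⁻¹ᵁ chart 1 l) (e : V ≤ U) :
    res e (hyperSec Q C h5 h4 h1) = hyperSec Q C (e.trans h5) (e.trans h4) (e.trans h1) := by
  unfold hyperSec
  rw [map_add, map_mul, map_mul, res_crd, res_crd, res_evalAt_crd₂, res_evalAt_crd₂]

variable {Q C} (hQ : IsBihomogeneous (m := 4) (n := 1) Q 2 1)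
  (hC : IsBihomogeneous (m := 4) (n := 1) C 3 1)

/-- The equations on two charts differ by a unit. The term with `C` has degree 3 in `y`, but one
factor `yⱼ' / yⱼ` is absorbed by replacing `xⱼ` with `xⱼ'`; so the exponent of this factor is 2 for
both terms. -/
lemma hyperSec_eq (hQ : IsBihomogeneous (m := 4) (n := 1) Q 2 1)
    (hC : IsBihomogeneous (m := 4) (n := 1) C 3 1)
    (h5 : U ≤ toP5 ⁻¹ᵁ chart 5 k) (h4 : U ≤ toP4 ⁻¹ᵁ chart 4 j)
    (h1 : U ≤ toP1 ⁻¹ᵁ chart 1 l) (h5' : U ≤ toP5 ⁻¹ᵁ chart 5 k') (h4' : U ≤ toP4 ⁻¹ᵁ chart 4 j')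
    (h1' : U ≤ toP1 ⁻¹ᵁ chart 1 l') :
    hyperSec Q C h5 h4 h1 = crd toP5 h5 k' * crd toP4 h4 j' ^ 2 * crd toP1 h1 l' *
      hyperSec Q C h5' h4' h1' := by
  unfold hyperSec
  rw [evalAt_crd₂_eq PxP1.toBase toP4 toP1 hQ h4 h1 h4' h1',
    evalAt_crd₂_eq PxP1.toBase toP4 toP1 hC h4 h1 h4' h1', ← crd_mul_crd toP5 h5 h5' (Fin.last 5),
    ← crd_mul_crd toP5 h5 h5' j.castSucc, crd_toP5_eq_mul h5' h4' j]
  have := crd_mul_crd_self toP4 h4 h4'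
  linear_combination (crd toP5 h5 k' * crd toP5 h5' j'.castSucc * crd toP4 h4 j' ^ 2 *
    crd toP1 h1 l' * (evalAt PxP1.toBase (crd₂ toP4 toP1 h4' h1')) C) * this

instance isProper_P : IsProper P.toBase := by
  have : P.toBase = incidenceIdeal.subschemeι ≫ PProd.toBase 5 4 := Category.assoc _ _ _
  rw [this]; infer_instance

instance quasiSeparatedSpace_PxP1 : QuasiSeparatedSpace PxP1 :=
  quasiSeparatedSpace_of_quasiSeparated PxP1.toBase

variable (Q C) in
/-- The ideal sheaf with local equations `x₅ Q(y, t) + xⱼ C(y, t)`. -/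
def hyperIdeal : PxP1.IdealSheafData :=
  localEquationsIdeal (fun a : Fin 6 × Fin 5 × Fin 2 ↦ xChart a.1 a.2.1 a.2.2)
    fun _ ↦ hyperSec Q C xChart_le_toP5 xChart_le_toP4 xChart_le_toP1

lemma idealOn_hyperIdeal (hQ : IsBihomogeneous (m := 4) (n := 1) Q 2 1)
    (hC : IsBihomogeneous (m := 4) (n := 1) C 3 1) (k : Fin 6) (j : Fin 5) (l : Fin 2) :
    idealOn (hyperIdeal Q C) (isAffineOpen_xChart (k := k) (j := j) (l := l)) =
      Ideal.span {hyperSec Q C xChart_le_toP5 xChart_le_toP4 xChart_le_toP1} := by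
  refine (idealOn_localEquationsIdeal_of_le
    (fun a : Fin 6 × Fin 5 × Fin 2 ↦ xChart a.1 a.2.1 a.2.2) _
    (fun a ↦ isAffineOpen_xChart.isCompact) isAffineOpen_xChart (k, j, l) le_rfl
    fun a ↦ ?_).trans ?_
  · rw [res_hyperSec, res_hyperSec]
    exact ⟨_, (hyperSec_eq hQ hC (inf_le_left.trans xChart_le_toP5)
      (inf_le_left.trans xChart_le_toP4) (inf_le_left.trans xChart_le_toP1)
      (inf_le_right.trans xChart_le_toP5) (inf_le_right.trans xChart_le_toP4)
      (inf_le_right.trans xChart_le_toP1)).trans (mul_comm _ _)⟩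
  · rw [res_self]

variable {F : Fin 2 → MvPolynomial (Fin 6) ℂ}

variable (Q C F) in
/-- `t₀ F₀ + t₁ F₁ = x₅ Q + C`. -/
def IsConePencil : Prop :=
  pencilForm F = MvPolynomial.X (.inl (Fin.last 5)) *
        MvPolynomial.rename (Sum.map Fin.castSucc id) Q +
      MvPolynomial.rename (Sum.map Fin.castSucc id) C

/-- Substituting `xₐ = xⱼ yₐ` into `x₅ Q(x, t) + C(x, t)` produces `xⱼ²` from the first term and
`xⱼ³` from the second. The common factor `xⱼ²` is the multiplicity 2 along `e`. -/
lemma evalAt_pencilForm (hQ : IsBihomogeneous (m := 4) (n := 1) Q 2 1)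
    (hC : IsBihomogeneous (m := 4) (n := 1) C 3 1) (hF : IsConePencil Q C F)
    (h5 : U ≤ toP5 ⁻¹ᵁ chart 5 k) (h4 : U ≤ toP4 ⁻¹ᵁ chart 4 j)
    (h1 : U ≤ toP1 ⁻¹ᵁ chart 1 l) :
    evalAt PxP1.toBase (crd₂ toP5 toP1 h5 h1) (pencilForm F) =
      crd toP5 h5 j.castSucc ^ 2 * hyperSec Q C h5 h4 h1 := by
  have h : crd₂ toP5 toP1 h5 h1 ∘ Sum.map Fin.castSucc id =
      Sum.elim (fun a ↦ crd toP5 h5 j.castSucc * crd toP4 h4 a) fun a ↦ 1 * crd toP1 h1 a := by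
    funext a; rcases a with a | a
    · exact crd_toP5_eq_mul h5 h4 a
    · exact (one_mul _).symm
  rw [hF, map_add, map_mul, evalAt_X, evalAt_rename, evalAt_rename, h,
    evalAt_smul_of_isBihomogeneous hQ, evalAt_smul_of_isBihomogeneous hC]
  simp only [Sum.elim_inl, one_pow, mul_one]
  unfold hyperSec
  ring

lemma isBihomogeneous_pencilForm (hQ : IsBihomogeneous (m := 4) (n := 1) Q 2 1)
    (hC : IsBihomogeneous (m := 4) (n := 1) C 3 1) (hF : IsConePencil Q C F) :
    IsBihomogeneous (m := 5) (n := 1) (pencilForm F) 3 1 := by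
  have hw : ∀ a : Fin 5 ⊕ Fin 2, (Sum.elim (fun _ ↦ ((1, 0) : ℕ × ℕ)) (fun _ ↦ (0, 1)) :
      Fin 6 ⊕ Fin 2 → ℕ × ℕ) (Sum.map Fin.castSucc id a) =
      (Sum.elim (fun _ ↦ ((1, 0) : ℕ × ℕ)) (fun _ ↦ (0, 1)) : Fin 5 ⊕ Fin 2 → ℕ × ℕ) a := by
    rintro (a | a) <;> rfl
  rw [hF]
  refine Submodule.add_mem (MvPolynomial.weightedHomogeneousSubmodule ℂ _ ((3, 1) : ℕ × ℕ)) ?_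
    (isWeightedHomogeneous_rename hw hC)
  exact (MvPolynomial.isWeightedHomogeneous_X ℂ _ _).mul (isWeightedHomogeneous_rename hw hQ)

lemma idealOn_zeroIdeal₂_pencilForm (hQ : IsBihomogeneous (m := 4) (n := 1) Q 2 1)
    (hC : IsBihomogeneous (m := 4) (n := 1) C 3 1) (hF : IsConePencil Q C F)
    (k : Fin 6) (j : Fin 5) (l : Fin 2) :
    idealOn (zeroIdeal₂ toP5 toP1 (pencilForm F))
      (isAffineOpen_xChart (k := k) (j := j) (l := l)) =
      Ideal.span {crd toP5 xChart_le_toP5 j.castSucc ^ 2 *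
        hyperSec Q C xChart_le_toP5 xChart_le_toP4 xChart_le_toP1} := by
  have : QuasiCompact toP5 := by
    have : QuasiCompact (toP5 ≫ PSpace.toBase 5) := by
      rw [toP5_toBase]; infer_instance
    exact .of_comp toP5 (PSpace.toBase 5)
  rw [idealOn_zeroIdeal₂ toP5 toP1 (isBihomogeneous_pencilForm hQ hC hF) isAffineOpen_xChart
    xChart_le_toP5 xChart_le_toP1, ← evalAt_pencilForm hQ hC hF, toP5_toBase]

lemma idealOn_excIdeal (k : Fin 6) (j : Fin 5) (l : Fin 2) :
    idealOn (excIdeal.comap (pullback.fst P.toBase (PSpace.toBase 1)))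
      (isAffineOpen_xChart (k := k) (j := j) (l := l)) =
      Ideal.span {crd toP5 xChart_le_toP5 j.castSucc} := by
  rw [excIdeal, ← Scheme.IdealSheafData.comap_comp, idealOn_comap originIdeal toP5
    (PSpace.isAffineOpen_chart 5 k) isAffineOpen_xChart xChart_le_toP5, idealOn_originIdeal,
    Ideal.map_span, ← Set.range_comp]
  apply le_antisymm
  · rw [Ideal.span_le]
    rintro _ ⟨a, rfl⟩
    exact Ideal.mem_span_singleton.mpr ⟨_, crd_toP5_eq_mul xChart_le_toP5 xChart_le_toP4 a⟩
  · exact Ideal.span_mono (Set.singleton_subset_iff.mpr ⟨j, rfl⟩)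

lemma iSup_xChart : ⨆ a : Fin 6 × Fin 5 × Fin 2, xChart a.1 a.2.1 a.2.2 = ⊤ := by
  refine top_le_iff.mp fun x _ ↦ ?_
  obtain ⟨k, hk⟩ := Opens.mem_iSup.mp (show toP5 x ∈ ⨆ i, chart 5 i by
    rw [PSpace.iSup_chart]; trivial)
  obtain ⟨j, hj⟩ := Opens.mem_iSup.mp (show toP4 x ∈ ⨆ i, chart 4 i by
    rw [PSpace.iSup_chart]; trivial)
  obtain ⟨l, hl⟩ := Opens.mem_iSup.mp (show toP1 x ∈ ⨆ i, chart 1 i by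
    rw [PSpace.iSup_chart]; trivial)
  exact Opens.mem_iSup.mpr ⟨(k, j, l), ⟨hk, hj⟩, hl⟩

/-- On a chart the divisor `D` has the equation `xⱼ² h`, and `e × ℙ¹` has the equation `xⱼ`. As `xⱼ`
is regular, an ideal multiplied by `xⱼ²` lies in `(xⱼ² h)` exactly when it lies in `(h)`. -/
theorem universalIdeal_eq (hQ : IsBihomogeneous (m := 4) (n := 1) Q 2 1)
    (hC : IsBihomogeneous (m := 4) (n := 1) C 3 1) (hF : IsConePencil Q C F) :
    universalIdeal F = hyperIdeal Q C := by
  have hmul (K L : PxP1.IdealSheafData) (k : Fin 6) (j : Fin 5) (l : Fin 2) :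
      idealOn (K * L ^ 2) (isAffineOpen_xChart (k := k) (j := j) (l := l)) =
        idealOn K isAffineOpen_xChart * idealOn L isAffineOpen_xChart ^ 2 := rfl
  apply le_antisymm
  · refine sSup_le fun K hK ↦ ?_
    refine Scheme.IdealSheafData.le_of_iSup_eq_top
      (fun a : Fin 6 × Fin 5 × Fin 2 ↦ ⟨xChart a.1 a.2.1 a.2.2, isAffineOpen_xChart⟩)
      iSup_xChart fun ⟨k, j, l⟩ ↦ ?_
    change idealOn K (isAffineOpen_xChart (k := k) (j := j) (l := l)) ≤ idealOn _ _
    have h1 : idealOn (K * (excIdeal.comap (pullback.fst P.toBase (PSpace.toBase 1))) ^ 2)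
        (isAffineOpen_xChart (k := k) (j := j) (l := l)) ≤ _ := hK ⟨_, isAffineOpen_xChart⟩
    rw [hmul, idealOn_excIdeal] at h1
    rw [idealOn_hyperIdeal hQ hC]
    intro a ha
    have h2 := h1 (Ideal.mul_mem_mul ha (Ideal.pow_mem_pow (Ideal.mem_span_singleton_self _) 2))
    change _ ∈ idealOn (zeroIdeal₂ toP5 toP1 (pencilForm F)) isAffineOpen_xChart at h2
    rw [idealOn_zeroIdeal₂_pencilForm hQ hC hF, Ideal.mem_span_singleton] at h2
    obtain ⟨b, hb⟩ := h2
    rw [Ideal.mem_span_singleton]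
    refine ⟨b, ?_⟩
    have h3 : (a - hyperSec Q C xChart_le_toP5 xChart_le_toP4 xChart_le_toP1 * b) *
        crd toP5 (xChart_le_toP5 (k := k) (j := j) (l := l)) j.castSucc ^ 2 = 0 := by
      linear_combination hb
    exact sub_eq_zero.mp ((mem_nonZeroDivisors_iff_right.mp
      (pow_mem crd_toP5_mem_nonZeroDivisors 2)) _ h3)
  · refine le_sSup ?_
    refine Scheme.IdealSheafData.le_of_iSup_eq_top
      (fun a : Fin 6 × Fin 5 × Fin 2 ↦ ⟨xChart a.1 a.2.1 a.2.2, isAffineOpen_xChart⟩)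
      iSup_xChart fun ⟨k, j, l⟩ ↦ ?_
    change idealOn (_ * _ ^ 2) (isAffineOpen_xChart (k := k) (j := j) (l := l)) ≤
      idealOn (zeroIdeal₂ toP5 toP1 (pencilForm F)) isAffineOpen_xChart
    rw [hmul, idealOn_excIdeal, idealOn_zeroIdeal₂_pencilForm hQ hC hF, idealOn_hyperIdeal hQ hC,
      Ideal.span_singleton_pow, Ideal.span_singleton_mul_span_singleton, mul_comm]

end Hypersurface

/-! ### The universal hypersurface as a blow-up of `ℙ⁴ × ℙ¹`. -/

section HypersurfaceBlowup

variable {k : Fin 6} {j : Fin 5} {l : Fin 2} {Q C : MvPolynomial (Fin 5 ⊕ Fin 2) ℂ}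
  {F : Fin 2 → MvPolynomial (Fin 6) ℂ}

/-- The charts of the universal hypersurface. -/
abbrev hChart (F : Fin 2 → MvPolynomial (Fin 6) ℂ) (k : Fin 6) (j : Fin 5) (l : Fin 2) :
    (universalHypersurface F).Opens :=
  (universalIdeal F).subschemeι ⁻¹ᵁ xChart k j l

lemma isAffineOpen_hChart : IsAffineOpen (hChart F k j l) :=
  isAffineOpen_xChart.preimage (universalIdeal F).subschemeι

lemma hChart_le : hChart F k j l ≤ rhoRestrict F ⁻¹ᵁ PProd.chart 4 1 j l :=
  fun _ hx ↦ le_rhoTimesId xChart_le_toP4 xChart_le_toP1 hx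

/-- The coordinates on the universal hypersurface. -/
def hCrd (F : Fin 2 → MvPolynomial (Fin 6) ℂ) (k : Fin 6) (j : Fin 5) (l : Fin 2)
    (a : (Fin 6 ⊕ Fin 5) ⊕ Fin 2) : Γ(universalHypersurface F, hChart F k j l) :=
  pb (universalIdeal F).subschemeι le_rfl (crd₃ xChart_le_toP5 xChart_le_toP4 xChart_le_toP1 a)

lemma presents_hChart (hQ : IsBihomogeneous (m := 4) (n := 1) Q 2 1)
    (hC : IsBihomogeneous (m := 4) (n := 1) C 3 1) (hF : IsConePencil Q C F) :
    Presents ((universalIdeal F).subschemeι ≫ PxP1.toBase) (hChart F k j l) (hCrd F k j l)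
      (Ideal.span ({hyperEq Q C j} ∪ xRelations k j l)) := by
  refine presents_xChart.subscheme_span isAffineOpen_xChart (universalIdeal F) ?_
  rw [universalIdeal_eq hQ hC hF, idealOn_hyperIdeal hQ hC, Set.image_singleton, evalAt_hyperEq]

/-- The value of a form on a chart of `ℙ⁴ × ℙ¹`. -/
def evalZ (Q : MvPolynomial (Fin 5 ⊕ Fin 2) ℂ) (j : Fin 5) (l : Fin 2) :
    Γ(PProd 4 1, PProd.chart 4 1 j l) := evalAt (PProd.toBase 4 1) (crdZ j l) Q

lemma hCrd_inr (a : Fin 5) : hCrd F k j l (.inl (.inr a)) =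
    pb (rhoRestrict F) hChart_le (crdZ j l (.inl a)) := by
  rw [hCrd]
  have := congr(pb (universalIdeal F).subschemeι (V := hChart F k j l) le_rfl
    $(pb_rhoTimesId_crdZ (xChart_le_toP4 (k := k) (j := j) (l := l)) xChart_le_toP1 (.inl a)))
  exact this.symm.trans (pb_pb _ _ _ _ _)

lemma hCrd_inr' (a : Fin 2) : hCrd F k j l (.inr a) =
    pb (rhoRestrict F) hChart_le (crdZ j l (.inr a)) := by
  rw [hCrd]
  have := congr(pb (universalIdeal F).subschemeι (V := hChart F k j l) le_rfl
    $(pb_rhoTimesId_crdZ (xChart_le_toP4 (k := k) (j := j) (l := l)) xChart_le_toP1 (.inr a)))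
  exact this.symm.trans (pb_pb _ _ _ _ _)

lemma hCrd_eq_mul (a : Fin 5) : hCrd F k j l (.inl (.inl a.castSucc)) =
    hCrd F k j l (.inl (.inl j.castSucc)) * hCrd F k j l (.inl (.inr a)) := by
  unfold hCrd
  rw [← map_mul]
  exact congrArg _ (crd_toP5_eq_mul xChart_le_toP5 xChart_le_toP4 a)

lemma hCrd_self : hCrd F k j l (.inl (.inl k)) = 1 := by
  unfold hCrd
  rw [← map_one (pb (universalIdeal F).subschemeι (V := hChart F k j l) le_rfl)]
  exact congrArg _ (crd_self _ _)

lemma pb_constHom_hChart (c : ℂ) : pb (rhoRestrict F) (hChart_le (k := k))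
    (constHom (PProd.toBase 4 1) (PProd.chart 4 1 j l) c) =
      constHom ((universalIdeal F).subschemeι ≫ PxP1.toBase) (hChart F k j l) c := by
  rw [pb_constHom, rhoRestrict, Category.assoc, rhoTimesId_toBase]

/-- The equation of the universal hypersurface. -/
lemma hyper_relation (hQ : IsBihomogeneous (m := 4) (n := 1) Q 2 1)
    (hC : IsBihomogeneous (m := 4) (n := 1) C 3 1) (hF : IsConePencil Q C F) :
    hCrd F k j l (.inl (.inl (Fin.last 5))) * pb (rhoRestrict F) hChart_le (evalZ Q j l) +
      hCrd F k j l (.inl (.inl j.castSucc)) * pb (rhoRestrict F) hChart_le (evalZ C j l) = 0 := by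
  have h := (presents_hChart (k := k) (j := j) (l := l) hQ hC hF).evalAt_eq_zero
    (Ideal.subset_span (Or.inl rfl))
  have hz (G) : pb (rhoRestrict F) (hChart_le (k := k)) (evalZ G j l) =
      evalAt ((universalIdeal F).subschemeι ≫ PxP1.toBase) (hCrd F k j l)
        (MvPolynomial.rename (Sum.map Sum.inr id) G) := by
    have e : rhoRestrict F ≫ PProd.toBase 4 1 = (universalIdeal F).subschemeι ≫ PxP1.toBase := by
      rw [rhoRestrict, Category.assoc, rhoTimesId_toBase]
    rw [evalZ, pb_evalAt, evalAt_rename, e]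
    refine congrArg (fun z ↦ evalAt _ z G) (funext fun a ↦ ?_)
    rcases a with a | a
    · exact (hCrd_inr a).symm
    · exact (hCrd_inr' a).symm
  rw [hz, hz]
  simpa only [hyperEq, map_add, map_mul, evalAt_X] using h

/-- Over the base only the fibre coordinates `x₅` and `xⱼ` are free: the others are `xₐ = xⱼ yₐ`. -/
lemma hom_ext_hChart (hQ : IsBihomogeneous (m := 4) (n := 1) Q 2 1)
    (hC : IsBihomogeneous (m := 4) (n := 1) C 3 1) (hF : IsConePencil Q C F)
    {R : Type} [CommRing R] {χ χ' : Γ(universalHypersurface F, hChart F k j l) →+* R}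
    (h : χ.comp (pb (rhoRestrict F) hChart_le) = χ'.comp (pb (rhoRestrict F) hChart_le))
    (hv : χ (hCrd F k j l (.inl (.inl (Fin.last 5)))) =
      χ' (hCrd F k j l (.inl (.inl (Fin.last 5)))))
    (hs : χ (hCrd F k j l (.inl (.inl j.castSucc))) =
      χ' (hCrd F k j l (.inl (.inl j.castSucc)))) : χ = χ' := by
  have hy (a : Fin 5) : χ (hCrd F k j l (.inl (.inr a))) = χ' (hCrd F k j l (.inl (.inr a))) := by
    rw [hCrd_inr]; exact congr($h _)
  refine (presents_hChart hQ hC hF).hom_ext (fun c ↦ ?_) ?_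
  · rw [← pb_constHom_hChart]; exact congr($h _)
  · rintro ((a | a) | a)
    · obtain ⟨a, rfl⟩ | rfl := a.eq_castSucc_or_eq_last
      · rw [hCrd_eq_mul, map_mul, map_mul, hs, hy]
      · exact hv
    · exact hy a
    · rw [hCrd_inr']; exact congr($h _)

/-- Together with `hom_ext_hChart` this says what a chart of `ℋ` represents over the base: pairs
`(v, s)` of values of `(x₅, xⱼ)` with `v Q + s C = 0`, normalized by `xₖ = 1`. -/
lemma exists_lift_hChart (hQ : IsBihomogeneous (m := 4) (n := 1) Q 2 1)
    (hC : IsBihomogeneous (m := 4) (n := 1) C 3 1) (hF : IsConePencil Q C F)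
    {R : Type} [CommRing R] (ψ : Γ(PProd 4 1, PProd.chart 4 1 j l) →+* R) (v s : R)
    (hk : coneCoord v s (fun a ↦ ψ (crdZ j l (.inl a))) k = 1)
    (h : v * ψ (evalZ Q j l) + s * ψ (evalZ C j l) = 0) :
    ∃ χ : Γ(universalHypersurface F, hChart F k j l) →+* R,
      χ.comp (pb (rhoRestrict F) hChart_le) = ψ ∧
      χ (hCrd F k j l (.inl (.inl (Fin.last 5)))) = v ∧
      χ (hCrd F k j l (.inl (.inl j.castSucc))) = s := by
  have hy : ψ (crdZ j l (.inl j)) = 1 := by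
    rw [← map_one ψ]; exact congrArg ψ (crd_self _ _)
  have ht : ψ (crdZ j l (.inr l)) = 1 := by
    rw [← map_one ψ]; exact congrArg ψ (crd_self _ _)
  have hz (G) : ψ (evalZ G j l) = MvPolynomial.eval₂
      (ψ.comp (constHom (PProd.toBase 4 1) (PProd.chart 4 1 j l))) (ψ ∘ crdZ j l) G :=
    MvPolynomial.eval₂_comp_left ψ _ _ G
  obtain ⟨χ, hc, hχ⟩ := (presents_hChart (k := k) (j := j) (l := l) hQ hC hF).exists_lift_span
    (ψ.comp (constHom (PProd.toBase 4 1) (PProd.chart 4 1 j l)))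
    (Sum.elim (Sum.elim (coneCoord v s fun a ↦ ψ (crdZ j l (.inl a)))
      fun a ↦ ψ (crdZ j l (.inl a))) fun a ↦ ψ (crdZ j l (.inr a))) (by
      rintro G (rfl | hG)
      · rw [hz, hz] at h
        have e : (Sum.elim (Sum.elim (coneCoord v s fun a ↦ ψ (crdZ j l (.inl a)))
            fun a ↦ ψ (crdZ j l (.inl a))) fun a ↦ ψ (crdZ j l (.inr a))) ∘
            Sum.map Sum.inr id = ψ ∘ crdZ j l := by
          funext a; rcases a with a | a <;> rfl
        rw [hyperEq, MvPolynomial.eval₂_add, MvPolynomial.eval₂_mul, MvPolynomial.eval₂_mul,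
          MvPolynomial.eval₂_X, MvPolynomial.eval₂_X, MvPolynomial.eval₂_rename,
          MvPolynomial.eval₂_rename, e]
        simp only [Sum.elim_inl, coneCoord_last, coneCoord_castSucc, crd_self, map_one, mul_one]
        exact h
      · exact eval₂_xRelations_coneCoord _ _ _ _ _ hk hy ht G hG)
  refine ⟨χ, ?_, ?_, ?_⟩
  · refine (PProd.presents 4 1 j l).hom_ext (fun c ↦ ?_) ?_
    · rw [RingHom.comp_apply, pb_constHom_hChart]
      exact hc c
    · rintro (a | a)
      · rw [RingHom.comp_apply]
        exact (congrArg χ (hCrd_inr a).symm).trans (hχ (.inl (.inr a)))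
      · rw [RingHom.comp_apply]
        exact (congrArg χ (hCrd_inr' a).symm).trans (hχ (.inr a))
  · exact (hχ _).trans (by simp only [Sum.elim_inl, coneCoord_last])
  · refine (hχ _).trans ?_
    simp

/-- The chart of the universal hypersurface with equation `aX + b` over a chart of `ℙ⁴ × ℙ¹`. -/
lemma regular_hChart (hQ : IsBihomogeneous (m := 4) (n := 1) Q 2 1)
    (hC : IsBihomogeneous (m := 4) (n := 1) C 3 1) (hF : IsConePencil Q C F)
    {R : Type} [CommRing R] (ψ : Γ(PProd 4 1, PProd.chart 4 1 j l) →+* R) (v s : R)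
    (hk : coneCoord v s (fun a ↦ ψ (crdZ j l (.inl a))) k = 1)
    (h : v * ψ (evalZ Q j l) + s * ψ (evalZ C j l) = 0)
    (η : R →+* Γ(universalHypersurface F, hChart F k j l))
    (hη : ∀ a, η (ψ a) = pb (rhoRestrict F) hChart_le a)
    (hv : η v = hCrd F k j l (.inl (.inl (Fin.last 5))))
    (hs : η s = hCrd F k j l (.inl (.inl j.castSucc)))
    (a : Γ(PProd 4 1, PProd.chart 4 1 j l)) (ha : ψ a ∈ nonZeroDivisors R) :
    pb (rhoRestrict F) hChart_le a ∈
      nonZeroDivisors Γ(universalHypersurface F, hChart F k j l) := by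
  -- The map `θ` has the left inverse `η`, so the chart embeds into `R`, and regularity in `R`
  -- descends to it.
  obtain ⟨θ, hθ, hθv, hθs⟩ := exists_lift_hChart (k := k) hQ hC hF ψ v s hk h
  have hid : η.comp θ = RingHom.id _ := by
    apply hom_ext_hChart hQ hC hF
    · rw [RingHom.comp_assoc, hθ]
      ext a
      exact hη a
    · rw [RingHom.comp_apply, hθv, hv]; rfl
    · rw [RingHom.comp_apply, hθs, hs]; rfl
  refine mem_nonZeroDivisors_of_injective θ (fun a b hab ↦ ?_) ?_
  · have := congr(η $hab)
    rwa [← RingHom.comp_apply, ← RingHom.comp_apply, hid] at this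
  · have : θ (pb (rhoRestrict F) hChart_le a) = ψ a := congr($hθ a)
    rwa [this]

-- Where `xⱼ = 1` and `X` is the coordinate `x₅`, the equation of `ℋ` is `Q X + C`; here `Q` is
-- regular by `IsRegularPair.mk_C_mem_nonZeroDivisors`.
open Polynomial in
lemma regular_hChart_castSucc (hQ : IsBihomogeneous (m := 4) (n := 1) Q 2 1)
    (hC : IsBihomogeneous (m := 4) (n := 1) C 3 1) (hF : IsConePencil Q C F)
    (hr : IsRegularPair (evalZ Q j l) (evalZ C j l)) :
    pb (rhoRestrict F) (hChart_le (k := j.castSucc)) (evalZ Q j l) ∈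
      nonZeroDivisors Γ(universalHypersurface F, hChart F j.castSucc j l) := by
  have hrel := hyper_relation (k := j.castSucc) (j := j) (l := l) hQ hC hF
  rw [hCrd_self, one_mul] at hrel
  set q := evalZ Q j l
  set c := evalZ C j l
  set I := Ideal.span {Polynomial.C q * X + Polynomial.C c}
  refine regular_hChart hQ hC hF ((Ideal.Quotient.mk I).comp Polynomial.C)
    (Ideal.Quotient.mk I X) 1 ?_ ?_ (Ideal.Quotient.lift I (Polynomial.eval₂RingHom
      (pb (rhoRestrict F) hChart_le) (hCrd F j.castSucc j l (.inl (.inl (Fin.last 5))))) ?_)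
      ?_ ?_ ?_ _ hr.mk_C_mem_nonZeroDivisors
  · rw [coneCoord_castSucc, one_mul, ← map_one ((Ideal.Quotient.mk I).comp Polynomial.C)]
    exact congrArg _ (crd_self _ _)
  · rw [one_mul, RingHom.comp_apply, RingHom.comp_apply, ← map_mul, ← map_add,
      Ideal.Quotient.eq_zero_iff_mem, mul_comm]
    exact Ideal.mem_span_singleton_self _
  · intro a ha
    obtain ⟨b, rfl⟩ := Ideal.mem_span_singleton.mp ha
    rw [map_mul]
    refine mul_eq_zero_of_left ?_ _
    rw [Polynomial.coe_eval₂RingHom, Polynomial.eval₂_add, Polynomial.eval₂_mul,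
      Polynomial.eval₂_C, Polynomial.eval₂_C, Polynomial.eval₂_X, mul_comm]
    exact hrel
  · intro a
    simp
  · simp
  · rw [map_one, hCrd_self]

-- The same argument where `x₅ = 1`, with `X = xⱼ` and the roles of `Q` and `C` exchanged: the
-- equation is `C X + Q`.
open Polynomial in
lemma regular_hChart_last (hQ : IsBihomogeneous (m := 4) (n := 1) Q 2 1)
    (hC : IsBihomogeneous (m := 4) (n := 1) C 3 1) (hF : IsConePencil Q C F)
    (hr : IsRegularPair (evalZ Q j l) (evalZ C j l)) :
    pb (rhoRestrict F) (hChart_le (k := Fin.last 5)) (evalZ C j l) ∈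
      nonZeroDivisors Γ(universalHypersurface F, hChart F (Fin.last 5) j l) := by
  have hrel := hyper_relation (k := Fin.last 5) (j := j) (l := l) hQ hC hF
  rw [hCrd_self, one_mul] at hrel
  set q := evalZ Q j l
  set c := evalZ C j l
  set I := Ideal.span {Polynomial.C c * X + Polynomial.C q}
  refine regular_hChart hQ hC hF ((Ideal.Quotient.mk I).comp Polynomial.C)
    1 (Ideal.Quotient.mk I X) ?_ ?_ (Ideal.Quotient.lift I (Polynomial.eval₂RingHom
      (pb (rhoRestrict F) hChart_le) (hCrd F (Fin.last 5) j l (.inl (.inl j.castSucc)))) ?_)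
      ?_ ?_ ?_ _ hr.symm.mk_C_mem_nonZeroDivisors
  · exact coneCoord_last _ _ _
  · rw [one_mul, RingHom.comp_apply, RingHom.comp_apply, ← map_mul, ← map_add,
      Ideal.Quotient.eq_zero_iff_mem, mul_comm, add_comm]
    exact Ideal.mem_span_singleton_self _
  · intro a ha
    obtain ⟨b, rfl⟩ := Ideal.mem_span_singleton.mp ha
    rw [map_mul]
    refine mul_eq_zero_of_left ?_ _
    rw [Polynomial.coe_eval₂RingHom, Polynomial.eval₂_add, Polynomial.eval₂_mul,
      Polynomial.eval₂_C, Polynomial.eval₂_C, Polynomial.eval₂_X, mul_comm, add_comm]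
    exact hrel
  · intro a
    simp
  · rw [map_one, hCrd_self]
  · simp

lemma idealOn_intersectionIdeal (hQ : IsBihomogeneous (m := 4) (n := 1) Q 2 1)
    (hC : IsBihomogeneous (m := 4) (n := 1) C 3 1) (j : Fin 5) (l : Fin 2) :
    idealOn (intersectionIdeal Q C) (PProd.isAffineOpen_chart 4 1 j l) =
      Ideal.span {evalZ Q j l, evalZ C j l} := by
  have h : idealOn (intersectionIdeal Q C) (PProd.isAffineOpen_chart 4 1 j l) =
    idealOn (zeroIdeal₂ _ _ Q) (PProd.isAffineOpen_chart 4 1 j l) ⊔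
      idealOn (zeroIdeal₂ _ _ C) (PProd.isAffineOpen_chart 4 1 j l) := rfl
  rw [h, idealOn_zeroIdeal₂ _ _ hQ (PProd.isAffineOpen_chart 4 1 j l) inf_le_left inf_le_right,
    idealOn_zeroIdeal₂ _ _ hC (PProd.isAffineOpen_chart 4 1 j l) inf_le_left inf_le_right,
    ← Ideal.span_insert]
  rfl

lemma basicOpen_hCrd (k' : Fin 6) :
    (universalHypersurface F).basicOpen (hCrd F k j l (.inl (.inl k'))) ≤ hChart F k' j l := by
  intro x hx
  have h1 := basicOpen_pb (universalIdeal F).subschemeι (V := hChart F k j l) le_rfl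
    (crd toP5 (xChart_le_toP5 (k := k) (j := j) (l := l)) k')
  have h2 := h1.le hx
  have h3 : (universalIdeal F).subschemeι x ∈ PxP1.basicOpen
    (crd toP5 (xChart_le_toP5 (k := k) (j := j) (l := l)) k') := h2.2
  rw [basicOpen_crd] at h3
  exact ⟨⟨h3.2, h3.1.1.2⟩, h3.1.2⟩

/-- If `x₅` vanishes, some `xₐ` with `a ≤ 4` does not, and then `xₐ = xⱼ yₐ` forces `xⱼ ≠ 0`. So
over `{yⱼ ≠ 0}` two charts are enough. -/
lemma hChart_cover {x : universalHypersurface F} (hx : x ∈ rhoRestrict F ⁻¹ᵁ PProd.chart 4 1 j l) :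
    x ∈ hChart F j.castSucc j l ∨ x ∈ hChart F (Fin.last 5) j l := by
  set y := (universalIdeal F).subschemeι x with hy
  have e1 : (rhoTimesId ≫ pullback.fst (PSpace.toBase 4) (PSpace.toBase 1)) ⁻¹ᵁ chart 4 j =
      toP4 ⁻¹ᵁ chart 4 j := by rw [rhoTimesId_fst]
  have e2 : (rhoTimesId ≫ pullback.snd (PSpace.toBase 4) (PSpace.toBase 1)) ⁻¹ᵁ chart 1 l =
      toP1 ⁻¹ᵁ chart 1 l := by rw [rhoTimesId_snd]
  have h4 : y ∈ toP4 ⁻¹ᵁ chart 4 j := e1.le hx.1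
  have h1 : y ∈ toP1 ⁻¹ᵁ chart 1 l := e2.le hx.2
  obtain ⟨k, hk⟩ := Opens.mem_iSup.mp (show toP5 y ∈ ⨆ i, chart 5 i by
    rw [PSpace.iSup_chart]; trivial)
  obtain ⟨a, rfl⟩ | rfl := k.eq_castSucc_or_eq_last
  · left
    have hyx : y ∈ xChart a.castSucc j l := ⟨⟨hk, h4⟩, h1⟩
    have h2 := crd_toP5_eq_mul (xChart_le_toP5 (k := a.castSucc) (j := j) (l := l))
      xChart_le_toP4 a
    rw [crd_self] at h2
    have h3 : y ∈ PxP1.basicOpen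
        (crd toP5 (xChart_le_toP5 (k := a.castSucc) (j := j) (l := l)) j.castSucc) := by
      rw [Scheme.basicOpen_of_isUnit _ (IsUnit.of_mul_eq_one _ h2.symm)]
      exact hyx
    rw [basicOpen_crd] at h3
    exact ⟨⟨h3.2, h4⟩, h1⟩
  · right
    exact ⟨⟨hk, h4⟩, h1⟩

/-- The charts of `ℋ` as blow-up of `ℙ⁴ × ℙ¹`. -/
def hyperCharts (hQ : IsBihomogeneous (m := 4) (n := 1) Q 2 1)
    (hC : IsBihomogeneous (m := 4) (n := 1) C 3 1) (hF : IsConePencil Q C F)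
    (hr : ∀ j l, IsRegularPair (evalZ Q j l) (evalZ C j l)) :
    BlowupCharts (rhoRestrict F) (intersectionIdeal Q C) (Fin 5 × Fin 2) Bool where
  U a := PProd.chart 4 1 a.1 a.2
  hU a := PProd.isAffineOpen_chart 4 1 a.1 a.2
  cov := PProd.iSup_chart 4 1
  -- The index `true` stands for the chart `xⱼ = 1`, where `x₅ Q + C = 0` makes `Q` a generator of
  -- `(Q, C)`; `false` stands for `x₅ = 1`, where `Q + xⱼ C = 0` makes `C` a generator.
  f a b := bif b then evalZ Q a.1 a.2 else evalZ C a.1 a.2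
  ideal_eq a := by
    rw [idealOn_intersectionIdeal hQ hC]
    congr 1
    ext x
    simp [or_comm]
  W a b := hChart F (bif b then a.1.castSucc else Fin.last 5) a.1 a.2
  hW a b := isAffineOpen_hChart
  hWU a b := hChart_le
  covW a x hx := by
    obtain h | h := hChart_cover hx
    · exact Opens.mem_iSup.mpr ⟨true, h⟩
    · exact Opens.mem_iSup.mpr ⟨false, h⟩
  regular := by
    rintro ⟨j, l⟩ (_ | _)
    · exact regular_hChart_last hQ hC hF (hr j l)
    · exact regular_hChart_castSucc hQ hC hF (hr j l)
  dvd := by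
    have hone (j l k) : (universalHypersurface F).basicOpen
        (1 : Γ(universalHypersurface F, hChart F k j l)) ≤ hChart F k j l :=
      Scheme.basicOpen_le _ _
    rintro ⟨j, l⟩ (_ | _) (_ | _)
    · exact ⟨1, (mul_one _).symm, hone _ _ _⟩
    · refine ⟨-hCrd F (Fin.last 5) j l (.inl (.inl j.castSucc)), ?_, ?_⟩
      · have h := hyper_relation (k := Fin.last 5) (j := j) (l := l) hQ hC hF
        rw [hCrd_self, one_mul] at h
        change pb (rhoRestrict F) _ (evalZ Q j l) = pb (rhoRestrict F) _ (evalZ C j l) * _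
        linear_combination h
      · have : (universalHypersurface F).basicOpen
            (-hCrd F (Fin.last 5) j l (.inl (.inl j.castSucc))) =
            (universalHypersurface F).basicOpen
            (hCrd F (Fin.last 5) j l (.inl (.inl j.castSucc))) := by
          rw [neg_eq_neg_one_mul, Scheme.basicOpen_mul,
            Scheme.basicOpen_of_isUnit _ (isUnit_one.neg)]
          exact inf_eq_right.mpr (Scheme.basicOpen_le _ _)
        exact this.le.trans (basicOpen_hCrd _)
    · refine ⟨-hCrd F j.castSucc j l (.inl (.inl (Fin.last 5))), ?_, ?_⟩
      · have h := hyper_relation (k := j.castSucc) (j := j) (l := l) hQ hC hF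
        rw [hCrd_self, one_mul] at h
        change pb (rhoRestrict F) _ (evalZ C j l) = pb (rhoRestrict F) _ (evalZ Q j l) * _
        linear_combination h
      · have : (universalHypersurface F).basicOpen
            (-hCrd F j.castSucc j l (.inl (.inl (Fin.last 5)))) =
            (universalHypersurface F).basicOpen
            (hCrd F j.castSucc j l (.inl (.inl (Fin.last 5)))) := by
          rw [neg_eq_neg_one_mul, Scheme.basicOpen_mul,
            Scheme.basicOpen_of_isUnit _ (isUnit_one.neg)]
          exact inf_eq_right.mpr (Scheme.basicOpen_le _ _)
        exact this.le.trans (basicOpen_hCrd _)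
    · exact ⟨1, (mul_one _).symm, hone _ _ _⟩
  exists_lift := by
    rintro ⟨j, l⟩ (_ | _) R _ ψ hψ hd
    · obtain ⟨s, hs⟩ := hd true
      have hs' : ψ (evalZ Q j l) = ψ (evalZ C j l) * s := hs
      obtain ⟨χ, hχ, -, -⟩ := exists_lift_hChart (k := Fin.last 5) hQ hC hF ψ 1 (-s)
        (coneCoord_last _ _ _) (by linear_combination hs')
      exact ⟨χ, hχ⟩
    · obtain ⟨s, hs⟩ := hd false
      have hs' : ψ (evalZ C j l) = ψ (evalZ Q j l) * s := hs
      obtain ⟨χ, hχ, -, -⟩ := exists_lift_hChart (k := j.castSucc) hQ hC hF ψ (-s) 1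
        (by
          rw [coneCoord_castSucc, one_mul, ← map_one ψ]
          exact congrArg ψ (crd_self _ _)) (by linear_combination hs')
      exact ⟨χ, hχ⟩
  hom_ext := by
    rintro ⟨j, l⟩ (_ | _) R _ χ χ' h hreg
    · have hC' : χ (pb (rhoRestrict F) hChart_le (evalZ C j l)) =
        χ' (pb (rhoRestrict F) hChart_le (evalZ C j l)) := congr($h _)
      have hQ' : χ (pb (rhoRestrict F) hChart_le (evalZ Q j l)) =
        χ' (pb (rhoRestrict F) hChart_le (evalZ Q j l)) := congr($h _)
      have hrel := hyper_relation (k := Fin.last 5) (j := j) (l := l) hQ hC hF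
      have h1 : χ (hCrd F (Fin.last 5) j l (.inl (.inl (Fin.last 5)))) =
        χ' (hCrd F (Fin.last 5) j l (.inl (.inl (Fin.last 5)))) := by
        rw [hCrd_self, map_one, map_one]
      refine hom_ext_hChart hQ hC hF h h1 ?_
      have h2 := congr(χ $hrel)
      have h3 := congr(χ' $hrel)
      rw [map_add, map_mul, map_mul, map_zero] at h2 h3
      rw [← h1, ← hC', ← hQ'] at h3
      have h4 : (χ (hCrd F (Fin.last 5) j l (.inl (.inl j.castSucc))) -
          χ' (hCrd F (Fin.last 5) j l (.inl (.inl j.castSucc)))) *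
          χ (pb (rhoRestrict F) hChart_le (evalZ C j l)) = 0 := by
        linear_combination h2 - h3
      exact sub_eq_zero.mp ((mem_nonZeroDivisors_iff_right.mp hreg) _ h4)
    · have hC' : χ (pb (rhoRestrict F) hChart_le (evalZ C j l)) =
        χ' (pb (rhoRestrict F) hChart_le (evalZ C j l)) := congr($h _)
      have hQ' : χ (pb (rhoRestrict F) hChart_le (evalZ Q j l)) =
        χ' (pb (rhoRestrict F) hChart_le (evalZ Q j l)) := congr($h _)
      have hrel := hyper_relation (k := j.castSucc) (j := j) (l := l) hQ hC hF
      have h1 : χ (hCrd F j.castSucc j l (.inl (.inl j.castSucc))) =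
        χ' (hCrd F j.castSucc j l (.inl (.inl j.castSucc))) := by
        rw [hCrd_self, map_one, map_one]
      refine hom_ext_hChart hQ hC hF h ?_ h1
      have h2 := congr(χ $hrel)
      have h3 := congr(χ' $hrel)
      rw [map_add, map_mul, map_mul, map_zero] at h2 h3
      rw [← h1, ← hC', ← hQ'] at h3
      have h4 : (χ (hCrd F j.castSucc j l (.inl (.inl (Fin.last 5)))) -
          χ' (hCrd F j.castSucc j l (.inl (.inl (Fin.last 5))))) *
          χ (pb (rhoRestrict F) hChart_le (evalZ Q j l)) = 0 := by
        linear_combination h2 - h3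
      exact sub_eq_zero.mp ((mem_nonZeroDivisors_iff_right.mp hreg) _ h4)

theorem isBlowup_rhoRestrict (hQ : IsBihomogeneous (m := 4) (n := 1) Q 2 1)
    (hC : IsBihomogeneous (m := 4) (n := 1) C 3 1) (hF : IsConePencil Q C F)
    (hr : ∀ j l, IsRegularPair (evalZ Q j l) (evalZ C j l)) :
    IsBlowup (rhoRestrict F) (intersectionIdeal Q C) :=
  (hyperCharts hQ hC hF hr).isBlowup

end HypersurfaceBlowup

/-! ### Smoothness of complete intersections from the Jacobian criterion -/

section JacobianCriterion

open MvPolynomial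

/-- The `2 × 2` minors of the Jacobian matrix of `(Q, C)`. -/
def minor {σ : Type} (Q C : MvPolynomial σ ℂ) (a b : σ) : MvPolynomial σ ℂ :=
  pderiv a Q * pderiv b C - pderiv b Q * pderiv a C

/-- The ideal of the singular locus of `{Q = C = 0}`. -/
def jacIdeal {σ : Type} (Q C : MvPolynomial σ ℂ) : Ideal (MvPolynomial σ ℂ) :=
  Ideal.span ({Q, C} ∪ Set.range fun ab : σ × σ ↦ minor Q C ab.1 ab.2)

/-- `Q` and `C` define a smooth complete intersection in `ℙ⁴ × ℙ¹`: the ideal of the singular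
locus contains a power of every `xⱼ tₗ`. -/
structure IsSmoothPair (Q C : MvPolynomial (Fin 5 ⊕ Fin 2) ℂ) : Prop where
  left : IsBihomogeneous (m := 4) (n := 1) Q 2 1
  right : IsBihomogeneous (m := 4) (n := 1) C 3 1
  exists_pow_mem (j : Fin 5) (l : Fin 2) : ∃ N, (X (.inl j) * X (.inr l)) ^ N ∈ jacIdeal Q C

lemma IsBihomogeneous.map_weight {m n : ℕ} {G : MvPolynomial (Fin (m + 1) ⊕ Fin (n + 1)) ℂ}
    {a b : ℕ} (hG : IsBihomogeneous G a b) (φ : ℕ × ℕ →+ ℕ) :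
    G.IsWeightedHomogeneous (Sum.elim (fun _ ↦ φ (1, 0)) fun _ ↦ φ (0, 1)) (φ (a, b)) := by
  intro d hd
  rw [← hG hd, Finsupp.weight_apply, Finsupp.weight_apply, Finsupp.sum, Finsupp.sum, map_sum]
  refine Finset.sum_congr rfl fun k _ ↦ ?_
  rw [map_nsmul]
  rcases k with k | k <;> rfl

lemma IsBihomogeneous.euler_left {m n : ℕ} {G : MvPolynomial (Fin (m + 1) ⊕ Fin (n + 1)) ℂ}
    {a b : ℕ} (hG : IsBihomogeneous G a b) :
    ∑ i, X (.inl i) * pderiv (.inl i) G = (a : MvPolynomial _ ℂ) * G := by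
  have := (hG.map_weight (AddMonoidHom.fst ℕ ℕ)).sum_weight_X_mul_pderiv
  simpa using this

lemma IsBihomogeneous.euler_right {m n : ℕ} {G : MvPolynomial (Fin (m + 1) ⊕ Fin (n + 1)) ℂ}
    {a b : ℕ} (hG : IsBihomogeneous G a b) :
    ∑ i, X (.inr i) * pderiv (.inr i) G = (b : MvPolynomial _ ℂ) * G := by
  have := (hG.map_weight (AddMonoidHom.snd ℕ ℕ)).sum_weight_X_mul_pderiv
  simpa using this

/-- On `Y` the two Euler relations, with `zⱼ = zₗ = 1`, express the columns `xⱼ` and `tₗ` of the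
Jacobian matrix as combinations of the other columns. Hence the minors that avoid both columns
generate all of them. -/
lemma minor_mem_of_euler {A : Type*} [CommRing A] {z q c : Fin 5 ⊕ Fin 2 → A} {j : Fin 5}
    {l : Fin 2} (hj : z (.inl j) = 1) (hl : z (.inr l) = 1)
    (hq : ∑ i, z (.inl i) * q (.inl i) = 0) (hq' : ∑ i, z (.inr i) * q (.inr i) = 0)
    (hc : ∑ i, z (.inl i) * c (.inl i) = 0) (hc' : ∑ i, z (.inr i) * c (.inr i) = 0)
    {I : Ideal A} (hI : ∀ a b, a ≠ .inl j → a ≠ .inr l → b ≠ .inl j → b ≠ .inr l →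
      q a * c b - q b * c a ∈ I) (a b) : q a * c b - q b * c a ∈ I := by
  have step (b) (hb : ∀ a, a ≠ .inl j → a ≠ .inr l → q a * c b - q b * c a ∈ I) (a) :
      q a * c b - q b * c a ∈ I := by
    by_cases haj : a = .inl j
    · have h : q a * c b - q b * c a =
          - ∑ i ∈ Finset.univ.erase j, z (.inl i) * (q (.inl i) * c b - q b * c (.inl i)) := by
        have h0 : ∑ i, z (.inl i) * (q (.inl i) * c b - q b * c (.inl i)) = 0 := by
          calc _ = (∑ i, z (.inl i) * q (.inl i)) * c b - q b * ∑ i, z (.inl i) * c (.inl i) := by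
                rw [Finset.sum_mul, Finset.mul_sum, ← Finset.sum_sub_distrib]
                exact Finset.sum_congr rfl fun i _ ↦ by ring
            _ = 0 := by rw [hq, hc]; ring
        rw [← Finset.add_sum_erase _ _ (Finset.mem_univ j), hj] at h0
        rw [haj]
        linear_combination h0
      rw [h]
      refine I.neg_mem (I.sum_mem fun i hi ↦ I.mul_mem_left _ (hb _ ?_ (by simp)))
      simpa using Finset.ne_of_mem_erase hi
    by_cases hal : a = .inr l
    · have h : q a * c b - q b * c a =
          - ∑ i ∈ Finset.univ.erase l, z (.inr i) * (q (.inr i) * c b - q b * c (.inr i)) := by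
        have h0 : ∑ i, z (.inr i) * (q (.inr i) * c b - q b * c (.inr i)) = 0 := by
          calc _ = (∑ i, z (.inr i) * q (.inr i)) * c b - q b * ∑ i, z (.inr i) * c (.inr i) := by
                rw [Finset.sum_mul, Finset.mul_sum, ← Finset.sum_sub_distrib]
                exact Finset.sum_congr rfl fun i _ ↦ by ring
            _ = 0 := by rw [hq', hc']; ring
        rw [← Finset.add_sum_erase _ _ (Finset.mem_univ l), hl] at h0
        rw [hal]
        linear_combination h0
      rw [h]
      refine I.neg_mem (I.sum_mem fun i hi ↦ I.mul_mem_left _ (hb _ (by simp) ?_))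
      simpa using Finset.ne_of_mem_erase hi
    exact hb a haj hal
  refine step b (fun a haj hal ↦ ?_) a
  have := step a (fun b hbj hbl ↦ hI b a hbj hbl haj hal) b
  rw [← neg_mem_iff]
  convert this using 1
  ring

/-- A localization of `ℂ[z] / (r)` at a Jacobian minor of the relations is standard smooth. -/
lemma isStandardSmoothOfRelativeDimension_of_jacobian {A B : Type} [CommRing A] [CommRing B]
    [Algebra ℂ A] [Algebra A B] [Algebra ℂ B] [IsScalarTower ℂ A B] {σ : Type} [Finite σ] {k n : ℕ}
    (hn : Nat.card σ = n + k) (z : σ → A) (r : Fin k → MvPolynomial σ ℂ)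
    (hz : Function.Surjective (aeval (R := ℂ) z))
    (hr : RingHom.ker (aeval (R := ℂ) z) = Ideal.span (Set.range r)) (m : Fin k → σ)
    (hm : Function.Injective m)
    (_ : IsLocalization.Away (aeval z (Matrix.of fun i j ↦ pderiv (m i) (r j)).det) B) :
    Algebra.IsStandardSmoothOfRelativeDimension n ℂ B := by
  let G : Algebra.Generators ℂ A σ := .ofSurjective z hz
  let P : Algebra.PreSubmersivePresentation ℂ A σ (Fin k) :=
    { toGenerators := G
      relation := r
      span_range_relation_eq_ker := hr.symm
      map := m
      map_inj := hm }
  have hP : P.jacobian = aeval z (Matrix.of fun i j ↦ pderiv (m i) (r j)).det := by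
    rw [P.jacobian_eq_jacobiMatrix_det]
    have : P.jacobiMatrix = Matrix.of fun i j ↦ pderiv (m i) (r j) := by
      ext i j : 1
      exact P.jacobiMatrix_apply i j
    rw [this]
    rfl
  let L : Algebra.PreSubmersivePresentation A B Unit Unit := .localizationAway B
    (aeval z (Matrix.of fun i j ↦ pderiv (m i) (r j)).det)
  let S : Algebra.SubmersivePresentation ℂ B (Unit ⊕ σ) (Unit ⊕ Fin k) :=
    { L.comp P with
      jacobian_isUnit := by
        rw [Algebra.PreSubmersivePresentation.comp_jacobian_eq_jacobian_smul_jacobian, hP,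
          Algebra.PreSubmersivePresentation.localizationAway_jacobian, Algebra.smul_def]
        exact (IsLocalization.Away.algebraMap_isUnit _).mul (IsLocalization.Away.algebraMap_isUnit _) }
  refine S.isStandardSmoothOfRelativeDimension ?_
  rw [Algebra.Presentation.dimension, Nat.card_sum, Nat.card_sum, hn]
  simp only [Nat.card_unique, Nat.card_eq_fintype_card, Fintype.card_fin]
  omega

lemma Presents.isStandardSmoothOfRelativeDimension_basicOpen {X : Scheme.{0}} {p : X ⟶ SpecC}
    {U : X.Opens} {σ : Type} [Finite σ] {z : σ → Γ(X, U)} {k n : ℕ}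
    {r : Fin k → MvPolynomial σ ℂ} (h : Presents p U z (Ideal.span (Set.range r)))
    (hU : IsAffineOpen U) (hn : Nat.card σ = n + k) (m : Fin k → σ) (hm : Function.Injective m)
    {g : Γ(X, U)} (hg : g = evalAt p z (Matrix.of fun i j ↦ pderiv (m i) (r j)).det) :
    (constHom p (X.basicOpen g)).IsStandardSmoothOfRelativeDimension n := by
  let := sectionsAlgebra p U
  let := sectionsAlgebra p (X.basicOpen g)
  have : IsScalarTower ℂ Γ(X, U) Γ(X, X.basicOpen g) :=
    IsScalarTower.of_algebraMap_eq' (res_comp_constHom _ (X.basicOpen_le g)).symm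
  have hloc : IsLocalization.Away g Γ(X, X.basicOpen g) := hU.isLocalization_basicOpen g
  exact isStandardSmoothOfRelativeDimension_of_jacobian hn z r h.surjective h.ker_eq m hm
    (hg ▸ hloc)

end JacobianCriterion

/-! ### Charts and smoothness of the complete intersection `Y`. -/

section Intersection

open MvPolynomial

/-- The threefold `Y = {Q = C = 0}`. -/
abbrev yScheme (Q C : MvPolynomial (Fin 5 ⊕ Fin 2) ℂ) : Scheme.{0} :=
  (intersectionIdeal Q C).subscheme

/-- The structure morphism of `Y`. -/
abbrev yToBase (Q C : MvPolynomial (Fin 5 ⊕ Fin 2) ℂ) : yScheme Q C ⟶ SpecC :=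
  (intersectionIdeal Q C).subschemeι ≫ PProd.toBase 4 1

variable {Q C : MvPolynomial (Fin 5 ⊕ Fin 2) ℂ} {j : Fin 5} {l : Fin 2}

variable (Q C j l) in
/-- The charts `{xⱼ ≠ 0, tₗ ≠ 0}` of `Y`. -/
def yChart : (yScheme Q C).Opens := (intersectionIdeal Q C).subschemeι ⁻¹ᵁ PProd.chart 4 1 j l

lemma isAffineOpen_yChart : IsAffineOpen (yChart Q C j l) :=
  (PProd.isAffineOpen_chart 4 1 j l).preimage _

variable (Q C j l) in
/-- The coordinates on the charts of `Y`. -/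
def yCrd (a : Fin 5 ⊕ Fin 2) : Γ(yScheme Q C, yChart Q C j l) :=
  pb (intersectionIdeal Q C).subschemeι le_rfl (crdZ j l a)

lemma iSup_yChart : ⨆ jl : Fin 5 × Fin 2, yChart Q C jl.1 jl.2 = ⊤ := by
  have := congr((intersectionIdeal Q C).subschemeι ⁻¹ᵁ $(PProd.iSup_chart 4 1))
  rwa [Scheme.Hom.preimage_iSup] at this

lemma exists_mem_yChart (x : yScheme Q C) : ∃ j l, x ∈ yChart Q C j l := by
  have : x ∈ (⨆ jl : Fin 5 × Fin 2, yChart Q C jl.1 jl.2) := by rw [iSup_yChart]; trivial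
  obtain ⟨jl, h⟩ := Opens.mem_iSup.mp this
  exact ⟨_, _, h⟩

lemma presents_yChart (hQ : IsBihomogeneous (m := 4) (n := 1) Q 2 1)
    (hC : IsBihomogeneous (m := 4) (n := 1) C 3 1) :
    Presents (yToBase Q C) (yChart Q C j l) (yCrd Q C j l)
      (Ideal.span ({Q, C} ∪ {X (.inl j) - 1, X (.inr l) - 1})) := by
  refine (PProd.presents 4 1 j l).subscheme_span (PProd.isAffineOpen_chart 4 1 j l)
    (intersectionIdeal Q C) ?_
  rw [idealOn_intersectionIdeal hQ hC, Set.image_pair]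
  rfl

lemma yCrd_inl : yCrd Q C j l (.inl j) = 1 := by
  unfold yCrd
  rw [← map_one (pb (intersectionIdeal Q C).subschemeι (V := yChart Q C j l) le_rfl)]
  exact congrArg _ (crd_self _ _)

lemma yCrd_inr : yCrd Q C j l (.inr l) = 1 := by
  unfold yCrd
  rw [← map_one (pb (intersectionIdeal Q C).subschemeι (V := yChart Q C j l) le_rfl)]
  exact congrArg _ (crd_self _ _)

namespace IsSmoothPair

variable (h : IsSmoothPair Q C)

lemma presents_yChart (h : IsSmoothPair Q C) :
    Presents (yToBase Q C) (yChart Q C j l) (yCrd Q C j l)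
      (Ideal.span ({Q, C} ∪ {X (.inl j) - 1, X (.inr l) - 1})) :=
  CubicPencil.presents_yChart h.left h.right

lemma evalAt_left (h : IsSmoothPair Q C) : evalAt (yToBase Q C) (yCrd Q C j l) Q = 0 :=
  h.presents_yChart.evalAt_eq_zero (Ideal.subset_span (by simp))

lemma evalAt_right (h : IsSmoothPair Q C) : evalAt (yToBase Q C) (yCrd Q C j l) C = 0 :=
  h.presents_yChart.evalAt_eq_zero (Ideal.subset_span (by simp))

/-- The minors that avoid the variables `xⱼ` and `tₗ` have no common zero on `{xⱼ ≠ 0, tₗ ≠ 0}`. -/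
lemma span_minor_eq_top (h : IsSmoothPair Q C) (j : Fin 5) (l : Fin 2) :
    Ideal.span {g | ∃ a b, (a ≠ .inl j ∧ a ≠ .inr l ∧ b ≠ .inl j ∧ b ≠ .inr l) ∧
      g = evalAt (yToBase Q C) (yCrd Q C j l) (minor Q C a b)} = ⊤ := by
  set I := Ideal.span {g | ∃ a b, (a ≠ .inl j ∧ a ≠ .inr l ∧ b ≠ .inl j ∧ b ≠ .inr l) ∧
      g = evalAt (yToBase Q C) (yCrd Q C j l) (minor Q C a b)}
  have key (a b) : evalAt (yToBase Q C) (yCrd Q C j l) (minor Q C a b) ∈ I := by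
    have hm (a b) : evalAt (yToBase Q C) (yCrd Q C j l) (minor Q C a b) =
        evalAt (yToBase Q C) (yCrd Q C j l) (pderiv a Q) *
          evalAt (yToBase Q C) (yCrd Q C j l) (pderiv b C) -
        evalAt (yToBase Q C) (yCrd Q C j l) (pderiv b Q) *
          evalAt (yToBase Q C) (yCrd Q C j l) (pderiv a C) := by
      rw [minor, map_sub, map_mul, map_mul]
    rw [hm]
    refine minor_mem_of_euler (z := yCrd Q C j l)
      (q := fun a ↦ evalAt (yToBase Q C) (yCrd Q C j l) (pderiv a Q))
      (c := fun a ↦ evalAt (yToBase Q C) (yCrd Q C j l) (pderiv a C)) yCrd_inl yCrd_inr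
      ?_ ?_ ?_ ?_ (fun a b h1 h2 h3 h4 ↦ ?_) a b
    · have := congr(evalAt (yToBase Q C) (yCrd Q C j l) $(h.left.euler_left))
      simpa only [map_sum, map_mul, evalAt_X, h.evalAt_left, mul_zero] using this
    · have := congr(evalAt (yToBase Q C) (yCrd Q C j l) $(h.left.euler_right))
      simpa only [map_sum, map_mul, evalAt_X, h.evalAt_left, mul_zero] using this
    · have := congr(evalAt (yToBase Q C) (yCrd Q C j l) $(h.right.euler_left))
      simpa only [map_sum, map_mul, evalAt_X, h.evalAt_right, mul_zero] using this
    · have := congr(evalAt (yToBase Q C) (yCrd Q C j l) $(h.right.euler_right))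
      simpa only [map_sum, map_mul, evalAt_X, h.evalAt_right, mul_zero] using this
    · exact Ideal.subset_span ⟨a, b, ⟨h1, h2, h3, h4⟩, (hm a b).symm⟩
  obtain ⟨N, hN⟩ := h.exists_pow_mem j l
  -- All generators of the Jacobian ideal lie in `I` on the chart, and there `xⱼ tₗ = 1`, so that
  -- `1` lies in `I`.
  have hle : jacIdeal Q C ≤ I.comap (evalAt (yToBase Q C) (yCrd Q C j l)) := by
    rw [jacIdeal, Ideal.span_le]
    rintro _ ((rfl | rfl) | ⟨ab, rfl⟩)
    · rw [SetLike.mem_coe, Ideal.mem_comap, h.evalAt_left]; exact I.zero_mem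
    · rw [SetLike.mem_coe, Ideal.mem_comap, h.evalAt_right]; exact I.zero_mem
    · exact key _ _
  have h1 := hle hN
  rw [Ideal.mem_comap, map_pow, map_mul, evalAt_X, evalAt_X, yCrd_inl, yCrd_inr, mul_one,
    one_pow] at h1
  exact (Ideal.eq_top_iff_one I).mpr h1

/-- The gradients of `xⱼ - 1` and `tₗ - 1` are unit vectors, so the determinant of size 4 collapses
to the minor of `Q` and `C` in the remaining columns. -/
lemma det_jacobian {a b : Fin 5 ⊕ Fin 2} (h1 : a ≠ .inl j) (h2 : a ≠ .inr l) (h3 : b ≠ .inl j)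
    (h4 : b ≠ .inr l) (Q C : MvPolynomial (Fin 5 ⊕ Fin 2) ℂ) :
    (Matrix.of fun i k ↦ pderiv ((![.inl j, .inr l, a, b] : Fin 4 → Fin 5 ⊕ Fin 2) i)
      ((![X (.inl j) - 1, X (.inr l) - 1, Q, C] : Fin 4 → MvPolynomial (Fin 5 ⊕ Fin 2) ℂ) k)).det =
      minor Q C a b := by
  rw [Matrix.det_succ_column_zero, Fin.sum_univ_four]
  simp [Matrix.det_fin_three, minor, Matrix.submatrix, pderiv_X,
    h1.symm, h2.symm, h3.symm, h4.symm, Fin.succAbove]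
  ring

lemma exists_isUnit_minor (h : IsSmoothPair Q C) (x : yScheme Q C) (hx : x ∈ yChart Q C j l) :
    ∃ a b, (a ≠ .inl j ∧ a ≠ .inr l ∧ b ≠ .inl j ∧ b ≠ .inr l ∧ a ≠ b) ∧
      x ∈ (yScheme Q C).basicOpen (evalAt (yToBase Q C) (yCrd Q C j l) (minor Q C a b)) := by
  have h1 := isAffineOpen_yChart.iSup_basicOpen_eq_self_iff.mpr (h.span_minor_eq_top j l)
  rw [← h1] at hx
  obtain ⟨⟨_, a, b, hab, rfl⟩, hx⟩ := Opens.mem_iSup.mp hx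
  refine ⟨a, b, ⟨hab.1, hab.2.1, hab.2.2.1, hab.2.2.2, ?_⟩, hx⟩
  rintro rfl
  change x ∈ (yScheme Q C).basicOpen (evalAt (yToBase Q C) (yCrd Q C j l) (minor Q C a a)) at hx
  rw [show minor Q C a a = 0 from sub_self _, map_zero, Scheme.basicOpen_zero] at hx
  exact hx

lemma range_relations (Q C : MvPolynomial (Fin 5 ⊕ Fin 2) ℂ) (j : Fin 5) (l : Fin 2) :
    ({Q, C} ∪ {X (.inl j) - 1, X (.inr l) - 1} : Set (MvPolynomial (Fin 5 ⊕ Fin 2) ℂ)) =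
      Set.range (![X (.inl j) - 1, X (.inr l) - 1, Q, C] :
        Fin 4 → MvPolynomial (Fin 5 ⊕ Fin 2) ℂ) := by
  simp only [Matrix.range_cons, Matrix.range_empty, Set.union_empty]
  rw [Set.union_comm]
  simp only [Set.insert_eq, Set.union_assoc]

lemma injective_variables {a b : Fin 5 ⊕ Fin 2} (h1 : a ≠ .inl j)
    (h2 : a ≠ .inr l) (h3 : b ≠ .inl j) (h4 : b ≠ .inr l) (h5 : a ≠ b) :
    Function.Injective (![.inl j, .inr l, a, b] : Fin 4 → Fin 5 ⊕ Fin 2) := by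
  intro i k hik
  fin_cases i <;> fin_cases k <;> simp_all

lemma isStandardSmooth_basicOpen (h : IsSmoothPair Q C) {a b : Fin 5 ⊕ Fin 2} (h1 : a ≠ .inl j)
    (h2 : a ≠ .inr l) (h3 : b ≠ .inl j) (h4 : b ≠ .inr l) (h5 : a ≠ b) :
    (constHom (yToBase Q C) ((yScheme Q C).basicOpen (evalAt (yToBase Q C) (yCrd Q C j l)
      (minor Q C a b)))).IsStandardSmoothOfRelativeDimension 3 := by
  have hp := h.presents_yChart (j := j) (l := l)
  rw [range_relations] at hp
  exact hp.isStandardSmoothOfRelativeDimension_basicOpen isAffineOpen_yChart (by simp)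
    ![.inl j, .inr l, a, b] (injective_variables h1 h2 h3 h4 h5)
    (congrArg _ (det_jacobian h1 h2 h3 h4 Q C).symm)

/-- A smooth pair defines a smooth threefold. -/
theorem smoothOfRelativeDimension (h : IsSmoothPair Q C) :
    SmoothOfRelativeDimension 3 (yToBase Q C) where
  exists_isStandardSmoothOfRelativeDimension x := by
    obtain ⟨j, l, hx⟩ := exists_mem_yChart x
    obtain ⟨a, b, ⟨h1, h2, h3, h4, h5⟩, hx⟩ := h.exists_isUnit_minor x hx
    refine ⟨⊤, isAffineOpen_top _, _, isAffineOpen_yChart.basicOpen _, hx, le_top, ?_⟩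
    have h6 := h.isStandardSmooth_basicOpen h1 h2 h3 h4 h5
    -- The definition of smoothness refers to the ring of global functions of `Spec ℂ`, which is
    -- only isomorphic to `ℂ`.
    have h7 := (RingHom.isStandardSmoothOfRelativeDimension_respectsIso (n := 3)).2 _
      (Scheme.ΓSpecIso (CommRingCat.of ℂ)).commRingCatIsoToRingEquiv h6
    convert h7 using 1
    ext c
    change _ = res le_top ((yToBase Q C).appTop.hom
      ((Scheme.ΓSpecIso (CommRingCat.of ℂ)).inv.hom
        ((Scheme.ΓSpecIso (CommRingCat.of ℂ)).hom.hom c)))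
    rw [← CommRingCat.comp_apply (Scheme.ΓSpecIso (CommRingCat.of ℂ)).hom, Iso.hom_inv_id]
    rfl

end IsSmoothPair

end Intersection

/-! ### Differential forms and localization -/

section FormMap

open scoped TensorProduct

variable (R A B : Type) [CommRing R] [CommRing A] [CommRing B] [Algebra R A] [Algebra R B]
  [Algebra A B] [IsScalarTower R A B] {n : ℕ}

lemma formMap_ιMulti (w : Fin n → KaehlerDifferential R A) :
    formMap R A B n (exteriorPower.ιMulti A n w) =
      exteriorPower.ιMulti B n fun i ↦ KaehlerDifferential.map R R A B (w i) := by
  let : Module A (⋀[B]^n (KaehlerDifferential R B)) := Module.compHom _ (algebraMap A B)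
  exact exteriorPower.alternatingMapLinearEquiv_apply_ιMulti _ _

lemma formMap_smul (a : A) (x : ⋀[A]^n (KaehlerDifferential R A)) :
    formMap R A B n (a • x) = algebraMap A B a • formMap R A B n x := by
  let : Module A (⋀[B]^n (KaehlerDifferential R B)) := Module.compHom _ (algebraMap A B)
  exact map_smul (exteriorPower.alternatingMapLinearEquiv _) a x

variable {R A} in
lemma form_induction {p : (⋀[A]^n (KaehlerDifferential R A)) → Prop}
    (h1 : ∀ w, p (exteriorPower.ιMulti A n w)) (h0 : p 0) (h2 : ∀ x y, p x → p y → p (x + y))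
    (h3 : ∀ (a : A) x, p x → p (a • x)) (x) : p x := by
  have hx : x ∈ Submodule.span A (Set.range (exteriorPower.ιMulti A n (M := Ω[A⁄R]))) := by
    rw [exteriorPower.ιMulti_span]; trivial
  induction hx using Submodule.span_induction with
  | mem x h => obtain ⟨w, rfl⟩ := h; exact h1 w
  | zero => exact h0
  | add x y _ _ hx hy => exact h2 x y hx hy
  | smul a x _ hx => exact h3 a x hx

lemma kaehler_map_map (C : Type) [CommRing C] [Algebra R C] [Algebra A C] [Algebra B C]
    [IsScalarTower R A C] [IsScalarTower R B C] [IsScalarTower A B C]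
    (x : KaehlerDifferential R A) :
    KaehlerDifferential.map R R B C (KaehlerDifferential.map R R A B x) =
      KaehlerDifferential.map R R A C x := by
  have hx : x ∈ Submodule.span A (Set.range (KaehlerDifferential.D R A)) := by
    rw [KaehlerDifferential.span_range_derivation]; trivial
  induction hx using Submodule.span_induction with
  | mem x h =>
    obtain ⟨a, rfl⟩ := h
    rw [KaehlerDifferential.map_D, KaehlerDifferential.map_D, KaehlerDifferential.map_D,
      ← IsScalarTower.algebraMap_apply]
  | zero => simp
  | add x y _ _ hx hy => simp [hx, hy]
  | smul a x _ hx =>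
    have h1 : KaehlerDifferential.map R R A B (a • x) =
        algebraMap A B a • KaehlerDifferential.map R R A B x := by rw [map_smul, algebraMap_smul]
    rw [h1, map_smul, map_smul, hx, ← algebraMap_smul C a, ← algebraMap_smul C (algebraMap A B a),
      ← IsScalarTower.algebraMap_apply]

lemma formMap_formMap (C : Type) [CommRing C] [Algebra R C] [Algebra A C] [Algebra B C]
    [IsScalarTower R A C] [IsScalarTower R B C] [IsScalarTower A B C]
    (x : ⋀[A]^n (KaehlerDifferential R A)) :
    formMap R B C n (formMap R A B n x) = formMap R A C n x := by
  induction x using form_induction with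
  | h1 w =>
    rw [formMap_ιMulti, formMap_ιMulti, formMap_ιMulti]
    congr 1
    funext i
    exact kaehler_map_map R A B C (w i)
  | h0 => simp
  | h2 x y hx hy => simp [hx, hy]
  | h3 a x hx => rw [formMap_smul, formMap_smul, formMap_smul, hx, ← IsScalarTower.algebraMap_apply]

/-- The comparison of the exterior algebra of a localized module with the localization. -/
lemma exists_exteriorAlgebra_lift {M N : Type} [AddCommGroup M] [Module A M] [AddCommGroup N]
    [Module A N] [Module B N] [IsScalarTower A B N] (S : Submonoid A) [IsLocalization S B]
    (φ : M →ₗ[A] N) [IsLocalizedModule S φ] :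
    ∃ Φ : ExteriorAlgebra B N →ₐ[B] B ⊗[A] ExteriorAlgebra A M,
      ∀ m, Φ (ExteriorAlgebra.ι B (φ m)) = 1 ⊗ₜ ExteriorAlgebra.ι A m := by
  let h : M →ₗ[A] B ⊗[A] ExteriorAlgebra A M :=
    (TensorProduct.mk A B (ExteriorAlgebra A M) 1).comp (ExteriorAlgebra.ι A)
  have hloc : IsLocalizedModule S (TensorProduct.mk A B (ExteriorAlgebra A M) 1) :=
    (isLocalizedModule_iff_isBaseChange S B _).mpr (TensorProduct.isBaseChange A _ B)
  let g : N →ₗ[A] B ⊗[A] ExteriorAlgebra A M :=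
    IsLocalizedModule.lift S φ h fun s ↦ hloc.map_units s
  have hg (m) : g (φ m) = 1 ⊗ₜ ExteriorAlgebra.ι A m := IsLocalizedModule.lift_apply ..
  let g' : N →ₗ[B] B ⊗[A] ExteriorAlgebra A M := g.extendScalarsOfIsLocalization S B
  have hg' (x) : g' x = g x := rfl
  -- Up to the square of an invertible denominator, `g' x * g' x` is the square of an element of
  -- degree one in an exterior algebra.
  have hsq (x : N) : g' x * g' x = 0 := by
    obtain ⟨⟨m, s⟩, hs⟩ := IsLocalizedModule.surj S φ x
    have hu : IsUnit (algebraMap A B s) := IsLocalization.map_units B s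
    have h1 : algebraMap A B s • g' x = 1 ⊗ₜ ExteriorAlgebra.ι A m := by
      rw [← map_smul, algebraMap_smul]
      change g' (s • x) = _
      rw [hs, hg', hg]
    have h2 : (algebraMap A B s • g' x) * (algebraMap A B s • g' x) = 0 := by
      rw [h1, Algebra.TensorProduct.tmul_mul_tmul, ExteriorAlgebra.ι_sq_zero, TensorProduct.tmul_zero]
    rw [smul_mul_smul_comm, (hu.mul hu).smul_eq_zero] at h2
    exact h2
  exact ⟨ExteriorAlgebra.lift B ⟨g', hsq⟩, fun m ↦ by
    rw [ExteriorAlgebra.lift_ι_apply, hg', hg]⟩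

/-- A form that vanishes in a localization is killed by one of the denominators. -/
lemma exists_smul_eq_zero_of_formMap_eq_zero (S : Submonoid A) [IsLocalization S B]
    {x : ⋀[A]^n (KaehlerDifferential R A)} (hx : formMap R A B n x = 0) :
    ∃ s ∈ S, s • x = 0 := by
  obtain ⟨Φ, hΦ⟩ := exists_exteriorAlgebra_lift A B S (KaehlerDifferential.map R R A B)
  -- Via `Φ` the restriction of forms becomes the localization map of the exterior algebra over `A`,
  -- whose kernel is known.
  have key (x : ⋀[A]^n (KaehlerDifferential R A)) :
      Φ (formMap R A B n x : ExteriorAlgebra B (KaehlerDifferential R B)) = 1 ⊗ₜ (x : ExteriorAlgebra A _) := by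
    induction x using form_induction with
    | h1 w =>
      rw [formMap_ιMulti, exteriorPower.ιMulti_apply_coe, exteriorPower.ιMulti_apply_coe,
        ExteriorAlgebra.ιMulti_apply, ExteriorAlgebra.ιMulti_apply, map_list_prod,
        ← Algebra.TensorProduct.includeRight_apply (R := A) (A := B), map_list_prod]
      congr 1
      simp [List.map_ofFn, Function.comp_def, hΦ]
    | h0 => simp
    | h2 x y hx hy => simp [hx, hy, TensorProduct.tmul_add]
    | h3 a x hx =>
      rw [formMap_smul, Submodule.coe_smul, map_smul, hx, Submodule.coe_smul,
        TensorProduct.tmul_smul, algebraMap_smul]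
  have hloc : IsLocalizedModule S (TensorProduct.mk A B (ExteriorAlgebra A (KaehlerDifferential R A)) 1) :=
    (isLocalizedModule_iff_isBaseChange S B _).mpr (TensorProduct.isBaseChange A _ B)
  have h0 : TensorProduct.mk A B (ExteriorAlgebra A (KaehlerDifferential R A)) 1 x = 0 := by
    rw [TensorProduct.mk_apply, ← key, hx]
    simp
  obtain ⟨s, hs⟩ := (IsLocalizedModule.eq_zero_iff S _).mp h0
  exact ⟨s, s.2, Subtype.ext hs⟩

/-- Every form on a localization has a denominator. -/
lemma exists_smul_eq_formMap (S : Submonoid A) [IsLocalization S B]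
    (y : ⋀[B]^n (KaehlerDifferential R B)) :
    ∃ s ∈ S, ∃ x, algebraMap A B s • y = formMap R A B n x := by
  induction y using form_induction with
  | h1 w =>
    choose m hm using fun i ↦ IsLocalizedModule.surj S (KaehlerDifferential.map R R A B) (w i)
    refine ⟨∏ i, (m i).2, S.prod_mem fun i _ ↦ (m i).2.2,
      exteriorPower.ιMulti A n fun i ↦ (m i).1, ?_⟩
    rw [formMap_ιMulti, map_prod, ← AlternatingMap.map_smul_univ]
    congr 1
    funext i
    rw [← hm, algebraMap_smul]
    rfl
  | h0 => exact ⟨1, S.one_mem, 0, by simp⟩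
  | h2 x y hx hy =>
    obtain ⟨s, hs, a, ha⟩ := hx
    obtain ⟨t, ht, b, hb⟩ := hy
    refine ⟨s * t, S.mul_mem hs ht, t • a + s • b, ?_⟩
    rw [map_add, formMap_smul, formMap_smul, ← ha, ← hb, smul_add, map_mul, mul_smul, smul_comm,
      mul_smul]
  | h3 b x hx =>
    obtain ⟨s, hs, a, ha⟩ := hx
    obtain ⟨⟨c, t⟩, hc⟩ := IsLocalization.surj S b
    refine ⟨t * s, S.mul_mem t.2 hs, c • a, ?_⟩
    rw [formMap_smul, ← ha, ← hc, map_mul, smul_smul, smul_smul]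
    congr 1
    ring

end FormMap

/-! ### Volume forms of complete intersections -/

section VolumeAlgebra

variable {A : Type*} [CommRing A]

/-- Both sides are alternating in the rows of `β`. On basis vectors they agree, because both change
by the sign of a permutation and coincide for the identity matrix. -/
lemma alternatingMap_sum_smul {N X ι : Type*} [Fintype ι] [DecidableEq ι] [AddCommGroup N]
    [Module A N] [AddCommGroup X] [Module A X] (f : N [⋀^ι]→ₗ[A] X) (β : Matrix ι ι A)
    (w : ι → N) : (f fun i ↦ ∑ b, β i b • w b) = β.det • f w := by
  let g : (ι → A) [⋀^ι]→ₗ[A] X := f.compLinearMap (Fintype.linearCombination A w)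
  let g' : (ι → A) [⋀^ι]→ₗ[A] X :=
    (LinearMap.toSpanSingleton A X (f w)).compAlternatingMap Matrix.detRowAlternating
  suffices h : g = g' from congr($h β)
  refine Module.Basis.ext_alternating (Pi.basisFun A ι) fun i hi ↦ ?_
  let σ : Equiv.Perm ι := Equiv.ofBijective i (Finite.injective_iff_bijective.1 hi)
  have h1 : (g fun b ↦ Pi.basisFun A ι b) = f w := by
    simp [g, Fintype.linearCombination_apply, Pi.single_apply, AlternatingMap.compLinearMap_apply]
  have h2 : (g' fun b ↦ Pi.basisFun A ι b) = f w := by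
    have : (Matrix.detRowAlternating fun b : ι ↦ Pi.basisFun A ι b) = (1 : A) := by
      rw [← Matrix.det_one (n := ι)]
      congr 1
      ext a b
      simp [Matrix.one_apply, Pi.single_apply, eq_comm]
    rw [LinearMap.compAlternatingMap_apply, this]
    simp
  change (g fun b ↦ Pi.basisFun A ι (σ b)) = g' fun b ↦ Pi.basisFun A ι (σ b)
  exact (AlternatingMap.map_perm g _ σ).trans
    ((congrArg _ (h1.trans h2.symm)).trans (AlternatingMap.map_perm g' _ σ).symm)

variable {σ : Type*} [Fintype σ] [DecidableEq σ] (e : σ ≃ Fin 4 ⊕ Fin 3)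

/-- The determinant of the matrix with four given rows `m` and three variable rows `θ`. -/
def rowsDet (m : Fin 4 → σ → A) : (σ → A) [⋀^Fin 3]→ₗ[A] A where
  toFun θ := Matrix.det fun i ↦ Sum.elim m θ (e i)
  map_update_add' θ i x y := by
    have h (x) : (fun k ↦ Sum.elim m (Function.update θ i x) (e k)) =
        Function.update (fun k ↦ Sum.elim m θ (e k)) (e.symm (.inr i)) x := by
      rw [Sum.elim_update_right]
      exact Function.update_comp_equiv _ e _ _
    simp only [h]
    exact Matrix.det_updateRow_add _ _ _ _
  map_update_smul' θ i c x := by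
    have h (x) : (fun k ↦ Sum.elim m (Function.update θ i x) (e k)) =
        Function.update (fun k ↦ Sum.elim m θ (e k)) (e.symm (.inr i)) x := by
      rw [Sum.elim_update_right]
      exact Function.update_comp_equiv _ e _ _
    simp only [h]
    exact Matrix.det_updateRow_smul _ _ _ _
  map_eq_zero_of_eq' θ i k h hik :=
    Matrix.det_zero_of_row_eq (i := e.symm (.inr i)) (j := e.symm (.inr k)) (by simpa using hik)
      (by simpa using h)

lemma rowsDet_apply (m : Fin 4 → σ → A) (θ : Fin 3 → σ → A) :
    rowsDet e m θ = Matrix.det fun i ↦ Sum.elim m θ (e i) := rfl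

lemma rowsDet_eq (m : Fin 4 → σ → A) (θ : Fin 3 → σ → A) :
    rowsDet e m θ = ((Matrix.of (Sum.elim m θ)).submatrix e id).det := rfl

/-- Two volume forms on the quotient by the rows `m` are proportional. -/
lemma rowsDet_smul_eq {N X : Type*} [AddCommGroup N] [Module A N] [AddCommGroup X] [Module A X]
    {m : Fin 4 → σ → A} (L : (σ → A) →ₗ[A] N) (hL : ∀ a, L (m a) = 0) (f : N [⋀^Fin 3]→ₗ[A] X)
    (θ θ' : Fin 3 → σ → A) (hu : IsUnit (rowsDet e m θ')) :
    rowsDet e m θ' • f (fun i ↦ L (θ i)) = rowsDet e m θ • f fun i ↦ L (θ' i) := by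
  let M : Matrix σ σ A := (Matrix.of (Sum.elim m θ')).submatrix e id
  have hM : IsUnit M.det := hu
  -- Coordinates of `θ i` in the basis consisting of the rows `m` and `θ'`. Since `L` kills the rows
  -- `m`, only the block `β` belonging to `θ'` contributes, to the forms as well as to the
  -- determinants.
  let c (i : Fin 3) : σ → A := Matrix.vecMul (θ i) M⁻¹
  have hc (i) : θ i = (∑ a, c i (e.symm (.inl a)) • m a) + ∑ b, c i (e.symm (.inr b)) • θ' b := by
    have h1 : θ i = Matrix.vecMul (c i) M := by
      rw [Matrix.vecMul_vecMul, Matrix.nonsing_inv_mul _ hM, Matrix.vecMul_one]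
    conv_lhs => rw [h1, Matrix.vecMul_eq_sum]
    rw [← Equiv.sum_comp e.symm, Fintype.sum_sum_type]
    congr 1
    · refine Finset.sum_congr rfl fun a _ ↦ congrArg _ (funext fun x ↦ ?_)
      simp [M]
    · refine Finset.sum_congr rfl fun a _ ↦ congrArg _ (funext fun x ↦ ?_)
      simp [M]
  let α : Matrix (Fin 3) (Fin 4) A := .of fun i a ↦ c i (e.symm (.inl a))
  let β : Matrix (Fin 3) (Fin 3) A := .of fun i b ↦ c i (e.symm (.inr b))
  have h1 : f (fun i ↦ L (θ i)) = β.det • f fun i ↦ L (θ' i) := by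
    rw [← alternatingMap_sum_smul]
    congr 1
    funext i
    conv_lhs => rw [hc]
    simp [hL, β]
  have h2 : rowsDet e m θ = β.det * rowsDet e m θ' := by
    have h3 : Matrix.of (Sum.elim m θ) =
        Matrix.fromBlocks 1 0 α β * Matrix.of (Sum.elim m θ') := by
      ext i k
      rcases i with i | i
      · simp [Matrix.mul_apply, Matrix.one_apply]
      · rw [Matrix.of_apply, Sum.elim_inr, hc, Matrix.mul_apply, Fintype.sum_sum_type]
        simp [α, β]
    rw [rowsDet_eq, h3, ← Matrix.submatrix_mul_equiv _ _ e e id, Matrix.det_mul,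
      Matrix.det_submatrix_equiv_self, Matrix.det_fromBlocks_zero₁₂, Matrix.det_one, one_mul,
      rowsDet_eq]
  rw [h1, h2, smul_smul, mul_comm]

/-- The rows of the Jacobian matrix of a complete intersection and of two normalized coordinates. -/
def jacRows (q c : σ → A) (j l : σ) : Fin 4 → σ → A := ![q, c, Pi.single j 1, Pi.single l 1]

/-- Invariance of the Jacobian determinant under a change of the normalization from `z j = 1`,
with `z k = u z' k` for `k ∈ S`, to `z' j' = 1`. -/
lemma rowsDet_change {S : Finset σ} {z' q q' c c' : σ → A} {u v : A} (huv : u * v = 1)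
    {j j' l : σ} (hj' : j' ∈ S) (hj : j ∈ S) (hl : l ∉ S)
    (hz' : z' j' = 1) (hzj : z' j = v) {a b : ℕ} (hab : a + b = S.card)
    (hq : ∀ k, u ^ a * q' k = if k ∈ S then u * q k else q k)
    (hc : ∀ k, u ^ b * c' k = if k ∈ S then u * c k else c k)
    (heq : ∑ k ∈ S, q' k * z' k = 0) (hec : ∑ k ∈ S, c' k * z' k = 0)
    (T : (σ → A) →ₗ[A] σ → A)
    (hT : ∀ k, T (Pi.single k 1) = if k ∈ S then v • (Pi.single k 1 - z' k • Pi.single j' 1)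
      else Pi.single k 1) (θ : Fin 3 → σ → A) :
    rowsDet e (jacRows q' c' j' l) θ = rowsDet e (jacRows q c j l) fun i ↦ T (θ i) := by
  have hTx (x : σ → A) (y : σ) : T x y = (if y ∈ S then v * x y else x y) -
      (Pi.single j' (v * ∑ k ∈ S, x k * z' k) : σ → A) y := by
    have hx : x = ∑ k, x k • (Pi.single k 1 : σ → A) := by
      ext y
      simp [Finset.sum_apply, Pi.single_apply]
    conv_lhs => rw [hx]
    have h1 (k) : x k * (T (Pi.single k 1) y) =
        (if k = y then (if y ∈ S then v * x y else x y) else 0) -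
          (if k ∈ S then (Pi.single j' (v * (x k * z' k)) : σ → A) y else 0) := by
      rw [hT]
      by_cases hy : k = y
      · subst hy
        by_cases hk : k ∈ S
        · simp only [hk, if_true, Pi.smul_apply, Pi.sub_apply, smul_eq_mul, Pi.single_apply]
          split_ifs <;> ring
        · simp [hk]
      · have hy' : y ≠ k := fun h ↦ hy h.symm
        by_cases hk : k ∈ S
        · simp only [hk, hy, hy', if_true, if_false, Pi.smul_apply, Pi.sub_apply, smul_eq_mul,
            Pi.single_apply]
          split_ifs <;> ring
        · simp [hk, hy, hy']
    simp only [map_sum, map_smul, Finset.sum_apply, Pi.smul_apply, smul_eq_mul, h1,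
      Finset.sum_sub_distrib, Finset.sum_ite_eq', Finset.mem_univ, if_true, Finset.sum_ite_mem,
      Finset.univ_inter]
    congr 1
    by_cases hj : y = j' <;> simp [hj, Finset.mul_sum]
  -- For a gradient the Euler relation `h0` removes the correction at `j'`, so `T` merely rescales
  -- it by a power of `v`.
  have hdeg {g g' : σ → A} {d : ℕ} (h : ∀ k, u ^ d * g' k = if k ∈ S then u * g k else g k)
      (h0 : ∑ k ∈ S, g' k * z' k = 0) (y) : T g' y = v ^ d * g y := by
    have hvu : v ^ d * u ^ d = 1 := by rw [← mul_pow, mul_comm v, huv, one_pow]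
    rw [hTx, h0]
    have h1 : g' y = v ^ d * if y ∈ S then u * g y else g y := by
      rw [← h, ← mul_assoc, hvu, one_mul]
    by_cases hy : y ∈ S
    · simp only [hy, if_true] at h1
      simp only [hy, if_true, h1, mul_zero, Pi.single_zero, Pi.zero_apply, sub_zero]
      linear_combination v ^ d * g y * huv
    · simpa [hy] using h1
  -- The map `T` kills the basis vector at `j'` and is not invertible. Adding the basis vector at
  -- `j` in this row repairs it without changing the determinant compared below.
  let K : Matrix σ σ A := .of fun k ↦ T (Pi.single k 1) + if k = j' then Pi.single j 1 else 0
  have hK : K.det = v ^ S.card := by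
    let U : Matrix σ (Fin 2) A := .of fun k ↦ ![-(if k ∈ S then z' k else 0), if k = j' then u else 0]
    let V : Matrix (Fin 2) σ A := .of ![Pi.single j' 1, Pi.single j 1]
    have h1 : K = Matrix.diagonal (fun k ↦ if k ∈ S then v else 1) * (1 + U * V) := by
      ext k x
      rw [Matrix.diagonal_mul, Matrix.add_apply, Matrix.mul_apply, Fin.sum_univ_two]
      simp only [K, U, V, Matrix.of_apply, hT, Matrix.cons_val_zero, Matrix.cons_val_one,
        Pi.add_apply, Matrix.one_apply]
      by_cases hk : k ∈ S
      · by_cases hkj : k = j'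
        · subst hkj
          simp only [hk, if_true, Pi.smul_apply, Pi.sub_apply, smul_eq_mul, Pi.single_apply]
          have : v * u = 1 := by rw [mul_comm, huv]
          simp only [eq_comm (a := x)]
          linear_combination (-(if j = x then (1 : A) else 0)) * this
        · simp only [hk, hkj, if_true, if_false, Pi.smul_apply, Pi.sub_apply, smul_eq_mul,
            Pi.single_apply, Pi.zero_apply, eq_comm (a := x)]
          ring
      · have hkj : k ≠ j' := fun h ↦ hk (h ▸ hj')
        simp [hk, hkj, Pi.single_apply, eq_comm]
    -- The determinant of `1 + U V` is that of the `2 × 2` matrix `1 + V U`. Its first diagonal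
    -- entry is `0`, and its off-diagonal entries are `u` and `-v`; so it equals `u v = 1`, whatever
    -- the last entry is.
    rw [h1, Matrix.det_mul, Matrix.det_diagonal, Matrix.det_one_add_mul_comm, Matrix.det_fin_two]
    have h00 : (V * U) 0 0 = -1 := by simp [V, U, Matrix.mul_apply, Pi.single_apply, hj', hz']
    have h01 : (V * U) 0 1 = u := by simp [V, U, Matrix.mul_apply, Pi.single_apply]
    have h10 : (V * U) 1 0 = -v := by simp [V, U, Matrix.mul_apply, Pi.single_apply, hj, hzj]
    simp only [Matrix.add_apply, h00, h01, h10, Matrix.one_apply, Finset.prod_ite, Finset.prod_const,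
      Finset.filter_mem_eq_inter, Finset.univ_inter, one_pow]
    simp
    linear_combination v ^ S.card * huv
  let M' : Matrix σ σ A := .of fun i ↦ Sum.elim (jacRows q' c' j' l) θ (e i)
  let B : Matrix σ σ A := .of fun i ↦ Sum.elim (jacRows q c j l) (fun i ↦ T (θ i)) (e i)
  let d : σ → A := fun i ↦ Sum.elim ![v ^ a, v ^ b, 1, 1] (fun _ ↦ 1) (e i)
  -- Here the condition `a + b = S.card` enters: the rescaling of the two gradients cancels the
  -- determinant of `K`. This is the numerical condition for a trivial canonical bundle.
  have hd : ∏ i, d i = v ^ S.card := by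
    rw [Equiv.prod_comp e (Sum.elim ![v ^ a, v ^ b, 1, 1] fun _ ↦ 1), Fintype.prod_sum_type]
    simp [Fin.prod_univ_four, ← hab, pow_add]
  -- Each row of `M' * K` is the corresponding scaled row of `B` plus a multiple of the basis vector
  -- at `j`, and that vector is itself a row of the scaled matrix.
  have hMK : (M' * K).det = (Matrix.of fun i k ↦ d i * B i k).det := by
    refine Matrix.det_eq_of_forall_row_eq_smul_add_const
      (fun i ↦ Sum.elim ![q' j', c' j', 0, 0] (fun a ↦ θ a j') (e i)) (e.symm (.inl 2))
      (by simp) fun i y ↦ ?_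
    have h1 : (M' * K) i y = T (M' i) y + M' i j' * (Pi.single j 1 : σ → A) y := by
      have hx : M' i = ∑ k, M' i k • (Pi.single k 1 : σ → A) := by
        ext y
        simp [Finset.sum_apply, Pi.single_apply]
      conv_rhs => rw [hx]
      rw [Matrix.mul_apply]
      simp only [K, Matrix.of_apply, Pi.add_apply, mul_add, Finset.sum_add_distrib, map_sum,
        map_smul, Finset.sum_apply, Pi.smul_apply, smul_eq_mul]
      congr 1
      simp [Pi.single_apply, ite_apply]
    have h2 : d (e.symm (.inl 2)) * B (e.symm (.inl 2)) y = (Pi.single j 1 : σ → A) y := by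
      simp [d, B, jacRows]
    rw [h1, Matrix.of_apply, Matrix.of_apply, h2]
    obtain ⟨s, rfl⟩ := e.symm.surjective i
    have hM : M' (e.symm s) = Sum.elim (jacRows q' c' j' l) θ s := by
      funext x
      simp [M']
    rw [hM]
    simp only [B, d, Matrix.of_apply, Equiv.apply_symm_apply]
    have hlj : l ≠ j' := fun h ↦ hl (h ▸ hj')
    rcases s with s | s
    · fin_cases s
      · simp [jacRows, hdeg hq heq]
      · simp [jacRows, hdeg hc hec]
      · simp [jacRows, hT, hj', hz']
      · simp [jacRows, hT, hl, hlj.symm]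
    · simp
  rw [Matrix.det_mul, hK, Matrix.det_mul_column, hd] at hMK
  have hv : IsUnit (v ^ S.card) := (IsUnit.of_mul_eq_one u (by rw [mul_comm, huv])).pow _
  rw [mul_comm] at hMK
  exact hv.mul_left_cancel hMK

end VolumeAlgebra

/-! ### Existence and uniqueness of the residue volume form on a chart. -/

section VolumeForms

open MvPolynomial

variable {A B : Type} [CommRing A] [Algebra ℂ A] [CommRing B] [Algebra ℂ B] [Algebra A B]
  [IsScalarTower ℂ A B]

/-- An enumeration of the rows of the `7 × 7` determinants. -/
def rowEquiv : Fin 5 ⊕ Fin 2 ≃ Fin 4 ⊕ Fin 3 := Fintype.equivOfCardEq (by simp)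

variable {σ : Type}

/-- The gradient of `G` at `z`. -/
def grad (z : σ → A) (G : MvPolynomial σ ℂ) (k : σ) : A := aeval z (pderiv k G)

lemma grad_algebraMap (z : σ → A) (G : MvPolynomial σ ℂ) :
    grad (fun k ↦ algebraMap A B (z k)) G = fun k ↦ algebraMap A B (grad z G k) :=
  funext fun k ↦ aeval_algebraMap_apply B z (pderiv k G)

variable [Fintype σ] [DecidableEq σ] (e : σ ≃ Fin 4 ⊕ Fin 3)

/-- The covector `∑ θₖ dzₖ`. -/
def diffMap (z : σ → A) : (σ → A) →ₗ[A] KaehlerDifferential ℂ A :=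
  Fintype.linearCombination A fun k ↦ KaehlerDifferential.D ℂ A (z k)

/-- The determinant with the rows `∇Q`, `∇C`, `eⱼ`, `eₗ` and the three given rows. -/
def volDet (z : σ → A) (Q C : MvPolynomial σ ℂ) (j l : σ) : (σ → A) [⋀^Fin 3]→ₗ[A] A :=
  rowsDet e (jacRows (grad z Q) (grad z C) j l)

/-- The `3`-form `ω` on `{Q = C = 0, zⱼ = zₗ = 1}` with
`dz_a ∧ dz_b ∧ dz_c = det(∇Q, ∇C, eⱼ, eₗ, e_a, e_b, e_c) ω`. -/
def IsVolume (z : σ → A) (Q C : MvPolynomial σ ℂ) (j l : σ)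
    (ω : ⋀[A]^3 (KaehlerDifferential ℂ A)) : Prop :=
  ∀ c : Fin 3 → σ, exteriorPower.ιMulti A 3 (fun i ↦ KaehlerDifferential.D ℂ A (z (c i))) =
    volDet e z Q C j l (fun i ↦ Pi.single (c i) 1) • ω

/-- The ideal of the determinants in `IsVolume`. -/
def volIdeal (z : σ → A) (Q C : MvPolynomial σ ℂ) (j l : σ) : Ideal A :=
  Ideal.span (Set.range fun c : Fin 3 → σ ↦ volDet e z Q C j l fun i ↦ Pi.single (c i) 1)

lemma diffMap_single (z : σ → A) (k : σ) :
    diffMap z (Pi.single k 1) = KaehlerDifferential.D ℂ A (z k) := by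
  simp [diffMap, Fintype.linearCombination_apply, Pi.single_apply]

lemma D_aeval (z : σ → A) (G : MvPolynomial σ ℂ) :
    KaehlerDifferential.D ℂ A (aeval z G) = diffMap z (grad z G) := by
  rw [diffMap, Fintype.linearCombination_apply]
  unfold grad
  induction G using MvPolynomial.induction_on with
  | C c => simp
  | add p q hp hq => simp [hp, hq, add_smul, Finset.sum_add_distrib]
  | mul_X p k hp =>
    rw [map_mul, aeval_X, Derivation.leibniz, hp, Finset.smul_sum]
    simp only [Derivation.leibniz, pderiv_X, smul_eq_mul, map_add, map_mul, aeval_X, add_smul,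
      Finset.sum_add_distrib]
    congr 1
    · simp [Pi.single_apply]
    · exact Finset.sum_congr rfl fun i _ ↦ by rw [smul_smul]

lemma eq_zero_of_span_eq_top {A : Type*} [CommRing A] {M : Type*} [AddCommGroup M] [Module A M] {s : Set A}
    (hs : Ideal.span s = ⊤) {x : M} (h : ∀ r ∈ s, ∃ n : ℕ, r ^ n • x = 0) : x = 0 := by
  have := Submodule.mem_of_span_eq_top_of_smul_pow_mem (⊥ : Submodule A M) s hs x
    fun r ↦ by simpa using h r r.2
  simpa using this

namespace IsVolume

variable {e} {z : σ → A} {Q C : MvPolynomial σ ℂ} {j l : σ} {ω : ⋀[A]^3 (KaehlerDifferential ℂ A)}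

lemma ιMulti_diffMap (h : IsVolume e z Q C j l ω) (θ : Fin 3 → σ → A) :
    exteriorPower.ιMulti A 3 (fun i ↦ diffMap z (θ i)) = volDet e z Q C j l θ • ω := by
  have : (exteriorPower.ιMulti A 3).compLinearMap (diffMap z) =
      (LinearMap.toSpanSingleton A _ ω).compAlternatingMap (volDet e z Q C j l) := by
    refine Module.Basis.ext_alternating (Pi.basisFun A σ) fun c _ ↦ ?_
    simp only [AlternatingMap.compLinearMap_apply, Pi.basisFun_apply, diffMap_single,
      LinearMap.compAlternatingMap_apply, LinearMap.toSpanSingleton_apply]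
    exact h c
  exact congr($this θ)

lemma unique (hv : volIdeal e z Q C j l = ⊤) (h : IsVolume e z Q C j l ω)
    {ω' : ⋀[A]^3 (KaehlerDifferential ℂ A)} (h' : IsVolume e z Q C j l ω') : ω = ω' := by
  rw [← sub_eq_zero]
  refine eq_zero_of_span_eq_top hv ?_
  rintro _ ⟨c, rfl⟩
  exact ⟨1, by rw [pow_one, smul_sub, ← h c, ← h' c, sub_self]⟩

lemma span_eq_top (h : IsVolume e z Q C j l ω)
    (hz : Submodule.span A (Set.range fun k ↦ KaehlerDifferential.D ℂ A (z k)) = ⊤) :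
    Submodule.span A {ω} = ⊤ := by
  rw [← top_le_iff, ← exteriorPower.ιMulti_span_of_span A 3 _ hz, Submodule.span_le]
  rintro _ ⟨w, hw, rfl⟩
  choose c hc using fun i ↦ hw ⟨i, rfl⟩
  have : w = fun i ↦ KaehlerDifferential.D ℂ A (z (c i)) := funext fun i ↦ (hc i).symm
  rw [this, h c]
  exact Submodule.smul_mem _ _ (Submodule.mem_span_singleton_self ω)

end IsVolume

lemma volDet_algebraMap (z : σ → A) (Q C : MvPolynomial σ ℂ) (j l : σ) (c : Fin 3 → σ) :
    volDet e (fun k ↦ algebraMap A B (z k)) Q C j l (fun i ↦ Pi.single (c i) 1) =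
      algebraMap A B (volDet e z Q C j l fun i ↦ Pi.single (c i) 1) := by
  have hs (k x : σ) : (Pi.single k 1 : σ → B) x = algebraMap A B ((Pi.single k 1 : σ → A) x) := by
    simp [Pi.single_apply, apply_ite (algebraMap A B)]
  refine Eq.trans ?_ (RingHom.map_det (algebraMap A B) (Matrix.of fun i ↦
    Sum.elim (jacRows (grad z Q) (grad z C) j l) (fun i ↦ Pi.single (c i) 1) (e i))).symm
  refine congrArg Matrix.det (Matrix.ext fun i x ↦ ?_)
  rw [RingHom.mapMatrix_apply, Matrix.map_apply, Matrix.of_apply]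
  rcases e i with a | a
  · fin_cases a
    · exact congrFun (grad_algebraMap z Q) x
    · exact congrFun (grad_algebraMap z C) x
    · exact hs j x
    · exact hs l x
  · exact hs _ x

lemma IsVolume.formMap {z : σ → A} {Q C : MvPolynomial σ ℂ} {j l : σ}
    {ω : ⋀[A]^3 (KaehlerDifferential ℂ A)} (h : IsVolume e z Q C j l ω) :
    IsVolume e (fun k ↦ algebraMap A B (z k)) Q C j l (formMap ℂ A B 3 ω) := fun c ↦ by
  have := congr(CubicPencil.formMap ℂ A B 3 $(h c))
  rw [formMap_ιMulti, formMap_smul] at this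
  simpa only [KaehlerDifferential.map_D, volDet_algebraMap] using this

lemma volIdeal_algebraMap {z : σ → A} {Q C : MvPolynomial σ ℂ} {j l : σ}
    (h : volIdeal e z Q C j l = ⊤) : volIdeal e (fun k ↦ algebraMap A B (z k)) Q C j l = ⊤ := by
  have h1 := congr(Ideal.map (algebraMap A B) $h)
  rw [Ideal.map_top, volIdeal, Ideal.map_span, ← Set.range_comp] at h1
  rw [volIdeal, ← h1]
  congr 2
  exact funext fun c ↦ volDet_algebraMap e z Q C j l c

/-- On the chart `dQ = dC = dzⱼ = dzₗ = 0`, so the four fixed rows are killed by `diffMap z`. Both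
forms can then be compared with the one belonging to the unit determinant of `θ₀`. -/
lemma volDet_smul_eq_of_isUnit {z : σ → A} {Q C : MvPolynomial σ ℂ} {j l : σ}
    (hQ : aeval z Q = 0) (hC : aeval z C = 0) (hj : z j = 1) (hl : z l = 1) {θ₀ : Fin 3 → σ → A}
    (hu : IsUnit (volDet e z Q C j l θ₀)) (θ θ' : Fin 3 → σ → A) :
    volDet e z Q C j l θ' • exteriorPower.ιMulti A 3 (fun i ↦ diffMap z (θ i)) =
      volDet e z Q C j l θ • exteriorPower.ιMulti A 3 (fun i ↦ diffMap z (θ' i)) := by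
  have h (θ) := rowsDet_smul_eq e (m := jacRows (grad z Q) (grad z C) j l) (diffMap z)
    (fun a ↦ by
      fin_cases a
      · exact (D_aeval z Q).symm.trans (by rw [hQ, map_zero])
      · exact (D_aeval z C).symm.trans (by rw [hC, map_zero])
      · exact (diffMap_single z j).trans (by rw [hj, Derivation.map_one_eq_zero])
      · exact (diffMap_single z l).trans (by rw [hl, Derivation.map_one_eq_zero]))
    (exteriorPower.ιMulti A 3) θ θ₀ hu
  refine hu.smul_left_cancel.mp ?_
  have h1 := h θ
  have h2 := h θ'
  change volDet e z Q C j l θ₀ • _ = volDet e z Q C j l θ • _ at h1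
  change volDet e z Q C j l θ₀ • _ = volDet e z Q C j l θ' • _ at h2
  rw [smul_comm, h1, smul_comm (volDet e z Q C j l θ₀), h2, smul_comm]

/-- Existence of the volume form. -/
lemma exists_isVolume {z : σ → A} {Q C : MvPolynomial σ ℂ} {j l : σ}
    (hQ : aeval z Q = 0) (hC : aeval z C = 0) (hj : z j = 1) (hl : z l = 1)
    (hv : volIdeal e z Q C j l = ⊤) : ∃ ω, IsVolume e z Q C j l ω := by
  let J (c : Fin 3 → σ) : A := volDet e z Q C j l fun i ↦ Pi.single (c i) 1
  let d (c : Fin 3 → σ) := exteriorPower.ιMulti A 3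
    fun i ↦ KaehlerDifferential.D ℂ A (z (c i))
  -- The relation between two coordinate forms can be checked after inverting each determinant `J
  -- c₀`, since these determinants generate the unit ideal.
  have key (c c') : J c' • d c = J c • d c' := by
    rw [← sub_eq_zero]
    refine eq_zero_of_span_eq_top hv ?_
    rintro _ ⟨c₀, rfl⟩
    change ∃ n : ℕ, J c₀ ^ n • _ = 0
    have h1 : formMap ℂ A (Localization.Away (J c₀)) 3 (J c' • d c - J c • d c') = 0 := by
      rw [map_sub, formMap_smul, formMap_smul, formMap_ιMulti, formMap_ιMulti, sub_eq_zero]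
      have h2 := volDet_smul_eq_of_isUnit e
        (z := fun k ↦ algebraMap A (Localization.Away (J c₀)) (z k))
        ((aeval_algebraMap_apply _ z Q).trans (by rw [hQ, map_zero]))
        ((aeval_algebraMap_apply _ z C).trans (by rw [hC, map_zero]))
        (by rw [hj, map_one]) (by rw [hl, map_one]) (θ₀ := fun i ↦ Pi.single (c₀ i) 1)
        (by rw [volDet_algebraMap]; exact IsLocalization.Away.algebraMap_isUnit _)
        (fun i ↦ Pi.single (c i) 1) fun i ↦ Pi.single (c' i) 1
      simpa only [volDet_algebraMap, diffMap_single, KaehlerDifferential.map_D] using h2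
    obtain ⟨_, ⟨n, rfl⟩, hs⟩ := exists_smul_eq_zero_of_formMap_eq_zero ℂ A _
      (Submonoid.powers (J c₀)) h1
    exact ⟨n, hs⟩
  have h1 : (1 : A) ∈ Ideal.span (Set.range J) := by
    change 1 ∈ volIdeal e z Q C j l
    rw [hv]; trivial
  obtain ⟨g, hg⟩ := (Ideal.mem_span_range_iff_exists_fun).mp h1
  -- With `∑ g c · J c = 1` this sum patches the local quotients `d c / J c`.
  refine ⟨∑ c, g c • d c, fun c ↦ ?_⟩
  change d c = J c • _
  rw [Finset.smul_sum]
  calc d c = (∑ c', g c' * J c') • d c := by rw [hg, one_smul]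
    _ = _ := by
      rw [Finset.sum_smul]
      exact Finset.sum_congr rfl fun c' _ ↦ by rw [mul_smul, key, smul_comm]

/-- `IsVolume.change` alters only the first of the two normalized variables. Exchanging the two rows
makes it applicable to the other group of variables, at the cost of a sign that cancels in the end.
-/
lemma volDet_swap (z : σ → A) (Q C : MvPolynomial σ ℂ) (j l : σ) (θ : Fin 3 → σ → A) :
    volDet e z Q C l j θ = - volDet e z Q C j l θ := by
  rw [volDet, volDet, rowsDet_apply, rowsDet_apply]
  have h := Matrix.det_permute (Equiv.swap (e.symm (.inl 2)) (e.symm (.inl 3)))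
    (Matrix.of fun i ↦ Sum.elim (jacRows (grad z Q) (grad z C) j l) θ (e i))
  rw [Equiv.Perm.sign_swap (by simp)] at h
  have h2 : (Matrix.of fun i ↦ Sum.elim (jacRows (grad z Q) (grad z C) j l) θ (e i)).submatrix
      (Equiv.swap (e.symm (.inl 2)) (e.symm (.inl 3))) id =
      fun i ↦ Sum.elim (jacRows (grad z Q) (grad z C) l j) θ (e i) := by
    ext i x
    obtain ⟨s, rfl⟩ := e.symm.surjective i
    rw [Matrix.submatrix_apply, Equiv.apply_symm_apply, Matrix.of_apply]
    rcases s with s | s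
    · fin_cases s
      · rw [Equiv.swap_apply_of_ne_of_ne (by simp) (by simp)]; simp [jacRows]
      · rw [Equiv.swap_apply_of_ne_of_ne (by simp) (by simp)]; simp [jacRows]
      · simp [jacRows]
      · simp [jacRows]
    · rw [Equiv.swap_apply_of_ne_of_ne (by simp) (by simp)]; simp
  rw [h2] at h
  rw [h]
  simp
  rfl

lemma IsVolume.swap {z : σ → A} {Q C : MvPolynomial σ ℂ} {j l : σ}
    {ω : ⋀[A]^3 (KaehlerDifferential ℂ A)} (h : IsVolume e z Q C j l ω) :
    IsVolume e z Q C l j (-ω) := fun c ↦ by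
  rw [volDet_swap, neg_smul_neg]
  exact h c

/-- The Jacobian minors are determinants of the volume form. -/
lemma minor_mem_volIdeal (z : σ → A) (Q C : MvPolynomial σ ℂ) {j l a b : σ}
    (hinj : Function.Injective (![a, b, j, l] : Fin 4 → σ)) :
    aeval z (minor Q C a b) ∈ volIdeal e z Q C j l := by
  let f : Fin 4 → σ := ![a, b, j, l]
  have hcard : Fintype.card {x // x ∉ Set.range f} = 3 := by
    have h1 := Fintype.card_subtype_compl fun x ↦ x ∈ Set.range f
    have h2 : Fintype.card {x // x ∈ Set.range f} = 4 :=
      (Set.card_range_of_injective hinj).trans (by simp)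
    have h3 : Fintype.card σ = 7 := (Fintype.card_congr e).trans (by simp)
    rw [h1, h2, h3]
  let τ₀ : Fin 3 ≃ {x // x ∉ Set.range f} := Fintype.equivOfCardEq (by rw [hcard, Fintype.card_fin])
  -- The columns are reordered with `a`, `b`, `j`, `l` in front. The matrix becomes block triangular
  -- with an identity block, and up to sign its determinant is the minor.
  let τ : Fin 4 ⊕ Fin 3 ≃ σ :=
    (Equiv.sumCongr (Equiv.ofInjective f hinj) τ₀).trans (Equiv.sumCompl fun x ↦ x ∈ Set.range f)
  have hτl (i : Fin 4) : τ (.inl i) = f i := rfl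
  let c (i : Fin 3) : σ := τ (.inr i)
  let M : Matrix σ σ A :=
    .of fun i ↦ Sum.elim (jacRows (grad z Q) (grad z C) j l) (fun i ↦ Pi.single (c i) 1) (e i)
  have hM : volDet e z Q C j l (fun i ↦ Pi.single (c i) 1) = M.det := rfl
  have hN : (M.submatrix e.symm τ).det = aeval z (minor Q C a b) := by
    have h1 : M.submatrix e.symm τ = Matrix.fromBlocks
        (Matrix.of fun i k ↦ jacRows (grad z Q) (grad z C) j l i (f k))
        (Matrix.of fun i k ↦ jacRows (grad z Q) (grad z C) j l i (c k)) 0 1 := by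
      ext i k
      rcases i with i | i <;> rcases k with k | k
      · simp [M, hτl]
      · simp [M, c]
      · simp [M, c]
      · simp [M, c, Pi.single_apply, Matrix.one_apply, eq_comm]
    have hne : ∀ i k : Fin 4, i ≠ k → f i ≠ f k := fun i k h ↦ hinj.ne h
    have h20 : a ≠ j := hne 0 2 (by decide)
    have h21 : b ≠ j := hne 1 2 (by decide)
    have h23 : l ≠ j := hne 3 2 (by decide)
    have h30 : a ≠ l := hne 0 3 (by decide)
    have h31 : b ≠ l := hne 1 3 (by decide)
    rw [h1, Matrix.det_fromBlocks_zero₂₁, Matrix.det_one, mul_one, Matrix.det_succ_row_zero,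
      Fin.sum_univ_four]
    simp [Matrix.det_fin_three, jacRows, f, minor, grad, Matrix.submatrix, h20, h21, h23, h30, h31,
      h23.symm, Fin.succAbove]
    ring
  have hs : (M.submatrix e.symm τ).det = Equiv.Perm.sign (τ.symm.trans e.symm).symm * M.det := by
    rw [← Matrix.det_permute', ← Matrix.det_submatrix_equiv_self e.symm (M.submatrix id _)]
    congr 1
    ext i k
    simp
  rw [← hN, hs, ← hM]
  exact Ideal.mul_mem_left _ _ (Ideal.subset_span ⟨c, rfl⟩)

end VolumeForms

/-! ### Change of charts for volume forms -/

section VolumeChange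

open MvPolynomial

variable {A : Type} [CommRing A] [Algebra ℂ A] {σ : Type} [DecidableEq σ]

/-- A derivative in a variable of `S` has degree `a - 1` in the variables of `S`, the other
derivatives have degree `a`. This accounts for the extra factor `u`. -/
lemma grad_smul {S : Finset σ} {G : MvPolynomial σ ℂ} {a : ℕ}
    (hG : G.IsWeightedHomogeneous (fun k ↦ if k ∈ S then 1 else 0) a) (ha : a ≠ 0) (u : A)
    (z : σ → A) (k : σ) : u ^ a * grad z G k =
      if k ∈ S then u * grad (fun k ↦ if k ∈ S then u * z k else z k) G k
      else grad (fun k ↦ if k ∈ S then u * z k else z k) G k := by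
  have hz : (fun k ↦ powChar u (.ofAdd (if k ∈ S then 1 else 0)) * z k) =
      fun k ↦ if k ∈ S then u * z k else z k := by
    funext k
    split_ifs <;> simp [powChar]
  by_cases hk : k ∈ S
  · obtain ⟨b, rfl⟩ := Nat.exists_eq_succ_of_ne_zero ha
    have h := eval₂_smul_of_isWeightedHomogeneous (hG.pderiv (i := k) (n' := b) (by simp [hk]))
      (algebraMap ℂ A) (powChar u) z
    rw [hz] at h
    rw [if_pos hk, grad, grad, aeval_def, aeval_def, h, ← mul_assoc]
    simp [powChar, pow_succ']
  · have h := eval₂_smul_of_isWeightedHomogeneous (hG.pderiv (i := k) (n' := a) (by simp [hk]))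
      (algebraMap ℂ A) (powChar u) z
    rw [hz] at h
    rw [if_neg hk, grad, grad, aeval_def, aeval_def, h]
    simp [powChar]

variable [Fintype σ]

lemma sum_grad_mul {S : Finset σ} {G : MvPolynomial σ ℂ} {a : ℕ}
    (hG : G.IsWeightedHomogeneous (fun k ↦ if k ∈ S then 1 else 0) a) {z : σ → A}
    (h0 : aeval z G = 0) : ∑ k ∈ S, grad z G k * z k = 0 := by
  have h := congr(aeval z $(hG.sum_weight_X_mul_pderiv))
  rw [map_nsmul, h0, smul_zero, map_sum] at h
  rw [← h, ← Finset.sum_filter_add_sum_filter_not Finset.univ (· ∈ S), Finset.filter_mem_eq_inter,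
    Finset.univ_inter, Finset.sum_eq_zero (s := Finset.univ.filter _), add_zero]
  · refine Finset.sum_congr rfl fun k hk ↦ ?_
    simp [hk, grad, mul_comm]
  · intro k hk
    rw [Finset.mem_filter] at hk
    simp [hk.2]

variable {e : σ ≃ Fin 4 ⊕ Fin 3}

/-- The volume form does not depend on the normalization of the homogeneous coordinates. -/
lemma IsVolume.change {S : Finset σ} {z z' : σ → A} {Q C : MvPolynomial σ ℂ} {j j' l : σ}
    {ω : ⋀[A]^3 (KaehlerDifferential ℂ A)} (h : IsVolume e z Q C j l ω)
    (hz : ∀ k, z k = if k ∈ S then z j' * z' k else z' k) (hj : j ∈ S) (hj' : j' ∈ S)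
    (hl : l ∉ S) (hzj : z j = 1) (hzj' : z' j' = 1) {a b : ℕ}
    (hQ : Q.IsWeightedHomogeneous (fun k ↦ if k ∈ S then 1 else 0) a)
    (hC : C.IsWeightedHomogeneous (fun k ↦ if k ∈ S then 1 else 0) b) (ha : a ≠ 0) (hb : b ≠ 0)
    (hab : a + b = S.card) (hQ0 : aeval z' Q = 0) (hC0 : aeval z' C = 0) :
    IsVolume e z' Q C j' l ω := by
  have hz2 : (fun k ↦ if k ∈ S then z j' * z' k else z' k) = z := (funext hz).symm
  have huv : z j' * z' j = 1 := by rw [← hzj, hz j, if_pos hj]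
  have hvu : z' j * z j' = 1 := by rw [mul_comm, huv]
  -- `T` is the change of differentials: from `zₖ = u z'ₖ` with `u = z j'` one gets `dz'ₖ = u⁻¹ (dzₖ
  -- - z'ₖ du)`, and `u⁻¹ = z' j`.
  let T : (σ → A) →ₗ[A] σ → A := (Pi.basisFun A σ).constr A fun k ↦
    if k ∈ S then z' j • (Pi.single k 1 - z' k • Pi.single j' 1) else Pi.single k 1
  have hT (k) : T (Pi.single k 1) =
      if k ∈ S then z' j • (Pi.single k 1 - z' k • Pi.single j' 1) else Pi.single k 1 := by
    have h1 := (Pi.basisFun A σ).constr_basis A (fun k ↦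
      if k ∈ S then z' j • ((Pi.single k 1 : σ → A) - z' k • Pi.single j' 1) else Pi.single k 1) k
    rwa [Pi.basisFun_apply] at h1
  intro c
  have h1 := rowsDet_change e huv hj' hj hl hzj' rfl hab
    (fun k ↦ by simpa only [hz2] using grad_smul hQ ha (z j') z' k)
    (fun k ↦ by simpa only [hz2] using grad_smul hC hb (z j') z' k)
    (sum_grad_mul hQ hQ0) (sum_grad_mul hC hC0) T hT (fun i ↦ Pi.single (c i) 1)
  have h2 := h.ιMulti_diffMap fun i ↦ T (Pi.single (c i) 1)
  rw [volDet, h1]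
  refine Eq.trans ?_ h2
  congr 1
  funext i
  rw [hT]
  split_ifs with hi
  · rw [(diffMap z).map_smul, map_sub, (diffMap z).map_smul, diffMap_single, diffMap_single, hz (c i), if_pos hi,
      Derivation.leibniz, add_sub_cancel_right, ← mul_smul (z' j) (z j'), hvu, one_smul]
  · rw [diffMap_single, hz (c i), if_neg hi]

end VolumeChange

/-! ### Restriction and gluing of differential forms. -/

section FormsAPI

variable {Y : Scheme.{0}} (p : Y ⟶ SpecC) {n : ℕ} {U V W : Y.Opens}

/-- Restriction of forms as a homomorphism of groups. -/
def Forms.restrictHom (h : U ≤ V) : Forms p n V →+ Forms p n U :=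
  let := sectionsAlgebra p U
  let := sectionsAlgebra p V
  let : Algebra Γ(Y, V) Γ(Y, U) := (res h).toAlgebra
  have : IsScalarTower ℂ Γ(Y, V) Γ(Y, U) :=
    IsScalarTower.of_algebraMap_eq' (res_comp_constHom p h).symm
  formMap ℂ Γ(Y, V) Γ(Y, U) n

lemma Forms.restrict_sub (h : U ≤ V) (x y : Forms p n V) :
    Forms.restrict p n h (x - y) = Forms.restrict p n h x - Forms.restrict p n h y :=
  map_sub (restrictHom p h) x y

lemma Forms.restrict_smul (h : U ≤ V) (a : Γ(Y, V)) (x : Forms p n V) :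
    Forms.restrict p n h (a • x) = res h a • Forms.restrict p n h x := by
  let := sectionsAlgebra p U
  let := sectionsAlgebra p V
  let : Algebra Γ(Y, V) Γ(Y, U) := (res h).toAlgebra
  have : IsScalarTower ℂ Γ(Y, V) Γ(Y, U) :=
    IsScalarTower.of_algebraMap_eq' (res_comp_constHom p h).symm
  exact formMap_smul ℂ Γ(Y, V) Γ(Y, U) a x

lemma Forms.restrict_restrict (h : U ≤ V) (h' : V ≤ W) (x : Forms p n W) :
    Forms.restrict p n h (Forms.restrict p n h' x) = Forms.restrict p n (h.trans h') x := by
  let := sectionsAlgebra p U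
  let := sectionsAlgebra p V
  let := sectionsAlgebra p W
  let : Algebra Γ(Y, V) Γ(Y, U) := (res h).toAlgebra
  let : Algebra Γ(Y, W) Γ(Y, V) := (res h').toAlgebra
  let : Algebra Γ(Y, W) Γ(Y, U) := (res (h.trans h')).toAlgebra
  have : IsScalarTower ℂ Γ(Y, V) Γ(Y, U) :=
    IsScalarTower.of_algebraMap_eq' (res_comp_constHom p h).symm
  have : IsScalarTower ℂ Γ(Y, W) Γ(Y, V) :=
    IsScalarTower.of_algebraMap_eq' (res_comp_constHom p h').symm
  have : IsScalarTower ℂ Γ(Y, W) Γ(Y, U) :=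
    IsScalarTower.of_algebraMap_eq' (res_comp_constHom p (h.trans h')).symm
  have : IsScalarTower Γ(Y, W) Γ(Y, V) Γ(Y, U) :=
    IsScalarTower.of_algebraMap_eq' (res_comp_res h h').symm
  exact formMap_formMap ℂ Γ(Y, W) Γ(Y, V) Γ(Y, U) x

lemma Forms.exists_pow_smul_eq_zero (hV : IsAffineOpen V) (h : U ≤ V) (f : Γ(Y, V))
    (hU : U = Y.basicOpen f) {x : Forms p n V} (hx : Forms.restrict p n h x = 0) :
    ∃ N : ℕ, f ^ N • x = 0 := by
  subst hU
  let := sectionsAlgebra p (Y.basicOpen f)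
  let := sectionsAlgebra p V
  let : Algebra Γ(Y, V) Γ(Y, Y.basicOpen f) := (res h).toAlgebra
  have : IsScalarTower ℂ Γ(Y, V) Γ(Y, Y.basicOpen f) :=
    IsScalarTower.of_algebraMap_eq' (res_comp_constHom p h).symm
  have : IsLocalization.Away f Γ(Y, Y.basicOpen f) := hV.isLocalization_basicOpen f
  obtain ⟨_, ⟨N, rfl⟩, h⟩ := exists_smul_eq_zero_of_formMap_eq_zero ℂ Γ(Y, V) Γ(Y, Y.basicOpen f)
    (Submonoid.powers f) hx
  exact ⟨N, h⟩

lemma Forms.exists_pow_smul_eq_restrict (hV : IsAffineOpen V) (h : U ≤ V) (f : Γ(Y, V))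
    (hU : U = Y.basicOpen f) (y : Forms p n U) :
    ∃ (N : ℕ) (x : Forms p n V), res h f ^ N • y = Forms.restrict p n h x := by
  subst hU
  let := sectionsAlgebra p (Y.basicOpen f)
  let := sectionsAlgebra p V
  let : Algebra Γ(Y, V) Γ(Y, Y.basicOpen f) := (res h).toAlgebra
  have : IsScalarTower ℂ Γ(Y, V) Γ(Y, Y.basicOpen f) :=
    IsScalarTower.of_algebraMap_eq' (res_comp_constHom p h).symm
  have : IsLocalization.Away f Γ(Y, Y.basicOpen f) := hV.isLocalization_basicOpen f
  obtain ⟨_, ⟨N, rfl⟩, x, h⟩ := exists_smul_eq_formMap ℂ Γ(Y, V) Γ(Y, Y.basicOpen f)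
    (Submonoid.powers f) y
  exact ⟨N, x, by rw [← map_pow]; exact h⟩

lemma exists_uniform_pow {κ M : Type*} [Finite κ] (P : κ → ℕ → M → Prop)
    (h : ∀ i, ∃ N, ∃ x, P i N x) (hs : ∀ i N x k, P i N x → ∃ x', P i (N + k) x') :
    ∃ N, ∀ i, ∃ x, P i N x := by
  have := Fintype.ofFinite κ
  choose N x hx using h
  refine ⟨Finset.univ.sup N, fun i ↦ ?_⟩
  obtain ⟨k, hk⟩ := Nat.exists_eq_add_of_le (Finset.le_sup (f := N) (Finset.mem_univ i))
  rw [hk]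
  exact hs i _ _ k (hx i)

/-- Gluing of forms on a cover of an affine open set by basic open sets. -/
theorem Forms.exists_glue (hV : IsAffineOpen V) {κ : Type*} [Finite κ] (f : κ → Γ(Y, V))
    (hf : Ideal.span (Set.range f) = ⊤) {U : κ → Y.Opens} (h : ∀ i, U i ≤ V)
    (hU : ∀ i, U i = Y.basicOpen (f i)) (ω : ∀ i, Forms p n (U i))
    (hω : ∀ i j, Forms.restrict p n (inf_le_left : U i ⊓ U j ≤ _) (ω i) =
      Forms.restrict p n inf_le_right (ω j)) :
    ∃ x : Forms p n V, ∀ i, Forms.restrict p n (h i) x = ω i := by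
  have := Fintype.ofFinite κ
  have hu (i) (k : ℕ) : IsUnit (res (h i) (f i) ^ k) := by
    refine IsUnit.pow _ ?_
    have := RingedSpace.isUnit_res_basicOpen Y.toRingedSpace (f i)
    obtain rfl := funext hU
    exact this
  -- With a common exponent `N` each `fᵢᴺ ωᵢ` extends to a form `yᵢ` on `V`; a further exponent `M`
  -- makes the extensions compatible on overlaps.
  obtain ⟨N, hN⟩ := exists_uniform_pow
    (fun i N (x : Forms p n V) ↦ res (h i) (f i) ^ N • ω i = Forms.restrict p n (h i) x)
    (fun i ↦ Forms.exists_pow_smul_eq_restrict p hV (h i) (f i) (hU i) (ω i))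
    fun i N x k hx ↦ ⟨f i ^ k • x, by
      rw [Forms.restrict_smul, ← hx, smul_smul, map_pow, ← pow_add, add_comm]⟩
  choose y hy using hN
  obtain ⟨M, hM⟩ := exists_uniform_pow
    (fun (ij : κ × κ) M (_ : Unit) ↦
      (f ij.1 * f ij.2) ^ M • (f ij.2 ^ N • y ij.1 - f ij.1 ^ N • y ij.2) = 0)
    (fun ij ↦ by
      have h1 : Forms.restrict p n ((inf_le_left : U ij.1 ⊓ U ij.2 ≤ U ij.1).trans (h ij.1))
          (f ij.2 ^ N • y ij.1 - f ij.1 ^ N • y ij.2) = 0 := by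
        rw [Forms.restrict_sub, Forms.restrict_smul, Forms.restrict_smul, map_pow, map_pow,
          ← Forms.restrict_restrict p inf_le_left (h ij.1), ← hy,
          ← Forms.restrict_restrict p inf_le_right (h ij.2), ← hy, Forms.restrict_smul,
          Forms.restrict_smul, hω ij.1 ij.2, map_pow, map_pow, res_res, res_res, smul_comm, sub_self]
      obtain ⟨M, hM⟩ := Forms.exists_pow_smul_eq_zero p hV _ (f ij.1 * f ij.2)
        (by rw [hU, hU, Scheme.basicOpen_mul]) h1
      exact ⟨M, (), hM⟩)
    fun ij M _ k hM ↦ ⟨(), by rw [pow_add, mul_comm, mul_smul, hM, smul_zero]⟩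
  have key (i j) : f i ^ (N + M) • f j ^ M • y j = f j ^ (N + M) • f i ^ M • y i := by
    obtain ⟨-, h1⟩ := hM (i, j)
    dsimp only at h1
    rw [smul_sub, sub_eq_zero, smul_smul, smul_smul] at h1
    rw [smul_smul, smul_smul]
    refine Eq.trans (congrArg (· • y j) ?_) (h1.symm.trans (congrArg (· • y i) ?_)) <;> ring
  have h1 : (1 : Γ(Y, V)) ∈ Ideal.span (Set.range fun i ↦ f i ^ (N + M)) := by
    have h2 := Ideal.span_pow_eq_top _ hf (N + M)
    rw [← Set.range_comp] at h2
    change 1 ∈ Ideal.span (Set.range ((· ^ (N + M)) ∘ f))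
    rw [h2]
    trivial
  obtain ⟨g, hg⟩ := (Ideal.mem_span_range_iff_exists_fun).mp h1
  -- Since `∑ gⱼ fⱼᴺ⁺ᴹ = 1`, this sum glues the quotients `yⱼ / fⱼᴺ`.
  refine ⟨∑ j, g j • f j ^ M • y j, fun i ↦ (hu i (N + M)).smul_left_cancel.mp ?_⟩
  rw [← map_pow, ← Forms.restrict_smul, Finset.smul_sum]
  have h2 : ∑ j, f i ^ (N + M) • g j • f j ^ M • y j = f i ^ M • y i := by
    rw [← one_smul Γ(Y, V) (f i ^ M • y i), ← hg, Finset.sum_smul]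
    exact Finset.sum_congr rfl fun j _ ↦ by rw [smul_comm, key, mul_smul]
  rw [h2, Forms.restrict_smul, ← hy, smul_smul, map_pow, map_pow, ← pow_add, add_comm]

lemma Forms.ext_of_cover (hV : IsAffineOpen V) {κ : Type*} (f : κ → Γ(Y, V))
    (hf : Ideal.span (Set.range f) = ⊤) {U : κ → Y.Opens} (h : ∀ i, U i ≤ V)
    (hU : ∀ i, U i = Y.basicOpen (f i)) {ω ω' : Forms p n V}
    (hω : ∀ i, Forms.restrict p n (h i) ω = Forms.restrict p n (h i) ω') : ω = ω' := by
  rw [← sub_eq_zero]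
  refine eq_zero_of_span_eq_top hf ?_
  rintro _ ⟨i, rfl⟩
  exact Forms.exists_pow_smul_eq_zero p hV (h i) (f i) (hU i)
    (by rw [Forms.restrict_sub, hω, sub_self])

/-- Being a generator is a local property. -/
lemma Forms.span_eq_top_of_cover (hV : IsAffineOpen V) {κ : Type*} (f : κ → Γ(Y, V))
    (hf : Ideal.span (Set.range f) = ⊤) {U : κ → Y.Opens} (h : ∀ i, U i ≤ V)
    (hU : ∀ i, U i = Y.basicOpen (f i)) (ω : Forms p n V)
    (hω : ∀ i, Submodule.span Γ(Y, U i) {Forms.restrict p n (h i) ω} = ⊤) :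
    Submodule.span Γ(Y, V) {ω} = ⊤ := by
  rw [eq_top_iff]
  rintro x -
  refine Submodule.mem_of_span_eq_top_of_smul_pow_mem _ _ hf _ ?_
  rintro ⟨_, i, rfl⟩
  have hx : Forms.restrict p n (h i) x ∈ Submodule.span Γ(Y, U i) {Forms.restrict p n (h i) ω} := by
    rw [hω i]; trivial
  obtain ⟨a, ha⟩ := Submodule.mem_span_singleton.mp hx
  obtain ⟨N, b, hb⟩ := exists_res_eq_pow_mul hV.isCompact hV.isQuasiSeparated (f i) (h i) (hU i) a
  have h1 : Forms.restrict p n (h i) (f i ^ N • x - b • ω) = 0 := by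
    rw [Forms.restrict_sub, Forms.restrict_smul, Forms.restrict_smul, hb, ← ha, map_pow, smul_smul,
      sub_self]
  obtain ⟨M, hM⟩ := Forms.exists_pow_smul_eq_zero p hV (h i) (f i) (hU i) h1
  refine ⟨M + N, ?_⟩
  rw [smul_sub, sub_eq_zero, smul_smul, smul_smul] at hM
  rw [pow_add]
  dsimp only
  rw [hM]
  exact Submodule.smul_mem _ _ (Submodule.mem_span_singleton_self ω)

end FormsAPI

/-! ### Triviality of the canonical bundle -/

section Canonical

open MvPolynomial

section YCoordinates

variable {Q C : MvPolynomial (Fin 5 ⊕ Fin 2) ℂ} {W : (yScheme Q C).Opens} {j j' : Fin 5}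
  {l l' : Fin 2}

lemma res_yCrd_inl (h : W ≤ yChart Q C j l) (k : Fin 5) : res h (yCrd Q C j l (.inl k)) =
    crd ((intersectionIdeal Q C).subschemeι ≫ pullback.fst _ _) (i := j)
      (h.trans ((Scheme.Hom.preimage_mono _ inf_le_left))) k :=
  (res_pb _ _ _ _).trans (pb_crd _ _ _ _ _)

lemma res_yCrd_inr (h : W ≤ yChart Q C j l) (k : Fin 2) : res h (yCrd Q C j l (.inr k)) =
    crd ((intersectionIdeal Q C).subschemeι ≫ pullback.snd _ _) (i := l)
      (h.trans ((Scheme.Hom.preimage_mono _ inf_le_right))) k :=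
  (res_pb _ _ _ _).trans (pb_crd _ _ _ _ _)

lemma yCrd_mul_inl (h : W ≤ yChart Q C j l) (h' : W ≤ yChart Q C j' l') (k : Fin 5) :
    res h (yCrd Q C j l (.inl j')) * res h' (yCrd Q C j' l' (.inl k)) =
      res h (yCrd Q C j l (.inl k)) := by
  rw [res_yCrd_inl, res_yCrd_inl, res_yCrd_inl, crd_mul_crd]

lemma yCrd_mul_inr (h : W ≤ yChart Q C j l) (h' : W ≤ yChart Q C j' l') (k : Fin 2) :
    res h (yCrd Q C j l (.inr l')) * res h' (yCrd Q C j' l' (.inr k)) =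
      res h (yCrd Q C j l (.inr k)) := by
  rw [res_yCrd_inr, res_yCrd_inr, res_yCrd_inr, crd_mul_crd]

end YCoordinates

lemma injective_vec {σ : Type*} {a b c d : σ} (h1 : a ≠ c) (h2 : a ≠ d) (h3 : b ≠ c) (h4 : b ≠ d)
    (h5 : a ≠ b) (h6 : c ≠ d) : Function.Injective (![a, b, c, d] : Fin 4 → σ) := by
  intro i k hik
  fin_cases i <;> fin_cases k <;> simp_all

/-- The volume form on an open set of a chart of `Y`. -/
def IsVolumeOn (Q C : MvPolynomial (Fin 5 ⊕ Fin 2) ℂ) {j : Fin 5} {l : Fin 2}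
    {W : (yScheme Q C).Opens} (hW : W ≤ yChart Q C j l) (ω : Forms (yToBase Q C) 3 W) : Prop :=
  letI := sectionsAlgebra (yToBase Q C) W
  IsVolume rowEquiv (fun k ↦ res hW (yCrd Q C j l k)) Q C (.inl j) (.inr l) ω

variable {Q C : MvPolynomial (Fin 5 ⊕ Fin 2) ℂ} {W W' : (yScheme Q C).Opens} {j j' : Fin 5}
  {l l' : Fin 2}

lemma IsVolumeOn.restrict {hW : W ≤ yChart Q C j l} {ω : Forms (yToBase Q C) 3 W}
    (hω : IsVolumeOn Q C hW ω) (h : W' ≤ W) :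
    IsVolumeOn Q C (h.trans hW) (Forms.restrict (yToBase Q C) 3 h ω) := by
  let := sectionsAlgebra (yToBase Q C) W
  let := sectionsAlgebra (yToBase Q C) W'
  let : Algebra Γ(yScheme Q C, W) Γ(yScheme Q C, W') := (res h).toAlgebra
  have : IsScalarTower ℂ Γ(yScheme Q C, W) Γ(yScheme Q C, W') :=
    IsScalarTower.of_algebraMap_eq' (res_comp_constHom (yToBase Q C) h).symm
  have h1 := IsVolume.formMap rowEquiv (A := Γ(yScheme Q C, W)) (B := Γ(yScheme Q C, W')) hω
  have h2 : (fun k ↦ algebraMap Γ(yScheme Q C, W) Γ(yScheme Q C, W') (res hW (yCrd Q C j l k))) =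
      fun k ↦ res (h.trans hW) (yCrd Q C j l k) := funext fun k ↦ res_res h hW _
  rw [h2] at h1
  exact h1

namespace IsSmoothPair

lemma volIdeal_eq_top (h : IsSmoothPair Q C) (hW : W ≤ yChart Q C j l) :
    letI := sectionsAlgebra (yToBase Q C) W
    volIdeal rowEquiv (fun k ↦ res hW (yCrd Q C j l k)) Q C (.inl j) (.inr l) = ⊤ := by
  let := sectionsAlgebra (yToBase Q C) W
  let := sectionsAlgebra (yToBase Q C) (yChart Q C j l)
  let : Algebra Γ(yScheme Q C, yChart Q C j l) Γ(yScheme Q C, W) := (res hW).toAlgebra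
  have : IsScalarTower ℂ Γ(yScheme Q C, yChart Q C j l) Γ(yScheme Q C, W) :=
    IsScalarTower.of_algebraMap_eq' (res_comp_constHom (yToBase Q C) hW).symm
  refine volIdeal_algebraMap rowEquiv (A := Γ(yScheme Q C, yChart Q C j l))
    (B := Γ(yScheme Q C, W)) (z := yCrd Q C j l) ?_
  rw [← top_le_iff, ← h.span_minor_eq_top j l, Ideal.span_le]
  rintro _ ⟨a, b, ⟨h1, h2, h3, h4⟩, rfl⟩
  by_cases hab : a = b
  · subst hab
    rw [show minor Q C a a = 0 from sub_self _, map_zero]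
    exact Ideal.zero_mem _
  · exact minor_mem_volIdeal rowEquiv (yCrd Q C j l) Q C (injective_vec h1 h2 h3 h4 hab (by simp))

lemma aeval_res_left (h : IsSmoothPair Q C) (hW : W ≤ yChart Q C j l) :
    evalAt (yToBase Q C) (fun k ↦ res hW (yCrd Q C j l k)) Q = 0 := by
  rw [← res_evalAt, h.evalAt_left, map_zero]

lemma aeval_res_right (h : IsSmoothPair Q C) (hW : W ≤ yChart Q C j l) :
    evalAt (yToBase Q C) (fun k ↦ res hW (yCrd Q C j l k)) C = 0 := by
  rw [← res_evalAt, h.evalAt_right, map_zero]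

lemma exists_isVolumeOn (h : IsSmoothPair Q C) (hW : W ≤ yChart Q C j l) :
    ∃ ω, IsVolumeOn Q C hW ω := by
  let := sectionsAlgebra (yToBase Q C) W
  exact exists_isVolume rowEquiv (h.aeval_res_left hW) (h.aeval_res_right hW)
    (by rw [yCrd_inl, map_one]) (by rw [yCrd_inr, map_one]) (h.volIdeal_eq_top hW)

lemma isVolumeOn_unique (h : IsSmoothPair Q C) {hW : W ≤ yChart Q C j l}
    {ω ω' : Forms (yToBase Q C) 3 W} (hω : IsVolumeOn Q C hW ω) (hω' : IsVolumeOn Q C hW ω') :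
    ω = ω' := by
  let := sectionsAlgebra (yToBase Q C) W
  exact IsVolume.unique (h.volIdeal_eq_top hW) hω hω'

/-- The normalization of `x` is changed first, where `2 + 3 = 5` is the number of variables `x`;
then that of `t`, where `1 + 1 = 2`. These two equalities say that `𝒪(2, 1) ⊗ 𝒪(3, 1)` is dual to
the canonical bundle of `ℙ⁴ × ℙ¹`. -/
lemma isVolumeOn_change (h : IsSmoothPair Q C) {hW : W ≤ yChart Q C j l}
    {ω : Forms (yToBase Q C) 3 W} (hω : IsVolumeOn Q C hW ω) (hW' : W ≤ yChart Q C j' l') :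
    IsVolumeOn Q C hW' ω := by
  let := sectionsAlgebra (yToBase Q C) W
  -- Intermediate coordinates: `x` is already normalized at `j'`, while `t` is still normalized at
  -- `l`.
  let z'' : Fin 5 ⊕ Fin 2 → Γ(yScheme Q C, W) :=
    Sum.elim (fun k ↦ res hW' (yCrd Q C j' l' (.inl k))) fun k ↦ res hW (yCrd Q C j l (.inr k))
  let S₁ : Finset (Fin 5 ⊕ Fin 2) := Finset.univ.filter (Sum.isLeft ·)
  let S₂ : Finset (Fin 5 ⊕ Fin 2) := Finset.univ.filter (Sum.isRight ·)
  have hw₁ : (Sum.elim (fun _ ↦ 1) fun _ ↦ 0 : Fin 5 ⊕ Fin 2 → ℕ) =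
      fun k ↦ if k ∈ S₁ then 1 else 0 := by
    funext k; rcases k with k | k <;> simp [S₁]
  have hw₂ : (Sum.elim (fun _ ↦ 0) fun _ ↦ 1 : Fin 5 ⊕ Fin 2 → ℕ) =
      fun k ↦ if k ∈ S₂ then 1 else 0 := by
    funext k; rcases k with k | k <;> simp [S₂]
  have hQ₁ : Q.IsWeightedHomogeneous (fun k ↦ if k ∈ S₁ then 1 else 0) 2 := by
    rw [← hw₁]
    exact h.left.map_weight (AddMonoidHom.fst ℕ ℕ)
  have hC₁ : C.IsWeightedHomogeneous (fun k ↦ if k ∈ S₁ then 1 else 0) 3 := by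
    rw [← hw₁]
    exact h.right.map_weight (AddMonoidHom.fst ℕ ℕ)
  have hQ₂ : Q.IsWeightedHomogeneous (fun k ↦ if k ∈ S₂ then 1 else 0) 1 := by
    rw [← hw₂]
    exact h.left.map_weight (AddMonoidHom.snd ℕ ℕ)
  have hC₂ : C.IsWeightedHomogeneous (fun k ↦ if k ∈ S₂ then 1 else 0) 1 := by
    rw [← hw₂]
    exact h.right.map_weight (AddMonoidHom.snd ℕ ℕ)
  have hz'' : z'' = fun k ↦ if k ∈ S₁ then res hW' (yCrd Q C j' l' k)
      else res hW (yCrd Q C j l k) := by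
    funext k; rcases k with k | k <;> simp [S₁, z'']
  have hbi (G : MvPolynomial (Fin 5 ⊕ Fin 2) ℂ) {a b : ℕ}
      (hG : IsBihomogeneous (m := 4) (n := 1) G a b)
      (h0 : evalAt (yToBase Q C) (fun k ↦ res hW' (yCrd Q C j' l' k)) G = 0) :
      aeval z'' G = 0 := by
    have h1 := eval₂_smul_of_isBihomogeneous (m := 4) (n := 1) hG (constHom (yToBase Q C) W) 1
      (res hW (yCrd Q C j l (.inr l'))) (fun k ↦ res hW' (yCrd Q C j' l' (.inl k)))
      (fun k ↦ res hW' (yCrd Q C j' l' (.inr k)))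
    have h2 : (Sum.elim (fun k ↦ res hW' (yCrd Q C j' l' (.inl k))) fun k ↦
        res hW' (yCrd Q C j' l' (.inr k))) = fun k ↦ res hW' (yCrd Q C j' l' k) := by
      funext k; rcases k with k | k <;> rfl
    simp only [one_mul, yCrd_mul_inr hW hW', h2] at h1
    refine h1.trans ?_
    rw [← coe_eval₂Hom]
    exact mul_eq_zero_of_right _ h0
  have h1 : IsVolume rowEquiv z'' Q C (.inl j') (.inr l) ω :=
    IsVolume.change (S := S₁) hω (z' := z'')
      (fun k ↦ by
        rcases k with k | k
        · simp [S₁, z'', yCrd_mul_inl hW hW']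
        · simp [S₁, z''])
      (by simp [S₁]) (by simp [S₁]) (by simp [S₁]) (by rw [yCrd_inl, map_one])
      (by simp only [z'', Sum.elim_inl, yCrd_inl, map_one])
      hQ₁ hC₁ (by simp) (by simp) rfl (hbi Q h.left (h.aeval_res_left hW'))
      (hbi C h.right (h.aeval_res_right hW'))
  have h2 : IsVolume rowEquiv (fun k ↦ res hW' (yCrd Q C j' l' k)) Q C (.inr l') (.inl j') (-ω) :=
    IsVolume.change (S := S₂) h1.swap
      (fun k ↦ by
        rcases k with k | k
        · simp [S₂, z'']
        · simp [S₂, z'', yCrd_mul_inr hW hW'])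
      (by simp [S₂]) (by simp [S₂]) (by simp [S₂])
      (by simp only [z'', Sum.elim_inr, yCrd_inr, map_one])
      (by rw [yCrd_inr, map_one])
      hQ₂ hC₂ (by simp) (by simp) rfl (h.aeval_res_left hW')
      (h.aeval_res_right hW')
  have h3 := h2.swap
  rw [neg_neg] at h3
  exact h3

end IsSmoothPair

lemma Presents.span_D_eq_top {X : Scheme.{0}} {p : X ⟶ SpecC} {V W : X.Opens} {σ : Type}
    [Fintype σ] [DecidableEq σ] {z : σ → Γ(X, V)} {J : Ideal (MvPolynomial σ ℂ)}
    (h : Presents p V z J) (hV : IsAffineOpen V) (hW : W ≤ V) (g : Γ(X, V))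
    (hg : W = X.basicOpen g) :
    letI := sectionsAlgebra p W
    Submodule.span Γ(X, W) (Set.range fun k ↦ KaehlerDifferential.D ℂ Γ(X, W) (res hW (z k))) =
      ⊤ := by
  subst hg
  let := sectionsAlgebra p (X.basicOpen g)
  let := sectionsAlgebra p V
  let : Algebra Γ(X, V) Γ(X, X.basicOpen g) := (res hW).toAlgebra
  have : IsScalarTower ℂ Γ(X, V) Γ(X, X.basicOpen g) :=
    IsScalarTower.of_algebraMap_eq' (res_comp_constHom p hW).symm
  have : IsLocalization.Away g Γ(X, X.basicOpen g) := hV.isLocalization_basicOpen g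
  have h1 := KaehlerDifferential.span_range_map_derivation_of_isLocalization ℂ Γ(X, V)
    Γ(X, X.basicOpen g) (Submonoid.powers g)
  rw [← top_le_iff, ← h1, Submodule.span_le]
  rintro _ ⟨a, rfl⟩
  obtain ⟨G, rfl⟩ := h.surjective a
  rw [Function.comp_apply, KaehlerDifferential.map_D]
  have h2 : algebraMap Γ(X, V) Γ(X, X.basicOpen g) (evalAt p z G) =
      aeval (fun k ↦ res hW (z k)) G := res_evalAt p hW z G
  rw [h2, D_aeval, diffMap, Fintype.linearCombination_apply]
  exact Submodule.sum_mem _ fun k _ ↦ Submodule.smul_mem _ _ (Submodule.subset_span ⟨k, rfl⟩)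

lemma IsVolumeOn.span_eq_top (h : IsSmoothPair Q C) {hW : W ≤ yChart Q C j l}
    {ω : Forms (yToBase Q C) 3 W} (hω : IsVolumeOn Q C hW ω)
    (g : Γ(yScheme Q C, yChart Q C j l)) (hg : W = (yScheme Q C).basicOpen g) :
    Submodule.span Γ(yScheme Q C, W) {ω} = ⊤ := by
  let := sectionsAlgebra (yToBase Q C) W
  exact IsVolume.span_eq_top hω (h.presents_yChart.span_D_eq_top isAffineOpen_yChart hW g hg)

/-- An affine open set is covered by finitely many basic open sets that are contained in charts. -/
lemma exists_cover_by_charts {U : (yScheme Q C).Opens} (hU : IsAffineOpen U) :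
    ∃ (t : Finset Γ(yScheme Q C, U)), Ideal.span (Set.range fun f : t ↦ f.1) = ⊤ ∧
      ∀ f : t, ∃ (j : Fin 5) (l : Fin 2) (g : Γ(yScheme Q C, yChart Q C j l)),
        (yScheme Q C).basicOpen f.1 = (yScheme Q C).basicOpen g := by
  let s : Set Γ(yScheme Q C, U) := {f | ∃ (j : Fin 5) (l : Fin 2)
    (g : Γ(yScheme Q C, yChart Q C j l)),
    (yScheme Q C).basicOpen f = (yScheme Q C).basicOpen g}
  have hs : Ideal.span s = ⊤ := by
    rw [← hU.iSup_basicOpen_eq_self_iff]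
    refine le_antisymm (iSup_le fun f ↦ (yScheme Q C).basicOpen_le _) fun x hx ↦ ?_
    obtain ⟨j, l, hjl⟩ := exists_mem_yChart x
    obtain ⟨f, g, hfg, hf⟩ :=
      exists_basicOpen_le_affine_inter hU (isAffineOpen_yChart (j := j) (l := l)) x ⟨hx, hjl⟩
    exact Opens.mem_iSup.mpr ⟨⟨f, j, l, g, hfg⟩, hf⟩
  obtain ⟨t, ht, ht'⟩ := (Ideal.span_eq_top_iff_finite s).mp hs
  exact ⟨t, by simpa using ht', fun f ↦ ht f.2⟩

namespace IsSmoothPair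

/-- A form on `U` that restricts to the volume form on every affine subset of a chart. -/
def IsCanonicalForm (U : (yScheme Q C).Opens) (ω : Forms (yToBase Q C) 3 U) : Prop :=
  ∀ (j : Fin 5) (l : Fin 2) (W : (yScheme Q C).Opens) (_ : IsAffineOpen W) (h : W ≤ U)
    (hW : W ≤ yChart Q C j l), IsVolumeOn Q C hW (Forms.restrict (yToBase Q C) 3 h ω)

/-- Volume forms on basic open sets inside charts agree on overlaps, by independence of the chart
and uniqueness; so they glue to the affine open set `U`, which need not lie in a chart. -/
lemma exists_isCanonicalForm (h : IsSmoothPair Q C) {U : (yScheme Q C).Opens}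
    (hU : IsAffineOpen U) : ∃ ω, IsCanonicalForm U ω := by
  obtain ⟨t, ht, htc⟩ := exists_cover_by_charts hU
  choose j l g hg using htc
  have hle (f : t) : (yScheme Q C).basicOpen f.1 ≤ yChart Q C (j f) (l f) :=
    (hg f).trans_le ((yScheme Q C).basicOpen_le _)
  choose ω hω using fun f : t ↦ h.exists_isVolumeOn (hle f)
  obtain ⟨x, hx⟩ := Forms.exists_glue (yToBase Q C) hU (fun f : t ↦ f.1) ht
    (fun f ↦ (yScheme Q C).basicOpen_le f.1) (fun _ ↦ rfl) ω fun f f' ↦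
      h.isVolumeOn_unique ((hω f).restrict inf_le_left)
        (h.isVolumeOn_change ((hω f').restrict inf_le_right) _)
  refine ⟨x, fun j' l' W hWa hWU hW ↦ ?_⟩
  obtain ⟨ω', hω'⟩ := h.exists_isVolumeOn hW
  have ht' : Ideal.span (Set.range fun f : t ↦ res hWU f.1) = ⊤ := by
    have h1 := congr(Ideal.map (res hWU) $ht)
    rw [Ideal.map_top, Ideal.map_span, ← Set.range_comp] at h1
    exact h1
  have heq : Forms.restrict (yToBase Q C) 3 hWU x = ω' := by
    refine Forms.ext_of_cover (yToBase Q C) hWa (fun f : t ↦ res hWU f.1) ht'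
      (fun f ↦ (yScheme Q C).basicOpen_le _) (fun _ ↦ rfl) fun f ↦ ?_
    have hle' : (yScheme Q C).basicOpen (res hWU f.1) ≤ (yScheme Q C).basicOpen f.1 := by
      rw [basicOpen_res']; exact inf_le_right
    rw [Forms.restrict_restrict, ← Forms.restrict_restrict (yToBase Q C) hle'
      ((yScheme Q C).basicOpen_le f.1), hx]
    exact h.isVolumeOn_unique (h.isVolumeOn_change ((hω f).restrict hle') _) (hω'.restrict _)
  rwa [heq]

lemma isCanonicalForm_restrict {U V : (yScheme Q C).Opens} {ω : Forms (yToBase Q C) 3 V}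
    (hω : IsCanonicalForm V ω) (hUV : U ≤ V) :
    IsCanonicalForm U (Forms.restrict (yToBase Q C) 3 hUV ω) := by
  intro j l W hWa hWU hW
  rw [Forms.restrict_restrict]
  exact hω j l W hWa (hWU.trans hUV) hW

lemma isCanonicalForm_unique (h : IsSmoothPair Q C) {U : (yScheme Q C).Opens}
    (hU : IsAffineOpen U) {ω ω' : Forms (yToBase Q C) 3 U} (hω : IsCanonicalForm U ω)
    (hω' : IsCanonicalForm U ω') : ω = ω' := by
  obtain ⟨t, ht, htc⟩ := exists_cover_by_charts hU
  refine Forms.ext_of_cover (yToBase Q C) hU (fun f : t ↦ f.1) ht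
    (fun f ↦ (yScheme Q C).basicOpen_le f.1) (fun _ ↦ rfl) fun f ↦ ?_
  obtain ⟨j, l, g, hg⟩ := htc f
  have hle : (yScheme Q C).basicOpen f.1 ≤ yChart Q C j l :=
    hg.trans_le ((yScheme Q C).basicOpen_le _)
  exact h.isVolumeOn_unique (hω j l _ (hU.basicOpen f.1) _ hle)
    (hω' j l _ (hU.basicOpen f.1) _ hle)

lemma span_isCanonicalForm (h : IsSmoothPair Q C) {U : (yScheme Q C).Opens}
    (hU : IsAffineOpen U) {ω : Forms (yToBase Q C) 3 U} (hω : IsCanonicalForm U ω) :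
    Submodule.span Γ(yScheme Q C, U) {ω} = ⊤ := by
  obtain ⟨t, ht, htc⟩ := exists_cover_by_charts hU
  refine Forms.span_eq_top_of_cover (yToBase Q C) hU (fun f : t ↦ f.1) ht
    (fun f ↦ (yScheme Q C).basicOpen_le f.1) (fun _ ↦ rfl) ω fun f ↦ ?_
  obtain ⟨j, l, g, hg⟩ := htc f
  have hle : (yScheme Q C).basicOpen f.1 ≤ yChart Q C j l :=
    hg.trans_le ((yScheme Q C).basicOpen_le _)
  exact (hω j l _ (hU.basicOpen f.1) _ hle).span_eq_top h g hg

/-- The canonical bundle of `Y` is trivial. -/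
theorem hasTrivialCanonicalBundle (h : IsSmoothPair Q C) :
    HasTrivialCanonicalBundle (yToBase Q C) 3 := by
  choose ω hω using fun U : (yScheme Q C).affineOpens ↦ h.exists_isCanonicalForm U.2
  exact ⟨ω, fun U V hUV ↦ h.isCanonicalForm_unique U.2 (isCanonicalForm_restrict (hω V) hUV) (hω U),
    fun U ↦ h.span_isCanonicalForm U.2 (hω U)⟩

end IsSmoothPair

end Canonical

/-! ### Laurent polynomials -/

section Laurent

open MvPolynomial

/-- Laurent polynomials. -/
abbrev Laurent (σ : Type) : Type := AddMonoidAlgebra ℂ (σ → ℤ)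

variable {σ : Type}

namespace Laurent

/-- The Laurent polynomials with exponents in `E`. -/
abbrev supp (E : Set (σ → ℤ)) : Submodule ℂ (Laurent σ) := AddMonoidAlgebra.supported ℂ ℂ E

/-- A Laurent monomial. -/
abbrev mono (u : σ → ℤ) (c : ℂ) : Laurent σ := AddMonoidAlgebra.single u c

lemma mono_mem {E : Set (σ → ℤ)} {u : σ → ℤ} (hu : u ∈ E) (c : ℂ) : mono u c ∈ supp E := by
  classical
  rw [AddMonoidAlgebra.mem_supported']
  intro m hm
  rw [AddMonoidAlgebra.coeff_single, Finsupp.single_apply, if_neg]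
  rintro rfl
  exact hm hu

lemma supp_induction {E : Set (σ → ℤ)} {p : Laurent σ → Prop} (h0 : p 0)
    (hadd : ∀ f g, p f → p g → p (f + g)) (h1 : ∀ u ∈ E, ∀ c, p (mono u c)) {f : Laurent σ}
    (hf : f ∈ supp E) : p f := by
  have h : f = ∑ u ∈ f.coeff.support, mono u (f.coeff u) := by
    rw [← AddMonoidAlgebra.coeff_inj, AddMonoidAlgebra.coeff_sum]
    exact (Finsupp.sum_single f.coeff).symm
  rw [h]
  exact Finset.sum_induction _ p hadd h0 fun u hu ↦ h1 u (hf hu) _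

lemma supp_mono {E E' : Set (σ → ℤ)} (h : E ⊆ E') : supp E ≤ supp E' :=
  AddMonoidAlgebra.supported_mono h

lemma mem_supp_univ (f : Laurent σ) : f ∈ supp (Set.univ : Set (σ → ℤ)) :=
  Set.subset_univ _

lemma mul_mem_supp {E E' E'' : Set (σ → ℤ)} (h : ∀ u ∈ E, ∀ v ∈ E', u + v ∈ E'') {f g : Laurent σ}
    (hf : f ∈ supp E) (hg : g ∈ supp E') : f * g ∈ supp E'' := by
  refine supp_induction (p := fun f ↦ f * g ∈ supp E'') ?_ (fun f f' hf hf' ↦ ?_)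
    (fun u hu c ↦ ?_) hf
  · rw [zero_mul]; exact zero_mem _
  · rw [add_mul]; exact add_mem hf hf'
  · refine supp_induction (p := fun g ↦ _ * g ∈ supp E'') ?_ (fun f f' hf hf' ↦ ?_)
      (fun v hv c' ↦ ?_) hg
    · rw [mul_zero]; exact zero_mem _
    · rw [mul_add]; exact add_mem hf hf'
    · rw [AddMonoidAlgebra.single_mul_single]; exact mono_mem (h u hu v hv) _

lemma mem_supp_inter {E E' : Set (σ → ℤ)} {f : Laurent σ} (h : f ∈ supp E) (h' : f ∈ supp E') :
    f ∈ supp (E ∩ E') := Set.subset_inter h h'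

lemma eq_zero_of_disjoint {E E' : Set (σ → ℤ)} (hE : ∀ u ∈ E, u ∉ E') {f : Laurent σ}
    (h : f ∈ supp E) (h' : f ∈ supp E') : f = 0 := by
  rw [← AddMonoidAlgebra.coeff_eq_zero, ← Finsupp.support_eq_empty, Finset.eq_empty_iff_forall_notMem]
  exact fun u hu ↦ hE u (h hu) (h' hu)

/-- The projection to the part with exponents in `E`. -/
def proj (E : Set (σ → ℤ)) : Laurent σ →ₗ[ℂ] Laurent σ :=
  let (u : σ → ℤ) : Decidable (u ∈ E) := Classical.propDecidable _
  { toFun := fun f ↦ .ofCoeff (f.coeff.filter (· ∈ E))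
    map_add' := fun f g ↦ by
      rw [AddMonoidAlgebra.coeff_add, Finsupp.filter_add]; rfl
    map_smul' := fun c f ↦ by
      rw [AddMonoidAlgebra.coeff_smul, Finsupp.filter_smul]; rfl }

open scoped Classical in
lemma coeff_proj (E : Set (σ → ℤ)) (f : Laurent σ) (u : σ → ℤ) :
    (proj E f).coeff u = if u ∈ E then f.coeff u else 0 :=
  Finsupp.filter_apply _ _ _

lemma proj_mem (E : Set (σ → ℤ)) {E' : Set (σ → ℤ)} {f : Laurent σ} (hf : f ∈ supp E') :
    proj E f ∈ supp (E' ∩ E) := by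
  classical
  rw [AddMonoidAlgebra.mem_supported'] at hf ⊢
  intro u hu
  rw [coeff_proj]
  split_ifs with h
  · exact hf u fun h' ↦ hu ⟨h', h⟩
  · rfl

lemma proj_mono_of_mem {E : Set (σ → ℤ)} {u : σ → ℤ} (hu : u ∈ E) (c : ℂ) :
    proj E (mono u c) = mono u c := by
  classical
  rw [← AddMonoidAlgebra.coeff_inj]
  ext v
  rw [coeff_proj, AddMonoidAlgebra.coeff_single, Finsupp.single_apply]
  split_ifs with h1 h2 h2 <;> first | rfl | exact absurd (h2 ▸ hu) h1

lemma proj_mono_of_notMem {E : Set (σ → ℤ)} {u : σ → ℤ} (hu : u ∉ E) (c : ℂ) :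
    proj E (mono u c) = 0 := by
  classical
  rw [← AddMonoidAlgebra.coeff_inj]
  ext v
  rw [coeff_proj, AddMonoidAlgebra.coeff_single, Finsupp.single_apply]
  split_ifs with h1 h2 <;> first | rfl | exact absurd (h2 ▸ h1) hu

lemma proj_eq_self {E : Set (σ → ℤ)} {f : Laurent σ} (hf : f ∈ supp E) : proj E f = f := by
  exact supp_induction (p := fun f ↦ proj E f = f) (map_zero _)
    (fun f g hf hg ↦ by rw [map_add, hf, hg]) (fun u hu c ↦ proj_mono_of_mem hu c) hf

lemma proj_add_proj_compl (E : Set (σ → ℤ)) (f : Laurent σ) : proj E f + proj Eᶜ f = f := by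
  classical
  rw [← AddMonoidAlgebra.coeff_inj, AddMonoidAlgebra.coeff_add]
  ext v
  rw [Finsupp.add_apply, coeff_proj, coeff_proj]
  by_cases h : v ∈ E <;> simp [h]

lemma sum_proj {κ : Type*} [Fintype κ] {E : κ → Set (σ → ℤ)} {f : Laurent σ} {E' : Set (σ → ℤ)}
    (hf : f ∈ supp E') (h : ∀ u ∈ E', ∃! v, u ∈ E v) : ∑ v, proj (E v) f = f := by
  classical
  refine supp_induction (p := fun f ↦ ∑ v, proj (E v) f = f) (by simp)
    (fun f g hf hg ↦ by simp only [map_add, Finset.sum_add_distrib, hf, hg]) (fun u hu c ↦ ?_) hf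
  · obtain ⟨v, hv, hv'⟩ := h u hu
    rw [Finset.sum_eq_single v, proj_mono_of_mem hv]
    · exact fun w _ hw ↦ proj_mono_of_notMem (fun h ↦ hw (hv' w h)) c
    · simp

/-- The exponents that are negative only at `S`. -/
def negIn (S : Set σ) : Set (σ → ℤ) := {u | ∀ k ∉ S, 0 ≤ u k}

lemma mem_negIn {S : Set σ} {u : σ → ℤ} : u ∈ negIn S ↔ ∀ k ∉ S, 0 ≤ u k := Iff.rfl

lemma negIn_mono {S S' : Set σ} (h : S ⊆ S') : negIn S ⊆ negIn S' :=
  fun _ hu ↦ mem_negIn.mpr fun k hk ↦ mem_negIn.mp hu k fun hk' ↦ hk (h hk')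

lemma mul_mem {S : Set σ} {f g : Laurent σ} (hf : f ∈ supp (negIn S)) (hg : g ∈ supp (negIn S)) :
    f * g ∈ supp (negIn S) :=
  mul_mem_supp (fun _ hu _ hv ↦ mem_negIn.mpr fun k hk ↦
    add_nonneg (mem_negIn.mp hu k hk) (mem_negIn.mp hv k hk)) hf hg

/-- Polynomials as Laurent polynomials. -/
def ofPoly : MvPolynomial σ ℂ →ₐ[ℂ] Laurent σ :=
  open scoped Classical in
  aeval fun k ↦ mono (Pi.single k 1) 1

lemma ofPoly_X [DecidableEq σ] (k : σ) :
    ofPoly (X k : MvPolynomial σ ℂ) = mono (Pi.single k 1) 1 := by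
  rw [ofPoly, aeval_X]
  congr!

lemma ofPoly_monomial (m : σ →₀ ℕ) (c : ℂ) :
    ofPoly (monomial m c) = mono (fun k ↦ (m k : ℤ)) c := by
  classical
  induction m using Finsupp.induction_linear generalizing c with
  | zero =>
    rw [← MvPolynomial.C_apply, ← MvPolynomial.algebraMap_eq, AlgHom.commutes]
    rfl
  | add f g hf hg =>
    have : monomial (f + g) c = monomial f c * monomial g 1 := by rw [monomial_mul, mul_one]
    rw [this, map_mul, hf, hg, AddMonoidAlgebra.single_mul_single, mul_one]
    rfl
  | single k n =>
    have : monomial (Finsupp.single k n) c = C c * X k ^ n := by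
      rw [X_pow_eq_monomial, C_mul_monomial, mul_one]
    rw [this, map_mul, map_pow, ofPoly_X, ← MvPolynomial.algebraMap_eq, AlgHom.commutes,
      AddMonoidAlgebra.single_pow, one_pow]
    change mono 0 c * _ = _
    rw [AddMonoidAlgebra.single_mul_single, mul_one, zero_add]
    congr 1
    ext i
    rw [Pi.smul_apply, Finsupp.single_apply, Pi.single_apply]
    split_ifs with h1 h2 h2
    · simp
    · exact absurd h1.symm h2
    · exact absurd h2.symm h1
    · simp

lemma coeff_ofPoly (G : MvPolynomial σ ℂ) (m : σ →₀ ℕ) :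
    (ofPoly G).coeff (fun k ↦ (m k : ℤ)) = G.coeff m := by
  classical
  induction G using MvPolynomial.induction_on' with
  | monomial u c =>
    rw [ofPoly_monomial, AddMonoidAlgebra.coeff_single, Finsupp.single_apply, coeff_monomial]
    congr 1
    simp only [funext_iff, Nat.cast_inj, DFunLike.ext_iff]
  | add p q hp hq => rw [map_add, AddMonoidAlgebra.coeff_add, Finsupp.add_apply, hp, hq, coeff_add]

lemma ofPoly_injective : Function.Injective (ofPoly : MvPolynomial σ ℂ → Laurent σ) :=
  fun G G' h ↦ MvPolynomial.ext _ _ fun m ↦ by rw [← coeff_ofPoly, h, coeff_ofPoly]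

lemma ofPoly_mem (G : MvPolynomial σ ℂ) (S : Set σ) : ofPoly G ∈ supp (negIn S) := by
  induction G using MvPolynomial.induction_on' with
  | monomial u c =>
    rw [ofPoly_monomial]
    exact mono_mem (fun k _ ↦ by simp) c
  | add p q hp hq => rw [map_add]; exact add_mem hp hq

lemma ofPoly_mem_of_isWeightedHomogeneous [Fintype σ] {G : MvPolynomial σ ℂ} {w : σ → ℕ} {a : ℕ}
    (hG : G.IsWeightedHomogeneous w a) : ofPoly G ∈ supp {u : σ → ℤ | ∑ k, w k * u k = a} := by
  rw [G.as_sum, map_sum]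
  refine sum_mem fun m hm ↦ ?_
  rw [ofPoly_monomial]
  refine mono_mem ?_ _
  have := hG (mem_support_iff.mp hm)
  rw [Finsupp.weight_apply, Finsupp.sum_fintype _ _ (by simp)] at this
  rw [Set.mem_ofPred_eq, ← this]
  push_cast
  exact Finset.sum_congr rfl fun k _ ↦ by rw [smul_eq_mul]; push_cast; ring

section Denominators

variable (S : Set σ)

open scoped Classical in
/-- The monomial `∏ₖ zₖ ^ n` over `k ∈ S`. -/
def den (n : ℤ) : Laurent σ := mono (fun k ↦ if k ∈ S then n else 0) 1

lemma den_mem (n : ℤ) : den S n ∈ supp (negIn S) :=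
  mono_mem (fun k hk ↦ by simp [hk]) 1

lemma den_mul_den (m n : ℤ) : den S m * den S n = den S (m + n) := by
  rw [den, den, den, AddMonoidAlgebra.single_mul_single, mul_one]
  congr 1
  ext k
  rw [Pi.add_apply]
  split_ifs <;> simp

lemma den_zero : den S 0 = 1 := by
  rw [den, AddMonoidAlgebra.one_def]
  congr 1
  ext k
  simp

lemma den_neg_mul_den (n : ℤ) : den S (-n) * den S n = 1 := by
  rw [den_mul_den, neg_add_cancel, den_zero]

variable {S} [Fintype σ]

lemma exists_den (n : ℕ) : ∃ D : MvPolynomial σ ℂ, den S n = ofPoly D := by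
  classical
  exact ⟨monomial (Finsupp.equivFunOnFinite.symm fun k ↦ if k ∈ S then n else 0) 1, by
    rw [ofPoly_monomial, den]; congr; ext k; simp⟩

lemma exists_den_mul_eq {f : Laurent σ} (hf : f ∈ supp (negIn S)) :
    ∃ (N : ℕ) (G : MvPolynomial σ ℂ), den S N * f = ofPoly G := by
  classical
  refine supp_induction (p := fun f ↦ ∃ (N : ℕ) (G : MvPolynomial σ ℂ), den S N * f = ofPoly G)
    ⟨0, 0, by simp⟩ (fun f g ↦ ?_) (fun u hu c ↦ ?_) hf
  · rintro ⟨N, G, h⟩ ⟨N', G', h'⟩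
    obtain ⟨D, hD⟩ := exists_den (S := S) N
    obtain ⟨D', hD'⟩ := exists_den (S := S) N'
    refine ⟨N + N', D' * G + D * G', ?_⟩
    rw [map_add, map_mul, map_mul, ← hD, ← hD', ← h, ← h', Nat.cast_add, ← den_mul_den]
    ring
  · refine ⟨∑ k, (u k).natAbs, monomial (Finsupp.equivFunOnFinite.symm fun k ↦
      ((if k ∈ S then ((∑ k, (u k).natAbs : ℕ) : ℤ) else 0) + u k).toNat) c, ?_⟩
    rw [den, ofPoly_monomial, AddMonoidAlgebra.single_mul_single, one_mul]
    congr 1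
    ext k
    rw [Pi.add_apply, Finsupp.equivFunOnFinite_symm_apply_apply, Int.toNat_of_nonneg]
    split_ifs with h
    · have := Finset.single_le_sum (f := fun k ↦ (u k).natAbs) (fun _ _ ↦ Nat.zero_le _)
        (Finset.mem_univ k)
      omega
    · simpa using mem_negIn.mp hu k h

/-- Relatively prime polynomials remain relatively prime for Laurent polynomials. -/
lemma exists_eq_mul_of_mul_eq_mul {Q C : MvPolynomial σ ℂ} (h : IsRelPrime Q C) (hQ : Q ≠ 0)
    {a b : Laurent σ} (ha : a ∈ supp (negIn S)) (hb : b ∈ supp (negIn S))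
    (heq : ofPoly Q * a = ofPoly C * b) :
    ∃ e ∈ supp (negIn S), a = ofPoly C * e ∧ b = ofPoly Q * e := by
  obtain ⟨M, A, hA⟩ := exists_den_mul_eq ha
  obtain ⟨N, B, hB⟩ := exists_den_mul_eq hb
  obtain ⟨D, hD⟩ := exists_den (S := S) M
  obtain ⟨D', hD'⟩ := exists_den (S := S) N
  -- After clearing denominators the identity holds between polynomials, where coprimality gives
  -- divisibility; the monomials used are invertible Laurent polynomials.
  have h1 : Q * (D' * A) = C * (D * B) := by
    refine ofPoly_injective ?_
    rw [map_mul, map_mul, map_mul, map_mul, ← hA, ← hB, ← hD, ← hD']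
    linear_combination den S N * den S M * heq
  obtain ⟨E, hE⟩ : Q ∣ D * B := h.dvd_of_dvd_mul_left (Dvd.intro _ h1)
  have h2 := congr(ofPoly $hE)
  rw [map_mul, map_mul, ← hB, ← hD] at h2
  have hb' : b = ofPoly Q * (den S (-M) * den S (-N) * ofPoly E) := by
    linear_combination den S (-M) * den S (-N) * h2 -
      den S (-M) * den S M * b * den_neg_mul_den S N - b * den_neg_mul_den S M
  refine ⟨_, mul_mem (mul_mem (den_mem S _) (den_mem S _)) (ofPoly_mem E S), ?_, hb'⟩
  have hQ' : ofPoly Q ≠ 0 := fun h0 ↦ hQ (ofPoly_injective (h0.trans (map_zero _).symm))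
  refine mul_left_cancel₀ hQ' (heq.trans ?_)
  conv_lhs => rw [hb']
  ring

end Denominators

end Laurent

end Laurent

/-! ### Evaluation of Laurent polynomials -/

section Evaluation

open MvPolynomial

variable {A B : Type} [CommRing A] [CommRing B]

/-- Integral powers in a ring. -/
def zp (x : A) (n : ℤ) : A := x ^ n.toNat * Ring.inverse x ^ (-n).toNat

lemma zp_of_nonneg (x : A) {n : ℤ} (hn : 0 ≤ n) : zp x n = x ^ n.toNat := by
  rw [zp, Int.toNat_of_nonpos (by omega : -n ≤ 0), pow_zero, mul_one]

@[simp] lemma zp_zero (x : A) : zp x 0 = 1 := by simp [zp]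

lemma zp_units (x : Aˣ) (n : ℤ) : zp (x : A) n = ((x ^ n : Aˣ) : A) := by
  rw [zp, Ring.inverse_unit, ← Units.val_pow_eq_pow_val, ← Units.val_pow_eq_pow_val, ← Units.val_mul,
    ← zpow_natCast, ← zpow_natCast, inv_zpow', ← zpow_add]
  congr 2
  omega

@[simp] lemma zp_one (n : ℤ) : zp (1 : A) n = 1 := by
  rw [← Units.val_one, zp_units, one_zpow]

lemma zp_add {x : A} {m n : ℤ} (h : IsUnit x ∨ 0 ≤ m ∧ 0 ≤ n) :
    zp x (m + n) = zp x m * zp x n := by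
  rcases h with ⟨x, rfl⟩ | ⟨h1, h2⟩
  · rw [zp_units, zp_units, zp_units, zpow_add, Units.val_mul]
  · rw [zp_of_nonneg x h1, zp_of_nonneg x h2, zp_of_nonneg x (add_nonneg h1 h2), Int.toNat_add h1 h2,
      pow_add]

lemma zp_mul {x y : A} {n : ℤ} (h : IsUnit x) (h' : IsUnit y ∨ 0 ≤ n) :
    zp (x * y) n = zp x n * zp y n := by
  rcases h' with ⟨y, rfl⟩ | h'
  · obtain ⟨x, rfl⟩ := h
    rw [← Units.val_mul, zp_units, zp_units, zp_units, mul_zpow, Units.val_mul]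
  · rw [zp_of_nonneg _ h', zp_of_nonneg _ h', zp_of_nonneg _ h', mul_pow]

lemma map_zp (φ : A →+* B) {x : A} {n : ℤ} (h : IsUnit x ∨ 0 ≤ n) : φ (zp x n) = zp (φ x) n := by
  rcases h with ⟨x, rfl⟩ | h
  · rw [zp_units]
    exact (congrArg Units.val (map_zpow (Units.map φ.toMonoidHom) x n)).trans
      (zp_units (Units.map φ.toMonoidHom x) n).symm
  · rw [zp_of_nonneg _ h, zp_of_nonneg _ h, map_pow]

lemma prod_zp {κ : Type*} (s : Finset κ) {x : A} (hx : IsUnit x) (n : κ → ℤ) :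
    ∏ k ∈ s, zp x (n k) = zp x (∑ k ∈ s, n k) := by
  classical
  induction s using Finset.induction_on with
  | empty => simp
  | insert a s ha ih => rw [Finset.prod_insert ha, Finset.sum_insert ha, ih, zp_add (.inl hx)]

namespace Laurent

variable [Algebra ℂ A] [Algebra ℂ B] {σ : Type} [Fintype σ]

/-- Evaluation of Laurent polynomials. -/
def ev (z : σ → A) : Laurent σ →ₗ[ℂ] A :=
  (Finsupp.linearCombination ℂ fun u : σ → ℤ ↦ ∏ k, zp (z k) (u k)) ∘ₗ
    (AddMonoidAlgebra.coeffLinearEquiv ℂ).toLinearMap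

lemma ev_mono (z : σ → A) (u : σ → ℤ) (c : ℂ) : ev z (mono u c) = c • ∏ k, zp (z k) (u k) :=
  Finsupp.linearCombination_single ..

lemma ev_ofPoly (z : σ → A) (G : MvPolynomial σ ℂ) : ev z (ofPoly G) = aeval z G := by
  induction G using MvPolynomial.induction_on' with
  | monomial m c =>
    rw [ofPoly_monomial, ev_mono, aeval_monomial, Algebra.smul_def, Finsupp.prod_fintype _ _ (by simp)]
    congr 1
    exact Finset.prod_congr rfl fun k _ ↦ by rw [zp_of_nonneg _ (by simp), Int.toNat_natCast]
  | add p q hp hq => rw [map_add, map_add, map_add, hp, hq]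

variable {S : Set σ} {z : σ → A}

/-- `ev z` is only linear in general, as `Ring.inverse` is `0` on nonunits. It is multiplicative as
long as negative exponents occur only at variables with invertible values. -/
lemma ev_mul (hz : ∀ k ∈ S, IsUnit (z k)) {f g : Laurent σ} (hf : f ∈ supp (negIn S))
    (hg : g ∈ supp (negIn S)) : ev z (f * g) = ev z f * ev z g := by
  refine supp_induction (p := fun f ↦ ev z (f * g) = ev z f * ev z g) (by simp)
    (fun f f' hf hf' ↦ by rw [add_mul, map_add, map_add, hf, hf', add_mul]) (fun u hu c ↦ ?_) hf
  refine supp_induction (p := fun g ↦ ev z (_ * g) = ev z _ * ev z g) (by simp)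
    (fun f f' hf hf' ↦ by rw [mul_add, map_add, map_add, hf, hf', mul_add]) (fun v hv c' ↦ ?_) hg
  rw [AddMonoidAlgebra.single_mul_single, ev_mono, ev_mono, ev_mono, smul_mul_smul_comm,
    ← Finset.prod_mul_distrib]
  congr 1
  refine Finset.prod_congr rfl fun k _ ↦ zp_add ?_
  by_cases hk : k ∈ S
  · exact .inl (hz k hk)
  · exact .inr ⟨mem_negIn.mp hu k hk, mem_negIn.mp hv k hk⟩

lemma map_ev (φ : A →ₐ[ℂ] B) (hz : ∀ k ∈ S, IsUnit (z k)) {f : Laurent σ}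
    (hf : f ∈ supp (negIn S)) : φ (ev z f) = ev (fun k ↦ φ (z k)) f := by
  refine supp_induction (p := fun f ↦ φ (ev z f) = ev (fun k ↦ φ (z k)) f) (by simp)
    (fun f f' hf hf' ↦ by rw [map_add, map_add, map_add, hf, hf']) (fun u hu c ↦ ?_) hf
  rw [ev_mono, ev_mono, map_smul, map_prod]
  congr 1
  refine Finset.prod_congr rfl fun k _ ↦ map_zp φ.toRingHom ?_
  by_cases hk : k ∈ S
  · exact .inl (hz k hk)
  · exact .inr (mem_negIn.mp hu k hk)

lemma ev_smul (hz : ∀ k ∈ S, IsUnit (z k)) {c : σ → A} (hc : ∀ k, IsUnit (c k))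
    {E : Set (σ → ℤ)} (hE : ∀ u ∈ E, ∏ k, zp (c k) (u k) = 1) {f : Laurent σ}
    (hf : f ∈ supp (negIn S ∩ E)) : ev (fun k ↦ c k * z k) f = ev z f := by
  refine supp_induction (p := fun f ↦ ev (fun k ↦ c k * z k) f = ev z f) (by simp)
    (fun f f' hf hf' ↦ by rw [map_add, map_add, hf, hf']) (fun u hu a ↦ ?_) hf
  rw [ev_mono, ev_mono]
  congr 1
  rw [← one_mul (∏ k, zp (z k) (u k)), ← hE u hu.2, ← Finset.prod_mul_distrib]
  refine Finset.prod_congr rfl fun k _ ↦ zp_mul (hc k) ?_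
  by_cases hk : k ∈ S
  · exact .inl (hz k hk)
  · exact .inr (mem_negIn.mp hu.1 k hk)

end Laurent

end Evaluation

/-! ### Bihomogeneous Laurent polynomials -/

section Bigraded

open MvPolynomial

namespace Laurent

/-- The variables of `ℙ⁴ × ℙ¹`. -/
abbrev Var : Type := Fin 5 ⊕ Fin 2

/-- The exponents of bidegree `(a, b)`. -/
def bideg (a b : ℤ) : Set (Var → ℤ) := {u | ∑ i, u (.inl i) = a ∧ ∑ l, u (.inr l) = b}

lemma mem_bideg {a b : ℤ} {u : Var → ℤ} :
    u ∈ bideg a b ↔ ∑ i, u (.inl i) = a ∧ ∑ l, u (.inr l) = b := Iff.rfl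

lemma ofPoly_mem_bideg {G : MvPolynomial Var ℂ} {a b : ℕ}
    (hG : IsBihomogeneous (m := 4) (n := 1) G a b) : ofPoly G ∈ supp (bideg a b) := by
  have h1 := ofPoly_mem_of_isWeightedHomogeneous (hG.map_weight (AddMonoidHom.fst ℕ ℕ))
  have h2 := ofPoly_mem_of_isWeightedHomogeneous (hG.map_weight (AddMonoidHom.snd ℕ ℕ))
  refine supp_mono (fun u hu ↦ mem_bideg.mpr ?_) (mem_supp_inter h1 h2)
  obtain ⟨hu1, hu2⟩ := hu
  rw [Set.mem_ofPred_eq, Fintype.sum_sum_type] at hu1 hu2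
  simpa using And.intro hu1 hu2

section Normalize

variable (j : Fin 5) (l : Fin 2)

/-- The exponents after the substitution `xⱼ = tₗ = 1` and homogenization to bidegree `0`. -/
def normExp : (Var → ℤ) →+ (Var → ℤ) where
  toFun u := u - Pi.single (.inl j) (∑ i, u (.inl i)) - Pi.single (.inr l) (∑ i, u (.inr i))
  map_zero' := by simp
  map_add' u v := by
    simp only [Pi.add_apply, Finset.sum_add_distrib, Pi.single_add]
    abel

/-- The substitution `xᵢ ↦ xᵢ / xⱼ`, `tₖ ↦ tₖ / tₗ`. -/
def normalize : Laurent Var →ₐ[ℂ] Laurent Var :=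
  AddMonoidAlgebra.mapDomainAlgHom ℂ ℂ (normExp j l)

variable {j l}

lemma normalize_mono (u : Var → ℤ) (c : ℂ) : normalize j l (mono u c) = mono (normExp j l u) c :=
  AddMonoidAlgebra.mapDomain_single

lemma normExp_inl_ne (u : Var → ℤ) {i : Fin 5} (hi : i ≠ j) : normExp j l u (.inl i) = u (.inl i) := by
  simp [normExp, hi]

lemma normExp_inr_ne (u : Var → ℤ) {i : Fin 2} (hi : i ≠ l) : normExp j l u (.inr i) = u (.inr i) := by
  simp [normExp, hi]

lemma normExp_mem_bideg (u : Var → ℤ) : normExp j l u ∈ bideg 0 0 := by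
  rw [mem_bideg]
  simp [normExp, Pi.single_apply]

lemma normalize_mem {S : Set Var} (hj : .inl j ∈ S) (hl : .inr l ∈ S) {f : Laurent Var}
    (hf : f ∈ supp (negIn S)) : normalize j l f ∈ supp (negIn S ∩ bideg 0 0) := by
  refine supp_induction (p := fun f ↦ normalize j l f ∈ supp (negIn S ∩ bideg 0 0))
    (by rw [map_zero]; exact zero_mem _)
    (fun f f' hf hf' ↦ by rw [map_add]; exact add_mem hf hf') (fun u hu c ↦ ?_) hf
  rw [normalize_mono]
  refine mono_mem (E := negIn S ∩ bideg 0 0)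
    ⟨mem_negIn.mpr fun k hk ↦ ?_, normExp_mem_bideg u⟩ c
  rcases k with k | k
  · rw [normExp_inl_ne u (by rintro rfl; exact hk hj)]; exact mem_negIn.mp hu _ hk
  · rw [normExp_inr_ne u (by rintro rfl; exact hk hl)]; exact mem_negIn.mp hu _ hk

lemma normalize_eq_of_mem_bideg {a b : ℤ} {f : Laurent Var} (hf : f ∈ supp (bideg a b)) :
    normalize j l f = mono (-Pi.single (.inl j) a - Pi.single (.inr l) b) 1 * f := by
  refine supp_induction (p := fun f ↦ normalize j l f = _ * f) (by simp)
    (fun f f' hf hf' ↦ by rw [map_add, hf, hf', mul_add]) (fun u hu c ↦ ?_) hf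
  obtain ⟨h1, h2⟩ := mem_bideg.mp hu
  rw [normalize_mono, AddMonoidAlgebra.single_mul_single, one_mul]
  congr 1
  change u - Pi.single (.inl j) (∑ i, u (.inl i)) - Pi.single (.inr l) (∑ i, u (.inr i)) = _
  rw [h1, h2]
  abel

lemma normalize_eq_self {f : Laurent Var} (hf : f ∈ supp (bideg 0 0)) : normalize j l f = f := by
  rw [normalize_eq_of_mem_bideg hf, Pi.single_zero, Pi.single_zero, neg_zero, sub_zero]
  exact one_mul f

lemma normalize_X_inl : normalize j l (ofPoly (X (.inl j) - 1)) = 0 := by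
  rw [map_sub, map_sub, map_one, map_one, ofPoly_X, normalize_mono, sub_eq_zero]
  have : normExp j l (Pi.single (.inl j) 1) = 0 := by
    simp [normExp, Pi.single_apply]
  rw [this]
  rfl

lemma normalize_X_inr : normalize j l (ofPoly (X (.inr l) - 1)) = 0 := by
  rw [map_sub, map_sub, map_one, map_one, ofPoly_X, normalize_mono, sub_eq_zero]
  have : normExp j l (Pi.single (.inr l) 1) = 0 := by
    simp [normExp, Pi.single_apply, -Fin.sum_univ_two]
  rw [this]
  rfl

variable {A : Type} [CommRing A] [Algebra ℂ A] {z : Var → A}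

lemma ev_normalize (hj : z (.inl j) = 1) (hl : z (.inr l) = 1) (f : Laurent Var) :
    ev z (normalize j l f) = ev z f := by
  refine supp_induction (p := fun f ↦ ev z (normalize j l f) = ev z f) (by simp)
    (fun f f' hf hf' ↦ by simp only [map_add, hf, hf']) (fun u _ c ↦ ?_) (mem_supp_univ f)
  rw [normalize_mono, ev_mono, ev_mono]
  congr 1
  refine Finset.prod_congr rfl fun k _ ↦ ?_
  rcases k with k | k
  · by_cases hk : k = j
    · rw [hk, hj, zp_one, zp_one]
    · rw [normExp_inl_ne u hk]
  · by_cases hk : k = l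
    · rw [hk, hl, zp_one, zp_one]
    · rw [normExp_inr_ne u hk]

/-- Exponents of bidegree `(0, 0)` are insensitive to rescaling all `x` by one unit and all `t` by
another. -/
lemma ev_change {S : Set Var} (hz : ∀ k ∈ S, IsUnit (z k)) {a b : A} (ha : IsUnit a) (hb : IsUnit b)
    {f : Laurent Var} (hf : f ∈ supp (negIn S ∩ bideg 0 0)) :
    ev (Sum.elim (fun i ↦ a * z (.inl i)) fun l ↦ b * z (.inr l)) f = ev z f := by
  have h := ev_smul hz (c := Sum.elim (fun _ ↦ a) fun _ ↦ b) (fun k ↦ by rcases k <;> assumption)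
    (E := bideg 0 0) (fun u hu ↦ by
      obtain ⟨h1, h2⟩ := mem_bideg.mp hu
      rw [Fintype.prod_sum_type]
      simp only [Sum.elim_inl, Sum.elim_inr]
      rw [prod_zp _ ha, prod_zp _ hb, h1, h2, zp_zero, zp_zero, one_mul]) hf
  rw [← h]
  exact congrArg (fun z ↦ ev z f) (funext fun k ↦ by rcases k <;> rfl)

/-- A multiple of `Q` vanishes where `Q` does, and so does its part of bidegree `0`. -/
lemma ev_proj_mul {S : Set Var} (hz : ∀ k ∈ S, IsUnit (z k)) {Q : MvPolynomial Var ℂ} {a b : ℕ}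
    (hQ : IsBihomogeneous (m := 4) (n := 1) Q a b) (h0 : aeval z Q = 0) {f : Laurent Var}
    (hf : f ∈ supp (negIn S)) : ev z (proj (bideg 0 0) (ofPoly Q * f)) = 0 := by
  refine supp_induction (p := fun f ↦ ev z (proj (bideg 0 0) (ofPoly Q * f)) = 0) (by simp)
    (fun f f' hf hf' ↦ by rw [mul_add, map_add, map_add, hf, hf', add_zero]) (fun u hu c ↦ ?_) hf
  have hm : ofPoly Q * mono u c ∈ supp (bideg (a + ∑ i, u (.inl i)) (b + ∑ i, u (.inr i))) :=
    mul_mem_supp (E' := {u}) (fun v hv w hw ↦ by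
      obtain ⟨h1, h2⟩ := mem_bideg.mp hv
      rw [Set.mem_singleton_iff] at hw
      rw [mem_bideg, hw]
      simp only [Pi.add_apply, Finset.sum_add_distrib, h1, h2, and_self])
      (ofPoly_mem_bideg hQ) (mono_mem (Set.mem_singleton u) c)
  have h1 : ev z (ofPoly Q * mono u c) = 0 := by
    rw [ev_mul hz (ofPoly_mem Q S) (mono_mem hu c), ev_ofPoly, h0, zero_mul]
  -- For a monomial the product with `Q` is bihomogeneous, so the projection to bidegree `(0, 0)`
  -- either keeps all of it or kills it.
  by_cases h : a + ∑ i, u (.inl i) = 0 ∧ b + ∑ i, u (.inr i) = 0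
  · rw [h.1, h.2] at hm
    rw [proj_eq_self hm, h1]
  · have h2 : proj (bideg 0 0) (ofPoly Q * mono u c) = 0 := by
      refine eq_zero_of_disjoint (E := bideg 0 0) (fun v hv hv' ↦ h ?_)
        (supp_mono Set.inter_subset_right (proj_mem (bideg 0 0) hm))
        (supp_mono Set.inter_subset_left (proj_mem (bideg 0 0) hm))
      obtain ⟨h1, h2⟩ := mem_bideg.mp hv
      obtain ⟨h3, h4⟩ := mem_bideg.mp hv'
      exact ⟨h3.symm.trans h1, h4.symm.trans h2⟩
    rw [h2, map_zero]

end Normalize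

end Laurent

end Bigraded

/-! ### Čech complexes of Laurent polynomials -/

section CechLists

variable {I M : Type*} [AddCommGroup M]

/-- The Čech differential on functions of finite sequences of indices. -/
def cechD : (List I → M) → List I → M
  | _, [] => 0
  | c, v :: s => c s - cechD (fun w ↦ c (v :: w)) s

lemma cechD_nil (c : List I → M) : cechD c [] = 0 := rfl

lemma cechD_cons (c : List I → M) (v : I) (s : List I) :
    cechD c (v :: s) = c s - cechD (fun w ↦ c (v :: w)) s := rfl

lemma cechD_add (c c' : List I → M) (s : List I) :
    cechD (fun w ↦ c w + c' w) s = cechD c s + cechD c' s := by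
  induction s generalizing c c' with
  | nil => simp [cechD_nil]
  | cons v s ih => rw [cechD_cons, cechD_cons, cechD_cons, ih]; abel

lemma cechD_sub (c c' : List I → M) (s : List I) :
    cechD (fun w ↦ c w - c' w) s = cechD c s - cechD c' s := by
  induction s generalizing c c' with
  | nil => simp [cechD_nil]
  | cons v s ih => rw [cechD_cons, cechD_cons, cechD_cons, ih]; abel

lemma cechD_map {N F : Type*} [AddCommGroup N] [FunLike F M N] [AddMonoidHomClass F M N] (φ : F)
    (c : List I → M) (s : List I) : cechD (fun w ↦ φ (c w)) s = φ (cechD c s) := by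
  induction s generalizing c with
  | nil => simp [cechD_nil]
  | cons v s ih => rw [cechD_cons, cechD_cons, ih, map_sub]

lemma cechD_sum {κ : Type*} (t : Finset κ) (c : κ → List I → M) (s : List I) :
    cechD (fun w ↦ ∑ k ∈ t, c k w) s = ∑ k ∈ t, cechD (c k) s := by
  induction s generalizing c with
  | nil => simp [cechD_nil]
  | cons v s ih => simp only [cechD_cons, ih, Finset.sum_sub_distrib]

/-- By the recursion the terms that omit the first index cancel, and the rest is the same statement
for a shorter list. -/
lemma cechD_cechD (c : List I → M) (s : List I) : cechD (cechD c) s = 0 := by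
  induction s generalizing c with
  | nil => rfl
  | cons v s ih =>
    rw [cechD_cons, funext fun w ↦ cechD_cons c v w, cechD_sub, ih]
    abel

lemma cechD_congr {c c' : List I → M} {n : ℕ} (h : ∀ s, s.length = n → c s = c' s) (s : List I)
    (hs : s.length = n + 1) : cechD c s = cechD c' s := by
  induction s generalizing c c' n with
  | nil => simp at hs
  | cons v s ih =>
    have hs' : s.length = n := by simpa using hs
    rw [cechD_cons, cechD_cons, h s hs']
    congr 1
    rcases n with _ | n
    · rw [List.length_eq_zero_iff.mp hs']; rfl
    · exact ih (fun w hw ↦ h _ (by simp [hw])) hs'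

lemma cechD_mem {R : Type*} [Ring R] [Module R M] {N : List I → Submodule R M}
    (hN : ∀ s s', (∀ i ∈ s, i ∈ s') → N s ≤ N s') {c : List I → M} {n : ℕ}
    (h : ∀ s, s.length = n → c s ∈ N s) (s : List I) (hs : s.length = n + 1) :
    cechD c s ∈ N s := by
  induction s generalizing c n N with
  | nil => simp at hs
  | cons v s ih =>
    have hs' : s.length = n := by simpa using hs
    rw [cechD_cons]
    refine sub_mem (hN s (v :: s) (fun i hi ↦ List.mem_cons_of_mem _ hi) (h s hs')) ?_
    rcases n with _ | n
    · rw [List.length_eq_zero_iff.mp hs']; exact zero_mem _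
    · refine ih (N := fun s ↦ N (v :: s)) (fun s s' h' ↦ hN _ _ fun i hi ↦ ?_)
        (fun w hw ↦ h _ (by simp [hw])) hs'
      rw [List.mem_cons] at hi ⊢
      exact hi.imp_right (h' i)

end CechLists

/-! ### Exactness of the Čech complex, and its transfer to `Y` by the Koszul relation. -/

section Koszul

open MvPolynomial

namespace Laurent

/-- The variables that may occur with negative exponents on the intersection of the charts
`{xᵢ ≠ 0}`, `i ∈ s`, and `{tₗ ≠ 0}`, `l ∈ J`. -/
def allow (s : List (Fin 5)) (J : Set (Fin 2)) : Set Var := {k | Sum.elim (· ∈ s) (· ∈ J) k}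

lemma inl_mem_allow {s : List (Fin 5)} {J : Set (Fin 2)} {i : Fin 5} :
    (.inl i : Var) ∈ allow s J ↔ i ∈ s := Iff.rfl

lemma inr_mem_allow {s : List (Fin 5)} {J : Set (Fin 2)} {l : Fin 2} :
    (.inr l : Var) ∈ allow s J ↔ l ∈ J := Iff.rfl

lemma allow_mono {s s' : List (Fin 5)} {J J' : Set (Fin 2)} (h : ∀ i ∈ s, i ∈ s') (hJ : J ⊆ J') :
    allow s J ⊆ allow s' J' := by
  rintro (k | k) hk
  · exact h k hk
  · exact hJ hk

/-- The Laurent polynomials that are regular on the intersection of charts. -/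
abbrev reg (J : Set (Fin 2)) (s : List (Fin 5)) : Submodule ℂ (Laurent Var) :=
  supp (negIn (allow s J))

lemma reg_mono {J : Set (Fin 2)} (s s' : List (Fin 5)) (h : ∀ i ∈ s, i ∈ s') : reg J s ≤ reg J s' :=
  supp_mono (negIn_mono (allow_mono h subset_rfl))

/-- The exponents for which `v` is the first index of a non-negative exponent. -/
def firstAt (v : Fin 5) : Set (Var → ℤ) := {u | 0 ≤ u (.inl v) ∧ ∀ i < v, u (.inl i) < 0}

/-- A list of at most four indices misses one of the five, and the exponent there is non-negative.
This bound is the reason why the intermediate cohomology of `ℙ⁴` vanishes. -/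
lemma existsUnique_firstAt {J : Set (Fin 2)} {s : List (Fin 5)} (hs : s.length ≤ 4) (u : Var → ℤ)
    (hu : u ∈ negIn (allow s J)) : ∃! v, u ∈ firstAt v := by
  have h1 : ∃ v : Fin 5, 0 ≤ u (.inl v) := by
    obtain ⟨v, hv⟩ : ∃ v : Fin 5, v ∉ s.toFinset := by
      by_contra! h
      have h2 : s.toFinset = Finset.univ := Finset.eq_univ_of_forall h
      have h3 := s.toFinset_card_le
      rw [h2, Finset.card_univ, Fintype.card_fin] at h3
      omega
    exact ⟨v, mem_negIn.mp hu _ fun h ↦ hv (List.mem_toFinset.mpr h)⟩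
  obtain ⟨v, hv, hmin⟩ := WellFounded.has_min (wellFounded_lt (α := Fin 5))
    {v | 0 ≤ u (.inl v)} h1
  refine ⟨v, ⟨hv, fun i hi ↦ ?_⟩, fun w hw ↦ ?_⟩
  · by_contra! h
    exact hmin i h hi
  · obtain ⟨h2, h3⟩ := hw
    rcases lt_trichotomy w v with h | h | h
    · exact absurd h (hmin w h2)
    · exact h
    · exact absurd hv (not_le.mpr (h3 v h))

/-- The contracting homotopy of the Čech complex. -/
def homotopy (c : List (Fin 5) → Laurent Var) (s : List (Fin 5)) : Laurent Var :=
  ∑ v, proj (firstAt v) (c (v :: s))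

/-- The projection to `firstAt v` keeps only exponents that are non-negative at `v`, so the
denominators at `v` allowed by `v :: s` have disappeared. -/
lemma homotopy_mem {J : Set (Fin 2)} {n : ℕ} {c : List (Fin 5) → Laurent Var}
    (h : ∀ s, s.length = n + 1 → c s ∈ reg J s) (s : List (Fin 5)) (hs : s.length = n) :
    homotopy c s ∈ reg J s := by
  refine sum_mem fun v _ ↦ supp_mono ?_ (proj_mem (firstAt v) (h (v :: s) (by simp [hs])))
  rintro u ⟨hu, hu'⟩
  refine mem_negIn.mpr fun k hk ↦ ?_
  rcases k with k | k
  · by_cases hkv : k = v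
    · rw [hkv]; exact hu'.1
    · refine mem_negIn.mp hu _ fun h' ↦ ?_
      rw [inl_mem_allow, List.mem_cons] at h'
      exact h'.elim hkv hk
  · exact mem_negIn.mp hu _ hk

/-- The Čech complex is exact. -/
lemma cechD_homotopy {J : Set (Fin 2)} {n : ℕ} (hn : n ≤ 4) {c : List (Fin 5) → Laurent Var}
    (h : ∀ s, s.length = n → c s ∈ reg J s) (hd : ∀ s, s.length = n + 1 → cechD c s = 0)
    (s : List (Fin 5)) (hs : s.length = n) : cechD (homotopy c) s = c s := by
  -- The cocycle condition on `v :: s` writes `c s` as the differential of `c (v :: ·)`. Projecting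
  -- it to `firstAt v` and summing over `v` recovers `c s`, because these sets partition the
  -- exponents.
  have h1 : ∑ v, proj (firstAt v) (cechD c (v :: s)) = 0 :=
    Finset.sum_eq_zero fun v _ ↦ by rw [hd _ (by simp [hs]), map_zero]
  have h2 : cechD (homotopy c) s = ∑ v, proj (firstAt v) (cechD (fun w ↦ c (v :: w)) s) := by
    change cechD (fun s ↦ ∑ v, proj (firstAt v) (c (v :: s))) s = _
    rw [cechD_sum]
    exact Finset.sum_congr rfl fun v _ ↦ cechD_map (proj (firstAt v)) (fun w ↦ c (v :: w)) s
  simp only [cechD_cons, map_sub, Finset.sum_sub_distrib] at h1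
  rw [sum_proj (h s hs) (existsUnique_firstAt (hs.trans_le hn)), sub_eq_zero] at h1
  rw [h2, h1]

/-- A cochain whose differential vanishes modulo `(Q, C)` is a cocycle up to `(Q, C)`. -/
theorem exists_cocycle {Q C : MvPolynomial Var ℂ} (hQC : IsRelPrime Q C) (hQ : Q ≠ 0) (hC : C ≠ 0)
    {J : Set (Fin 2)} {n : ℕ} (hn : n ≤ 2) {c A B : List (Fin 5) → Laurent Var}
    (hA : ∀ s, s.length = n + 1 → A s ∈ reg J s) (hB : ∀ s, s.length = n + 1 → B s ∈ reg J s)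
    (h : ∀ s, s.length = n + 1 → cechD c s = ofPoly Q * A s + ofPoly C * B s) :
    ∃ a b : List (Fin 5) → Laurent Var, (∀ s, s.length = n → a s ∈ reg J s) ∧
      (∀ s, s.length = n → b s ∈ reg J s) ∧ ∀ s, s.length = n + 1 →
        cechD (fun w ↦ c w - (ofPoly Q * a w + ofPoly C * b w)) s = 0 := by
  have hC' : ofPoly C ≠ 0 := fun h0 ↦ hC (ofPoly_injective (h0.trans (map_zero _).symm))
  have hmul (f : Laurent Var) (c) (s : List (Fin 5)) : cechD (fun w ↦ f * c w) s = f * cechD c s :=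
    cechD_map (AddMonoidHom.mulLeft f) c s
  -- Applying the differential once more gives `Q dA + C dB = 0`. By coprimality `dA = C E` and `-dB
  -- = Q E` for one cochain `E`: this is exactness of the Koszul complex.
  have h1 (s : List (Fin 5)) (hs : s.length = n + 2) :
      ofPoly Q * cechD A s = ofPoly C * (- cechD B s) := by
    have h2 := cechD_congr h s hs
    rw [cechD_cechD, cechD_add, hmul, hmul] at h2
    linear_combination -h2
  have h2 (s : List (Fin 5)) : ∃ e, s.length = n + 2 → e ∈ reg J s ∧
      cechD A s = ofPoly C * e ∧ - cechD B s = ofPoly Q * e := by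
    by_cases hs : s.length = n + 2
    · obtain ⟨e, he⟩ := exists_eq_mul_of_mul_eq_mul (S := allow s J) hQC hQ
        (cechD_mem reg_mono hA s hs) (neg_mem (cechD_mem reg_mono hB s hs)) (h1 s hs)
      exact ⟨e, fun _ ↦ he⟩
    · exact ⟨0, fun h ↦ absurd h hs⟩
  choose E hE using h2
  -- Since `C` is not a zero divisor, `E` is a cocycle. Its lists have length `n + 2 ≤ 4`, so it is
  -- a coboundary.
  have hdE (s : List (Fin 5)) (hs : s.length = n + 2 + 1) : cechD E s = 0 := by
    have h3 := cechD_congr (fun w hw ↦ (hE w hw).2.1) s hs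
    rw [cechD_cechD, hmul] at h3
    exact (mul_eq_zero.mp h3.symm).resolve_left hC'
  have hE' (s : List (Fin 5)) (hs : s.length = n + 2) : E s ∈ reg J s := (hE s hs).1
  have hdh := cechD_homotopy (by omega) hE' hdE
  have hh := homotopy_mem hE'
  -- Subtracting Koszul terms turns `A` and `B` into cocycles without changing `Q A + C B`; their
  -- homotopies are the required `a` and `b`.
  let A' (w : List (Fin 5)) := A w - ofPoly C * homotopy E w
  let B' (w : List (Fin 5)) := B w + ofPoly Q * homotopy E w
  have hA' (s : List (Fin 5)) (hs : s.length = n + 1) : A' s ∈ reg J s :=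
    sub_mem (hA s hs) (mul_mem (ofPoly_mem C _) (hh s hs))
  have hB' (s : List (Fin 5)) (hs : s.length = n + 1) : B' s ∈ reg J s :=
    add_mem (hB s hs) (mul_mem (ofPoly_mem Q _) (hh s hs))
  have hdA' (s : List (Fin 5)) (hs : s.length = n + 1 + 1) : cechD A' s = 0 := by
    rw [cechD_sub, hmul, hdh s hs, (hE s hs).2.1, sub_self]
  have hdB' (s : List (Fin 5)) (hs : s.length = n + 1 + 1) : cechD B' s = 0 := by
    rw [cechD_add, hmul, hdh s hs, ← (hE s hs).2.2, add_neg_cancel]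
  refine ⟨homotopy A', homotopy B', homotopy_mem hA', homotopy_mem hB', fun s hs ↦ ?_⟩
  rw [cechD_sub, cechD_add, hmul, hmul, cechD_homotopy (by omega) hA' hdA' s hs,
    cechD_homotopy (by omega) hB' hdB' s hs, h s hs]
  ring

end Laurent

/-! ### The equations are relatively prime -/

/-- Modulo a common factor `h` both gradients are multiples of the gradient of `h`, so the minors
vanish. -/
lemma minor_mem_span_of_dvd {σ : Type} {Q C h : MvPolynomial σ ℂ} (hQ : h ∣ Q) (hC : h ∣ C) :
    jacIdeal Q C ≤ Ideal.span {h} := by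
  rw [jacIdeal, Ideal.span_le]
  rintro _ ((rfl | rfl) | ⟨ab, rfl⟩)
  · exact Ideal.mem_span_singleton.mpr hQ
  · exact Ideal.mem_span_singleton.mpr hC
  · obtain ⟨q, rfl⟩ := hQ
    obtain ⟨c, rfl⟩ := hC
    refine Ideal.mem_span_singleton.mpr ?_
    simp only [minor, Derivation.leibniz, smul_eq_mul]
    exact ⟨h * (pderiv ab.1 q * pderiv ab.2 c - pderiv ab.2 q * pderiv ab.1 c) +
      c * (pderiv ab.1 q * pderiv ab.2 h - pderiv ab.2 q * pderiv ab.1 h) +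
      q * (pderiv ab.1 h * pderiv ab.2 c - pderiv ab.2 h * pderiv ab.1 c), by ring⟩

namespace IsSmoothPair

variable {Q C : MvPolynomial (Fin 5 ⊕ Fin 2) ℂ}

/-- A common irreducible factor would divide `xⱼ` or `tₗ` for each pair `(j, l)`. The pairs `(0, 0)`
and `(1, 1)` then give two different variables with the same prime factor. -/
lemma not_dvd_of_irreducible (h : IsSmoothPair Q C) {g : MvPolynomial (Fin 5 ⊕ Fin 2) ℂ}
    (hg : Irreducible g) (hgQ : g ∣ Q) (hgC : g ∣ C) : False := by
  have hle := minor_mem_span_of_dvd hgQ hgC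
  have key (j : Fin 5) (l : Fin 2) : g ∣ X (.inl j) ∨ g ∣ X (.inr l) := by
    obtain ⟨N, hN⟩ := h.exists_pow_mem j l
    exact hg.prime.dvd_or_dvd (hg.prime.dvd_of_dvd_pow (Ideal.mem_span_singleton.mp (hle hN)))
  have key2 {a b : Fin 5 ⊕ Fin 2} (hab : a ≠ b) (ha : g ∣ X a) (hb : g ∣ X b) : False := by
    have h1 : Associated g (X a) := hg.associated_of_dvd (MvPolynomial.X_prime).irreducible ha
    exact hab (MvPolynomial.X_dvd_X.mp (h1.symm.dvd.trans hb))
  rcases key 0 0 with h1 | h1 <;> rcases key 1 1 with h2 | h2 <;> exact key2 (by simp) h1 h2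

lemma isRelPrime (h : IsSmoothPair Q C) : IsRelPrime Q C :=
  WfDvdMonoid.isRelPrime_of_no_irreducible_factors
    (fun h0 ↦ h.not_dvd_of_irreducible (g := X (.inl 0)) MvPolynomial.X_prime.irreducible
      (h0.1 ▸ dvd_zero _) (h0.2 ▸ dvd_zero _))
    fun _ hg hgQ hgC ↦ h.not_dvd_of_irreducible hg hgQ hgC

end IsSmoothPair

lemma not_isUnit_of_isBihomogeneous {G : MvPolynomial (Fin 5 ⊕ Fin 2) ℂ} {a b : ℕ}
    (hG : IsBihomogeneous (m := 4) (n := 1) G (a + 1) b) : ¬ IsUnit G := fun hu ↦ by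
  have h1 := (hu.map (constantCoeff (R := ℂ))).ne_zero
  have h2 := hG (d := 0) h1
  rw [map_zero, Prod.ext_iff] at h2
  simp at h2

namespace IsSmoothPair

variable {Q C : MvPolynomial (Fin 5 ⊕ Fin 2) ℂ}

lemma ne_zero_left (h : IsSmoothPair Q C) : Q ≠ 0 := by
  rintro rfl
  exact not_isUnit_of_isBihomogeneous h.right (isRelPrime_zero_left.mp h.isRelPrime)

lemma ne_zero_right (h : IsSmoothPair Q C) : C ≠ 0 := by
  rintro rfl
  exact not_isUnit_of_isBihomogeneous h.left (isRelPrime_zero_right.mp h.isRelPrime)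

end IsSmoothPair

end Koszul

/-! ### Laurent polynomials and sections on charts -/

section EvOn

open MvPolynomial Laurent

variable {Y : Scheme.{0}} (p : Y ⟶ SpecC) {U V W : Y.Opens}

/-- Evaluation of Laurent polynomials at sections. -/
def evOn {σ : Type} [Fintype σ] (z : σ → Γ(Y, W)) : Laurent σ →+ Γ(Y, W) :=
  letI := sectionsAlgebra p W
  (ev z).toAddMonoidHom

section General

variable {σ : Type} [Fintype σ] {z : σ → Γ(Y, W)} {S : Set σ}

lemma evOn_ofPoly (z : σ → Γ(Y, W)) (G : MvPolynomial σ ℂ) : evOn p z (ofPoly G) = evalAt p z G :=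
  letI := sectionsAlgebra p W
  ev_ofPoly z G

lemma evOn_const (z : σ → Γ(Y, W)) (c : ℂ) : evOn p z (mono 0 c) = constHom p W c := by
  rw [← evalAt_C p z c, ← evOn_ofPoly, ← algebraMap_eq, AlgHom.commutes]
  rfl

lemma evOn_one (z : σ → Γ(Y, W)) : evOn p z 1 = 1 := by
  rw [← map_one ofPoly, evOn_ofPoly, map_one]

lemma evOn_mul (hz : ∀ k ∈ S, IsUnit (z k)) {f g : Laurent σ} (hf : f ∈ supp (negIn S))
    (hg : g ∈ supp (negIn S)) : evOn p z (f * g) = evOn p z f * evOn p z g :=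
  letI := sectionsAlgebra p W
  ev_mul hz hf hg

lemma res_evOn (hz : ∀ k ∈ S, IsUnit (z k)) {f : Laurent σ} (hf : f ∈ supp (negIn S))
    (h : V ≤ W) : res h (evOn p z f) = evOn p (fun k ↦ res h (z k)) f :=
  letI := sectionsAlgebra p W
  letI := sectionsAlgebra p V
  map_ev ({ res h with commutes' := fun c ↦ res_constHom p h c } : Γ(Y, W) →ₐ[ℂ] Γ(Y, V)) hz hf

variable (S) in
open scoped Classical in
/-- The product of the variables in `S`. -/
def denPoly : MvPolynomial σ ℂ := ∏ k, if k ∈ S then X k else 1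

lemma ofPoly_denPoly : ofPoly (denPoly S) = den S 1 := by
  classical
  have h (k : σ) : ofPoly (if k ∈ S then X k else 1 : MvPolynomial σ ℂ) =
      mono (if k ∈ S then Pi.single k 1 else 0) 1 := by
    split_ifs
    · exact ofPoly_X k
    · rw [map_one]; rfl
  have h2 (s : Finset σ) (v : σ → σ → ℤ) :
      ∏ k ∈ s, (mono (v k) 1 : Laurent σ) = mono (∑ k ∈ s, v k) 1 := by
    induction s using Finset.induction_on with
    | empty => rfl
    | insert a s ha ih =>
      rw [Finset.prod_insert ha, Finset.sum_insert ha, ih, AddMonoidAlgebra.single_mul_single, mul_one]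
  rw [denPoly, map_prod, Finset.prod_congr rfl fun k _ ↦ h k, h2, den]
  congr 1
  funext i
  rw [Finset.sum_apply, Finset.sum_eq_single i]
  · split_ifs <;> simp
  · intro k _ hk
    split_ifs <;> simp [hk.symm]
  · simp

lemma ofPoly_denPoly_pow (n : ℕ) : ofPoly (denPoly S ^ n) = den S n := by
  rw [map_pow, ofPoly_denPoly]
  induction n with
  | zero => rw [pow_zero, Nat.cast_zero, den_zero]
  | succ n ih => rw [pow_succ, ih, den_mul_den, Nat.cast_succ]

lemma mem_basicOpen_denPoly (z : σ → Γ(Y, W)) (x : Y) :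
    x ∈ Y.basicOpen (evalAt p z (denPoly S)) ↔ x ∈ W ∧ ∀ k ∈ S, x ∈ Y.basicOpen (z k) := by
  classical
  constructor
  · intro hx
    have hW := Y.basicOpen_le _ hx
    refine ⟨hW, fun k hk ↦ ?_⟩
    rw [Scheme.mem_basicOpen _ _ _ hW, denPoly, map_prod, map_prod, IsUnit.prod_univ_iff] at hx
    rw [Scheme.mem_basicOpen _ _ _ hW]
    simpa [hk] using hx k
  · rintro ⟨hW, h⟩
    rw [Scheme.mem_basicOpen _ _ _ hW, denPoly, map_prod, map_prod, IsUnit.prod_univ_iff]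
    intro k
    split_ifs with hk
    · have := h k hk
      rw [Scheme.mem_basicOpen _ _ _ hW] at this
      simpa using this
    · simp

lemma evOn_den_isUnit (hz : ∀ k ∈ S, IsUnit (z k)) (n : ℤ) :
    evOn p z (den S (-n)) * evOn p z (den S n) = 1 := by
  rw [← evOn_mul p hz (den_mem S _) (den_mem S _), den_neg_mul_den, evOn_one]

end General

section Bihomogeneous

variable {z : Var → Γ(Y, W)} {S : Set Var} {j : Fin 5} {l : Fin 2}

lemma evOn_normalize (hj : z (.inl j) = 1) (hl : z (.inr l) = 1) (f : Laurent Var) :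
    evOn p z (normalize j l f) = evOn p z f :=
  letI := sectionsAlgebra p W
  ev_normalize hj hl f

lemma evOn_change (hz : ∀ k ∈ S, IsUnit (z k)) {a b : Γ(Y, W)} (ha : IsUnit a) (hb : IsUnit b)
    {z' : Var → Γ(Y, W)} (h1 : ∀ i, z' (.inl i) = a * z (.inl i))
    (h2 : ∀ i, z' (.inr i) = b * z (.inr i))
    {f : Laurent Var} (hf : f ∈ supp (negIn S ∩ bideg 0 0)) : evOn p z' f = evOn p z f := by
  let := sectionsAlgebra p W
  have : z' = Sum.elim (fun i ↦ a * z (.inl i)) fun l ↦ b * z (.inr l) := by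
    funext k; rcases k with k | k
    · exact h1 k
    · exact h2 k
  rw [this]
  exact ev_change hz ha hb hf

lemma evOn_proj_mul (hz : ∀ k ∈ S, IsUnit (z k)) {Q : MvPolynomial Var ℂ} {a b : ℕ}
    (hQ : IsBihomogeneous (m := 4) (n := 1) Q a b) (h0 : evalAt p z Q = 0) {f : Laurent Var}
    (hf : f ∈ supp (negIn S)) : evOn p z (proj (bideg 0 0) (ofPoly Q * f)) = 0 :=
  letI := sectionsAlgebra p W
  ev_proj_mul hz hQ h0 hf

lemma evOn_mono_one (hj : z (.inl j) = 1) (hl : z (.inr l) = 1) (a b : ℤ) :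
    evOn p z (mono (-Pi.single (.inl j) a - Pi.single (.inr l) b) 1) = 1 := by
  rw [← evOn_normalize p hj hl, normalize_mono, ← evOn_one p z]
  congr 1
  have : normExp j l (-Pi.single (.inl j) a - Pi.single (.inr l) b) = 0 := by
    simp [normExp, Pi.single_apply, -Fin.sum_univ_two]
    rw [Pi.single_neg, Pi.single_neg]
    abel
  rw [this]
  rfl

lemma mono_mem_negIn (hj : .inl j ∈ S) (hl : .inr l ∈ S) (a b : ℤ) :
    (mono (-Pi.single (.inl j) a - Pi.single (.inr l) b) 1 : Laurent Var) ∈ supp (negIn S) := by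
  refine mono_mem (mem_negIn.mpr fun k hk ↦ ?_) 1
  have h1 : k ≠ .inl j := by rintro rfl; exact hk hj
  have h2 : k ≠ .inr l := by rintro rfl; exact hk hl
  simp [h1, h2]

lemma normalize_mem' (hj : .inl j ∈ S) (hl : .inr l ∈ S) {f : Laurent Var}
    (hf : f ∈ supp (negIn S)) : normalize j l f ∈ supp (negIn S) :=
  supp_mono Set.inter_subset_left (normalize_mem hj hl hf)

/-- The equations of a smooth complete intersection form a regular sequence on the charts. -/
lemma left_dvd_of_isRelPrime {Q C : MvPolynomial Var ℂ} {a b a' b' : ℕ}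
    (hQ : IsBihomogeneous (m := 4) (n := 1) Q a b) (hC : IsBihomogeneous (m := 4) (n := 1) C a' b')
    (h : IsRelPrime Q C) (hQ0 : Q ≠ 0)
    (hP : Presents p W z (Ideal.span {X (.inl j) - 1, X (.inr l) - 1}))
    (hj : z (.inl j) = 1) (hl : z (.inr l) = 1) (c : Γ(Y, W))
    (hc : evalAt p z Q ∣ evalAt p z C * c) : evalAt p z Q ∣ c := by
  obtain ⟨d, hd⟩ := hc
  obtain ⟨c, rfl⟩ := hP.surjective c
  obtain ⟨d, rfl⟩ := hP.surjective d
  let S : Set Var := {.inl j, .inr l}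
  have hjS : .inl j ∈ S := by simp [S]
  have hlS : .inr l ∈ S := by simp [S]
  have hz : ∀ k ∈ S, IsUnit (z k) := by
    rintro k (rfl | rfl)
    · rw [hj]; exact isUnit_one
    · rw [hl]; exact isUnit_one
  have h1 : C * c - Q * d ∈ Ideal.span {X (.inl j) - 1, X (.inr l) - 1} := by
    rw [← hP.ker_eq, RingHom.mem_ker, map_sub, map_mul, map_mul, hd, sub_self]
  -- `normalize` kills the relations `xⱼ = 1` and `tₗ = 1`, and so turns a congruence into an
  -- equation of Laurent polynomials; on a bihomogeneous form it is multiplication by a monomial.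
  have h2 : normalize j l (ofPoly (C * c - Q * d)) = 0 := by
    obtain ⟨s, t, hst⟩ := Ideal.mem_span_pair.mp h1
    rw [← hst, map_add, map_add, map_mul, map_mul, map_mul, map_mul, normalize_X_inl,
      normalize_X_inr, mul_zero, mul_zero, add_zero]
  rw [map_sub, map_sub, map_mul, map_mul, map_mul, map_mul,
    normalize_eq_of_mem_bideg (ofPoly_mem_bideg hQ), normalize_eq_of_mem_bideg (ofPoly_mem_bideg hC)]
    at h2
  obtain ⟨e, he, -, he'⟩ := exists_eq_mul_of_mul_eq_mul (S := S) h hQ0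
    (mul_mem (mono_mem_negIn hjS hlS a b) (normalize_mem' hjS hlS (ofPoly_mem d S)))
    (mul_mem (mono_mem_negIn hjS hlS a' b') (normalize_mem' hjS hlS (ofPoly_mem c S)))
    (by linear_combination -h2)
  have h3 := congr(evOn p z $he')
  rw [evOn_mul p hz (mono_mem_negIn hjS hlS a' b') (normalize_mem' hjS hlS (ofPoly_mem c S)),
    evOn_mono_one p hj hl, evOn_normalize p hj hl, evOn_ofPoly, one_mul,
    evOn_mul p hz (ofPoly_mem Q S) he, evOn_ofPoly] at h3
  exact ⟨_, h3⟩

/-- Via `normalize`, a product that vanishes on the chart becomes a product of Laurent polynomials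
equal to zero, and these form a domain. -/
lemma mem_nonZeroDivisors_of_ne_zero {Q : MvPolynomial Var ℂ} {a b : ℕ}
    (hQ : IsBihomogeneous (m := 4) (n := 1) Q a b) (hQ0 : Q ≠ 0)
    (hP : Presents p W z (Ideal.span {X (.inl j) - 1, X (.inr l) - 1}))
    (hj : z (.inl j) = 1) (hl : z (.inr l) = 1) : evalAt p z Q ∈ nonZeroDivisors Γ(Y, W) := by
  refine mem_nonZeroDivisors_iff_right.mpr fun c hc ↦ ?_
  obtain ⟨c, rfl⟩ := hP.surjective c
  have h1 : c * Q ∈ Ideal.span {X (.inl j) - 1, X (.inr l) - 1} := by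
    rw [← hP.ker_eq, RingHom.mem_ker, map_mul, hc]
  have h2 : normalize j l (ofPoly (c * Q)) = 0 := by
    obtain ⟨s, t, hst⟩ := Ideal.mem_span_pair.mp h1
    rw [← hst, map_add, map_add, map_mul, map_mul, map_mul, map_mul, normalize_X_inl,
      normalize_X_inr, mul_zero, mul_zero, add_zero]
  rw [map_mul, map_mul, normalize_eq_of_mem_bideg (ofPoly_mem_bideg hQ)] at h2
  have hQ' : ofPoly Q ≠ 0 := fun h0 ↦ hQ0 (ofPoly_injective (h0.trans (map_zero _).symm))
  have h3 := (mul_eq_zero.mp h2).resolve_right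
    (mul_ne_zero (AddMonoidAlgebra.single_ne_zero.mpr one_ne_zero) hQ')
  rw [← evOn_ofPoly, ← evOn_normalize p hj hl, h3, map_zero]

/-- A function on the basic open set is a polynomial divided by a power of the product of the
inverted variables; `normalize` brings the fraction to bidegree `(0, 0)` without changing its
values. -/
lemma exists_evOn_eq (hU : IsAffineOpen U) {I : Ideal (MvPolynomial Var ℂ)} {y : Var → Γ(Y, U)}
    (hP : Presents p U y I) (hj : y (.inl j) = 1) (hl : y (.inr l) = 1)
    (hjS : .inl j ∈ S) (hlS : .inr l ∈ S) (hWU : W ≤ U)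
    (hW : W = Y.basicOpen (evalAt p y (denPoly S)))
    (hz : ∀ k ∈ S, IsUnit (res hWU (y k))) (c : Γ(Y, W)) :
    ∃ F ∈ supp (negIn S ∩ bideg 0 0), evOn p (fun k ↦ res hWU (y k)) F = c := by
  obtain ⟨n, c', hc⟩ :=
    exists_res_eq_pow_mul hU.isCompact hU.isQuasiSeparated _ hWU hW c
  obtain ⟨G, rfl⟩ := hP.surjective c'
  refine ⟨normalize j l (den S (-n) * ofPoly G),
    normalize_mem hjS hlS (mul_mem (den_mem S _) (ofPoly_mem G S)), ?_⟩
  rw [evOn_normalize p (by rw [hj, map_one]) (by rw [hl, map_one]),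
    evOn_mul p hz (den_mem S _) (ofPoly_mem G S), evOn_ofPoly, ← res_evalAt, hc, res_evalAt,
    ← map_pow, ← evOn_ofPoly, ofPoly_denPoly_pow, ← mul_assoc, evOn_den_isUnit p hz, one_mul]

/-- Up to denominators `F` lies in the ideal of `Q`, `C`, `xⱼ - 1` and `tₗ - 1`. Applying
`normalize` removes the last two generators and leaves `F` unchanged. -/
lemma exists_eq_of_evOn_eq_zero (hU : IsAffineOpen U) {Q C : MvPolynomial Var ℂ} {a b a' b' : ℕ}
    (hQ : IsBihomogeneous (m := 4) (n := 1) Q a b) (hC : IsBihomogeneous (m := 4) (n := 1) C a' b')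
    {y : Var → Γ(Y, U)}
    (hP : Presents p U y (Ideal.span ({Q, C} ∪ {X (.inl j) - 1, X (.inr l) - 1})))
    (hjS : .inl j ∈ S) (hlS : .inr l ∈ S) (hWU : W ≤ U)
    (hW : W = Y.basicOpen (evalAt p y (denPoly S)))
    (hz : ∀ k ∈ S, IsUnit (res hWU (y k))) {F : Laurent Var} (hF : F ∈ supp (negIn S ∩ bideg 0 0))
    (h0 : evOn p (fun k ↦ res hWU (y k)) F = 0) :
    ∃ A ∈ supp (negIn S), ∃ B ∈ supp (negIn S), F = ofPoly Q * A + ofPoly C * B := by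
  have hF1 := supp_mono Set.inter_subset_left hF
  obtain ⟨N, G, hG⟩ := exists_den_mul_eq hF1
  have h1 : res hWU (evalAt p y G) = 0 := by
    rw [res_evalAt, ← evOn_ofPoly, ← hG, evOn_mul p hz (den_mem S _) hF1, h0, mul_zero]
  obtain ⟨M, hM⟩ := exists_pow_mul_eq_zero hU.isCompact _ hWU hW _ h1
  have h2 : denPoly S ^ M * G ∈ Ideal.span ({Q, C} ∪ {X (.inl j) - 1, X (.inr l) - 1}) := by
    rw [← hP.ker_eq, RingHom.mem_ker, map_mul, map_pow, hM]
  rw [Ideal.span_union] at h2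
  obtain ⟨f, hf, g, hg, hfg⟩ := Submodule.mem_sup.mp h2
  obtain ⟨A, B, rfl⟩ := Ideal.mem_span_pair.mp hf
  obtain ⟨s, t, rfl⟩ := Ideal.mem_span_pair.mp hg
  have h3 : F = den S (-N) * den S (-M) * ofPoly (denPoly S ^ M * G) := by
    rw [map_mul, ofPoly_denPoly_pow, ← hG]
    linear_combination -(F * den S (-N) * den S N) * den_neg_mul_den S M - F * den_neg_mul_den S N
  have h4 := normalize_eq_self (j := j) (l := l) (supp_mono Set.inter_subset_right hF)
  have hmem (G : MvPolynomial Var ℂ) : normalize j l (den S (-N) * den S (-M) * ofPoly G) ∈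
      supp (negIn S) :=
    normalize_mem' hjS hlS (mul_mem (mul_mem (den_mem S _) (den_mem S _)) (ofPoly_mem G S))
  refine ⟨_, mul_mem (mono_mem_negIn hjS hlS a b) (hmem A), _,
    mul_mem (mono_mem_negIn hjS hlS a' b') (hmem B), ?_⟩
  conv_lhs => rw [← h4, h3, ← hfg]
  simp only [map_mul, map_add, normalize_X_inl, normalize_X_inr, mul_zero, add_zero,
    normalize_eq_of_mem_bideg (ofPoly_mem_bideg hQ), normalize_eq_of_mem_bideg (ofPoly_mem_bideg hC)]
  ring

end Bihomogeneous

end EvOn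

/-- The equations of a smooth complete intersection form a regular sequence on the charts. -/
theorem IsSmoothPair.isRegularPair {Q C : MvPolynomial (Fin 5 ⊕ Fin 2) ℂ} (h : IsSmoothPair Q C)
    (j : Fin 5) (l : Fin 2) : IsRegularPair (evalZ Q j l) (evalZ C j l) where
  left := mem_nonZeroDivisors_of_ne_zero _ h.left h.ne_zero_left (PProd.presents 4 1 j l)
    (crd_self _ _) (crd_self _ _)
  right := mem_nonZeroDivisors_of_ne_zero _ h.right h.ne_zero_right (PProd.presents 4 1 j l)
    (crd_self _ _) (crd_self _ _)
  left_dvd := left_dvd_of_isRelPrime _ h.left h.right h.isRelPrime h.ne_zero_left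
    (PProd.presents 4 1 j l) (crd_self _ _) (crd_self _ _)
  right_dvd := left_dvd_of_isRelPrime _ h.right h.left h.isRelPrime.symm h.ne_zero_right
    (PProd.presents 4 1 j l) (crd_self _ _) (crd_self _ _)

/-! ### Cohomology of the structure sheaf of `Y` -/

section YOpens

open MvPolynomial Laurent

variable (Q C : MvPolynomial (Fin 5 ⊕ Fin 2) ℂ)

/-- The open set `{xᵢ ≠ 0}` of `Y`. -/
def xOpen (i : Fin 5) : (yScheme Q C).Opens :=
  ((intersectionIdeal Q C).subschemeι ≫ pullback.fst _ _) ⁻¹ᵁ chart 4 i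

/-- The open set `{tₗ ≠ 0}` of `Y`. -/
def tOpen (l : Fin 2) : (yScheme Q C).Opens :=
  ((intersectionIdeal Q C).subschemeι ≫ pullback.snd _ _) ⁻¹ᵁ chart 1 l

/-- The open set `{xᵢ ≠ 0, tₗ ≠ 0 : i ∈ s, l ∈ J}` of `Y`. -/
def yOpen (s : List (Fin 5)) (J : Set (Fin 2)) : (yScheme Q C).Opens :=
  ⟨{x | ∀ i ∈ s, x ∈ xOpen Q C i} ∩ {x | ∀ l ∈ J, x ∈ tOpen Q C l}, by
    have h1 : {x | ∀ i ∈ s, x ∈ xOpen Q C i} = ⋂ i ∈ {i | i ∈ s}, (xOpen Q C i : Set _) := by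
      ext x; simp
    have h2 : {x | ∀ l ∈ J, x ∈ tOpen Q C l} = ⋂ l ∈ J, (tOpen Q C l : Set _) := by
      ext x; simp
    rw [h1, h2]
    exact ((List.finite_toSet s).isOpen_biInter fun i _ ↦ (xOpen Q C i).2).inter
      ((Set.toFinite J).isOpen_biInter fun l _ ↦ (tOpen Q C l).2)⟩

variable {Q C} {s s' : List (Fin 5)} {J J' : Set (Fin 2)} {j j' : Fin 5} {l l' : Fin 2}

lemma mem_yOpen {x : yScheme Q C} :
    x ∈ yOpen Q C s J ↔ (∀ i ∈ s, x ∈ xOpen Q C i) ∧ ∀ l ∈ J, x ∈ tOpen Q C l := Iff.rfl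

lemma mem_yChart {x : yScheme Q C} : x ∈ yChart Q C j l ↔ x ∈ xOpen Q C j ∧ x ∈ tOpen Q C l :=
  Iff.rfl

lemma yOpen_anti (h : ∀ i ∈ s, i ∈ s') (hJ : J ⊆ J') : yOpen Q C s' J' ≤ yOpen Q C s J :=
  fun _ hx ↦ mem_yOpen.mpr ⟨fun i hi ↦ (mem_yOpen.mp hx).1 i (h i hi),
    fun l hl ↦ (mem_yOpen.mp hx).2 l (hJ hl)⟩

lemma yOpen_le_yChart (hj : j ∈ s) (hl : l ∈ J) : yOpen Q C s J ≤ yChart Q C j l :=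
  fun _ hx ↦ ⟨(mem_yOpen.mp hx).1 j hj, (mem_yOpen.mp hx).2 l hl⟩

lemma basicOpen_yCrd_inl (i : Fin 5) :
    (yScheme Q C).basicOpen (yCrd Q C j l (.inl i)) = yChart Q C j l ⊓ xOpen Q C i := by
  have h := res_yCrd_inl (le_refl (yChart Q C j l)) i
  rw [res_self] at h
  rw [h, basicOpen_crd]
  rfl

lemma basicOpen_yCrd_inr (i : Fin 2) :
    (yScheme Q C).basicOpen (yCrd Q C j l (.inr i)) = yChart Q C j l ⊓ tOpen Q C i := by
  have h := res_yCrd_inr (le_refl (yChart Q C j l)) i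
  rw [res_self] at h
  rw [h, basicOpen_crd]
  rfl

lemma yOpen_eq_basicOpen (hj : j ∈ s) (hl : l ∈ J) : yOpen Q C s J =
    (yScheme Q C).basicOpen (evalAt (yToBase Q C) (yCrd Q C j l) (denPoly (allow s J))) := by
  ext x
  rw [SetLike.mem_coe, SetLike.mem_coe, mem_basicOpen_denPoly]
  constructor
  · intro hx
    have hx' := yOpen_le_yChart hj hl hx
    refine ⟨hx', ?_⟩
    rintro (k | k) hk
    · rw [basicOpen_yCrd_inl]
      exact ⟨hx', (mem_yOpen.mp hx).1 k hk⟩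
    · rw [basicOpen_yCrd_inr]
      exact ⟨hx', (mem_yOpen.mp hx).2 k hk⟩
  · rintro ⟨-, h⟩
    refine mem_yOpen.mpr ⟨fun i hi ↦ ?_, fun i hi ↦ ?_⟩
    · have := h (.inl i) hi
      rw [basicOpen_yCrd_inl] at this
      exact this.2
    · have := h (.inr i) hi
      rw [basicOpen_yCrd_inr] at this
      exact this.2

/-- Evaluation of Laurent polynomials on open sets of `Y`. -/
def yEv {W : (yScheme Q C).Opens} (h : W ≤ yChart Q C j l) : Laurent Var →+ Γ(yScheme Q C, W) :=
  evOn (yToBase Q C) fun k ↦ res h (yCrd Q C j l k)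

variable {W W' : (yScheme Q C).Opens}

lemma isUnit_res_yCrd (hW : W ≤ yOpen Q C s J) (h : W ≤ yChart Q C j l) (k : Var)
    (hk : k ∈ allow s J) : IsUnit (res h (yCrd Q C j l k)) := by
  rcases k with k | k
  · rw [res_yCrd_inl]
    exact isUnit_crd _ _ fun x hx ↦ (mem_yOpen.mp (hW hx)).1 k hk
  · rw [res_yCrd_inr]
    exact isUnit_crd _ _ fun x hx ↦ (mem_yOpen.mp (hW hx)).2 k hk

lemma res_yEv (hW : W ≤ yOpen Q C s J) (h : W ≤ yChart Q C j l) (h' : W' ≤ W) {F : Laurent Var}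
    (hF : F ∈ reg J s) : res h' (yEv h F) = yEv (h'.trans h) F := by
  refine (res_evOn _ (isUnit_res_yCrd hW h) hF h').trans ?_
  simp only [res_res]
  rfl

/-- Passing to another chart multiplies all `x` and all `t` by units, which does not matter in
bidegree `(0, 0)`. -/
lemma yEv_change (hW : W ≤ yOpen Q C s J) (h : W ≤ yChart Q C j l) (h' : W ≤ yChart Q C j' l')
    {F : Laurent Var} (hF : F ∈ supp (negIn (allow s J) ∩ bideg 0 0)) : yEv h F = yEv h' F := by
  refine evOn_change _ (isUnit_res_yCrd hW h') (a := res h (yCrd Q C j l (.inl j')))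
    (b := res h (yCrd Q C j l (.inr l'))) ?_ ?_ (fun i ↦ (yCrd_mul_inl h h' i).symm)
    (fun i ↦ (yCrd_mul_inr h h' i).symm) hF
  · refine isUnit_res_yCrd (s := [j']) (J := ∅) (fun x hx ↦ mem_yOpen.mpr ⟨?_, by simp⟩) h _
      (by simp [inl_mem_allow])
    exact fun i hi ↦ List.mem_singleton.mp hi ▸ (h' hx).1
  · refine isUnit_res_yCrd (s := []) (J := {l'}) (fun x hx ↦ mem_yOpen.mpr ⟨by simp, ?_⟩) h _
      (by simp [inr_mem_allow])
    exact fun i hi ↦ Set.mem_singleton_iff.mp hi ▸ (h' hx).2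

lemma yEv_const (h : W ≤ yChart Q C j l) (c : ℂ) : yEv h (mono 0 c) = constHom (yToBase Q C) W c :=
  evOn_const _ _ c

namespace IsSmoothPair

variable (h : IsSmoothPair Q C)

lemma exists_yEv_eq (h : IsSmoothPair Q C) (hj : j ∈ s) (hl : l ∈ J)
    (c : Γ(yScheme Q C, yOpen Q C s J)) :
    ∃ F ∈ supp (negIn (allow s J) ∩ bideg 0 0), yEv (yOpen_le_yChart hj hl) F = c :=
  exists_evOn_eq _ isAffineOpen_yChart h.presents_yChart yCrd_inl yCrd_inr hj hl _
    (yOpen_eq_basicOpen hj hl) (isUnit_res_yCrd le_rfl _) c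

lemma exists_eq_of_yEv_eq_zero (h : IsSmoothPair Q C) (hj : j ∈ s) (hl : l ∈ J) {F : Laurent Var}
    (hF : F ∈ supp (negIn (allow s J) ∩ bideg 0 0))
    (h0 : yEv (Q := Q) (C := C) (yOpen_le_yChart hj hl) F = 0) :
    ∃ AB : Laurent Var × Laurent Var, AB.1 ∈ reg J s ∧ AB.2 ∈ reg J s ∧
      F = ofPoly Q * AB.1 + ofPoly C * AB.2 := by
  obtain ⟨A, hA, B, hB, hAB⟩ := exists_eq_of_evOn_eq_zero _ isAffineOpen_yChart h.left h.right
    h.presents_yChart hj hl (yOpen_le_yChart hj hl) (yOpen_eq_basicOpen hj hl)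
    (isUnit_res_yCrd le_rfl _) hF h0
  exact ⟨(A, B), hA, hB, hAB⟩

/-- The cochains supplied by the Koszul argument need not be bihomogeneous. Projecting to bidegree
`(0, 0)` is harmless, since the projection of a multiple of `Q` or `C` still vanishes on `Y`. -/
lemma yEv_proj (h : IsSmoothPair Q C) (hW : W ≤ yOpen Q C s J) (hc : W ≤ yChart Q C j l)
    {A B : Laurent Var} (hA : A ∈ reg J s) (hB : B ∈ reg J s) :
    yEv hc (proj (bideg 0 0) (ofPoly Q * A + ofPoly C * B)) = 0 := by
  rw [map_add, map_add]
  have h1 := evOn_proj_mul (yToBase Q C) (isUnit_res_yCrd hW hc) h.left (h.aeval_res_left hc) hA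
  have h2 := evOn_proj_mul (yToBase Q C) (isUnit_res_yCrd hW hc) h.right (h.aeval_res_right hc) hB
  exact (congrArg₂ (· + ·) h1 h2).trans (add_zero 0)

lemma proj_mem_inter {F : Laurent Var} (hF : F ∈ reg J s) :
    proj (bideg 0 0) F ∈ supp (negIn (allow s J) ∩ bideg 0 0) := proj_mem _ hF

/-- Laurent polynomials of bidegree `0` without denominators in `x` that vanish on `Y` are `0`. -/
lemma eq_zero_of_yEv_eq_zero (h : IsSmoothPair Q C) (hl : l ∈ J) {F : Laurent Var}
    (hF : F ∈ supp (negIn (allow [] J) ∩ bideg 0 0))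
    (h0 : ∀ j, yEv (Q := Q) (C := C) (yOpen_le_yChart (s := [j]) (by simp : j ∈ [j]) hl) F = 0) :
    F = 0 := by
  have hF' (j : Fin 5) : F ∈ supp (negIn (allow [j] J) ∩ bideg 0 0) :=
    supp_mono (Set.inter_subset_inter_left _ (negIn_mono (allow_mono (by simp) subset_rfl))) hF
  choose AB hA hB hAB using fun j ↦ h.exists_eq_of_yEv_eq_zero (s := [j]) (by simp) hl (hF' j) (h0 j)
  have hlist (s : List (Fin 5)) (hs : s.length = 1) : s = [s.headI] := by
    obtain ⟨i, rfl⟩ := List.length_eq_one_iff.mp hs; rfl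
  have hd (c : List (Fin 5) → Laurent Var) (j : Fin 5) : cechD c [j] = c [] := by
    rw [cechD_cons, cechD_nil, sub_zero]
  -- The value of a cochain on the empty list is a polynomial in `x`. The case `n = 0` yields `F = Q
  -- a + C b` with `a` and `b` free of denominators in `x`.
  obtain ⟨a, b, ha, hb, hab⟩ := exists_cocycle h.isRelPrime h.ne_zero_left h.ne_zero_right
    (J := J) (n := 0) (by omega) (c := fun _ ↦ F) (A := fun s ↦ (AB s.headI).1)
    (B := fun s ↦ (AB s.headI).2)
    (fun s hs ↦ by rw [hlist s hs]; exact hA _) (fun s hs ↦ by rw [hlist s hs]; exact hB _)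
    (fun s hs ↦ by rw [hlist s hs, hd]; exact hAB _)
  have h1 := hab [0] rfl
  rw [hd, sub_eq_zero] at h1
  -- Each exponent of such a multiple has positive total degree in `x`, whereas `F` has degree `0`.
  have key {G : MvPolynomial Var ℂ} {m n : ℕ} (hG : IsBihomogeneous (m := 4) (n := 1) G m n)
      (hm : 0 < m) {f : Laurent Var} (hf : f ∈ reg J []) :
      ofPoly G * f ∈ supp {u : Var → ℤ | 0 < ∑ i, u (.inl i)} := by
    refine mul_mem_supp (fun u hu v hv ↦ ?_) (ofPoly_mem_bideg hG) hf
    have h2 : ∑ i, u (.inl i) = m := (mem_bideg.mp hu).1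
    have h3 : 0 ≤ ∑ i, v (.inl i) := Finset.sum_nonneg fun i _ ↦ mem_negIn.mp hv _ (by
      rw [inl_mem_allow]; simp)
    rw [Set.mem_ofPred_eq]
    simp only [Pi.add_apply, Finset.sum_add_distrib, h2]
    omega
  refine eq_zero_of_disjoint (E := bideg 0 0) (fun u hu hu' ↦ ?_)
    (supp_mono Set.inter_subset_right hF)
    (h1 ▸ add_mem (key h.left (by omega) (ha [] rfl)) (key h.right (by omega) (hb [] rfl)))
  rw [Set.mem_ofPred_eq, (mem_bideg.mp hu).1] at hu'
  exact lt_irrefl _ hu'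

/-- Compatible sections on the sets `{xⱼ ≠ 0}` come from a Laurent polynomial in `t`. -/
lemma exists_yEv_eq_of_compatible (h : IsSmoothPair Q C) (hl : l ∈ J)
    (g : ∀ j, Γ(yScheme Q C, yOpen Q C [j] J))
    (hg : ∀ i j, res (yOpen_anti (by simp) subset_rfl : yOpen Q C [i, j] J ≤ yOpen Q C [i] J) (g i) =
      res (yOpen_anti (by simp) subset_rfl) (g j)) :
    ∃ F ∈ supp (negIn (allow [] J) ∩ bideg 0 0),
      ∀ j, g j = yEv (yOpen_le_yChart (s := [j]) (by simp : j ∈ [j]) hl) F := by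
  choose F hF hFg using fun j ↦ h.exists_yEv_eq (s := [j]) (by simp : j ∈ [j]) hl (g j)
  have hF1 (j) : F j ∈ reg J [j] := supp_mono Set.inter_subset_left (hF j)
  have hle (i j s) (hi : i = j ∨ i ∈ s) : supp (negIn (allow [i] J) ∩ bideg 0 0) ≤
      supp (negIn (allow (j :: s) J) ∩ bideg 0 0) :=
    supp_mono (Set.inter_subset_inter_left _ (negIn_mono (allow_mono (by simpa using hi) subset_rfl)))
  have h1 (i j) : yEv (Q := Q) (C := C) (yOpen_le_yChart (s := [i, j]) (by simp : i ∈ [i, j]) hl) (F j - F i) = 0 := by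
    have h2 := hg i j
    rw [← hFg, ← hFg, res_yEv le_rfl _ _ (hF1 i), res_yEv le_rfl _ _ (hF1 j),
      yEv_change (s := [i, j]) le_rfl _ (yOpen_le_yChart (s := [i, j]) (by simp : i ∈ [i, j]) hl)
      (hle j i [j] (by simp) (hF j))] at h2
    rw [map_sub, h2, sub_self]
  choose AB hA hB hAB using fun i j ↦ h.exists_eq_of_yEv_eq_zero (s := [i, j]) (by simp) hl
    (sub_mem (hle j i [j] (by simp) (hF j)) (hle i i [j] (by simp) (hF i))) (h1 i j)
  have hlist (s : List (Fin 5)) (hs : s.length = 2) : s = [s.headI, s.tail.headI] := by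
    obtain ⟨i, j, rfl⟩ := List.length_eq_two.mp hs; rfl
  have hd (c : List (Fin 5) → Laurent Var) (i j : Fin 5) : cechD c [i, j] = c [j] - c [i] := by
    rw [cechD_cons, cechD_cons, cechD_nil, sub_zero]
  obtain ⟨a, b, ha, hb, hab⟩ := exists_cocycle h.isRelPrime h.ne_zero_left h.ne_zero_right
    (J := J) (n := 1) (by omega) (c := fun s ↦ F s.headI)
    (A := fun s ↦ (AB s.headI s.tail.headI).1) (B := fun s ↦ (AB s.headI s.tail.headI).2)
    (fun s hs ↦ by rw [hlist s hs]; exact hA _ _) (fun s hs ↦ by rw [hlist s hs]; exact hB _ _)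
    (fun s hs ↦ by rw [hlist s hs, hd]; exact hAB _ _)
  -- The corrected cochain is a cocycle: the `G j` are one and the same Laurent polynomial.
  let G (j : Fin 5) : Laurent Var := F j - (ofPoly Q * a [j] + ofPoly C * b [j])
  have hGG (i j) : G i = G j := by
    have h2 := hab [i, j] rfl
    rw [hd, sub_eq_zero] at h2
    exact h2.symm
  have hab' (j) : ofPoly Q * a [j] + ofPoly C * b [j] ∈ reg J [j] :=
    add_mem (mul_mem (ofPoly_mem Q _) (ha [j] rfl)) (mul_mem (ofPoly_mem C _) (hb [j] rfl))
  have hG (j) : G j ∈ reg J [j] := sub_mem (hF1 j) (hab' j)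
  -- Negative exponents could occur only at `x₀`, because of the chart `0`, and only at `x₁`,
  -- because of the chart `1`; so there are none in `x`.
  have hG0 : G 0 ∈ reg J [] := by
    refine supp_mono (fun u hu ↦ mem_negIn.mpr fun k hk ↦ ?_)
      (mem_supp_inter (hG 0) (hGG 0 1 ▸ hG 1))
    rcases k with k | k
    · by_cases hk0 : k = 0
      · exact mem_negIn.mp hu.2 _ (by rw [inl_mem_allow, hk0]; simp)
      · exact mem_negIn.mp hu.1 _ (by rw [inl_mem_allow]; simpa using hk0)
    · exact mem_negIn.mp hu.1 _ hk
  refine ⟨proj (bideg 0 0) (G 0), proj_mem_inter hG0, fun j ↦ ?_⟩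
  have h2 : F j = G j + (ofPoly Q * a [j] + ofPoly C * b [j]) := (sub_add_cancel _ _).symm
  have h3 : proj (bideg 0 0) (F j) = F j := proj_eq_self (supp_mono Set.inter_subset_right (hF j))
  rw [← hFg, ← h3, h2, map_add, map_add, h.yEv_proj le_rfl _ (ha [j] rfl) (hb [j] rfl), add_zero,
    hGG j 0]

/-- The first cohomology of `{tₗ ≠ 0 : l ∈ J}` vanishes. -/
lemma exists_eq_sub_of_cocycle (h : IsSmoothPair Q C) (hl : l ∈ J)
    (f : ∀ i j, Γ(yScheme Q C, yOpen Q C [i, j] J))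
    (hf : ∀ i j k, res (yOpen_anti (by simp) subset_rfl : yOpen Q C [i, j, k] J ≤ _) (f i j) +
      res (yOpen_anti (by simp) subset_rfl) (f j k) = res (yOpen_anti (by simp) subset_rfl) (f i k)) :
    ∃ g : ∀ j, Γ(yScheme Q C, yOpen Q C [j] J), ∀ i j,
      f i j = res (yOpen_anti (by simp) subset_rfl) (g j) -
        res (yOpen_anti (by simp) subset_rfl) (g i) := by
  choose F hF hFf using fun i j ↦ h.exists_yEv_eq (s := [i, j]) (by simp : i ∈ [i, j]) hl (f i j)
  have hF1 (i j) : F i j ∈ reg J [i, j] := supp_mono Set.inter_subset_left (hF i j)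
  have hle (s s' : List (Fin 5)) (hs : ∀ i ∈ s, i ∈ s') : supp (negIn (allow s J) ∩ bideg 0 0) ≤
      supp (negIn (allow s' J) ∩ bideg 0 0) :=
    supp_mono (Set.inter_subset_inter_left _ (negIn_mono (allow_mono hs subset_rfl)))
  have h1 (i j k) : yEv (Q := Q) (C := C) (yOpen_le_yChart (s := [i, j, k]) (by simp : i ∈ [i, j, k]) hl)
      (F j k - (F i k - F i j)) = 0 := by
    have h2 := hf i j k
    rw [← hFf, ← hFf, ← hFf, res_yEv le_rfl _ _ (hF1 i j), res_yEv le_rfl _ _ (hF1 j k),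
      res_yEv le_rfl _ _ (hF1 i k),
      yEv_change (s := [i, j, k]) le_rfl _
      (yOpen_le_yChart (s := [i, j, k]) (by simp : i ∈ [i, j, k]) hl)
      (hle [j, k] [i, j, k] (by simp) (hF j k))] at h2
    rw [map_sub, map_sub, ← h2]
    abel
  choose AB hA hB hAB using fun i j k ↦ h.exists_eq_of_yEv_eq_zero (s := [i, j, k]) (by simp) hl
    (sub_mem (hle [j, k] [i, j, k] (by simp) (hF j k))
      (sub_mem (hle [i, k] [i, j, k] (by simp) (hF i k))
        (hle [i, j] [i, j, k] (by simp) (hF i j)))) (h1 i j k)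
  have hlist (s : List (Fin 5)) (hs : s.length = 3) :
      s = [s.headI, s.tail.headI, s.tail.tail.headI] := by
    obtain ⟨i, j, k, rfl⟩ := List.length_eq_three.mp hs; rfl
  have hd (c : List (Fin 5) → Laurent Var) (i j k : Fin 5) :
      cechD c [i, j, k] = c [j, k] - (c [i, k] - c [i, j]) := by
    rw [cechD_cons, cechD_cons, cechD_cons, cechD_nil, sub_zero]
  have hd' (c : List (Fin 5) → Laurent Var) (i j : Fin 5) : cechD c [i, j] = c [j] - c [i] := by
    rw [cechD_cons, cechD_cons, cechD_nil, sub_zero]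
  obtain ⟨a, b, ha, hb, hab⟩ := exists_cocycle h.isRelPrime h.ne_zero_left h.ne_zero_right
    (J := J) (n := 2) (by omega) (c := fun s ↦ F s.headI s.tail.headI)
    (A := fun s ↦ (AB s.headI s.tail.headI s.tail.tail.headI).1)
    (B := fun s ↦ (AB s.headI s.tail.headI s.tail.tail.headI).2)
    (fun s hs ↦ by rw [hlist s hs]; exact hA _ _ _)
    (fun s hs ↦ by rw [hlist s hs]; exact hB _ _ _)
    (fun s hs ↦ by rw [hlist s hs, hd]; exact hAB _ _ _)
  let G (s : List (Fin 5)) : Laurent Var :=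
    F s.headI s.tail.headI - (ofPoly Q * a s + ofPoly C * b s)
  have hG (s : List (Fin 5)) (hs : s.length = 2) : G s ∈ reg J s := by
    refine sub_mem ?_ (add_mem (mul_mem (ofPoly_mem Q _) (ha s hs))
      (mul_mem (ofPoly_mem C _) (hb s hs)))
    obtain ⟨i, j, rfl⟩ := List.length_eq_two.mp hs
    exact hF1 i j
  -- Once it is an honest cocycle of Laurent polynomials, the cochain is the coboundary of its
  -- homotopy; the projection to bidegree `(0, 0)` then descends to `Y`.
  have hGh := cechD_homotopy (by omega) hG hab
  have hH (j : Fin 5) : homotopy G [j] ∈ reg J [j] := homotopy_mem hG [j] rfl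
  have hP (j : Fin 5) := proj_mem_inter (hH j)
  refine ⟨fun j ↦ yEv (yOpen_le_yChart (s := [j]) (by simp : j ∈ [j]) hl)
    (proj (bideg 0 0) (homotopy G [j])), fun i j ↦ ?_⟩
  have h2 : F i j = homotopy G [j] - homotopy G [i] +
      (ofPoly Q * a [i, j] + ofPoly C * b [i, j]) := by
    rw [← hd', hGh [i, j] rfl]
    exact (sub_add_cancel _ _).symm
  have h3 : proj (bideg 0 0) (F i j) = F i j :=
    proj_eq_self (supp_mono Set.inter_subset_right (hF i j))
  rw [← hFf, ← h3, h2, map_add, map_add, map_sub, map_sub,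
    h.yEv_proj le_rfl _ (ha [i, j] rfl) (hb [i, j] rfl), add_zero,
    res_yEv le_rfl _ _ (supp_mono Set.inter_subset_left (hP i)),
    res_yEv le_rfl _ _ (supp_mono Set.inter_subset_left (hP j)),
    yEv_change (s := [i, j]) le_rfl _ (yOpen_le_yChart (s := [i, j]) (by simp : j ∈ [i, j]) hl)
      (hle [j] [i, j] (by simp) (hP j))]

end IsSmoothPair

end YOpens

/-! ### Vanishing of `H¹` for the cover by all charts. -/

section CechComplex

variable {Y : Scheme.{0}} {ι : Type} {U : ι → Y.Opens}

lemma res_cocycle {f : ∀ i j, Γ(Y, U i ⊓ U j)}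
    (hf : ∀ i j k,
      res (le_inf (inf_le_left.trans inf_le_left) (inf_le_left.trans inf_le_right) :
        U i ⊓ U j ⊓ U k ≤ U i ⊓ U j) (f i j) +
      res (le_inf (inf_le_left.trans inf_le_right) inf_le_right :
        U i ⊓ U j ⊓ U k ≤ U j ⊓ U k) (f j k) =
      res (le_inf (inf_le_left.trans inf_le_left) inf_le_right :
        U i ⊓ U j ⊓ U k ≤ U i ⊓ U k) (f i k))
    {W : Y.Opens} {i j k : ι} (hi : W ≤ U i) (hj : W ≤ U j) (hk : W ≤ U k) :
    res (le_inf hi hj) (f i j) + res (le_inf hj hk) (f j k) = res (le_inf hi hk) (f i k) := by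
  have h := congrArg (res (le_inf (le_inf hi hj) hk)) (hf i j k)
  simpa only [map_add, res_res] using h

end CechComplex

namespace IsSmoothPair

open MvPolynomial Laurent

variable {Q C : MvPolynomial (Fin 5 ⊕ Fin 2) ℂ}

lemma yOpen_singleton (j : Fin 5) (l : Fin 2) : yOpen Q C [j] {l} = yChart Q C j l := by
  ext x
  rw [SetLike.mem_coe, SetLike.mem_coe, mem_yOpen, mem_yChart]
  exact ⟨fun h ↦ ⟨h.1 j (List.mem_singleton_self j), h.2 l rfl⟩,
    fun h ↦ ⟨fun i hi ↦ List.mem_singleton.mp hi ▸ h.1,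
      fun i hi ↦ Set.mem_singleton_iff.mp hi ▸ h.2⟩⟩

lemma le_yOpen {W : (yScheme Q C).Opens} {s : List (Fin 5)} {J : Set (Fin 2)}
    (hs : ∀ i ∈ s, ∃ l, W ≤ yChart Q C i l) (hJ : ∀ l ∈ J, ∃ i, W ≤ yChart Q C i l) :
    W ≤ yOpen Q C s J := by
  intro x hx
  refine mem_yOpen.mpr ⟨fun i hi ↦ ?_, fun l hl ↦ ?_⟩
  · obtain ⟨l, hl⟩ := hs i hi
    exact (mem_yChart.mp (hl hx)).1
  · obtain ⟨i, hi⟩ := hJ l hl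
    exact (mem_yChart.mp (hi hx)).2

/-- A Laurent polynomial of bidegree `0` in `t` is the difference of two polynomials in `t₀/t₁` and
`t₁/t₀`. -/
lemma exists_eq_sub_of_mem {p : Laurent Var} (hp : p ∈ supp (negIn (allow [] Set.univ) ∩ bideg 0 0)) :
    ∃ q : Fin 2 → Laurent Var, (∀ l, q l ∈ supp (negIn (allow [] {l}) ∩ bideg 0 0)) ∧
      p = q 1 - q 0 := by
  let E : Set (Var → ℤ) := {u | 0 ≤ u (.inr 0)}
  have key (u : Var → ℤ) (l : Fin 2) (hu : u ∈ negIn (allow [] Set.univ) ∩ bideg 0 0)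
      (hl : ∀ k, k ≠ l → 0 ≤ u (.inr k)) : u ∈ negIn (allow [] {l}) ∩ bideg 0 0 := by
    refine ⟨mem_negIn.mpr ?_, hu.2⟩
    rintro (k | k) hk
    · exact mem_negIn.mp hu.1 _ (by rw [inl_mem_allow]; simp)
    · exact hl k fun hkl ↦ hk (by rw [inr_mem_allow, hkl]; rfl)
  refine ⟨![-proj Eᶜ p, proj E p], fun l ↦ ?_, ?_⟩
  · fin_cases l
    · refine neg_mem (supp_mono (fun u hu ↦ key u 0 hu.1 fun k hk ↦ ?_) (proj_mem Eᶜ hp))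
      obtain rfl : k = 1 := by omega
      have h1 : ¬ 0 ≤ u (.inr 0) := hu.2
      have h2 := (mem_bideg.mp hu.1.2).2
      simp only [Fin.sum_univ_two] at h2
      omega
    · refine supp_mono (fun u hu ↦ key u 1 hu.1 fun k hk ↦ ?_) (proj_mem E hp)
      obtain rfl : k = 0 := by omega
      exact hu.2
  · change p = proj E p - -proj Eᶜ p
    rw [sub_neg_eq_add, proj_add_proj_compl]

/-- For fixed `l`, `H¹` of `{tₗ ≠ 0}` vanishes. After correction on these two sets, a cocycle
reduces to one function on `{t₀ t₁ ≠ 0}`. Such a function is a Laurent polynomial in `t` alone and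
splits as on `ℙ¹`. -/
theorem hasVanishingH1 (h : IsSmoothPair Q C) : HasVanishingH1 (yScheme Q C) := by
  let U (a : Fin 5 × Fin 2) : (yScheme Q C).Opens := yChart Q C a.1 a.2
  refine ⟨Fin 5 × Fin 2, U, fun a ↦ isAffineOpen_yChart, iSup_yChart, fun f hf ↦ ?_⟩
  have hfc {W : (yScheme Q C).Opens} {a b c : Fin 5 × Fin 2} (ha : W ≤ U a) (hb : W ≤ U b)
      (hc : W ≤ U c) := res_cocycle hf ha hb hc
  have h2 (s : List (Fin 5)) (J : Set (Fin 2)) (j l) (hj : j ∈ s) (hl : l ∈ J) :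
    yOpen Q C s J ≤ U (j, l) := yOpen_le_yChart hj hl
  have h3 (l : Fin 2) := h.exists_eq_sub_of_cocycle (J := {l}) (l := l) rfl
    (fun i j ↦ res (le_inf (h2 [i, j] {l} i l (by simp) rfl) (h2 [i, j] {l} j l (by simp) rfl))
      (f (i, l) (j, l))) (fun i j k ↦ by
        simp only [res_res]
        exact hfc (h2 [i, j, k] {l} i l (by simp) rfl) (h2 [i, j, k] {l} j l (by simp) rfl)
          (h2 [i, j, k] {l} k l (by simp) rfl))
  choose g hg using h3
  let g₁ (a : Fin 5 × Fin 2) : Γ(yScheme Q C, U a) := res (yOpen_singleton a.1 a.2).ge (g a.2 a.1)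
  have hg₁ {W : (yScheme Q C).Opens} (i j l) (hi : W ≤ U (i, l)) (hj : W ≤ U (j, l)) :
      res (le_inf hi hj) (f (i, l) (j, l)) = res hj (g₁ (j, l)) - res hi (g₁ (i, l)) := by
    have hW : W ≤ yOpen Q C [i, j] {l} := le_yOpen
      (fun k hk ↦ by
        rcases List.mem_pair.mp hk with rfl | rfl
        exacts [⟨l, hi⟩, ⟨l, hj⟩])
      fun k hk ↦ ⟨i, Set.mem_singleton_iff.mp hk ▸ hi⟩
    have h4 := congrArg (res hW) (hg l i j)
    rw [map_sub] at h4
    simp only [res_res] at h4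
    refine h4.trans ?_
    simp only [g₁, res_res]
  -- After the correction by `g₁` the component between `(j, 0)` and `(j, 1)` no longer depends on
  -- `j`, so these components glue over `{t₀ t₁ ≠ 0}`.
  have h5 (i j : Fin 5) {W : (yScheme Q C).Opens} (hi0 : W ≤ U (i, 0)) (hi1 : W ≤ U (i, 1))
      (hj0 : W ≤ U (j, 0)) (hj1 : W ≤ U (j, 1)) :
      res (le_inf hi0 hi1) (f (i, 0) (i, 1)) - res hi1 (g₁ (i, 1)) + res hi0 (g₁ (i, 0)) =
      res (le_inf hj0 hj1) (f (j, 0) (j, 1)) - res hj1 (g₁ (j, 1)) + res hj0 (g₁ (j, 0)) := by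
    have e1 := hfc hi0 hi1 hj1
    have e2 := hfc hi0 hj0 hj1
    rw [hg₁ i j 1 hi1 hj1] at e1
    rw [hg₁ i j 0 hi0 hj0] at e2
    linear_combination e1 - e2
  obtain ⟨p, hp, hpg⟩ := h.exists_yEv_eq_of_compatible (J := Set.univ) (l := 0) (Set.mem_univ _)
    (fun j ↦ res (le_inf (h2 [j] _ j 0 (by simp) (Set.mem_univ _))
      (h2 [j] _ j 1 (by simp) (Set.mem_univ _))) (f (j, 0) (j, 1)) -
      res (h2 [j] _ j 1 (by simp) (Set.mem_univ _)) (g₁ (j, 1)) +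
      res (h2 [j] _ j 0 (by simp) (Set.mem_univ _)) (g₁ (j, 0))) (fun i j ↦ by
        simp only [map_add, map_sub, res_res]
        exact h5 i j (h2 [i, j] _ i 0 (by simp) (Set.mem_univ _))
          (h2 [i, j] _ i 1 (by simp) (Set.mem_univ _)) (h2 [i, j] _ j 0 (by simp) (Set.mem_univ _))
          (h2 [i, j] _ j 1 (by simp) (Set.mem_univ _)))
  -- `H¹(ℙ¹, 𝒪) = 0`: the part with non-negative exponent of `t₀` is regular where `t₁ ≠ 0`, and the
  -- rest where `t₀ ≠ 0`.
  obtain ⟨q, hq, rfl⟩ := exists_eq_sub_of_mem hp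
  let g₂ (a : Fin 5 × Fin 2) : Γ(yScheme Q C, U a) := yEv (le_refl (yChart Q C a.1 a.2)) (q a.2)
  have hreg (l) : q l ∈ reg {l} [] := supp_mono Set.inter_subset_left (hq l)
  have hres (a : Fin 5 × Fin 2) {W : (yScheme Q C).Opens} (ha : W ≤ U a) :
      res ha (g₂ a) = yEv ha (q a.2) :=
    res_yEv (s := []) (J := {a.2}) (le_yOpen (by simp) fun k hk ↦
      ⟨a.1, Set.mem_singleton_iff.mp hk ▸ le_rfl⟩) _ _ (hreg a.2)
  have hchange (i j l) {W : (yScheme Q C).Opens} (hi : W ≤ U (i, l)) (hj : W ≤ U (j, l)) :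
      res hi (g₂ (i, l)) = res hj (g₂ (j, l)) := by
    rw [hres, hres]
    exact yEv_change (s := []) (J := {l}) (le_yOpen (by simp) fun k hk ↦
      ⟨i, Set.mem_singleton_iff.mp hk ▸ hi⟩) hi hj (hq l)
  have h6 (i j : Fin 5) {W : (yScheme Q C).Opens} (hi : W ≤ U (i, 0)) (hj : W ≤ U (j, 1)) :
      res (le_inf hi hj) (f (i, 0) (j, 1)) =
        res hj (g₁ (j, 1) + g₂ (j, 1)) - res hi (g₁ (i, 0) + g₂ (i, 0)) := by
    -- On `W` both `xⱼ` and `t₀` are invertible, so the index `(j, 0)` can be inserted between `(i,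
    -- 0)` and `(j, 1)`.
    have hj0 : W ≤ U (j, 0) := fun x hx ↦
      mem_yChart.mpr ⟨(mem_yChart.mp (hj hx)).1, (mem_yChart.mp (hi hx)).2⟩
    have e1 := hfc hi hj0 hj
    rw [hg₁ i j 0 hi hj0] at e1
    have hW : W ≤ yOpen Q C [j] Set.univ := le_yOpen (fun k hk ↦
      ⟨1, List.mem_singleton.mp hk ▸ hj⟩) (fun l _ ↦ by
        fin_cases l
        exacts [⟨i, hi⟩, ⟨j, hj⟩])
    have e2 := congrArg (res hW) (hpg j)
    rw [res_yEv le_rfl _ _ (supp_mono Set.inter_subset_left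
      (supp_mono (Set.inter_subset_inter_left _ (negIn_mono (allow_mono (by simp) subset_rfl))) hp)),
      map_sub] at e2
    simp only [map_add, map_sub, res_res] at e2
    have e3 : yEv (hW.trans (yOpen_le_yChart (List.mem_singleton_self j) (Set.mem_univ 0))) (q 0) =
      res hi (g₂ (i, 0)) := by
        rw [hchange i j 0 hi hj0, hres]
    have e4 : yEv (hW.trans (yOpen_le_yChart (List.mem_singleton_self j) (Set.mem_univ 0))) (q 1) =
      res hj (g₂ (j, 1)) := by
        rw [hres]
        exact yEv_change (s := []) (J := {1}) (le_yOpen (by simp) fun k hk ↦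
          ⟨j, Set.mem_singleton_iff.mp hk ▸ hj⟩) hj0 hj (hq 1)
    rw [e3, e4] at e2
    rw [map_add, map_add]
    linear_combination e2 - e1
  have hself (a) {W : (yScheme Q C).Opens} (ha : W ≤ U a) : res (le_inf ha ha) (f a a) = 0 := by
    have := hfc ha ha ha
    linear_combination this
  have h7 (a b) {W : (yScheme Q C).Opens} (ha : W ≤ U a) (hb : W ≤ U b) :
      res (le_inf ha hb) (f a b) = res hb (g₁ b + g₂ b) - res ha (g₁ a + g₂ a) := by
    obtain ⟨i, l⟩ := a
    obtain ⟨j, m⟩ := b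
    by_cases hlm : l = m
    · subst hlm
      rw [hg₁ i j l ha hb, map_add, map_add, hchange i j l ha hb]
      ring
    · by_cases hl : l = 0
      · obtain rfl : m = 1 := by omega
        subst hl
        exact h6 i j ha hb
      · obtain rfl : m = 0 := by omega
        obtain rfl : l = 1 := by omega
        have e1 := hfc ha hb ha
        rw [hself _ ha, h6 j i hb ha] at e1
        linear_combination e1
  refine ⟨fun a ↦ g₁ a + g₂ a, fun a b ↦ ?_⟩
  rw [← h7 a b inf_le_left inf_le_right]
  exact (res_self le_rfl (f a b)).symm

end IsSmoothPair

/-! ### Global functions and connectedness of `Y`. -/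

section Connected

variable {Y : Scheme.{0}}

lemma eq_of_res_eq {ι : Type} {V : Y.Opens} (U : ι → Y.Opens) (hU : ∀ i, U i ≤ V)
    (hV : V ≤ ⨆ i, U i) {a b : Γ(Y, V)} (h : ∀ i, res (hU i) a = res (hU i) b) : a = b :=
  Y.sheaf.eq_of_locally_eq' U V (fun i ↦ homOfLE (hU i)) hV a b h

lemma eq_bot_of_isUnit_zero {U : Y.Opens} (h : IsUnit (0 : Γ(Y, U))) : U = ⊥ := by
  rw [← Scheme.basicOpen_of_isUnit Y h, Scheme.basicOpen_zero]

lemma exists_idempotent_of_isClopen {s : Set Y} (hs : IsClopen s) :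
    ∃ e : Γ(Y, ⊤), res (le_top : (⟨s, hs.2⟩ : Y.Opens) ≤ ⊤) e = 0 ∧
      res (le_top : (⟨sᶜ, hs.compl.2⟩ : Y.Opens) ≤ ⊤) e = 1 := by
  let U : Bool → Y.Opens := fun b ↦ bif b then ⟨sᶜ, hs.compl.2⟩ else ⟨s, hs.2⟩
  let sf : ∀ b, Γ(Y, U b) := fun b ↦ match b with
    | true => (1 : Γ(Y, U true))
    | false => (0 : Γ(Y, U false))
  have hsub (W : Y.Opens) (hW : W ≤ ⊥) (a b : Γ(Y, W)) : a = b :=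
    eq_of_res_eq (ι := Empty) (fun i ↦ i.elim) (fun i ↦ i.elim) (hW.trans bot_le) fun i ↦ i.elim
  obtain ⟨e, he, -⟩ := Y.sheaf.existsUnique_gluing' U ⊤ (fun i ↦ homOfLE le_top)
    (fun x _ ↦ by
      rw [Opens.mem_iSup]
      by_cases hx : x ∈ s
      · exact ⟨false, hx⟩
      · exact ⟨true, hx⟩) sf (by
      intro i j
      rcases i with _ | _ <;> rcases j with _ | _
      · rfl
      · exact hsub _ (fun x (hx : x ∈ s ∧ x ∈ sᶜ) ↦ (hx.2 hx.1).elim) _ _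
      · exact hsub _ (fun x (hx : x ∈ sᶜ ∧ x ∈ s) ↦ (hx.1 hx.2).elim) _ _
      · rfl)
  exact ⟨e, he false, he true⟩

/-- A clopen set gives a function that is `0` on it and `1` on its complement. If the function is a
constant, one of the two sets is empty. -/
lemma preconnectedSpace_of_constHom {p : Y ⟶ SpecC} (h : ∀ e : Γ(Y, ⊤), ∃ c, e = constHom p ⊤ c) :
    PreconnectedSpace Y := by
  rw [preconnectedSpace_iff_clopen]
  intro s hs
  obtain ⟨e, h0, h1⟩ := exists_idempotent_of_isClopen hs
  obtain ⟨c, rfl⟩ := h e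
  rw [res_constHom] at h0 h1
  by_cases hc : c = 0
  · right
    rw [hc, map_zero] at h1
    have h2 := eq_bot_of_isUnit_zero (h1 ▸ isUnit_one)
    rw [← Set.compl_empty_iff]
    exact congrArg (SetLike.coe) h2
  · left
    have h2 := eq_bot_of_isUnit_zero (h0 ▸ (IsUnit.mk0 c hc).map (constHom p _))
    exact congrArg (SetLike.coe) h2

end Connected

namespace IsSmoothPair

open MvPolynomial Laurent

variable {Q C : MvPolynomial (Fin 5 ⊕ Fin 2) ℂ}

lemma zero_mem_supp (s : List (Fin 5)) (J : Set (Fin 2)) (c : ℂ) :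
    mono 0 c ∈ supp (negIn (allow s J) ∩ bideg 0 0) :=
  mono_mem (E := negIn (allow s J) ∩ bideg 0 0)
    ⟨mem_negIn.mpr fun _ _ ↦ le_rfl, mem_bideg.mpr (by simp)⟩ c

/-- On an empty scheme the constant `1` would evaluate to zero, although a nonzero Laurent
polynomial of bidegree `(0, 0)` without denominators in `x` does not vanish on `Y`. -/
theorem nonempty (h : IsSmoothPair Q C) : Nonempty (yScheme Q C) := by
  by_contra hne
  have h1 := h.eq_zero_of_yEv_eq_zero (J := {0}) (l := 0) rfl (zero_mem_supp [] {0} 1) fun j ↦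
    eq_of_res_eq (ι := Empty) (fun i ↦ i.elim) (fun i ↦ i.elim)
      (fun x _ ↦ (hne ⟨x⟩).elim) fun i ↦ i.elim
  exact one_ne_zero (α := Laurent Var) h1

/-- Over each `{tₗ ≠ 0}` a global function comes from a Laurent polynomial with denominators in `tₗ`
only. Both polynomials agree over the overlap, so there are no denominators, and bidegree `(0, 0)`
leaves a constant. -/
lemma exists_eq_constHom (h : IsSmoothPair Q C) (e : Γ(yScheme Q C, ⊤)) :
    ∃ c, e = constHom (yToBase Q C) ⊤ c := by
  have h1 (l : Fin 2) := h.exists_yEv_eq_of_compatible (J := {l}) (l := l) rfl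
    (fun j ↦ res le_top e) (fun i j ↦ by simp only [res_res])
  choose p hp hpe using h1
  have hreg (s : List (Fin 5)) (J J' : Set (Fin 2)) (hJ : J ⊆ J') :
      supp (negIn (allow [] J) ∩ bideg 0 0) ≤ supp (negIn (allow s J') ∩ bideg 0 0) :=
    supp_mono (Set.inter_subset_inter_left _ (negIn_mono (allow_mono (by simp) hJ)))
  have h2 (l : Fin 2) (j : Fin 5) : yEv (yOpen_le_yChart (Q := Q) (C := C) (s := [j])
      (by simp : j ∈ [j]) (Set.mem_univ 0)) (p l) = res le_top e := by
    have h3 := congrArg (res (yOpen_anti (fun _ hi ↦ hi) (Set.subset_univ _) :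
      yOpen Q C [j] Set.univ ≤ yOpen Q C [j] {l})) (hpe l j)
    rw [res_res, res_yEv le_rfl _ _ (supp_mono Set.inter_subset_left (hreg [j] _ _ subset_rfl (hp l)))]
      at h3
    rw [h3]
    exact yEv_change le_rfl _ _ (hreg [j] _ _ (Set.subset_univ _) (hp l))
  have h4 : p 1 - p 0 = 0 := h.eq_zero_of_yEv_eq_zero (J := Set.univ) (Set.mem_univ 0)
    (sub_mem (hreg [] _ _ (Set.subset_univ _) (hp 1)) (hreg [] _ _ (Set.subset_univ _) (hp 0)))
    fun j ↦ by rw [map_sub, h2, h2, sub_self]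
  rw [sub_eq_zero] at h4
  have h5 : ∃ c, p 0 = mono 0 c := by
    refine supp_induction (p := fun f ↦ ∃ c, f = mono 0 c) ⟨0, ?_⟩ ?_ ?_
      (mem_supp_inter (hp 0) (h4 ▸ hp 1))
    · exact (AddMonoidAlgebra.single_zero (0 : Var → ℤ)).symm
    · rintro _ _ ⟨c, rfl⟩ ⟨d, rfl⟩
      exact ⟨c + d, (AddMonoidAlgebra.single_add 0 c d).symm⟩
    · intro u hu c
      have hpos (k : Var) : 0 ≤ u k := by
        rcases k with k | k
        · exact mem_negIn.mp hu.1.1 _ (by rw [inl_mem_allow]; simp)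
        · by_cases hk : k = 0
          · exact mem_negIn.mp hu.2.1 _ (by rw [inr_mem_allow, hk]; simp)
          · exact mem_negIn.mp hu.1.1 _ (by rw [inr_mem_allow]; simpa using hk)
      have hb := mem_bideg.mp hu.1.2
      have hu0 : u = 0 := by
        funext k
        rcases k with k | k
        · exact (Finset.sum_eq_zero_iff_of_nonneg fun i _ ↦ hpos (.inl i)).mp hb.1 k
            (Finset.mem_univ k)
        · exact (Finset.sum_eq_zero_iff_of_nonneg fun i _ ↦ hpos (.inr i)).mp hb.2 k
            (Finset.mem_univ k)
      exact ⟨c, by rw [hu0]⟩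
  obtain ⟨c, hc⟩ := h5
  have hpl (l : Fin 2) : p l = mono 0 c := by
    by_cases hl : l = 0
    · rw [hl, hc]
    · obtain rfl : l = 1 := by omega
      rw [h4, hc]
  refine ⟨c, eq_of_res_eq (fun a : Fin 5 × Fin 2 ↦ yOpen Q C [a.1] {a.2}) (fun _ ↦ le_top)
    (fun x _ ↦ ?_) fun a ↦ ?_⟩
  · obtain ⟨j, l, hx⟩ := exists_mem_yChart x
    exact Opens.mem_iSup.mpr ⟨(j, l), (yOpen_singleton j l).ge hx⟩
  · rw [hpe, hpl, yEv_const, res_constHom]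

theorem connectedSpace (h : IsSmoothPair Q C) : ConnectedSpace (yScheme Q C) :=
  { preconnectedSpace_of_constHom h.exists_eq_constHom with toNonempty := h.nonempty }

end IsSmoothPair

/-! ### Irreducibility -/

section Etale

open TensorProduct

/-- An étale algebra over a field is a finite product of fields; `e` is the indicator of the factors
where `x` is nonzero, and `z` inverts `x` there. -/
lemma exists_idempotent_of_etale {K T : Type} [Field K] [CommRing T] [Algebra K T]
    [Algebra.Etale K T] (x : T) : ∃ e z, e * e = e ∧ x * z = e ∧ x * e = x := by
  classical
  obtain ⟨I, _, L, _, _, φ, -⟩ := (Algebra.FormallyEtale.iff_exists_algEquiv_prod K T).mp inferInstance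
  refine ⟨φ.symm fun i ↦ if φ x i = 0 then 0 else 1, φ.symm fun i ↦ (φ x i)⁻¹, ?_, ?_, ?_⟩ <;>
  · apply φ.injective
    funext i
    by_cases h : φ x i = 0 <;> simp [h]

/-- In an étale algebra over a normal domain, the zero divisors are separated by idempotents. -/
lemma exists_mul_eq_zero_of_etale {A S : Type} [CommRing A] [IsDomain A] [IsIntegrallyClosed A]
    [CommRing S] [Algebra A S] [Algebra.IsStandardEtale A S] {x y : S} (h : x * y = 0) :
    ∃ e, e * y = 0 ∧ x * (1 - e) = 0 := by
  let K := FractionRing A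
  obtain ⟨e₀, z₀, h1, h2, h3⟩ := exists_idempotent_of_etale (K := K) (T := K ⊗[A] S) (1 ⊗ₜ x)
  let c := Algebra.TensorProduct.comm A K S
  have hinj : Function.Injective (Algebra.TensorProduct.includeLeft : S →ₐ[S] S ⊗[A] K) :=
    Algebra.TensorProduct.includeLeft_injective (IsFractionRing.injective A K)
  have hc (s : S) : c (1 ⊗ₜ s) = s ⊗ₜ 1 := rfl
  -- An idempotent is integral. Integral closure commutes with smooth base change, and `A` is
  -- integrally closed, so the idempotent found over the fraction field already lies in `S`.
  have hint : IsIntegral S (c e₀) :=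
    ⟨Polynomial.X ^ 2 - Polynomial.X, by monicity!, by
      simp [pow_two, ← map_mul, h1]⟩
  obtain ⟨t, ht⟩ := (TensorProduct.toIntegralClosure_bijective_of_smooth (R := A) (S := S)
    (B := K)).2 ⟨c e₀, hint⟩
  have hbot : ∀ t : S ⊗[A] integralClosure A K, ∃ s : S, t = s ⊗ₜ 1 := by
    intro t
    induction t with
    | zero => exact ⟨0, (zero_tmul _ _).symm⟩
    | add a b ha hb =>
      obtain ⟨a, rfl⟩ := ha
      obtain ⟨b, rfl⟩ := hb
      exact ⟨a + b, (add_tmul _ _ _).symm⟩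
    | tmul s k =>
      obtain ⟨a, ha⟩ := IsIntegrallyClosed.isIntegral_iff.mp k.2
      refine ⟨a • s, ?_⟩
      rw [smul_tmul]
      congr 1
      ext
      rw [← ha]
      simp [Algebra.smul_def]
  obtain ⟨s, rfl⟩ := hbot t
  have hs : s ⊗ₜ[A] (1 : K) = c e₀ := by
    have := congrArg Subtype.val ht
    simpa [TensorProduct.toIntegralClosure] using this
  refine ⟨s, hinj ?_, hinj ?_⟩
  · rw [map_mul, map_zero]
    change (s ⊗ₜ[A] (1 : K)) * (y ⊗ₜ 1) = 0
    rw [hs, ← hc y, ← map_mul, ← h2, mul_right_comm, Algebra.TensorProduct.tmul_mul_tmul, h,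
      tmul_zero, zero_mul, map_zero]
  · rw [map_mul, map_sub, map_one, map_zero]
    change (x ⊗ₜ[A] (1 : K)) * (1 - s ⊗ₜ 1) = 0
    rw [hs, ← hc x, ← map_one c, ← map_sub, ← map_mul, mul_sub, mul_one, h3, sub_self, map_zero]

/-- The local rings of a smooth algebra are domains. -/
lemma exists_notMem_mul_eq_zero_of_smooth {T : Type} [CommRing T] [Algebra ℂ T] [Algebra.Smooth ℂ T]
    (p : Ideal T) [hp : p.IsPrime] {x y : T} (h : x * y = 0) :
    (∃ s, s ∉ p ∧ s * x = 0) ∨ ∃ s, s ∉ p ∧ s * y = 0 := by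
  obtain ⟨f, hfp, n, _, _, _⟩ :=
    Algebra.IsSmoothAt.exists_isStandardEtale_mvPolynomial (R := ℂ) (p := p)
  obtain ⟨e, he1, he2⟩ := exists_mul_eq_zero_of_etale (A := MvPolynomial (Fin n) ℂ)
    (S := Localization.Away f) (x := algebraMap _ _ x) (y := algebraMap _ _ y)
    (by rw [← map_mul, h, map_zero])
  obtain ⟨t, ⟨_, k, rfl⟩, hte⟩ := IsLocalization.exists_mk'_eq (Submonoid.powers f) e
  have hfk (k : ℕ) : f ^ k ∉ p := fun h' ↦ hfp (hp.mem_of_pow_mem k h')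
  have key (t' y : T) (h : algebraMap T (Localization.Away f) (t' * y) = 0) :
      ∃ m, f ^ m * t' * y = 0 := by
    rw [IsLocalization.map_eq_zero_iff (Submonoid.powers f)] at h
    obtain ⟨⟨_, m, rfl⟩, hm⟩ := h
    exact ⟨m, by rw [mul_assoc]; exact hm⟩
  have hf : IsUnit (algebraMap T (Localization.Away f) (f ^ k)) :=
    IsLocalization.map_units (Localization.Away f) (⟨_, k, rfl⟩ : Submonoid.powers f)
  have he : algebraMap T (Localization.Away f) t = algebraMap T (Localization.Away f) (f ^ k) * e := by
    rw [← hte]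
    exact (IsLocalization.mk'_spec' (Localization.Away f) t _).symm
  -- One of `e` and `1 - e` is nonzero at `p`; its numerator annihilates the corresponding factor.
  by_cases ht : t ∈ p
  · left
    obtain ⟨m, hm⟩ := key (f ^ k - t) x (by
      rw [map_mul, map_sub, he]
      linear_combination algebraMap T (Localization.Away f) (f ^ k) * he2)
    refine ⟨f ^ m * (f ^ k - t), fun h' ↦ ?_, hm⟩
    rcases hp.mem_or_mem h' with h' | h'
    · exact hfk m h'
    · exact hfk k (by simpa using add_mem h' ht)
  · right
    obtain ⟨m, hm⟩ := key t y (by rw [map_mul, he, mul_assoc, he1, mul_zero])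
    refine ⟨f ^ m * t, fun h' ↦ ?_, hm⟩
    rcases hp.mem_or_mem h' with h' | h'
    · exact hfk m h'
    · exact ht h'

/-- The kernel of the localization at `p` is prime, because the local ring is a domain. It is
contained in every prime ideal below `p`. -/
lemma exists_prime_le_of_smooth {T : Type} [CommRing T] [Algebra ℂ T] [Algebra.Smooth ℂ T]
    (p : PrimeSpectrum T) : ∃ q : PrimeSpectrum T, ∀ p' : PrimeSpectrum T, p' ≤ p → q ≤ p' := by
  let q : Ideal T :=
    { carrier := {x | ∃ s, s ∉ p.asIdeal ∧ s * x = 0}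
      zero_mem' := ⟨1, p.2.one_notMem, mul_zero 1⟩
      add_mem' := by
        rintro x y ⟨s, hs, hx⟩ ⟨t, ht, hy⟩
        exact ⟨s * t, p.2.mul_notMem hs ht, by linear_combination t * hx + s * hy⟩
      smul_mem' := by
        rintro c x ⟨s, hs, hx⟩
        exact ⟨s, hs, by rw [smul_eq_mul]; linear_combination c * hx⟩ }
  have hq : q.IsPrime := by
    refine ⟨(Ideal.ne_top_iff_one q).mpr ?_, ?_⟩
    · rintro ⟨s, hs, h⟩
      rw [mul_one] at h
      exact hs (h ▸ zero_mem _)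
    · rintro x y ⟨s, hs, h⟩
      rcases exists_notMem_mul_eq_zero_of_smooth p.asIdeal (x := s * x) (y := y)
        (by rw [mul_assoc, h]) with ⟨t, ht, h⟩ | ⟨t, ht, h⟩
      · exact Or.inl ⟨t * s, p.2.mul_notMem ht hs, by rw [mul_assoc, h]⟩
      · exact Or.inr ⟨t, ht, h⟩
  refine ⟨⟨q, hq⟩, fun p' hp' ↦ ?_⟩
  rintro x ⟨s, hs, hx⟩
  exact (p'.2.mem_or_mem (hx ▸ zero_mem p'.asIdeal)).resolve_left fun h ↦ hs (hp' h)

end Etale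

/-! ### From local irreducibility and connectedness to irreducibility. -/

section Irreducible

/-- The hypothesis makes `w` the generic point of every component through `x`, so distinct
components are disjoint. There are finitely many of them, hence each is open and closed. -/
lemma irreducibleSpace_of_specializes {X : Type*} [TopologicalSpace X] [NoetherianSpace X]
    [QuasiSober X] [ConnectedSpace X] (h : ∀ x : X, ∃ w, ∀ y, y ⤳ x → w ⤳ y) :
    IrreducibleSpace X := by
  have key (Z Z' : Set X) (hZ : Z ∈ irreducibleComponents X) (hZ' : Z' ∈ irreducibleComponents X)
      (x : X) (hx : x ∈ Z) (hx' : x ∈ Z') : Z = Z' := by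
    obtain ⟨w, hw⟩ := h x
    have h1 (Z : Set X) (hZ : Z ∈ irreducibleComponents X) (hx : x ∈ Z) : Z = closure {w} := by
      have hc := isClosed_of_mem_irreducibleComponents Z hZ
      obtain ⟨z, hz⟩ := QuasiSober.sober hZ.1 hc
      have h2 := hw z (specializes_iff_mem_closure.mpr (hz.symm ▸ hx : x ∈ closure {z}))
      have h3 : Z ≤ closure {w} := by
        rw [← hz.def]
        exact specializes_iff_closure_subset.mp h2
      exact le_antisymm h3 (hZ.2 isIrreducible_singleton.closure h3)
    rw [h1 Z hZ hx, h1 Z' hZ' hx']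
  obtain ⟨x⟩ := (inferInstance : Nonempty X)
  let Z := irreducibleComponent x
  have hZ : Z ∈ irreducibleComponents X := irreducibleComponent_mem_irreducibleComponents x
  have hc : IsClopen Z := by
    refine ⟨isClosed_of_mem_irreducibleComponents Z hZ, ?_⟩
    have h1 : Zᶜ = ⋃₀ (irreducibleComponents X \ {Z}) := by
      ext y
      constructor
      · intro hy
        exact ⟨_, ⟨irreducibleComponent_mem_irreducibleComponents y, fun h' ↦
          hy (Set.mem_singleton_iff.mp h' ▸ mem_irreducibleComponent)⟩, mem_irreducibleComponent⟩
      · rintro ⟨Z', ⟨hZ', hne⟩, hy⟩ hy'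
        exact hne (key _ _ hZ' hZ y hy hy')
    rw [← isClosed_compl_iff, h1]
    rw [Set.sUnion_eq_biUnion]
    exact (NoetherianSpace.finite_irreducibleComponents.subset Set.sdiff_subset).isClosed_biUnion
      fun Z' hZ' ↦ isClosed_of_mem_irreducibleComponents Z' hZ'.1
  have huniv : Z = Set.univ := hc.eq_univ ⟨x, mem_irreducibleComponent⟩
  have hirr : IsIrreducible (Set.univ : Set X) := huniv ▸ hZ.1
  exact { isPreirreducible_univ := hirr.2, toNonempty := ⟨x⟩ }

lemma exists_specializes_of_smooth {Y : Scheme.{0}} {p : Y ⟶ SpecC} {U : Y.Opens}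
    (hU : IsAffineOpen U) (h : (constHom p U).Smooth) {x : Y} (hx : x ∈ U) :
    ∃ w, ∀ y, y ⤳ x → w ⤳ y := by
  let _ : Algebra ℂ Γ(Y, U) := (constHom p U).toAlgebra
  have _ : Algebra.Smooth ℂ Γ(Y, U) := h
  obtain ⟨q, hq⟩ := exists_prime_le_of_smooth (hU.primeIdealOf ⟨x, hx⟩)
  refine ⟨hU.fromSpec q, fun y hy ↦ ?_⟩
  have hyU : y ∈ U := hy.mem_open U.2 hx
  have h1 : hU.fromSpec (hU.primeIdealOf ⟨y, hyU⟩) = y := hU.fromSpec_primeIdealOf ⟨y, hyU⟩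
  have h2 : hU.fromSpec (hU.primeIdealOf ⟨x, hx⟩) = x := hU.fromSpec_primeIdealOf ⟨x, hx⟩
  rw [← h1, ← h2] at hy
  rw [← h1]
  have hi := hU.fromSpec.isOpenEmbedding.isInducing
  have h3 : hU.primeIdealOf ⟨y, hyU⟩ ⤳ hU.primeIdealOf ⟨x, hx⟩ := hi.specializes_iff.mp hy
  exact hi.specializes_iff.mpr ((PrimeSpectrum.le_iff_specializes _ _).mp
    (hq _ ((PrimeSpectrum.le_iff_specializes _ _).mpr h3)))

end Irreducible

namespace IsSmoothPair

variable {Q C : MvPolynomial (Fin 5 ⊕ Fin 2) ℂ}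

instance isProper_yToBase : IsProper (yToBase Q C) := by
  unfold yToBase PProd.toBase
  infer_instance

theorem irreducibleSpace (h : IsSmoothPair Q C) : IrreducibleSpace (yScheme Q C) := by
  have _ := h.connectedSpace
  have _ : IsLocallyNoetherian (yScheme Q C) := LocallyOfFiniteType.isLocallyNoetherian (yToBase Q C)
  have _ : CompactSpace (yScheme Q C) := QuasiCompact.compactSpace_of_compactSpace (yToBase Q C)
  have _ : IsNoetherian (yScheme Q C) := {}
  refine irreducibleSpace_of_specializes fun x ↦ ?_
  obtain ⟨j, l, hx⟩ := exists_mem_yChart x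
  obtain ⟨a, b, ⟨h1, h2, h3, h4, h5⟩, hx⟩ := h.exists_isUnit_minor x hx
  exact exists_specializes_of_smooth (p := yToBase Q C) (isAffineOpen_yChart.basicOpen _)
    (h.isStandardSmooth_basicOpen h1 h2 h3 h4 h5).isStandardSmooth.smooth hx

/-- The threefold of a smooth pair is Calabi–Yau. -/
theorem isCalabiYauThreefold (h : IsSmoothPair Q C) :
    IsCalabiYauThreefold (yToBase Q C) where
  isProper := inferInstance
  smooth := h.smoothOfRelativeDimension
  irreducible := h.irreducibleSpace
  trivialCanonical := h.hasTrivialCanonicalBundle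
  vanishingH1 := h.hasVanishingH1

end IsSmoothPair

/-! ### Sections of `𝒪(3)(-2e)` -/

section Sections

lemma exists_eq_sum_last {n d : ℕ} {F : MvPolynomial (Fin (n + 1)) ℂ} (hF : F.IsHomogeneous d) :
    ∃ f : Fin (d + 1) → MvPolynomial (Fin n) ℂ, (∀ k, (f k).IsHomogeneous (d - k)) ∧
      F = ∑ k : Fin (d + 1), MvPolynomial.X (Fin.last n) ^ (k : ℕ) * MvPolynomial.rename Fin.castSucc (f k) := by
  rw [F.as_sum]
  refine Finset.sum_induction _ (fun F ↦ ∃ f : Fin (d + 1) → MvPolynomial (Fin n) ℂ,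
    (∀ k, (f k).IsHomogeneous (d - k)) ∧ F = ∑ k : Fin (d + 1), MvPolynomial.X (Fin.last n) ^ (k : ℕ) *
      MvPolynomial.rename Fin.castSucc (f k)) ?_ ?_ fun m hm ↦ ?_
  · rintro _ _ ⟨f, hf, rfl⟩ ⟨g, hg, rfl⟩
    exact ⟨f + g, fun k ↦ (hf k).add (hg k), by
      simp only [Pi.add_apply, map_add, mul_add, Finset.sum_add_distrib]⟩
  · exact ⟨0, fun k ↦ MvPolynomial.isHomogeneous_zero _ _ _, by simp⟩
  · have hd : m.degree = d := by
      rw [← hF (MvPolynomial.mem_support_iff.mp hm), Finsupp.degree_eq_weight_one]; rfl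
    have hsum : ∑ i : Fin n, m i.castSucc + m (Fin.last n) = d := by
      rw [← Fin.sum_univ_castSucc, ← hd, Finsupp.degree_eq_sum]
    let u : Fin n →₀ ℕ := Finsupp.equivFunOnFinite.symm fun i ↦ m i.castSucc
    let k₀ : Fin (d + 1) := ⟨m (Fin.last n), by omega⟩
    have hu : m = Finsupp.single (Fin.last n) (m (Fin.last n)) + u.mapDomain Fin.castSucc := by
      ext i
      obtain ⟨i, rfl⟩ | rfl := i.eq_castSucc_or_eq_last
      · rw [Finsupp.add_apply, Finsupp.mapDomain_apply (Fin.castSucc_injective n),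
          Finsupp.single_apply, if_neg (Fin.castSucc_lt_last i).ne', zero_add]
        rfl
      · rw [Finsupp.add_apply, Finsupp.mapDomain_of_notMem_range, Finsupp.single_eq_same, add_zero]
        rintro ⟨i, hi⟩
        exact (Fin.castSucc_lt_last i).ne hi
    refine ⟨Pi.single k₀ (MvPolynomial.monomial u (F.coeff m)), fun k ↦ ?_, ?_⟩
    · by_cases hk : k = k₀
      · subst hk
        rw [Pi.single_eq_same]
        refine MvPolynomial.isHomogeneous_monomial _ ?_
        rw [Finsupp.degree_eq_sum]
        change ∑ i : Fin n, m i.castSucc = d - m (Fin.last n)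
        omega
      · rw [Pi.single_eq_of_ne hk]
        exact MvPolynomial.isHomogeneous_zero _ _ _
    · rw [Finset.sum_eq_single k₀ (fun k _ hk ↦ by rw [Pi.single_eq_of_ne hk, map_zero, mul_zero])
        (fun h ↦ (h (Finset.mem_univ _)).elim), Pi.single_eq_same, MvPolynomial.rename_monomial,
        MvPolynomial.X_pow_eq_monomial, MvPolynomial.monomial_mul, one_mul]
      exact congrArg (fun m' ↦ MvPolynomial.monomial m' (F.coeff m)) hu

lemma idealOn_excIdeal_pChart (k : Fin 6) (j : Fin 5) :
    idealOn excIdeal (isAffineOpen_pChart k j) =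
      Ideal.span {crd blowDown (U := pChart k j) inf_le_left j.castSucc} := by
  refine (idealOn_comap originIdeal blowDown (PSpace.isAffineOpen_chart 5 k)
    (isAffineOpen_pChart k j) inf_le_left).trans ?_
  rw [idealOn_originIdeal, Ideal.map_span]
  apply le_antisymm
  · rw [Ideal.span_le]
    rintro _ ⟨_, ⟨b, rfl⟩, rfl⟩
    exact Ideal.mem_span_singleton.mpr ⟨_, incidence_crd_eq_mul inf_le_left inf_le_right b⟩
  · exact Ideal.span_mono (Set.singleton_subset_iff.mpr ⟨_, ⟨j, rfl⟩, rfl⟩)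

instance quasiSeparatedSpace_P : QuasiSeparatedSpace P :=
  quasiSeparatedSpace_of_quasiSeparated P.toBase

instance quasiCompact_blowDown : QuasiCompact blowDown := by
  have : QuasiCompact (blowDown ≫ PSpace.toBase 5) := inferInstanceAs (QuasiCompact P.toBase)
  exact QuasiCompact.of_comp blowDown (PSpace.toBase 5)

lemma idealOn_zeroIdeal_pChart {F : MvPolynomial (Fin 6) ℂ} (hF : F.IsHomogeneous 3) (k : Fin 6)
    (j : Fin 5) : idealOn (zeroIdeal blowDown F) (isAffineOpen_pChart k j) =
      Ideal.span {evalAt P.toBase (crd blowDown (U := pChart k j) inf_le_left) F} :=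
  idealOn_zeroIdeal blowDown hF (isAffineOpen_pChart k j) inf_le_left

lemma iSup_pChart : ⨆ a : Fin 6 × Fin 5, pChart a.1 a.2 = ⊤ := by
  refine top_le_iff.mp fun x _ ↦ ?_
  obtain ⟨k, hk⟩ := Opens.mem_iSup.mp (show blowDown x ∈ ⨆ i, chart 5 i by
    rw [PSpace.iSup_chart]; trivial)
  obtain ⟨j, hj⟩ := Opens.mem_iSup.mp (show x ∈ ⨆ j, rho ⁻¹ᵁ chart 4 j by
    rw [iSup_rho_preimage]; trivial)
  exact Opens.mem_iSup.mpr ⟨(k, j), hk, hj⟩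

/-- The forms `x₅ q + c` are sections of `𝒪(3)(-2e)`. -/
lemma isSectionO3Minus2e_coneForm {q c : MvPolynomial (Fin 5) ℂ} (hq : q.IsHomogeneous 2)
    (hc : c.IsHomogeneous 3) : IsSectionO3Minus2e (coneForm q c) := by
  have hF := isHomogeneous_coneForm hq hc
  refine ⟨hF, Scheme.IdealSheafData.le_of_iSup_eq_top
    (fun a : Fin 6 × Fin 5 ↦ ⟨pChart a.1 a.2, isAffineOpen_pChart a.1 a.2⟩) iSup_pChart
    fun ⟨k, j⟩ ↦ ?_⟩
  change idealOn (zeroIdeal blowDown (coneForm q c)) (isAffineOpen_pChart k j) ≤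
    idealOn excIdeal (isAffineOpen_pChart k j) ^ 2
  rw [idealOn_excIdeal_pChart, idealOn_zeroIdeal_pChart hF, Ideal.span_singleton_pow,
    Ideal.span_singleton_le_span_singleton]
  have h1 : crd blowDown (U := pChart k j) (i := k) inf_le_left ∘ Fin.castSucc =
      fun b ↦ crd blowDown (U := pChart k j) (i := k) inf_le_left j.castSucc *
        crd rho (U := pChart k j) (i := j) inf_le_right b :=
    funext fun b ↦ incidence_crd_eq_mul inf_le_left inf_le_right b
  rw [coneForm, map_add, map_mul, evalAt_rename, evalAt_rename, h1]
  refine dvd_add (Dvd.dvd.mul_left ?_ _) ?_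
  · exact ⟨_, eval₂_smul_of_isHomogeneous hq _ _ _⟩
  · exact (pow_dvd_pow _ (by omega)).trans ⟨_, eval₂_smul_of_isHomogeneous hc _ _ _⟩

/-- Every section of `𝒪(3)(-2e)` is of the form `x₅ q + c`. -/
lemma IsSectionO3Minus2e.exists_eq_coneForm {F : MvPolynomial (Fin 6) ℂ}
    (hF : IsSectionO3Minus2e F) : ∃ q c : MvPolynomial (Fin 5) ℂ, q.IsHomogeneous 2 ∧
      c.IsHomogeneous 3 ∧ F = coneForm q c := by
  obtain ⟨f, hf, hFf⟩ := exists_eq_sum_last hF.1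
  -- The sections are tested in `K[X]`, where `K` is the field of rational functions in `x₀, …, x₄`:
  -- put `x₅ = 1`, `x_b = X x_b` and `y_b = x_b / x₀`. The equation of `e` becomes a nonzero
  -- constant times `X`.
  let A := MvPolynomial (Fin 5) ℂ
  let K := FractionRing A
  let x (b : Fin 5) : K := algebraMap A K (MvPolynomial.X b)
  have hx : x 0 ≠ 0 := (map_ne_zero_iff _ (IsFractionRing.injective A K)).mpr
    (MvPolynomial.X_ne_zero (R := ℂ) (0 : Fin 5))
  let φ : ℂ →+* Polynomial K := Polynomial.C.comp ((algebraMap A K).comp MvPolynomial.C)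
  let z : Fin 6 → Polynomial K := Fin.lastCases 1 fun b ↦ Polynomial.X * Polynomial.C (x b)
  have hz (b : Fin 5) : z b.castSucc = Polynomial.X * Polynomial.C (x b) :=
    Fin.lastCases_castSucc ..
  have hz5 : z (Fin.last 5) = 1 := Fin.lastCases_last ..
  obtain ⟨θ, hθc, hθ⟩ := (presents_pChart (Fin.last 5) 0).exists_lift_span (R := Polynomial K) φ
    (Sum.elim z fun b ↦ Polynomial.C (x b / x 0)) (by
      rintro G (⟨⟨b, c⟩, rfl⟩ | rfl | rfl)
      · simp only [incidenceEq, MvPolynomial.eval₂_sub, MvPolynomial.eval₂_mul,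
          MvPolynomial.eval₂_X, Sum.elim_inl, Sum.elim_inr, hz]
        rw [mul_assoc, mul_assoc, ← Polynomial.C_mul, ← Polynomial.C_mul, ← mul_sub,
          ← Polynomial.C_sub, mul_div_left_comm, sub_self, Polynomial.C_0, mul_zero]
      · simp only [MvPolynomial.eval₂_sub, MvPolynomial.eval₂_X, MvPolynomial.eval₂_one,
          Sum.elim_inl, hz5, sub_self]
      · simp only [MvPolynomial.eval₂_sub, MvPolynomial.eval₂_X, MvPolynomial.eval₂_one,
          Sum.elim_inr, div_self hx, Polynomial.C_1, sub_self])
  have h1 : idealOn (zeroIdeal blowDown F) (isAffineOpen_pChart (Fin.last 5) 0) ≤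
    idealOn excIdeal (isAffineOpen_pChart (Fin.last 5) 0) ^ 2 := hF.2 _
  rw [idealOn_excIdeal_pChart, idealOn_zeroIdeal_pChart hF.1, Ideal.span_singleton_pow,
    Ideal.span_singleton_le_span_singleton] at h1
  have h2 := map_dvd θ h1
  have h3 : θ (crd blowDown (U := pChart (Fin.last 5) 0) (i := Fin.last 5) inf_le_left
      (Fin.castSucc 0)) = Polynomial.X * Polynomial.C (x 0) := (hθ (.inl (Fin.castSucc 0))).trans (hz 0)
  have h4 (G : MvPolynomial (Fin 6) ℂ) : θ (evalAt P.toBase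
      (crd blowDown (U := pChart (Fin.last 5) 0) (i := Fin.last 5) inf_le_left) G) =
      MvPolynomial.eval₂ φ z G := by
    refine (MvPolynomial.hom_eval₂ _ _ _ _).trans ?_
    congr 1
    · exact RingHom.ext hθc
    · exact funext fun k ↦ hθ (.inl k)
  have h5 (k : Fin 4) : MvPolynomial.eval₂ φ z (MvPolynomial.rename Fin.castSucc (f k)) =
      Polynomial.X ^ (3 - (k : ℕ)) * Polynomial.C (algebraMap A K (f k)) := by
    rw [MvPolynomial.eval₂_rename, show z ∘ Fin.castSucc = _ from funext hz,
      eval₂_smul_of_isHomogeneous (hf k)]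
    congr 1
    have := MvPolynomial.hom_eval₂ (f k) MvPolynomial.C (Polynomial.C.comp (algebraMap A K))
      MvPolynomial.X
    rw [MvPolynomial.eval₂_eta] at this
    exact this.symm
  rw [map_pow, h3, h4, hFf] at h2
  simp only [MvPolynomial.eval₂_sum, MvPolynomial.eval₂_mul, MvPolynomial.eval₂_pow,
    MvPolynomial.eval₂_X, hz5, one_pow, one_mul, h5] at h2
  have h6 := (dvd_mul_right (Polynomial.X ^ 2) (Polynomial.C (x 0) ^ 2)).trans
    ((mul_pow (Polynomial.X : Polynomial K) (Polynomial.C (x 0)) 2).symm.dvd.trans h2)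
  rw [Polynomial.X_pow_dvd_iff] at h6
  -- The coefficient of `X³⁻ᵏ` is `f k`. Divisibility by `X²` therefore kills the terms with `x₅²`
  -- and `x₅³`.
  have h7 (k : Fin 4) (hk : 3 - (k : ℕ) < 2) : f k = 0 := by
    have h8 := h6 _ hk
    simp only [Polynomial.finsetSum_coeff, Polynomial.coeff_X_pow_mul', Polynomial.coeff_C] at h8
    rw [Finset.sum_eq_single k (fun k' _ hk' ↦ ?_) (fun h ↦ (h (Finset.mem_univ _)).elim),
      if_pos le_rfl, if_pos (Nat.sub_self _)] at h8
    · exact (map_eq_zero_iff _ (IsFractionRing.injective A K)).mp h8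
    · split_ifs with h9 h10
      · exact (hk' (by omega)).elim
      · rfl
      · rfl
  refine ⟨f 1, f 0, hf 1, hf 0, ?_⟩
  rw [hFf, Fin.sum_univ_four, h7 2 (by decide), h7 3 (by decide), coneForm]
  simp only [map_zero, mul_zero, add_zero, Fin.val_zero, Fin.val_one, pow_zero, pow_one, one_mul]
  exact add_comm _ _

end Sections

/-! ### Smoothness is an open condition on pencils -/

section Families

open MvPolynomial Laurent

/-- Pairs of quadratic and of cubic forms on `ℙ⁴`. -/
abbrev ConeData : Type := (Fin 2 → MvPolynomial (Fin 5) ℂ) × (Fin 2 → MvPolynomial (Fin 5) ℂ)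

/-- The pencil spanned by `x₅ q₀ + c₀` and `x₅ q₁ + c₁`. -/
def ConeData.pencil (b : ConeData) (k : Fin 2) : MvPolynomial (Fin 6) ℂ := coneForm (b.1 k) (b.2 k)

/-- Functions on the space of pencils that are polynomial in the coefficients. -/
def polyFun : Subalgebra ℂ (ConeData → ℂ) where
  carrier := {φ | ∃ Δ, ∀ b, φ b = evalCoeffs Δ b.pencil}
  mul_mem' := by
    rintro φ ψ ⟨Δ, h⟩ ⟨Δ', h'⟩
    exact ⟨Δ * Δ', fun b ↦ by rw [Pi.mul_apply, h, h', evalCoeffs, evalCoeffs, evalCoeffs, map_mul]⟩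
  add_mem' := by
    rintro φ ψ ⟨Δ, h⟩ ⟨Δ', h'⟩
    exact ⟨Δ + Δ', fun b ↦ by rw [Pi.add_apply, h, h', evalCoeffs, evalCoeffs, evalCoeffs, map_add]⟩
  algebraMap_mem' c := ⟨C c, fun b ↦ by rw [evalCoeffs, eval_C]; rfl⟩

lemma coeff_pencil_mem (k : Fin 2) (m : Fin 6 →₀ ℕ) : (fun b ↦ coeff m (b.pencil k)) ∈ polyFun :=
  ⟨X (k, m), fun b ↦ by rw [evalCoeffs, eval_X]⟩

lemma mapDomain_castSucc_last (u : Fin 5 →₀ ℕ) : u.mapDomain Fin.castSucc (Fin.last 5) = 0 := by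
  refine Finsupp.mapDomain_of_notMem_range _ _ ?_
  rintro ⟨i, hi⟩
  exact (Fin.castSucc_lt_last i).ne hi

lemma coeff_fst_mem (k : Fin 2) (u : Fin 5 →₀ ℕ) : (fun b : ConeData ↦ coeff u (b.1 k)) ∈ polyFun := by
  convert coeff_pencil_mem k (Finsupp.single (Fin.last 5) 1 + u.mapDomain Fin.castSucc) using 2 with b
  rw [ConeData.pencil, coneForm, coeff_add, coeff_X_mul,
    coeff_rename_mapDomain _ (Fin.castSucc_injective 5), coeff_rename_eq_zero, add_zero]
  intro v hv
  have := DFunLike.congr_fun hv (Fin.last 5)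
  rw [Finsupp.add_apply, mapDomain_castSucc_last, mapDomain_castSucc_last,
    Finsupp.single_eq_same] at this
  omega

lemma coeff_snd_mem (k : Fin 2) (u : Fin 5 →₀ ℕ) : (fun b : ConeData ↦ coeff u (b.2 k)) ∈ polyFun := by
  convert coeff_pencil_mem k (u.mapDomain Fin.castSucc) using 2 with b
  rw [ConeData.pencil, coneForm, coeff_add, coeff_X_mul', if_neg, zero_add,
    coeff_rename_mapDomain _ (Fin.castSucc_injective 5)]
  rw [Finsupp.mem_support_iff, mapDomain_castSucc_last, not_not]

/-- Families of polynomials whose coefficients are polynomial in those of the pencil. -/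
def polyFamily : Subalgebra ℂ (ConeData → MvPolynomial Var ℂ) where
  carrier := {G | ∀ m, (fun b ↦ coeff m (G b)) ∈ polyFun}
  mul_mem' := by
    classical
    intro G H hG hH m
    have : (fun b ↦ coeff m ((G * H) b)) = ∑ x ∈ Finset.HasAntidiagonal.antidiagonal m,
        (fun b ↦ coeff x.1 (G b)) * fun b ↦ coeff x.2 (H b) := by
      funext b
      rw [Pi.mul_apply, coeff_mul, Finset.sum_apply]
      rfl
    rw [this]
    exact sum_mem fun x _ ↦ mul_mem (hG _) (hH _)
  add_mem' := by
    intro G H hG hH m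
    exact add_mem (hG m) (hH m)
  algebraMap_mem' c m := polyFun.algebraMap_mem (coeff m (algebraMap ℂ (MvPolynomial Var ℂ) c))

lemma const_mem_polyFamily (G : MvPolynomial Var ℂ) : (fun _ ↦ G) ∈ polyFamily :=
  fun m ↦ polyFun.algebraMap_mem (coeff m G)

lemma pderiv_mem_polyFamily {G : ConeData → MvPolynomial Var ℂ} (hG : G ∈ polyFamily) (a : Var) :
    (fun b ↦ pderiv a (G b)) ∈ polyFamily := by
  intro m
  simp only [coeff_pderiv]
  exact mul_mem (hG _) (polyFun.algebraMap_mem (m a + 1))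

lemma pencilOf_mem_polyFamily {q : ConeData → Fin 2 → MvPolynomial (Fin 5) ℂ}
    (hq : ∀ k u, (fun b ↦ coeff u (q b k)) ∈ polyFun) : (fun b ↦ pencilOf (q b)) ∈ polyFamily := by
  classical
  have h : (fun b ↦ pencilOf (q b)) =
      ∑ k, (fun _ ↦ X (.inr k)) * fun b ↦ rename (Sum.inl : Fin 5 → Var) (q b k) := by
    funext b
    rw [Finset.sum_apply]
    rfl
  rw [h]
  refine sum_mem fun k _ ↦ mul_mem (const_mem_polyFamily _) fun m ↦ ?_
  by_cases hm : ∃ u : Fin 5 →₀ ℕ, u.mapDomain Sum.inl = m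
  · obtain ⟨u, rfl⟩ := hm
    simp only [coeff_rename_mapDomain _ Sum.inl_injective]
    exact hq k u
  · have h0 : (fun b ↦ coeff m (rename (Sum.inl : Fin 5 → Var) (q b k))) = 0 :=
      funext fun b ↦ coeff_rename_eq_zero _ _ _ fun u hu ↦ (hm ⟨u, hu⟩).elim
    rw [h0]
    exact zero_mem _

/-- The ideal of the singular locus of the threefold of a pencil. -/
def ConeData.jacIdeal (b : ConeData) : Ideal (MvPolynomial Var ℂ) :=
  CubicPencil.jacIdeal (pencilOf b.1) (pencilOf b.2)

/-- The elements of the ideal of the singular locus extend to all pencils. -/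
lemma exists_family {b₀ : ConeData} {p : MvPolynomial Var ℂ} (hp : p ∈ b₀.jacIdeal) :
    ∃ P ∈ polyFamily, P b₀ = p ∧ ∀ b, P b ∈ b.jacIdeal := by
  have h1 := pencilOf_mem_polyFamily (q := fun b ↦ b.1) coeff_fst_mem
  have h2 := pencilOf_mem_polyFamily (q := fun b ↦ b.2) coeff_snd_mem
  induction hp using Submodule.span_induction with
  | mem p hp =>
    rcases hp with (rfl | rfl) | ⟨a, rfl⟩
    · exact ⟨_, h1, rfl, fun b ↦ Ideal.subset_span (Or.inl (Or.inl rfl))⟩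
    · exact ⟨_, h2, rfl, fun b ↦ Ideal.subset_span (Or.inl (Or.inr rfl))⟩
    · exact ⟨_, sub_mem (mul_mem (pderiv_mem_polyFamily h1 a.1) (pderiv_mem_polyFamily h2 a.2))
        (mul_mem (pderiv_mem_polyFamily h1 a.2) (pderiv_mem_polyFamily h2 a.1)), rfl,
        fun b ↦ Ideal.subset_span (Or.inr ⟨a, rfl⟩)⟩
  | zero => exact ⟨0, zero_mem _, rfl, fun b ↦ zero_mem _⟩
  | add p q _ _ hp hq =>
    obtain ⟨P, hP, rfl, hP'⟩ := hp
    obtain ⟨R, hR, rfl, hR'⟩ := hq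
    exact ⟨P + R, add_mem hP hR, rfl, fun b ↦ add_mem (hP' b) (hR' b)⟩
  | smul a p _ hp =>
    obtain ⟨P, hP, rfl, hP'⟩ := hp
    exact ⟨(fun _ ↦ a) * P, mul_mem (const_mem_polyFamily a) hP, rfl,
      fun b ↦ Ideal.mul_mem_left _ _ (hP' b)⟩

/-- The bidegrees of the variables. -/
abbrev biweight : Var → ℕ × ℕ := Sum.elim (fun _ ↦ (1, 0)) fun _ ↦ (0, 1)

attribute [local instance] MvPolynomial.weightedGradedAlgebra

/-- The derivative of `C` in a variable has the bidegree of the corresponding derivative of `Q` plus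
`(1, 0)`, so both products in a minor have the same bidegree. -/
lemma isHomogeneous_jacIdeal {Q C : MvPolynomial Var ℂ}
    (hQ : IsBihomogeneous (m := 4) (n := 1) Q 2 1) (hC : IsBihomogeneous (m := 4) (n := 1) C 3 1) :
    (jacIdeal Q C).IsHomogeneous (weightedHomogeneousSubmodule ℂ biweight) := by
  refine Ideal.homogeneous_span _ _ ?_
  have key (a : Var) : ∃ d : ℕ × ℕ, (pderiv a Q).IsWeightedHomogeneous biweight d ∧
      (pderiv a C).IsWeightedHomogeneous biweight (d + (1, 0)) := by
    rcases a with a | a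
    · exact ⟨(1, 1), IsWeightedHomogeneous.pderiv hQ rfl, IsWeightedHomogeneous.pderiv hC rfl⟩
    · exact ⟨(2, 0), IsWeightedHomogeneous.pderiv hQ rfl, IsWeightedHomogeneous.pderiv hC rfl⟩
  rintro p ((rfl | rfl) | ⟨⟨a, b⟩, rfl⟩)
  · exact ⟨(2, 1), hQ⟩
  · exact ⟨(3, 1), hC⟩
  · obtain ⟨d, h1, h2⟩ := key a
    obtain ⟨e, h3, h4⟩ := key b
    refine ⟨d + (e + (1, 0)), sub_mem (h1.mul h4) ?_⟩
    have h5 := h3.mul h2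
    rwa [show e + (d + (1, 0)) = d + (e + (1, 0)) from add_left_comm _ _ _] at h5

/-- The exponents of the monomials of bidegree `(d, e)`. -/
def biexponents (d e : ℕ) : Finset (Var →₀ ℕ) :=
  (Finset.finsuppAntidiag Finset.univ (d + e)).filter fun m ↦ Finsupp.weight biweight m = (d, e)

lemma weight_biweight (m : Var →₀ ℕ) :
    Finsupp.weight biweight m = (∑ j, m (.inl j), ∑ l, m (.inr l)) := by
  rw [Finsupp.weight_apply, Finsupp.sum_fintype _ (fun i c ↦ c • biweight i) (fun _ ↦ zero_smul _ _),
    Fintype.sum_sum_type]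
  ext <;> simp [Prod.fst_sum, Prod.snd_sum]

lemma mem_biexponents {d e : ℕ} {m : Var →₀ ℕ} :
    m ∈ biexponents d e ↔ Finsupp.weight biweight m = (d, e) := by
  rw [biexponents, Finset.mem_filter, Finset.mem_finsuppAntidiag, and_iff_right_iff_imp]
  intro h
  rw [weight_biweight, Prod.mk.injEq] at h
  exact ⟨by rw [Fintype.sum_sum_type, h.1, h.2], Finset.subset_univ _⟩

lemma weightedHomogeneousComponent_eq_sum (d e : ℕ) (p : MvPolynomial Var ℂ) :
    weightedHomogeneousComponent biweight (d, e) p =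
      ∑ m : biexponents d e, monomial m.1 (coeff m.1 p) := by
  classical
  ext u
  rw [coeff_weightedHomogeneousComponent, coeff_sum]
  simp only [coeff_monomial]
  rw [Finset.sum_coe_sort (biexponents d e) fun m ↦ if m = u then coeff m p else 0,
    Finset.sum_ite_eq']
  simp only [mem_biexponents]

/-- By the pigeonhole principle a monomial of bidegree `(5 N, 2 N)` contains the `N`-th power of one
of the five `x` and of one of the two `t`. -/
lemma monomial_mem_of_pow_mem {I : Ideal (MvPolynomial Var ℂ)} {N : ℕ}
    (hN : ∀ j l, ((X (.inl j) * X (.inr l)) ^ N : MvPolynomial Var ℂ) ∈ I) {m : Var →₀ ℕ}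
    (hm : m ∈ biexponents (5 * N) (2 * N)) : monomial m 1 ∈ I := by
  rw [mem_biexponents, weight_biweight, Prod.mk.injEq] at hm
  obtain ⟨j, -, hj⟩ := Finset.exists_le_of_sum_le (s := Finset.univ) (f := fun _ : Fin 5 ↦ N)
    (g := fun j ↦ m (.inl j)) Finset.univ_nonempty (by simp [hm.1])
  obtain ⟨l, -, hl⟩ := Finset.exists_le_of_sum_le (s := Finset.univ) (f := fun _ : Fin 2 ↦ N)
    (g := fun l ↦ m (.inr l)) Finset.univ_nonempty (by simp [hm.2])
  refine I.mem_of_dvd ?_ (hN j l)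
  rw [mul_pow, X_pow_eq_monomial, X_pow_eq_monomial, monomial_mul, one_mul, monomial_dvd_monomial]
  refine ⟨Or.inr fun k ↦ ?_, one_dvd _⟩
  rw [Finsupp.add_apply, Finsupp.single_apply, Finsupp.single_apply]
  split_ifs with h1 h2 h2
  · exact (Sum.inl_ne_inr (h1.trans h2.symm)).elim
  · subst h1; exact hj
  · subst h2; simpa using hl
  · exact Nat.zero_le _

/-- The parts of the `p m` supported in `S` are obtained from the monomials by a square matrix; when
it is invertible, the monomials are linear combinations of these parts. -/
lemma monomial_mem_of_det_ne_zero {S : Finset (Var →₀ ℕ)} {I : Ideal (MvPolynomial Var ℂ)}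
    {p : S → MvPolynomial Var ℂ} (hp : ∀ m, ∑ m' : S, monomial m'.1 (coeff m'.1 (p m)) ∈ I)
    (hdet : (Matrix.of fun m' m : S ↦ coeff m'.1 (p m)).det ≠ 0) (m₀ : S) : monomial m₀.1 1 ∈ I := by
  let A : Matrix S S ℂ := .of fun m' m : S ↦ coeff m'.1 (p m)
  have h1 : A * A⁻¹ = 1 := Matrix.mul_nonsing_inv _ (isUnit_iff_ne_zero.mpr hdet)
  have h2 : ∑ m : S, C (A⁻¹ m m₀) * ∑ m' : S, monomial m'.1 (A m' m) = monomial m₀.1 1 := by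
    simp only [Finset.mul_sum, C_mul_monomial]
    rw [Finset.sum_comm]
    have h3 (m' : S) : ∑ m : S, monomial m'.1 (A⁻¹ m m₀ * A m' m) =
        monomial m'.1 (if m' = m₀ then (1 : ℂ) else 0) := by
      rw [← map_sum, ← Matrix.one_apply, ← h1, Matrix.mul_apply]
      simp only [mul_comm]
    simp only [h3, apply_ite (monomial _), map_zero]
    rw [Finset.sum_ite_eq' Finset.univ m₀ fun m' : S ↦ monomial m'.1 (1 : ℂ),
      if_pos (Finset.mem_univ _)]
  rw [← h2]
  exact sum_mem fun m _ ↦ Ideal.mul_mem_left _ _ (hp m)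

lemma exists_evalCoeffs_eq_det {S : Finset (Var →₀ ℕ)} {R : S → ConeData → MvPolynomial Var ℂ}
    (hR : ∀ m, R m ∈ polyFamily) : ∃ Δ, ∀ b : ConeData,
      evalCoeffs Δ b.pencil = (Matrix.of fun m' m : S ↦ coeff m'.1 (R m b)).det := by
  choose D hD using fun m' m : S ↦ hR m m'.1
  refine ⟨(Matrix.of D).det, fun b ↦ ?_⟩
  rw [evalCoeffs, RingHom.map_det]
  congr 1
  ext m' m
  exact (hD m' m b).symm

lemma exists_pow_mem_jacIdeal {b₀ : ConeData} (h₀ : IsSmoothPair (pencilOf b₀.1) (pencilOf b₀.2)) :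
    ∃ N, ∀ j l, ((X (.inl j) * X (.inr l)) ^ N : MvPolynomial Var ℂ) ∈ b₀.jacIdeal := by
  choose n hn using h₀.exists_pow_mem
  refine ⟨∑ j, ∑ l, n j l, fun j l ↦ Ideal.mem_of_dvd _ (pow_dvd_pow _ ?_) (hn j l)⟩
  exact (Finset.single_le_sum (f := fun l ↦ n j l) (fun _ _ ↦ Nat.zero_le _)
    (Finset.mem_univ l)).trans (Finset.single_le_sum (f := fun j ↦ ∑ l, n j l)
      (fun _ _ ↦ Nat.zero_le _) (Finset.mem_univ j))

/-- Smoothness of the threefold holds on a Zariski open set of pencils. -/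
theorem exists_discriminant {b₀ : ConeData}
    (h₀ : IsSmoothPair (pencilOf b₀.1) (pencilOf b₀.2)) :
    ∃ Δ, evalCoeffs Δ b₀.pencil ≠ 0 ∧ ∀ b : ConeData, (∀ k, (b.1 k).IsHomogeneous 2) →
      (∀ k, (b.2 k).IsHomogeneous 3) → evalCoeffs Δ b.pencil ≠ 0 →
      IsSmoothPair (pencilOf b.1) (pencilOf b.2) := by
  classical
  obtain ⟨N, hN⟩ := exists_pow_mem_jacIdeal h₀
  -- Each monomial of bidegree `(5 N, 2 N)` lies in the ideal at `b₀` and extends to a family in the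
  -- ideals of all pencils. The determinant of the coefficients of these families in this bidegree
  -- is polynomial in the pencil, and it is `1` at `b₀`.
  choose R hR hR₀ hRb using fun m : biexponents (5 * N) (2 * N) ↦
    exists_family (monomial_mem_of_pow_mem hN m.2)
  obtain ⟨Δ, hΔ⟩ := exists_evalCoeffs_eq_det hR
  refine ⟨Δ, ?_, fun b hq hc hb ↦ ?_⟩
  · rw [hΔ]
    convert one_ne_zero (α := ℂ)
    rw [← Matrix.det_one (n := biexponents (5 * N) (2 * N))]
    congr 1
    ext m' m
    rw [Matrix.of_apply, hR₀, coeff_monomial, Matrix.one_apply]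
    exact if_congr (by rw [Subtype.ext_iff, eq_comm]) rfl rfl
  · have hQ := isBihomogeneous_pencilOf hq
    have hC := isBihomogeneous_pencilOf hc
    rw [hΔ] at hb
    have hmon := monomial_mem_of_det_ne_zero (I := b.jacIdeal) (fun m ↦ by
      rw [← weightedHomogeneousComponent_eq_sum]
      exact weightedHomogeneousComponent_mem_of_mem ℂ biweight (isHomogeneous_jacIdeal hQ hC)
        (hRb m b) (5 * N, 2 * N)) hb
    -- The power `(xⱼ tₗ)⁷ᴺ` is a multiple of `xⱼ⁵ᴺ tₗ²ᴺ`, which has the required bidegree.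
    refine ⟨hQ, hC, fun j l ↦ ⟨7 * N, ?_⟩⟩
    have h4 : Finsupp.single (.inl j) (5 * N) + Finsupp.single (.inr l) (2 * N) ∈
        biexponents (5 * N) (2 * N) := by
      rw [mem_biexponents, map_add, Finsupp.weight_single, Finsupp.weight_single]
      ext <;> simp
    refine Ideal.mem_of_dvd _ ?_ (hmon ⟨_, h4⟩)
    rw [mul_pow, X_pow_eq_monomial, X_pow_eq_monomial, monomial_mul, one_mul, monomial_dvd_monomial]
    exact ⟨Or.inr (add_le_add (Finsupp.single_mono (by omega)) (Finsupp.single_mono (by omega))),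
      one_dvd _⟩

end Families

/-! ### A smooth diagonal example -/

section Weights

variable {ι : Type} {a b s : ι → ℂ} {I : Finset ι} {k l : ι} {z : ℂ}

/-- The summand `(z - aₖ)³ / (z - bₖ)²` (in a form with denominator `(z - bₖ)³`). -/
def cubicTerm (a b : ι → ℂ) (k : ι) (z : ℂ) : ℂ := (z - a k) ^ 3 * (z - b k) / (z - b k) ^ 3

/-- Up to a factor `3`, the derivative of `cubicTerm`. -/
def cubicTerm' (a b : ι → ℂ) (k : ι) (z : ℂ) : ℂ :=
  (z - a k) ^ 2 * (z - 3 * b k + 2 * a k) / (z - b k) ^ 3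

lemma cubicTerm_ne_zero (ha : z ≠ a k) (hb : z ≠ b k) : cubicTerm a b k z ≠ 0 :=
  div_ne_zero (mul_ne_zero (pow_ne_zero _ (sub_ne_zero.mpr ha)) (sub_ne_zero.mpr hb))
    (pow_ne_zero _ (sub_ne_zero.mpr hb))

/-- After clearing denominators the zeros are roots of a polynomial, which is nonzero because of its
value at `w`. -/
lemma finite_zeros (g : ι → Polynomial ℂ) {w : ℂ} (hw : ∀ i ∈ I, w ≠ b i)
    (h : ∑ i ∈ I, (g i).eval w / (w - b i) ^ 3 ≠ 0) :
    {z | (∀ i ∈ I, z ≠ b i) ∧ ∑ i ∈ I, (g i).eval z / (z - b i) ^ 3 = 0}.Finite := by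
  classical
  let R : Polynomial ℂ := ∑ i ∈ I, g i * ∏ j ∈ I.erase i, (Polynomial.X - Polynomial.C (b j)) ^ 3
  have hR (z : ℂ) (hz : ∀ i ∈ I, z ≠ b i) : R.eval z =
      (∏ j ∈ I, (z - b j) ^ 3) * ∑ i ∈ I, (g i).eval z / (z - b i) ^ 3 := by
    rw [Polynomial.eval_finsetSum, Finset.mul_sum]
    refine Finset.sum_congr rfl fun i hi ↦ ?_
    have h0 : z - b i ≠ 0 := sub_ne_zero.mpr (hz i hi)
    rw [← Finset.mul_prod_erase I _ hi, Polynomial.eval_mul, Polynomial.eval_prod]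
    simp only [Polynomial.eval_pow, Polynomial.eval_sub, Polynomial.eval_X, Polynomial.eval_C]
    field_simp
  have hR0 : R ≠ 0 := by
    intro h0
    have h1 := hR w hw
    rw [h0, Polynomial.eval_zero, eq_comm, mul_eq_zero] at h1
    exact h1.elim (Finset.prod_ne_zero_iff.mpr fun i hi ↦
      pow_ne_zero _ (sub_ne_zero.mpr (hw i hi))) h
  refine (Polynomial.finite_setOfPred_isRoot hR0).subset fun z hz ↦ ?_
  have h1 := hR z hz.1
  rw [hz.2, mul_zero] at h1
  exact h1

/-- For `S = ∑ sᵢ φᵢ`, with `φᵢ` the cubic terms, the expression is up to elementary factors the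
derivative of `S / φₖ`. At `z = bₖ` it has the nonzero value `2 (aₖ - bₖ) S(bₖ)`, so it has finitely
many zeros. -/
lemma finite_critical (hb : ∀ i ∈ I, b k ≠ b i) (hab : a k ≠ b k)
    (h : ∑ i ∈ I, s i * cubicTerm a b i (b k) ≠ 0) :
    {z | (∀ i ∈ I, z ≠ b i) ∧ (∑ i ∈ I, s i * cubicTerm a b i z) * (z - 3 * b k + 2 * a k) -
      (∑ i ∈ I, s i * cubicTerm' a b i z) * ((z - a k) * (z - b k)) = 0}.Finite := by
  let lin (c : ℂ) : Polynomial ℂ := Polynomial.X - Polynomial.C c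
  let g (i : ι) : Polynomial ℂ := Polynomial.C (s i) * (lin (a i) ^ 3 * lin (b i) *
    lin (3 * b k - 2 * a k) - lin (a i) ^ 2 * lin (3 * b i - 2 * a i) * (lin (a k) * lin (b k)))
  have hg (z : ℂ) : ∑ i ∈ I, (g i).eval z / (z - b i) ^ 3 =
      (∑ i ∈ I, s i * cubicTerm a b i z) * (z - 3 * b k + 2 * a k) -
      (∑ i ∈ I, s i * cubicTerm' a b i z) * ((z - a k) * (z - b k)) := by
    rw [Finset.sum_mul, Finset.sum_mul, ← Finset.sum_sub_distrib]
    refine Finset.sum_congr rfl fun i _ ↦ ?_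
    simp only [g, lin, cubicTerm, cubicTerm', Polynomial.eval_mul, Polynomial.eval_sub,
      Polynomial.eval_pow, Polynomial.eval_X, Polynomial.eval_C]
    ring
  have h1 := finite_zeros (I := I) (b := b) g hb (by
    rw [hg, sub_self, mul_zero, mul_zero, sub_zero]
    refine mul_ne_zero h fun h0 ↦ hab ?_
    linear_combination h0 / 2)
  simpa only [hg] using h1

/-- The conditions on the weights `s` for the subset `I` of `T`. -/
structure IsGoodWeight (a b s : ι → ℂ) (I T : Finset ι) : Prop where
  sum_ne_zero : ∑ i ∈ I, s i ≠ 0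
  eval_ne_zero : ∀ l ∉ T, ∑ i ∈ I, s i * cubicTerm a b i (b l) ≠ 0
  noncritical : ∀ z, (∀ i ∈ I, z ≠ a i ∧ z ≠ b i) → ∑ i ∈ I, s i * cubicTerm a b i z = 0 →
    ∑ i ∈ I, s i * cubicTerm' a b i z ≠ 0

/-- A Bertini argument by hand, by induction on `T`. A sum `S + c φₖ` has a multiple zero only if
`-S / φₖ` takes the value `c` at a critical point; there are finitely many critical values, and a
new weight `c` that avoids them exists. -/
lemma exists_isGoodWeight [Finite ι] (hb : Function.Injective b) (hab : ∀ i j, a i ≠ b j)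
    (T : Finset ι) : ∃ s : ι → ℂ, ∀ I ⊆ T, I.Nonempty → IsGoodWeight a b s I T := by
  classical
  induction T using Finset.induction_on with
  | empty =>
    exact ⟨0, fun I hI h ↦ (h.ne_empty (Finset.subset_empty.mp hI)).elim⟩
  | insert k T hk ih =>
    obtain ⟨s, hs⟩ := ih
    let Z (I : Finset ι) : Set ℂ := {z | I.Nonempty ∧ (∀ i ∈ I, z ≠ b i) ∧
      (∑ i ∈ I, s i * cubicTerm a b i z) * (z - 3 * b k + 2 * a k) -
      (∑ i ∈ I, s i * cubicTerm' a b i z) * ((z - a k) * (z - b k)) = 0}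
    have hkI (I) (hI : I ⊆ T) : ∀ i ∈ I, b k ≠ b i := fun i hi h ↦ hk (hb h ▸ hI hi)
    have hZ (I) (hI : I ⊆ T) : (Z I).Finite := by
      by_cases h : I.Nonempty
      · exact (finite_critical (hkI I hI) (hab k k) ((hs I hI h).eval_ne_zero k hk)).subset
          fun z hz ↦ hz.2
      · exact Set.finite_empty.subset fun z hz ↦ h hz.1
    -- The value of `c` for which `z` becomes a zero. The set `B` collects the weights that violate
    -- one of the three conditions: vanishing sum of weights, vanishing at some `b l`, and a
    -- multiple zero.
    let f (I : Finset ι) (z : ℂ) : ℂ := -(∑ i ∈ I, s i * cubicTerm a b i z) / cubicTerm a b k z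
    let B : Set ℂ := ⋃ I ∈ {I | I ⊆ T},
      ({-∑ i ∈ I, s i} ∪ (Set.range fun l ↦ f I (b l)) ∪ f I '' Z I)
    have hB : B.Finite := by
      refine Set.Finite.biUnion ((Finset.finite_toSet T.powerset).subset fun I hI ↦
        Finset.mem_coe.mpr (Finset.mem_powerset.mpr hI)) fun I hI ↦ ?_
      exact ((Set.finite_singleton _).union (Set.finite_range _)).union ((hZ I hI).image _)
    obtain ⟨c, hc⟩ := hB.infinite_compl.nonempty
    have hcB (I) (hI : I ⊆ T) : c ∉ ({-∑ i ∈ I, s i} ∪ (Set.range fun l ↦ f I (b l)) ∪ f I '' Z I) :=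
      fun h ↦ hc (Set.mem_biUnion (s := {I | I ⊆ T}) hI h)
    have hupd (I) (hI : I ⊆ T) (g : ι → ℂ) :
        ∑ i ∈ I, Function.update s k c i * g i = ∑ i ∈ I, s i * g i :=
      Finset.sum_congr rfl fun i hi ↦ by
        rw [Function.update_of_ne (fun h : i = k ↦ hk (h ▸ hI hi))]
    refine ⟨Function.update s k c, fun I hI hne ↦ ?_⟩
    by_cases hkI' : k ∈ I
    · have hI' : I.erase k ⊆ T := fun i hi ↦
        (Finset.mem_insert.mp (hI (Finset.mem_of_mem_erase hi))).resolve_left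
          (Finset.ne_of_mem_erase hi)
      have hsum (g : ι → ℂ) : ∑ i ∈ I, Function.update s k c i * g i =
          c * g k + ∑ i ∈ I.erase k, s i * g i := by
        rw [← Finset.add_sum_erase I _ hkI', hupd _ hI', Function.update_self]
      have hc1 : c + ∑ i ∈ I.erase k, s i ≠ 0 := fun h ↦
        hcB _ hI' (Or.inl (Or.inl (eq_neg_of_add_eq_zero_left h)))
      have hc2 (z : ℂ) (hz : cubicTerm a b k z ≠ 0)
          (h : c * cubicTerm a b k z + ∑ i ∈ I.erase k, s i * cubicTerm a b i z = 0) :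
          f (I.erase k) z = c := by
        rw [div_eq_iff hz]
        linear_combination -h
      refine ⟨?_, fun l hl h ↦ ?_, fun z hz h h' ↦ ?_⟩
      · have := hsum fun _ ↦ 1
        simp only [mul_one] at this
        rwa [this]
      · rw [hsum] at h
        refine hcB _ hI' (Or.inl (Or.inr ⟨l, hc2 _ (cubicTerm_ne_zero (hab k l).symm fun h' ↦ ?_) h⟩))
        exact hl (hb h' ▸ Finset.mem_insert_self k T)
      · rw [hsum] at h h'
        have hzk := cubicTerm_ne_zero (hz k hkI').1 (hz k hkI').2
        have h1 : z - a k ≠ 0 := sub_ne_zero.mpr (hz k hkI').1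
        have h2 : z - b k ≠ 0 := sub_ne_zero.mpr (hz k hkI').2
        -- If `I = {k}`, the sum is the single term `c φₖ`, which has no zeros here; otherwise the
        -- multiple zero would be a critical point in `Z`.
        by_cases hemp : (I.erase k).Nonempty
        · refine hcB _ hI' (Or.inr ⟨z, ⟨hemp, fun i hi ↦ (hz i (Finset.mem_of_mem_erase hi)).2, ?_⟩,
            hc2 z hzk h⟩)
          have e1 := eq_neg_of_add_eq_zero_right h
          have e2 := eq_neg_of_add_eq_zero_right h'
          rw [e1, e2, cubicTerm, cubicTerm']
          field_simp
          ring
        · rw [Finset.not_nonempty_iff_eq_empty.mp hemp, Finset.sum_empty, add_zero] at h hc1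
          exact (mul_ne_zero hc1 hzk) h
    · have hI' : I ⊆ T := fun i hi ↦ (Finset.mem_insert.mp (hI hi)).resolve_left
        fun h ↦ hkI' (h ▸ hi)
      have h := hs I hI' hne
      refine ⟨?_, fun l hl ↦ ?_, fun z hz ↦ ?_⟩
      · have := hupd I hI' fun _ ↦ 1
        simp only [mul_one] at this
        rw [this]
        exact h.sum_ne_zero
      · rw [hupd I hI']
        exact h.eval_ne_zero l fun hl' ↦ hl (Finset.mem_insert_of_mem hl')
      · rw [hupd I hI', hupd I hI']
        exact h.noncritical z hz

end Weights

/-! ### Smoothness of diagonal complete intersections. -/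

section Diagonal

open MvPolynomial Laurent

/-- The diagonal forms of degree `d` with coefficients `A`. -/
def diagForm (d : ℕ) (A : Fin 2 → Fin 5 → ℂ) (k : Fin 2) : MvPolynomial (Fin 5) ℂ :=
  ∑ i, C (A k i) * X i ^ d

variable {d : ℕ} {A : Fin 2 → Fin 5 → ℂ}

lemma isHomogeneous_diagForm (k : Fin 2) : (diagForm d A k).IsHomogeneous d :=
  IsHomogeneous.sum _ _ _ fun i _ ↦ by
    simpa using (isHomogeneous_C _ (A k i)).mul ((isHomogeneous_X ℂ i).pow d)

lemma pencilOf_diagForm : pencilOf (diagForm d A) =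
    ∑ k, ∑ i, X (.inr k) * (C (A k i) * X (.inl i) ^ d) := by
  simp only [pencilOf, diagForm, map_sum, map_mul, map_pow, rename_C, rename_X, Finset.mul_sum]

lemma eval_pencilOf_diagForm (w : Var → ℂ) : eval w (pencilOf (diagForm d A)) =
    ∑ i, (∑ k, w (.inr k) * A k i) * w (.inl i) ^ d := by
  rw [pencilOf_diagForm]
  simp only [map_sum, map_mul, map_pow, eval_X, eval_C, Finset.sum_mul]
  rw [Finset.sum_comm]
  simp only [mul_assoc]

lemma eval_pderiv_inl_diagForm (w : Var → ℂ) (j : Fin 5) :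
    eval w (pderiv (.inl j) (pencilOf (diagForm (d + 1) A))) =
      (∑ k, w (.inr k) * A k j) * ((d + 1) * w (.inl j) ^ d) := by
  rw [pencilOf_diagForm]
  simp only [map_sum, Derivation.leibniz, Derivation.leibniz_pow, pderiv_X, pderiv_C, smul_eq_mul,
    Pi.single_apply, map_mul, map_pow, map_add, eval_X, eval_C, nsmul_eq_mul, apply_ite (eval w),
    map_zero, map_one, Finset.sum_mul]
  refine Finset.sum_congr rfl fun k _ ↦ ?_
  rw [Finset.sum_eq_single j (fun i _ hi ↦ by simp [hi])
    (fun h ↦ (h (Finset.mem_univ _)).elim)]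
  simp
  ring

lemma eval_pderiv_inr_diagForm (w : Var → ℂ) (l : Fin 2) :
    eval w (pderiv (.inr l) (pencilOf (diagForm d A))) = ∑ i, A l i * w (.inl i) ^ d := by
  rw [pencilOf_diagForm]
  simp only [map_sum, Derivation.leibniz, Derivation.leibniz_pow, pderiv_X, pderiv_C, smul_eq_mul,
    Pi.single_apply, map_mul, map_pow, map_add, eval_X, eval_C, nsmul_eq_mul, apply_ite (eval w),
    map_zero, map_one]
  rw [Finset.sum_eq_single l (fun k _ hk ↦ by simp [hk])
    (fun h ↦ (h (Finset.mem_univ _)).elim)]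
  simp

/-- The minors of the Jacobian matrix vanish only if its rows are proportional. -/
lemma exists_eq_mul_of_minors {σ : Type} {g h : σ → ℂ} (hgh : ∀ a b, g a * h b - g b * h a = 0)
    (hg : g ≠ 0) (hh : h ≠ 0) : ∃ κ, κ ≠ 0 ∧ ∀ a, h a = κ * g a := by
  obtain ⟨a, ha⟩ := Function.ne_iff.mp hg
  have key (b : σ) : h b = h a / g a * g b := by
    rw [div_mul_eq_mul_div, eq_div_iff ha]
    linear_combination hgh a b
  refine ⟨h a / g a, fun h0 ↦ hh (funext fun b ↦ ?_), key⟩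
  rw [key b, h0, zero_mul]
  rfl

variable {a b σ x : Fin 5 → ℂ} {t : Fin 2 → ℂ}

lemma eq_of_linear_eq_zero (ha : Function.Injective a) (ht : t ≠ 0) {i j : Fin 5}
    (hi : t 0 - a i * t 1 = 0) (hj : t 0 - a j * t 1 = 0) : i = j := by
  by_contra hij
  have h1 : t 1 = 0 := by
    have : (a i - a j) * t 1 = 0 := by linear_combination hj - hi
    exact (mul_eq_zero.mp this).resolve_left (sub_ne_zero.mpr fun h ↦ hij (ha h))
  have h0 : t 0 = 0 := by rw [h1, mul_zero, sub_zero] at hi; exact hi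
  exact ht (funext fun k ↦ by fin_cases k <;> assumption)

/-- At most one linear form `t₀ - aᵢ t₁` vanishes at `t`, so exactly one `xⱼ` is nonzero and one
summand survives. This shows below that the gradients of `Q` and `C` are nonzero. -/
lemma sum_pow_ne_zero (ha : Function.Injective a) (ht : t ≠ 0) (hx : x ≠ 0) {c : Fin 5 → ℂ}
    (hc : ∀ i, c i ≠ 0) {n : ℕ} (hn : n ≠ 0) (h : ∀ i, (t 0 - a i * t 1) * x i = 0) :
    ∑ i, c i * x i ^ n ≠ 0 := by
  obtain ⟨j, hj⟩ := Function.ne_iff.mp hx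
  rw [Finset.sum_eq_single j (fun i _ hi ↦ ?_) (fun h ↦ (h (Finset.mem_univ _)).elim)]
  · exact mul_ne_zero (hc j) (pow_ne_zero _ hj)
  · have h1 := (mul_eq_zero.mp (h j)).resolve_right hj
    have h2 := (mul_eq_zero.mp (h i)).resolve_left fun h2 ↦ hi (eq_of_linear_eq_zero ha ht h2 h1)
    rw [h2, zero_pow hn, mul_zero]

/-- The coefficients of the quadratic forms `Σ xᵢ²`, `-Σ aᵢ xᵢ²`, multiplied by `σᵢ`. -/
def diagCoeff (σ a : Fin 5 → ℂ) : Fin 2 → Fin 5 → ℂ := ![σ, fun i ↦ -(σ i * a i)]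

lemma sum_diagCoeff (i : Fin 5) : ∑ k, t k * diagCoeff σ a k i = σ i * (t 0 - a i * t 1) := by
  rw [Fin.sum_univ_two, diagCoeff]
  simp only [Matrix.cons_val_zero, Matrix.cons_val_one]
  ring

/-- The critical point equations have no solution. -/
lemma false_of_critical (hab : ∀ i j, a i ≠ b j)
    (hs : ∀ I : Finset (Fin 5), I.Nonempty → IsGoodWeight a b (fun i ↦ (σ i ^ 2)⁻¹) I Finset.univ)
    (hσ : ∀ i, σ i ≠ 0) (ht : t ≠ 0) (hx : x ≠ 0) {κ : ℂ} (hκ : κ ≠ 0)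
    (h1 : ∀ i, σ i * (t 0 - b i * t 1) * (3 * x i ^ 2) = κ * ((t 0 - a i * t 1) * (2 * x i)))
    (h2 : ∑ i, σ i * x i ^ 3 = κ * ∑ i, x i ^ 2)
    (h3 : ∑ i, (t 0 - a i * t 1) * x i ^ 2 = 0) : False := by
  classical
  let I : Finset (Fin 5) := Finset.univ.filter fun i ↦ x i ≠ 0
  have hI : I.Nonempty := by
    obtain ⟨j, hj⟩ := Function.ne_iff.mp hx
    exact ⟨j, Finset.mem_filter.mpr ⟨Finset.mem_univ _, hj⟩⟩
  have hxI (i) (hi : i ∈ I) : x i ≠ 0 := (Finset.mem_filter.mp hi).2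
  have hsum (f : Fin 5 → ℂ) (hf : ∀ i, x i = 0 → f i = 0) : ∑ i, f i = ∑ i ∈ I, f i :=
    (Finset.sum_filter_of_ne (p := fun i ↦ x i ≠ 0) fun i _ hi h ↦ hi (hf i h)).symm
  have hg := hs I hI
  let ν : ℂ := 2 * κ / 3
  have hν : ν ≠ 0 := div_ne_zero (mul_ne_zero two_ne_zero hκ) three_ne_zero
  -- Proportionality of the gradients in `xᵢ`, divided by `3 xᵢ`. It determines `xᵢ` as `ν (z - aᵢ)
  -- / (σᵢ (z - bᵢ))`.
  have h4 (i) (hi : i ∈ I) : σ i * (t 0 - b i * t 1) * x i = ν * (t 0 - a i * t 1) :=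
    mul_right_cancel₀ (hxI i hi) (by
      simp only [ν]
      linear_combination h1 i / 3)
  by_cases ht1 : t 1 = 0
  -- The point at infinity of `ℙ¹`: there `xᵢ = ν / σᵢ`, and `Q = 0` says that the sum of the
  -- weights vanishes.
  · have ht0 : t 0 ≠ 0 := fun h ↦ ht (funext fun k ↦ by fin_cases k <;> assumption)
    apply hg.sum_ne_zero
    rw [hsum _ fun i hi ↦ by rw [hi]; ring] at h3
    have h5 : (t 0 * ν ^ 2) * ∑ i ∈ I, (σ i ^ 2)⁻¹ = 0 := by
      rw [← h3, Finset.mul_sum]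
      refine Finset.sum_congr rfl fun i hi ↦ ?_
      have h6 := h4 i hi
      rw [ht1, mul_zero, mul_zero, sub_zero] at h6
      have h7 : x i = ν / σ i := by
        rw [eq_div_iff (hσ i)]
        exact mul_right_cancel₀ ht0 (by linear_combination h6)
      rw [ht1, h7, mul_zero, sub_zero, div_pow]
      ring
    exact (mul_eq_zero.mp h5).resolve_left (mul_ne_zero ht0 (pow_ne_zero _ hν))
  · let z : ℂ := t 0 / t 1
    have hz (c : ℂ) : t 0 - c * t 1 = t 1 * (z - c) := by
      simp only [z]
      field_simp
    have h5 (i) (hi : i ∈ I) : σ i * (z - b i) * x i = ν * (z - a i) := by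
      have h6 := h4 i hi
      rw [hz, hz] at h6
      exact mul_left_cancel₀ ht1 (by linear_combination h6)
    have h6 (i) (hi : i ∈ I) : z ≠ a i ∧ z ≠ b i := by
      have h7 := h5 i hi
      constructor
      · intro h
        rw [h, sub_self, mul_zero, mul_eq_zero, mul_eq_zero, sub_eq_zero] at h7
        exact h7.elim (fun h7 ↦ h7.elim (hσ i) (hab i i)) (hxI i hi)
      · intro h
        rw [h, sub_self, mul_zero, zero_mul, eq_comm, mul_eq_zero, sub_eq_zero] at h7
        exact h7.elim hν fun h7 ↦ hab i i h7.symm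
    have h7 (i) (hi : i ∈ I) : x i = ν * (z - a i) / (σ i * (z - b i)) := by
      rw [eq_div_iff (mul_ne_zero (hσ i) (sub_ne_zero.mpr (h6 i hi).2)), ← h5 i hi]
      ring
    -- With `xᵢ` inserted, `Q = 0` becomes the vanishing of the weighted sum, and proportionality of
    -- the derivatives in `t₀` becomes the vanishing of its derivative.
    refine hg.noncritical z h6 ?_ ?_
    · rw [hsum _ fun i hi ↦ by rw [hi]; ring] at h3
      have h8 : (t 1 * ν ^ 2) * ∑ i ∈ I, (σ i ^ 2)⁻¹ * cubicTerm a b i z = 0 := by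
        rw [← h3, Finset.mul_sum]
        refine Finset.sum_congr rfl fun i hi ↦ ?_
        have e1 := hσ i
        have e2 := sub_ne_zero.mpr (h6 i hi).2
        rw [hz, h7 i hi, cubicTerm]
        field_simp
      exact (mul_eq_zero.mp h8).resolve_left (mul_ne_zero ht1 (pow_ne_zero _ hν))
    · have h8 : -(ν ^ 3 / 2) * ∑ i ∈ I, (σ i ^ 2)⁻¹ * cubicTerm' a b i z = 0 := by
        rw [← sub_eq_zero, Finset.mul_sum, ← Finset.sum_sub_distrib,
          hsum _ fun i hi ↦ by rw [hi]; ring] at h2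
        rw [← h2, Finset.mul_sum]
        refine Finset.sum_congr rfl fun i hi ↦ ?_
        have e1 := hσ i
        have e2 := sub_ne_zero.mpr (h6 i hi).2
        have e3 : κ = 3 * ν / 2 := by simp only [ν]; ring
        rw [h7 i hi, cubicTerm', e3]
        field_simp
        ring
      exact (mul_eq_zero.mp h8).resolve_left
        (neg_ne_zero.mpr (div_ne_zero (pow_ne_zero _ hν) two_ne_zero))

/-- Hilbert's Nullstellensatz; it reduces `IsSmoothPair` to the absence of singular points over `ℂ`.
-/
lemma exists_pow_mem_of_forall_eval {τ : Type} [Finite τ] {I : Ideal (MvPolynomial τ ℂ)}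
    {p : MvPolynomial τ ℂ} (h : ∀ w, (∀ q ∈ I, eval w q = 0) → eval w p = 0) : ∃ N, p ^ N ∈ I := by
  have hev (w : τ → ℂ) (p : MvPolynomial τ ℂ) : aeval w p = eval w p := by rw [aeval_eq_eval]
  change p ∈ I.radical
  rw [← vanishingIdeal_zeroLocus_eq_radical (K := ℂ), mem_vanishingIdeal_iff]
  intro w hw
  rw [mem_zeroLocus_iff] at hw
  rw [hev]
  exact h w fun q hq ↦ (hev w q).symm.trans (hw q hq)

/-- At a singular point with `x ≠ 0` and `t ≠ 0` both gradients are nonzero, so the vanishing minors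
make them proportional with a factor `κ ≠ 0`. These are the equations excluded by
`false_of_critical`. -/
theorem isSmoothPair_diagForm (ha : Function.Injective a) (hb : Function.Injective b)
    (hab : ∀ i j, a i ≠ b j)
    (hs : ∀ I : Finset (Fin 5), I.Nonempty → IsGoodWeight a b (fun i ↦ (σ i ^ 2)⁻¹) I Finset.univ)
    (hσ : ∀ i, σ i ≠ 0) :
    IsSmoothPair (pencilOf (diagForm 2 (diagCoeff 1 a))) (pencilOf (diagForm 3 (diagCoeff σ b))) := by
  refine ⟨isBihomogeneous_pencilOf isHomogeneous_diagForm,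
    isBihomogeneous_pencilOf isHomogeneous_diagForm, fun j l ↦
    exists_pow_mem_of_forall_eval fun w hw ↦ ?_⟩
  set Q := pencilOf (diagForm 2 (diagCoeff 1 a)) with hQ
  set C := pencilOf (diagForm 3 (diagCoeff σ b)) with hC
  by_contra hne
  rw [map_mul, eval_X, eval_X, mul_eq_zero, not_or] at hne
  have hx : (fun i ↦ w (.inl i)) ≠ 0 := Function.ne_iff.mpr ⟨j, hne.1⟩
  have ht : (fun k ↦ w (.inr k)) ≠ 0 := Function.ne_iff.mpr ⟨l, hne.2⟩
  have hg1 (i : Fin 5) : eval w (pderiv (.inl i) Q) =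
      (w (.inr 0) - a i * w (.inr 1)) * (2 * w (.inl i)) := by
    rw [hQ, eval_pderiv_inl_diagForm, sum_diagCoeff, Pi.one_apply]
    push_cast
    ring
  have hh1 (i : Fin 5) : eval w (pderiv (.inl i) C) =
      σ i * (w (.inr 0) - b i * w (.inr 1)) * (3 * w (.inl i) ^ 2) := by
    rw [hC, eval_pderiv_inl_diagForm, sum_diagCoeff]
    push_cast
    ring
  have hg2 : eval w (pderiv (.inr 0) Q) = ∑ i, 1 * w (.inl i) ^ 2 := eval_pderiv_inr_diagForm w 0
  have hh2 : eval w (pderiv (.inr 0) C) = ∑ i, σ i * w (.inl i) ^ 3 := eval_pderiv_inr_diagForm w 0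
  have hminor (c d : Var) : eval w (pderiv c Q) * eval w (pderiv d C) -
      eval w (pderiv d Q) * eval w (pderiv c C) = 0 := by
    have := hw _ (Ideal.subset_span (Or.inr ⟨(c, d), rfl⟩))
    simpa only [minor, map_sub, map_mul] using this
  obtain ⟨κ, hκ, hk⟩ := exists_eq_mul_of_minors (g := fun c ↦ eval w (pderiv c Q))
    (h := fun c ↦ eval w (pderiv c C)) hminor (fun h ↦ by
      refine sum_pow_ne_zero (c := 1) ha ht hx (fun _ ↦ one_ne_zero) two_ne_zero (fun i ↦ ?_)
        (hg2.symm.trans (congrFun h (.inr 0)))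
      have h1 := (hg1 i).symm.trans (congrFun h (.inl i))
      refine mul_left_cancel₀ (two_ne_zero (α := ℂ)) ?_
      rw [mul_zero, ← mul_assoc, mul_comm (2 : ℂ), mul_assoc]
      exact h1) (fun h ↦ by
      refine sum_pow_ne_zero hb ht hx hσ three_ne_zero (fun i ↦ ?_)
        (hh2.symm.trans (congrFun h (.inr 0)))
      have h1 := (hh1 i).symm.trans (congrFun h (.inl i))
      rw [Pi.zero_apply, mul_eq_zero, mul_eq_zero, mul_eq_zero] at h1
      rcases h1 with (h1 | h1) | h1 | h1
      · exact (hσ i h1).elim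
      · exact mul_eq_zero_of_left h1 _
      · exact (three_ne_zero h1).elim
      · exact mul_eq_zero_of_right _ (pow_eq_zero_iff two_ne_zero |>.mp h1))
  have hQ0 : eval w Q = 0 := hw Q (Ideal.subset_span (Or.inl (Or.inl rfl)))
  rw [hQ, eval_pencilOf_diagForm] at hQ0
  simp only [sum_diagCoeff (t := fun k ↦ w (.inr k)), Pi.one_apply, one_mul] at hQ0
  refine false_of_critical (t := fun k ↦ w (.inr k)) (x := fun i ↦ w (.inl i)) hab hs hσ ht hx hκ
    (fun i ↦ ?_) ?_ hQ0
  · rw [← hh1, ← hg1]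
    exact hk (.inl i)
  · have := hk (.inr 0)
    rw [hh2, hg2] at this
    simpa only [one_mul] using this

end Diagonal

/-! ### A smooth pencil, and the conclusion for generic pencils. -/

open MvPolynomial Laurent

lemma exists_isSmoothPair_diagForm : ∃ (a b σ : Fin 5 → ℂ), Function.Injective a ∧
    IsSmoothPair (pencilOf (diagForm 2 (diagCoeff 1 a))) (pencilOf (diagForm 3 (diagCoeff σ b))) := by
  have ha : Function.Injective fun i : Fin 5 ↦ ((i : ℕ) : ℂ) :=
    Nat.cast_injective.comp Fin.val_injective
  have hb : Function.Injective fun i : Fin 5 ↦ (((i : ℕ) + 5 : ℕ) : ℂ) :=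
    Nat.cast_injective.comp ((add_left_injective 5).comp Fin.val_injective)
  have hab (i j : Fin 5) : ((i : ℕ) : ℂ) ≠ (((j : ℕ) + 5 : ℕ) : ℂ) :=
    fun h ↦ absurd (Nat.cast_injective h) (by omega)
  obtain ⟨s, hs⟩ := exists_isGoodWeight hb hab Finset.univ
  have hs0 (i : Fin 5) : s i ≠ 0 := by
    simpa using (hs {i} (Finset.subset_univ _) (Finset.singleton_nonempty i)).sum_ne_zero
  -- The weights are the `σᵢ⁻²`, so `σᵢ` is a square root of the inverse of `s i`.
  choose σ hσ using fun i ↦ IsAlgClosed.exists_pow_nat_eq (s i)⁻¹ (n := 2) two_pos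
  refine ⟨_, _, σ, ha, isSmoothPair_diagForm ha hb hab (fun I hI ↦ ?_) fun i h ↦ ?_⟩
  · simpa only [hσ, inv_inv] using hs I (Finset.subset_univ _) hI
  · exact inv_ne_zero (hs0 i) (by rw [← hσ i, h, zero_pow two_ne_zero])

lemma eval_diagForm_single {d : ℕ} (hd : d ≠ 0) (A : Fin 2 → Fin 5 → ℂ) (k : Fin 2) (i : Fin 5) :
    eval (Pi.single i 1) (diagForm d A k) = A k i := by
  rw [diagForm, map_sum, Finset.sum_eq_single i (fun j _ hj ↦ by simp [hj, hd])
    fun h ↦ absurd (Finset.mem_univ i) h]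
  simp

lemma eval_snoc_coneForm (q c : MvPolynomial (Fin 5) ℂ) (x : Fin 5 → ℂ) (v : ℂ) :
    eval (Fin.snoc x v : Fin 6 → ℂ) (coneForm q c) = v * eval x q + eval x c := by
  have h : (Fin.snoc x v : Fin 6 → ℂ) ∘ Fin.castSucc = x :=
    funext fun i ↦ Fin.snoc_castSucc (α := fun _ ↦ ℂ) v x i
  rw [coneForm, map_add, map_mul, eval_X, eval_rename, eval_rename, h,
    Fin.snoc_last (α := fun _ ↦ ℂ)]

lemma isPencil_diagForm {a b σ : Fin 5 → ℂ} (ha : Function.Injective a) :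
    IsPencil fun k ↦ coneForm (diagForm 2 (diagCoeff 1 a) k) (diagForm 3 (diagCoeff σ b) k) := by
  refine ⟨Fintype.linearIndependent_iff.mpr fun g h ↦ ?_, fun k ↦
    isSectionO3Minus2e_coneForm (isHomogeneous_diagForm k) (isHomogeneous_diagForm k)⟩
  rw [Fin.sum_univ_two] at h
  -- The values at `(eᵢ, v)` for `v = 1` and `v = 0` differ by the coefficient of `x₅ xᵢ²`, which is
  -- `g 0 - g 1 * a i`; two different values of `a` then force `g = 0`.
  have hst (i : Fin 5) : g 0 = g 1 * a i := by
    have h1 (v : ℂ) := congrArg (eval (Fin.snoc (Pi.single i 1) v : Fin 6 → ℂ)) h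
    simp only [map_add, smul_eval, eval_snoc_coneForm, map_zero,
      eval_diagForm_single two_ne_zero, eval_diagForm_single three_ne_zero, diagCoeff,
      Matrix.cons_val_zero, Matrix.cons_val_one, Pi.one_apply] at h1
    linear_combination h1 1 - h1 0
  have ht : g 1 = 0 := by
    have h2 : g 1 * (a 0 - a 1) = 0 := by linear_combination hst 1 - hst 0
    exact (mul_eq_zero.mp h2).resolve_right (sub_ne_zero.mpr (ha.ne (by decide)))
  exact Fin.forall_fin_two.mpr ⟨by rw [hst 0, ht, zero_mul], ht⟩

theorem forGenericPencil_isBlowup : ForGenericPencil fun F ↦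
    ∃ Q C : MvPolynomial (Fin 5 ⊕ Fin 2) ℂ,
      IsBihomogeneous (m := 4) (n := 1) Q 2 1 ∧ IsBihomogeneous (m := 4) (n := 1) C 3 1 ∧
      IsCalabiYauThreefold ((intersectionIdeal Q C).subschemeι ≫ PProd.toBase 4 1) ∧
      IsBlowup (rhoRestrict F) (intersectionIdeal Q C) := by
  obtain ⟨a, b, σ, ha, h₀⟩ := exists_isSmoothPair_diagForm
  let b₀ : ConeData := (diagForm 2 (diagCoeff 1 a), diagForm 3 (diagCoeff σ b))
  obtain ⟨Δ, hΔ, h⟩ := exists_discriminant (b₀ := b₀) h₀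
  refine ⟨Δ, ⟨b₀.pencil, isPencil_diagForm ha, hΔ⟩, fun F hF hne ↦ ?_⟩
  choose q c hq hc hqc using fun k ↦ (hF.2 k).exists_eq_coneForm
  obtain rfl : F = ConeData.pencil (q, c) := funext hqc
  have hs := h (q, c) hq hc hne
  exact ⟨_, _, hs.left, hs.right, hs.isCalabiYauThreefold,
    isBlowup_rhoRestrict hs.left hs.right (pencilForm_coneForm q c) fun j l ↦ hs.isRegularPair j l⟩

end CubicPencil

end

theorem mainTheorem6 :
    CubicPencil.IsBlowup CubicPencil.blowDown CubicPencil.originIdeal ∧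
    CubicPencil.ForGenericPencil fun F ↦
      ∃ Q C : MvPolynomial (Fin 5 ⊕ Fin 2) ℂ,
        CubicPencil.IsBihomogeneous (m := 4) (n := 1) Q 2 1 ∧
        CubicPencil.IsBihomogeneous (m := 4) (n := 1) C 3 1 ∧
        CubicPencil.IsCalabiYauThreefold ((CubicPencil.intersectionIdeal Q C).subschemeι ≫ CubicPencil.PProd.toBase 4 1) ∧
        CubicPencil.IsBlowup (CubicPencil.rhoRestrict F) (CubicPencil.intersectionIdeal Q C) := by
  exact ⟨CubicPencil.isBlowup_blowDown, CubicPencil.forGenericPencil_isBlowup⟩
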